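/- Let $n\ge 0$. The terms of $\mathcal K_n$ are built from generators $h_i$ ($1\le i\le n-1$, the diapsides), $c$ (the circle) and $\mathbf 1$ by binary multiplication, and $\mathcal K_n$ is the monoid of terms modulo the least congruence containing $\mathbf 1t=t=t\mathbf 1$, $t(uv)=(tu)v$ and, whenever the indices lie in $\{1,\dots,n-1\}$, $$(h1)\ h_ih_{j+2}=h_{j+2}h_i\ (i\le j),\quad (h2)\ h_ih_{i\pm1}h_i=h_i,\quad (hc1)\ h_ic=ch_i,\quad (hc2)\ h_ih_i=ch_i.$$ For $1\le j\le i\le n-1$ put $h_{[i,j]}=h_ih_{i-1}\cdots h_{j+1}h_j$. A term is in *Jones normal form* if it is $c^l h_{[b_1,a_1]}\cdots h_{[b_k,a_k]}$ with $l,k\ge 0$, $a_1<\dots<a_k$ and $b_1<\dots<b_k$ (the term $\mathbf 1$ if $l=k=0$), where parentheses are restored in one fixed way, say to the left. For $a>0$ let $R_a=[0,\infty)\times[0,a]$. A *frieze* in $R_a$ is a subset $D\subseteq R_a$ which, as a subspace, is a one-manifold with boundary having denumerably many connected components, all compact, such that $D$ meets the top $[0,\infty)\times\{a\}$ exactly in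 the points $(i,a)$ and the bottom $[0,\infty)\times\{0\}$ exactly in the points $(i,0)$, $i=1,2,3,\dots$, these points are exactly the boundary points of $D$, and only finitely many components are circular (homeomorphic to $S^1$), cups (homeomorphic to $[0,1]$ with both end points at the top) or caps (the same with both end points at the bottom). Components homeomorphic to $[0,1]$ are called threads; a region of $D$ is a connected component of $R_a$ minus the threads. A frieze is an *$n$-frieze* if for every $k\ge n+1$ some thread has end points $(k,0)$ and $(k,a)$, and for every $k\ge n+2$ no circular component lies in the region between the threads so obtained for $k-1$ and $k$, i.e. the region that contains the points $(x,0)$ with $k-1<x<k$. Friezes $D$ in $R_a$ and $E$ in $R_b$ are *$\mathcal K$-equivalent*, $D\cong_{\mathcal K}E$, if there is a homeomorphism $h:D\to E$ with $h(i,0)=(i,0)$ and $h(i,a)=(i,b)$ for all $i\ge1$. The composition of $D$ in $R_a$ and $E$ in $R_b$ is $E\circ D=\{(x,y+b)\mid(x,y)\in D\}\cup E$ in $R_{a+b}$. Let $I=\{(i,y)\mid i\ge 1,\ 0\le y\le 1\}$ in $R_1$, let $C$ in $R_1$ be $I$ together with the circle of radius $1/4$ and centre $(1/2,1/2)$, and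 let $H_k$ in $R_2$ consist of the semicircular cup with end points $(k,2),(k+1,2)$, the semicircular cap with end points $(k,0),(k+1,0)$, and the vertical segments $\{i\}\times[0,2]$ for $i\ge1$, $i\ne k,k+1$. Define $\delta$ on terms by $\delta(h_i)=H_i$, $\delta(c)=C$, $\delta(\mathbf 1)=I$, $\delta(tu)=\delta(t)\circ\delta(u)$. Then: 1. for all terms $t,u$ of $\mathcal K_n$: $\delta(t)\cong_{\mathcal K}\delta(u)$ if and only if $t=u$ in $\mathcal K_n$; 2. $I$ and all $\delta(t)$ are $n$-friezes, the composition of two $n$-friezes is an $n$-frieze, and the set $[\mathcal F_n]_{\mathcal K}$ of $\mathcal K$-equivalence classes of $n$-friezes is a monoid with unit $[I]$ and product $[D][E]=[D\circ E]$; the map $t\mapsto[\delta(t)]$ induces an isomorphism of monoids $\mathcal K_n\cong[\mathcal F_n]_{\mathcal K}$; 3. for every term $t$ of $\mathcal K_n$ there is a unique term $t'$ in Jones normal form such that $t=t'$ in $\mathcal K_n$. -/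

import Mathlib

open Set

namespace KFrieze

noncomputable section

/-! ### The monoid `K_n`: terms, equality of terms, Jones normal form -/

/-- Generators of `K_n`: the diapsides `h_i`, `1 ≤ i ≤ n - 1`, and the circle `c`. -/
inductive Gen (n : ℕ) : Type
  | h (i : ℕ) (hi : 1 ≤ i ∧ i < n) : Gen n
  | c : Gen n

/-- Terms of `K_n`: built from the generators and `1` by binary multiplication. -/
inductive KTerm (n : ℕ) : Type
  | gen (g : Gen n) : KTerm n
  | one : KTerm n
  | mul (t u : KTerm n) : KTerm n

namespace KTerm

/-- The term `h_i`. -/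
def h {n : ℕ} (i : ℕ) (hi : 1 ≤ i ∧ i < n) : KTerm n := gen (Gen.h i hi)

/-- The term `c`. -/
def c {n : ℕ} : KTerm n := gen Gen.c

/-- `t = u` in `K_n`: the least congruence on terms containing the equations of `K_n`. -/
inductive Eqv {n : ℕ} : KTerm n → KTerm n → Prop
  | refl (t : KTerm n) : Eqv t t
  | symm {t u : KTerm n} : Eqv t u → Eqv u t
  | trans {t u v : KTerm n} : Eqv t u → Eqv u v → Eqv t v
  | mul_congr {t t' u u' : KTerm n} : Eqv t t' → Eqv u u' → Eqv (mul t u) (mul t' u')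
  | one_mul (t : KTerm n) : Eqv (mul one t) t
  | mul_one (t : KTerm n) : Eqv (mul t one) t
  | mul_assoc (t u v : KTerm n) : Eqv (mul t (mul u v)) (mul (mul t u) v)
  | h1 (i j : ℕ) (hi : 1 ≤ i ∧ i < n) (hj : 1 ≤ j + 2 ∧ j + 2 < n) (hij : i ≤ j) :
      Eqv (mul (h i hi) (h (j + 2) hj)) (mul (h (j + 2) hj) (h i hi))
  | h2_up (i : ℕ) (hi : 1 ≤ i ∧ i < n) (hi' : 1 ≤ i + 1 ∧ i + 1 < n) :
      Eqv (mul (mul (h i hi) (h (i + 1) hi')) (h i hi)) (h i hi)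
  | h2_down (i : ℕ) (hi : 1 ≤ i ∧ i < n) (hi' : 1 ≤ i - 1 ∧ i - 1 < n) :
      Eqv (mul (mul (h i hi) (h (i - 1) hi')) (h i hi)) (h i hi)
  | hc1 (i : ℕ) (hi : 1 ≤ i ∧ i < n) : Eqv (mul (h i hi) c) (mul c (h i hi))
  | hc2 (i : ℕ) (hi : 1 ≤ i ∧ i < n) : Eqv (mul (h i hi) (h i hi)) (mul c (h i hi))

/-- The product of a word of generators, with parentheses restored to the left;
the empty word gives the term `1`. -/
def ofWord {n : ℕ} : List (Gen n) → KTerm n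
  | [] => one
  | g :: gs => gs.foldl (fun t g' => mul t (gen g')) (gen g)

end KTerm

/-- Indices of a block `h_[b,a]` with `1 ≤ a ≤ b ≤ n - 1`. -/
structure Block (n : ℕ) where
  b : ℕ
  a : ℕ
  one_le : 1 ≤ a
  le : a ≤ b
  lt : b < n

/-- The word `h_b h_{b-1} … h_{a+1} h_a`. -/
def Block.word {n : ℕ} (B : Block n) : List (Gen n) :=
  List.ofFn fun m : Fin (B.b + 1 - B.a) =>
    Gen.h (B.b - m) (by
      have h1 := m.2
      have h2 := B.one_le
      have h3 := B.lt
      omega)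

/-- Jones normal form: `c^l h_[b_1,a_1] … h_[b_k,a_k]` with `a_1 < … < a_k` and `b_1 < … < b_k`;
for `l = k = 0` this is the term `1`. -/
def IsJonesNormalForm {n : ℕ} (t : KTerm n) : Prop :=
  ∃ (l : ℕ) (L : List (Block n)),
    L.Pairwise (fun B B' => B.a < B'.a ∧ B.b < B'.b) ∧
    t = KTerm.ofWord (List.replicate l Gen.c ++ L.flatMap Block.word)

instance KTerm.setoid (n : ℕ) : Setoid (KTerm n) where
  r := KTerm.Eqv
  iseqv := ⟨KTerm.Eqv.refl, KTerm.Eqv.symm, KTerm.Eqv.trans⟩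

/-- The monoid `K_n`: terms modulo equality in `K_n`. -/
def KMonoid (n : ℕ) : Type := Quotient (KTerm.setoid n)

/-- The element of `K_n` denoted by a term. -/
def KMonoid.mk {n : ℕ} (t : KTerm n) : KMonoid n := Quotient.mk (KTerm.setoid n) t

instance KMonoid.instMonoid (n : ℕ) : Monoid (KMonoid n) where
  mul := Quotient.map₂ KTerm.mul (fun _ _ h₁ _ _ h₂ => KTerm.Eqv.mul_congr h₁ h₂)
  one := KMonoid.mk KTerm.one
  mul_assoc := by
    rintro ⟨x⟩ ⟨y⟩ ⟨z⟩
    exact Quotient.sound (KTerm.Eqv.symm (KTerm.Eqv.mul_assoc x y z))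
  one_mul := by
    rintro ⟨x⟩
    exact Quotient.sound (KTerm.Eqv.one_mul x)
  mul_one := by
    rintro ⟨x⟩
    exact Quotient.sound (KTerm.Eqv.mul_one x)

/-! ### One-manifolds with boundary -/

/-- `x` has an open neighbourhood homeomorphic to `(-1,1)`. -/
def IsInteriorPoint {X : Type*} [TopologicalSpace X] (x : X) : Prop :=
  ∃ U : Set X, IsOpen U ∧ x ∈ U ∧ Nonempty (U ≃ₜ Ioo (-1 : ℝ) 1)

/-- `x` has an open neighbourhood homeomorphic to `[0,1)`, with `x` corresponding to `0`. -/
def IsBoundaryPoint {X : Type*} [TopologicalSpace X] (x : X) : Prop :=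
  ∃ (U : Set X) (_ : IsOpen U) (hx : x ∈ U) (e : U ≃ₜ Ico (0 : ℝ) 1), (e ⟨x, hx⟩ : ℝ) = 0

/-- One-manifolds with boundary (all those considered here are subspaces of the plane, so
they are Hausdorff and second countable). -/
def IsOneManifold (X : Type*) [TopologicalSpace X] : Prop :=
  ∀ x : X, IsInteriorPoint x ∨ IsBoundaryPoint x

/-! ### Diagrams and friezes -/

/-- The strip `R_a = [0,∞) × [0,a]`. -/
def strip (a : ℝ) : Set (ℝ × ℝ) := {p | 0 ≤ p.1 ∧ 0 ≤ p.2 ∧ p.2 ≤ a}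

/-- A planar set `D` together with the height `a` of the strip `R_a` in which it is regarded. -/
structure PlaneSet where
  height : ℝ
  carrier : Set (ℝ × ℝ)

namespace PlaneSet

/-- The point `(i,a)` at the top. -/
def topPt (D : PlaneSet) (i : ℕ) : ℝ × ℝ := ((i : ℝ), D.height)

/-- The point `(i,0)` at the bottom. -/
def botPt (i : ℕ) : ℝ × ℝ := ((i : ℝ), 0)

/-- `t(D) = {(i,a) | i ≥ 1}`. -/
def topPts (D : PlaneSet) : Set (ℝ × ℝ) := {p | ∃ i : ℕ, 1 ≤ i ∧ p = D.topPt i}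

/-- `b(D) = {(i,0) | i ≥ 1}`. -/
def botPts : Set (ℝ × ℝ) := {p | ∃ i : ℕ, 1 ≤ i ∧ p = botPt i}

/-- The connected components of `D`. -/
def components (D : PlaneSet) : Set (Set (ℝ × ℝ)) :=
  {T | ∃ p ∈ D.carrier, T = connectedComponentIn D.carrier p}

/-- An `ω`-diagram in `R_a`, where `a` is `D.height`. -/
structure IsOmegaDiagram (D : PlaneSet) : Prop where
  height_pos : 0 < D.height
  subset_strip : D.carrier ⊆ strip D.height
  inter_top : D.carrier ∩ {p | 0 ≤ p.1 ∧ p.2 = D.height} = D.topPts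
  inter_bot : D.carrier ∩ {p | 0 ≤ p.1 ∧ p.2 = 0} = botPts
  manifold : IsOneManifold D.carrier
  boundary : ∀ p : D.carrier, IsBoundaryPoint p ↔ (p : ℝ × ℝ) ∈ D.topPts ∪ botPts
  compact_components : ∀ T ∈ D.components, IsCompact T
  countable_components : D.components.Countable
  infinite_components : D.components.Infinite

/-- Threads: the components homeomorphic to `[0,1]`. -/
def threads (D : PlaneSet) : Set (Set (ℝ × ℝ)) :=
  {T | T ∈ D.components ∧ Nonempty (T ≃ₜ Icc (0 : ℝ) 1)}

/-- Circular components: those homeomorphic to `S¹`. -/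
def circularComponents (D : PlaneSet) : Set (Set (ℝ × ℝ)) :=
  {T | T ∈ D.components ∧ Nonempty (T ≃ₜ Circle)}

/-- Cups: threads with both end points at the top. -/
def cups (D : PlaneSet) : Set (Set (ℝ × ℝ)) :=
  {T | T ∈ D.threads ∧ ∃ i j : ℕ, 1 ≤ i ∧ 1 ≤ j ∧ i ≠ j ∧ D.topPt i ∈ T ∧ D.topPt j ∈ T}

/-- Caps: threads with both end points at the bottom. -/
def caps (D : PlaneSet) : Set (Set (ℝ × ℝ)) :=
  {T | T ∈ D.threads ∧ ∃ i j : ℕ, 1 ≤ i ∧ 1 ≤ j ∧ i ≠ j ∧ botPt i ∈ T ∧ botPt j ∈ T}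

/-- A frieze is an `ω`-diagram with finitely many cups, caps and circular components. -/
structure IsFrieze (D : PlaneSet) : Prop extends IsOmegaDiagram D where
  finite_cups : D.cups.Finite
  finite_caps : D.caps.Finite
  finite_circular : D.circularComponents.Finite

/-- The region of `D` that contains the point `p`: a connected component of `R_a` without the
threads of `D`. -/
def regionAt (D : PlaneSet) (p : ℝ × ℝ) : Set (ℝ × ℝ) :=
  connectedComponentIn (strip D.height \ ⋃₀ D.threads) p

/-- `n`-friezes. For every `k ≥ n + 1` there is a vertical thread `[-k,k]`, with end points `(k,0)`
and `(k,a)`; for every `k ≥ n + 2` no circular component is in the region whose lowest thread is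
`[-k,k]`. That region is the one between the vertical threads `[-(k-1),k-1]` and `[-k,k]`, which is
the one reaching the bottom of the strip in the open interval from `(k-1,0)` to `(k,0)`. -/
structure IsNFrieze (n : ℕ) (D : PlaneSet) : Prop extends IsFrieze D where
  vertical : ∀ k : ℕ, n + 1 ≤ k → ∃ T ∈ D.threads, botPt k ∈ T ∧ D.topPt k ∈ T
  no_circular : ∀ k : ℕ, n + 2 ≤ k → ∀ S ∈ D.circularComponents,
    ¬ S ⊆ D.regionAt ((k : ℝ) - 1 / 2, 0)

/-- `K`-equivalence: a homeomorphism `D → E` with `(i,0) ↦ (i,0)` and `(i,a) ↦ (i,b)`. -/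
def KEquiv (D E : PlaneSet) : Prop :=
  ∃ f : D.carrier ≃ₜ E.carrier, ∀ i : ℕ, 1 ≤ i → ∀ p : D.carrier,
    ((p : ℝ × ℝ) = botPt i → (f p : ℝ × ℝ) = botPt i) ∧
    ((p : ℝ × ℝ) = D.topPt i → (f p : ℝ × ℝ) = E.topPt i)

/-- The composition `E ∘ D`: `D` is put on top of `E`. -/
def comp (E D : PlaneSet) : PlaneSet where
  height := D.height + E.height
  carrier := {q | ∃ p ∈ D.carrier, q = (p.1, p.2 + E.height)} ∪ E.carrier

/-- The unit frieze `I` in `R_1`. -/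
def unit : PlaneSet where
  height := 1
  carrier := {p | (∃ i : ℕ, 1 ≤ i ∧ p.1 = i) ∧ 0 ≤ p.2 ∧ p.2 ≤ 1}

/-- The circular frieze `C`: `I` with a circle of radius `1/4` and centre `(1/2,1/2)`. -/
def circular : PlaneSet where
  height := 1
  carrier := unit.carrier ∪ {p | (p.1 - 1 / 2) ^ 2 + (p.2 - 1 / 2) ^ 2 = (1 / 4) ^ 2}

/-- The diapsidal frieze `H_k` in `R_2`: a semicircular cup with end points `(k,2)`, `(k+1,2)`, a
semicircular cap with end points `(k,0)`, `(k+1,0)`, and straight vertical threads elsewhere. -/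
def diapsidal (k : ℕ) : PlaneSet where
  height := 2
  carrier :=
    {p | (∃ i : ℕ, 1 ≤ i ∧ i ≠ k ∧ i ≠ k + 1 ∧ p.1 = i) ∧ 0 ≤ p.2 ∧ p.2 ≤ 2} ∪
    {p | (p.1 - (k + 1 / 2)) ^ 2 + (p.2 - 2) ^ 2 = (1 / 2) ^ 2 ∧ p.2 ≤ 2} ∪
    {p | (p.1 - (k + 1 / 2)) ^ 2 + p.2 ^ 2 = (1 / 2) ^ 2 ∧ 0 ≤ p.2}

end PlaneSet

/-- The diagrammatic interpretation of terms. -/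
def delta {n : ℕ} : KTerm n → PlaneSet
  | .gen (.h i _) => PlaneSet.diapsidal i
  | .gen .c => PlaneSet.circular
  | .one => PlaneSet.unit
  | .mul t u => (delta t).comp (delta u)

/-- The type of `n`-friezes. -/
def NFrieze (n : ℕ) : Type := {D : PlaneSet // D.IsNFrieze n}

theorem PlaneSet.IsOmegaDiagram.botPt_mem {D : PlaneSet} (hD : D.IsOmegaDiagram) {i : ℕ}
    (hi : 1 ≤ i) : PlaneSet.botPt i ∈ D.carrier :=
  (hD.inter_bot.symm.subset ⟨i, hi, rfl⟩).1

theorem PlaneSet.IsOmegaDiagram.topPt_mem {D : PlaneSet} (hD : D.IsOmegaDiagram) {i : ℕ}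
    (hi : 1 ≤ i) : D.topPt i ∈ D.carrier :=
  (hD.inter_top.symm.subset ⟨i, hi, rfl⟩).1

/-- `K`-equivalence is an equivalence relation on `n`-friezes. -/
instance NFrieze.setoid (n : ℕ) : Setoid (NFrieze n) where
  r D E := PlaneSet.KEquiv D.1 E.1
  iseqv := by
    refine ⟨fun D => ⟨Homeomorph.refl _, fun i _ p => ⟨id, id⟩⟩, ?_, ?_⟩
    · rintro D E ⟨f, hf⟩
      refine ⟨f.symm, fun i hi q => ⟨fun hq => ?_, fun hq => ?_⟩⟩
      · have hD := D.2.toIsOmegaDiagram.botPt_mem hi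
        have h := (hf i hi ⟨_, hD⟩).1 rfl
        have h' : f ⟨_, hD⟩ = q := Subtype.ext (h.trans hq.symm)
        rw [← h', Homeomorph.symm_apply_apply]
      · have hD := D.2.toIsOmegaDiagram.topPt_mem hi
        have h := (hf i hi ⟨_, hD⟩).2 rfl
        have h' : f ⟨_, hD⟩ = q := Subtype.ext (h.trans hq.symm)
        rw [← h', Homeomorph.symm_apply_apply]
    · rintro D E F ⟨f, hf⟩ ⟨g, hg⟩
      exact ⟨f.trans g, fun i hi p =>
        ⟨fun hp => (hg i hi (f p)).1 ((hf i hi p).1 hp),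
          fun hp => (hg i hi (f p)).2 ((hf i hi p).2 hp)⟩⟩

/-- `[F_n]_K`: the set of `K`-equivalence classes of `n`-friezes. -/
def FriezeClass (n : ℕ) : Type := Quotient (NFrieze.setoid n)

/-- The `K`-equivalence class of an `n`-frieze. -/
def FriezeClass.mk {n : ℕ} (D : PlaneSet) (hD : D.IsNFrieze n) : FriezeClass n :=
  Quotient.mk (NFrieze.setoid n) ⟨D, hD⟩

end

end KFrieze

/-! ### Rewriting to Jones normal form in any monoid satisfying the relations. -/

namespace KFrieze

/-! Everything is reduced to one combinatorial invariant. Label the marked points of a frieze by the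
non-zero integers, positive labels at the bottom and negative ones at the top. The threads then
define a fixed-point-free involution `σ` of the labels, and the circular components are counted by a
number `l`. Two friezes are K-equivalent exactly when they have the same pair `(σ, l)`
(`HasInvariant.kEquiv`, `KEquiv.hasInvariant`). Putting `H_i` or `C` on top changes the pair by an
explicit rule: `loopAct`, or adding one loop. Hence the invariant of `δ(t)` is the result of letting
`t` act on the pairing of the unit (`delta_hasInvariant`).

It remains to compare terms through this action. The defining relations hold for it
(`KTerm.Eqv.act_eq`). Conversely they suffice to bring every term into Jones normal form
(`exists_jonesProd`), and different normal forms act differently (`listAct_injective`). In the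
pairing of a normal form the last block `h_[b,a]` is visible: `a` is the place of the rightmost cup
on neighbouring top points, and `b + 1` is the last place whose thread is not vertical. Undoing this
block leaves a shorter normal form. So equality in `K_n`, equality of invariants and K-equivalence
of friezes coincide, and normal forms are unique. For surjectivity, the pairing of an `n`-frieze is
non-crossing and vertical beyond `n`. Any such pairing comes from a word (`exists_word`), found by
sliding a cup to the right until the outermost thread becomes vertical.

The topology needed is the following. Components of diagrams are intervals or circles
(`IsOneManifold.nonempty_homeomorph`), because an open arc maximal with respect to a finite cover by
charts can end only in boundary points or close up. Threads do not cross because paths in a half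
plane with interleaved real end points meet (`inter_nonempty_of_interleaved`), by a count of the
argument of the difference of the paths. In a composition, two threads meeting in a point of the
middle line glue to an open arc (`isInteriorPoint_glue`). Verticality beyond `n` keeps the
components compact, and the condition on regions is inherited by following the gap between two
neighbouring vertical threads (`comp_isNFrieze`). -/

/-- The relations of `K_n` for a sequence `h` and an element `c` of a monoid. -/
structure JonesRelations {M : Type*} [Monoid M] (n : ℕ) (h : ℕ → M) (c : M) : Prop where
  comm : ∀ i j, 1 ≤ i → i + 2 ≤ j → j < n → h i * h j = h j * h i
  up : ∀ i, 1 ≤ i → i + 1 < n → h i * h (i + 1) * h i = h i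
  down : ∀ i, 1 ≤ i → i + 1 < n → h (i + 1) * h i * h (i + 1) = h (i + 1)
  comm_c : ∀ i, 1 ≤ i → i < n → h i * c = c * h i
  sq : ∀ i, 1 ≤ i → i < n → h i * h i = c * h i

/-- The descending product `h_{a+k-1} ⋯ h_a` of `k` factors. -/
def descProd {M : Type*} [Monoid M] (h : ℕ → M) (a : ℕ) : ℕ → M
  | 0 => 1
  | k + 1 => h (a + k) * descProd h a k

/-- The submonoid generated by `c` and the `h_i` with `1 ≤ i < m`. -/
def jonesSubmonoid {M : Type*} [Monoid M] (h : ℕ → M) (c : M) (m : ℕ) : Submonoid M :=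
  Submonoid.closure ({c} ∪ h '' {i | 1 ≤ i ∧ i < m})

/-- The element `c^l h_[b_1,a_1] ⋯ h_[b_k,a_k]`, the block `h_[b,a]` being given by the pair
`(a, b + 1 - a)`. -/
def jonesProd {M : Type*} [Monoid M] (h : ℕ → M) (c : M) (l : ℕ) (L : List (ℕ × ℕ)) : M :=
  c ^ l * (L.map fun B => descProd h B.1 B.2).prod

/-- Admissible lists of blocks for the Jones normal form with letters below `m`. -/
def IsJonesList (m : ℕ) (L : List (ℕ × ℕ)) : Prop :=
  (∀ B ∈ L, 1 ≤ B.1 ∧ 1 ≤ B.2 ∧ B.1 + B.2 ≤ m) ∧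
    L.Pairwise fun B B' => B.1 < B'.1 ∧ B.1 + B.2 < B'.1 + B'.2

namespace JonesRelations

variable {M : Type*} [Monoid M] {n : ℕ} {h : ℕ → M} {c : M}

theorem descProd_succ (h : ℕ → M) (a k : ℕ) :
    descProd h a (k + 1) = descProd h (a + 1) k * h a := by
  induction k with
  | zero => simp [descProd]
  | succ k ih =>
    rw [descProd, ih, descProd, mul_assoc, add_right_comm a 1 k, add_assoc a k 1]

theorem descProd_add (h : ℕ → M) (a k l : ℕ) :
    descProd h a (k + l) = descProd h (a + k) l * descProd h a k := by
  induction l with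
  | zero => simp [descProd]
  | succ l ih => rw [← add_assoc, descProd, ih, descProd, mul_assoc, add_assoc]

theorem h_mem {m i : ℕ} (h1 : 1 ≤ i) (h2 : i < m) : h i ∈ jonesSubmonoid h c m :=
  Submonoid.subset_closure (Or.inr ⟨i, ⟨h1, h2⟩, rfl⟩)

theorem c_mem {m : ℕ} : c ∈ jonesSubmonoid h c m :=
  Submonoid.subset_closure (Or.inl rfl)

theorem descProd_mem {m a k : ℕ} (h1 : 1 ≤ a) (h2 : a + k ≤ m) :
    descProd h a k ∈ jonesSubmonoid h c m := by
  induction k with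
  | zero => exact one_mem _
  | succ k ih => exact mul_mem (h_mem (by omega) (by omega)) (ih (by omega))

variable (R : JonesRelations n h c)
include R

theorem commute_descProd_of_lt {j a k : ℕ} (hj : 1 ≤ j) (hja : j + 2 ≤ a) (hk : a + k ≤ n) :
    h j * descProd h a k = descProd h a k * h j := by
  induction k with
  | zero => simp [descProd]
  | succ k ih =>
    rw [descProd, ← mul_assoc, R.comm j (a + k) hj (by omega) (by omega), mul_assoc,
      ih (by omega), mul_assoc]

theorem commute_descProd_of_gt {j a k : ℕ} (ha : 1 ≤ a) (hj : j < n) (hja : a + k + 1 ≤ j) :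
    h j * descProd h a k = descProd h a k * h j := by
  induction k with
  | zero => simp [descProd]
  | succ k ih =>
    rw [descProd, ← mul_assoc, ← R.comm (a + k) j (by omega) (by omega) hj, mul_assoc,
      ih (by omega), mul_assoc]

theorem commute_descProd_descProd {a k a' k' : ℕ} (ha : 1 ≤ a) (h1 : a + k + 1 ≤ a')
    (h2 : a' + k' ≤ n) :
    descProd h a k * descProd h a' k' = descProd h a' k' * descProd h a k := by
  induction k with
  | zero => simp [descProd]
  | succ k ih =>
    rw [descProd, mul_assoc, ih (by omega), ← mul_assoc,
      R.commute_descProd_of_lt (by omega) (by omega) h2, mul_assoc]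

theorem descProd_mul_c {a k : ℕ} (ha : 1 ≤ a) (hk : a + k ≤ n) :
    descProd h a k * c = c * descProd h a k := by
  induction k with
  | zero => simp [descProd]
  | succ k ih =>
    rw [descProd, mul_assoc, ih (by omega), ← mul_assoc, R.comm_c _ (by omega) (by omega),
      mul_assoc]

/-- Induction on a word, one letter being added on the right at a time. The descending block at the
end either lets the new letter pass, grows by it or loses letters through it, so the letter with the
largest index `m` is needed at most once. -/
theorem exists_eq_mul_descProd {m : ℕ} (hm1 : 1 ≤ m) (hm : m < n) {x : M}
    (hx : x ∈ jonesSubmonoid h c (m + 1)) :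
    ∃ y ∈ jonesSubmonoid h c m, ∃ a k, 1 ≤ a ∧ a + k = m + 1 ∧ x = y * descProd h a k := by
  induction hx using Submonoid.closure_induction_right with
  | one => exact ⟨1, one_mem _, m + 1, 0, by omega, rfl, by simp [descProd]⟩
  | mul_right x hx g hg ih =>
    obtain ⟨y, hy, a, k, ha, hak, rfl⟩ := ih
    rcases hg with rfl | ⟨j, ⟨hj1, hj2⟩, rfl⟩
    · refine ⟨y * g, mul_mem hy c_mem, a, k, ha, hak, ?_⟩
      rw [mul_assoc, R.descProd_mul_c ha (by omega), mul_assoc]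
    -- The letter `h_j` follows the block `h_m ⋯ h_a`. For `j < a - 1` it commutes with the block,
    -- for `j = a - 1` it lengthens it, for `j = a` it produces `c` by `sq`, and for `j > a` it is
    -- absorbed by `down`.
    · rcases lt_or_ge (j + 1) a with h1 | h1
      · refine ⟨y * h j, mul_mem hy (h_mem hj1 (by omega)), a, k, ha, hak, ?_⟩
        rw [mul_assoc, mul_assoc, R.commute_descProd_of_lt hj1 (by omega) (by omega)]
      obtain rfl | h1 := h1.eq_or_lt
      · exact ⟨y, hy, j, k + 1, hj1, by omega, by rw [descProd_succ, mul_assoc]⟩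
      obtain rfl | h1 := (show a ≤ j by omega).eq_or_lt
      · obtain ⟨k, rfl⟩ : ∃ k', k = k' + 1 := ⟨k - 1, by omega⟩
        refine ⟨y * c, mul_mem hy c_mem, a, k + 1, ha, hak, ?_⟩
        have e : descProd h a (k + 1) * h a = c * descProd h a (k + 1) := by
          rw [descProd_succ, mul_assoc, R.sq a ha (by omega), ← mul_assoc,
            R.descProd_mul_c (by omega) (by omega), mul_assoc]
        rw [mul_assoc, e, mul_assoc]
      obtain rfl | h1 := (show a + 1 ≤ j by omega).eq_or_lt
      · obtain ⟨k, rfl⟩ : ∃ k', k = k' + 2 := ⟨k - 2, by omega⟩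
        refine ⟨y, hy, a + 1, k + 1, by omega, by omega, ?_⟩
        rw [descProd_succ, descProd_succ, mul_assoc, mul_assoc, mul_assoc,
          ← mul_assoc (h (a + 1)), R.down a ha (by omega)]
      obtain ⟨p, rfl⟩ : ∃ p, j = a + (p + 2) := ⟨j - a - 2, by omega⟩
      obtain ⟨q, rfl⟩ : ∃ q, k = p + 2 + (q + 1) := ⟨k - (p + 2) - 1, by omega⟩
      refine ⟨y * descProd h a (p + 1), mul_mem hy (descProd_mem ha (by omega)), a + (p + 2), q + 1,
        by omega, by omega, ?_⟩
      -- The letter passes everything below `h_{a+p+1}` and gives `h_{a+p+2} h_{a+p+1} h_{a+p+2}`,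
      -- to which `down` applies. The lower part of the block then moves to the left into `y`.
      have e1 : descProd h a (p + 2) * h (a + (p + 2)) =
          h (a + (p + 1)) * h (a + (p + 2)) * descProd h a (p + 1) := by
        rw [show descProd h a (p + 2) = h (a + (p + 1)) * descProd h a (p + 1) from rfl, mul_assoc,
          ← R.commute_descProd_of_gt ha (by omega) (by omega), mul_assoc]
      have e2 := R.down (a + (p + 1)) (by omega) (by omega)
      have e3 : ∀ z, h (a + (p + 2)) * (h (a + (p + 1)) * (h (a + (p + 2)) * z)) =
          h (a + (p + 2)) * z := fun z => by
        rw [← mul_assoc, ← mul_assoc, show a + (p + 2) = a + (p + 1) + 1 from rfl, e2]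
      rw [mul_assoc, mul_assoc, descProd_add, mul_assoc, e1,
        R.commute_descProd_descProd ha (by omega) (by omega), descProd_succ]
      simp only [mul_assoc, e3]

/-- The last letter `h_d` of the first block commutes with the second block as far as `h_{d+2}` and
is then consumed by `h_d h_{d+1} h_d = h_d`. The block left over on the right, `h_m ⋯ h_{d+2}`, is
strictly shorter than the one before, so the rewriting terminates. -/
theorem descProd_mul_descProd {d e a k m : ℕ} (ha : 1 ≤ a) (had : a ≤ d) (hd : d + (e + 1) ≤ m)
    (hm : m < n) (hak : a + k = m + 1) :
    descProd h d (e + 1) * descProd h a k =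
      descProd h (d + 1) e * descProd h a (d + 1 - a) * descProd h (d + 2) (m - (d + 1)) := by
  obtain ⟨p, rfl⟩ : ∃ p, d = a + p := ⟨d - a, by omega⟩
  obtain ⟨q, rfl⟩ : ∃ q, m = a + p + 1 + q := ⟨m - (a + p + 1), by omega⟩
  obtain rfl : k = p + 2 + q := by omega
  rw [show a + p + 1 - a = p + 1 by omega, show a + p + 1 + q - (a + p + 1) = q by omega]
  rw [descProd_add h a (p + 2) q, descProd_succ, mul_assoc, mul_assoc,
    R.commute_descProd_descProd ha (by omega) (by omega), ← mul_assoc (h (a + p)),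
    R.commute_descProd_of_lt (by omega) (by omega) (by omega),
    show descProd h a (p + 2) = h (a + p + 1) * (h (a + p) * descProd h a p) from rfl,
    show descProd h a (p + 1) = h (a + p) * descProd h a p from rfl]
  rw [mul_assoc (descProd h (a + (p + 2)) q), ← mul_assoc (h (a + p + 1)), ← mul_assoc (h (a + p)),
    ← mul_assoc (h (a + p)), R.up (a + p) (by omega) (by omega)]
  rfl

/-- The outer induction bounds the letters; the inner one is on the length of the block `h_m ⋯ h_a`
split off on the right. If the normal form in front of it ends in a block with lower index below
`a`, the new block is appended. Otherwise the two blocks are rewritten by `descProd_mul_descProd`,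
which shortens the split-off block. -/
theorem exists_jonesProd {m : ℕ} (hm : m ≤ n) {x : M} (hx : x ∈ jonesSubmonoid h c m) :
    ∃ l L, IsJonesList m L ∧ x = jonesProd h c l L := by
  induction m generalizing x with
  | zero =>
    have : jonesSubmonoid h c 0 = Submonoid.powers c := by
      simp [jonesSubmonoid, Submonoid.powers_eq_closure]
    rw [this] at hx
    obtain ⟨l, rfl⟩ := hx
    exact ⟨l, [], by simp [IsJonesList], by simp [jonesProd]⟩
  | succ m ihm =>
    obtain rfl | hm1 := Nat.eq_zero_or_pos m
    · have : jonesSubmonoid h c (0 + 1) = jonesSubmonoid h c 0 := by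
        have : {i : ℕ | 1 ≤ i ∧ i < 0 + 1} = {i : ℕ | 1 ≤ i ∧ i < 0} := by ext; simp; omega
        simp only [jonesSubmonoid, this]
      rw [this] at hx
      obtain ⟨l, L, hL, rfl⟩ := ihm (by omega) hx
      exact ⟨l, L, ⟨fun B hB => by have := hL.1 B hB; omega, hL.2⟩, rfl⟩
    obtain ⟨y, hy, a, k, ha, hak, rfl⟩ := R.exists_eq_mul_descProd hm1 hm hx
    clear hx
    induction k using Nat.strong_induction_on generalizing y a with
    | _ k ihk =>
    obtain ⟨l, L, hL, rfl⟩ := ihm (by omega) hy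
    obtain rfl | hk := Nat.eq_zero_or_pos k
    · exact ⟨l, L, ⟨fun B hB => by have := hL.1 B hB; omega, hL.2⟩, by simp [descProd]⟩
    by_cases hlast : ∀ B ∈ L, B.1 < a
    · refine ⟨l, L ++ [(a, k)], ⟨?_, ?_⟩, ?_⟩
      · intro B hB
        rcases List.mem_append.1 hB with hB | hB
        · have := hL.1 B hB; omega
        · obtain rfl := List.mem_singleton.1 hB
          exact ⟨ha, hk, hak.le⟩
      -- Upper ends increase automatically: the earlier blocks have letters below `m`, and the new
      -- one begins with `h_m`.
      · refine List.pairwise_append.2 ⟨hL.2, by simp, fun B hB B' hB' => ?_⟩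
        obtain rfl := List.mem_singleton.1 hB'
        have := hL.1 B hB
        exact ⟨hlast B hB, by simp only; omega⟩
      · simp [jonesProd, mul_assoc]
    · rcases List.eq_nil_or_concat L with rfl | ⟨L', ⟨d, e⟩, rfl⟩
      · simp at hlast
      rw [List.concat_eq_append] at *
      -- Lower indices increase along the list, so a failure must already occur at the last block.
      have had : a ≤ d := by
        by_contra hcon
        refine hlast fun B hB => ?_
        rcases List.mem_append.1 hB with hB | hB
        · have := (List.pairwise_append.1 hL.2).2.2 B hB (d, e) (by simp)
          simp only at this
          omega
        · obtain rfl := List.mem_singleton.1 hB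
          simpa using hcon
      have hde := hL.1 (d, e) (by simp)
      simp only at hde
      obtain ⟨e, rfl⟩ : ∃ e', e = e' + 1 := ⟨e - 1, by omega⟩
      have hmem : jonesProd h c l L' ∈ jonesSubmonoid h c m := by
        refine mul_mem (pow_mem c_mem l) (list_prod_mem fun z hz => ?_)
        obtain ⟨B, hB, rfl⟩ := List.mem_map.1 hz
        have := hL.1 B (by simp [hB])
        exact descProd_mem this.1 this.2.2
      obtain ⟨l'', L'', h1, h2⟩ := ihk (m - (d + 1)) (by omega)
        (jonesProd h c l L' * (descProd h (d + 1) e * descProd h a (d + 1 - a)))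
        (mul_mem hmem (mul_mem (descProd_mem (by omega) (by omega))
          (descProd_mem ha (by omega)))) (d + 2) (by omega) (by omega)
      refine ⟨l'', L'', h1, h2 ▸ ?_⟩
      rw [mul_assoc (jonesProd h c l L'), ← R.descProd_mul_descProd ha had hde.2.2 hm hak]
      simp [jonesProd, mul_assoc]

end JonesRelations
end KFrieze

/-! ### Pairings of marked points and the action of blocks on them. -/

namespace KFrieze

/-- A fixed-point-free involution of the non-zero integers (extended by `0 ↦ 0`). The integer `z`
stands for the bottom point `(z,0)` if `z > 0` and for the top point `(-z,a)` if `z < 0`. -/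
structure IsPairing (σ : ℤ → ℤ) : Prop where
  invol : ∀ z, σ (σ z) = z
  zero : σ 0 = 0
  ne : ∀ z, z ≠ 0 → σ z ≠ z

/-- All points beyond `m` are paired vertically. -/
def PairingLevel (m : ℕ) (σ : ℤ → ℤ) : Prop := ∀ z, (m : ℤ) < |z| → σ z = -z

/-- A pairing without crossing arcs. -/
def NonCrossing (σ : ℤ → ℤ) : Prop := ∀ x y, ¬ (x < y ∧ y < σ x ∧ σ x < σ y)

/-- The pairing obtained by putting the diapsis `h_i` on top. -/
def pairingAct (i : ℕ) (σ : ℤ → ℤ) (z : ℤ) : ℤ :=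
  if z = -i then -(i + 1)
  else if z = -(i + 1) then -i
  else if z = σ (-i) then σ (-(i + 1))
  else if z = σ (-(i + 1)) then σ (-i)
  else σ z

/-- A pairing with a number of loops, acted upon by `h_i`. -/
def loopAct (s : (ℤ → ℤ) × ℕ) (i : ℕ) : (ℤ → ℤ) × ℕ :=
  (pairingAct i s.1, s.2 + if s.1 (-i) = -(i + 1) then 1 else 0)

/-- The action of the block `h_{a+k-1} ⋯ h_a`. -/
def blockAct (s : (ℤ → ℤ) × ℕ) (a : ℕ) : ℕ → (ℤ → ℤ) × ℕ
  | 0 => s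
  | k + 1 => loopAct (blockAct s (a + 1) k) a

/-- The pairing of the unit. -/
def unitPairing : (ℤ → ℤ) × ℕ := (fun z => -z, 0)

theorem isPairing_unitPairing : IsPairing unitPairing.1 :=
  ⟨fun z => by simp [unitPairing], by simp [unitPairing], fun z hz => by
    simp only [unitPairing]; omega⟩

theorem IsPairing.injective {σ : ℤ → ℤ} (h : IsPairing σ) : Function.Injective σ := fun x y e => by
  rw [← h.invol x, e, h.invol]

theorem IsPairing.ne_zero {σ : ℤ → ℤ} (h : IsPairing σ) {z : ℤ} (hz : z ≠ 0) : σ z ≠ 0 :=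
  fun e => hz (by rw [← h.invol z, e, h.zero])

theorem IsPairing.pairingAct {σ : ℤ → ℤ} (h : IsPairing σ) {i : ℕ} (hi : 1 ≤ i) :
    IsPairing (pairingAct i σ) := by
  have h1 := h.invol
  have h2 := h.zero
  have h3 := h.ne
  refine ⟨fun z => ?_, ?_, fun z hz => ?_⟩ <;> unfold KFrieze.pairingAct
  · grind
  · grind
  · grind

theorem PairingLevel.pairingAct {σ : ℤ → ℤ} {m : ℕ} (h : IsPairing σ) (hm : PairingLevel m σ)
    {i : ℕ} (hi : i + 1 ≤ m) : PairingLevel m (pairingAct i σ) := by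
  intro z hz
  have h1 := hm z hz
  have h2 := hm (-z) (by simpa using hz)
  have h3 := h.invol
  have h5 : z ≠ -i := by rintro rfl; simp at hz; omega
  have h6 : z ≠ -(i + 1) := by rintro rfl; rw [abs_neg, abs_of_nonneg (by omega)] at hz; omega
  have h7 : -z ≠ -i := by rw [← abs_neg] at hz; intro e; rw [e] at hz; simp at hz; omega
  have h8 : -z ≠ -(i + 1) := by
    intro e; rw [← abs_neg, e, abs_neg, abs_of_nonneg (by omega)] at hz; omega
  unfold KFrieze.pairingAct
  grind

/-- The relabelling of points under the action of the block from `b` down to `a`. -/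
def blockShift (a b : ℕ) (x : ℤ) : ℤ :=
  if x = -b then b + 1 else if -b < x ∧ x ≤ -a then x - 2 else x

theorem blockShift_cases (a b : ℕ) (x : ℤ) :
    (x = -b ∧ blockShift a b x = b + 1) ∨
    (-b < x ∧ x ≤ -a ∧ blockShift a b x = x - 2) ∨
    (x ≠ -b ∧ ¬ (-b < x ∧ x ≤ -a) ∧ blockShift a b x = x) := by
  unfold blockShift
  split_ifs <;> simp_all

/-- With `b = a + k`, the block creates a cup on the top places `a, a + 1` and moves the strands at
the top places `a, …, b - 1` two places to the right. The strand at place `b` is led down the thread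
of `b + 1`, which was vertical, to the bottom. No loop is closed: before `h_i` acts, the top point
`i + 1` is joined to the top point `i + 2`, or for the first letter to the bottom. -/
theorem blockAct_spec {s : (ℤ → ℤ) × ℕ} (hs : IsPairing s.1) {a k : ℕ} (ha : 1 ≤ a)
    (hlev : s.1 (-(a + k + 1)) = a + k + 1) :
    IsPairing (blockAct s a (k + 1)).1 ∧ (blockAct s a (k + 1)).2 = s.2 ∧
    (blockAct s a (k + 1)).1 (-a) = -(a + 1) ∧
    ∀ x : ℤ, x ≠ a + k + 1 → x ≠ -(a + k + 1) →
      (blockAct s a (k + 1)).1 (blockShift a (a + k) x) = blockShift a (a + k) (s.1 x) := by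
  induction k generalizing a with
  | zero =>
    have h1 := hs.invol
    have h2 := hs.zero
    have h3 := hs.ne
    simp only [Nat.cast_zero, add_zero] at hlev
    have h4 : s.1 (a + 1) = -(a + 1) := by have := h1 (-(a + 1)); rwa [hlev] at this
    refine ⟨hs.pairingAct ha, ?_, ?_, ?_⟩
    · change (loopAct s a).2 = s.2
      simp only [loopAct]
      rw [if_neg, add_zero]
      intro e
      have := h1 (-a)
      rw [e, hlev] at this
      omega
    · simp [blockAct, loopAct, pairingAct]
    · intro x hx1 hx2
      simp only [blockAct, loopAct, pairingAct, blockShift]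
      push_cast at hx1 hx2 ⊢
      grind
  | succ k ih =>
    obtain ⟨hp, hl, hpk, hsh⟩ := ih (a := a + 1) (by omega) (by push_cast at hlev ⊢; grind)
    set t := blockAct s (a + 1) (k + 1) with ht
    have h1 := hp.invol
    have h2 := hp.zero
    have h3 := hp.ne
    have g1 := hs.invol
    push_cast at hpk hsh hlev
    have h4 : t.1 (-(a + 2)) = -(a + 1) := by
      have := h1 (-(a + 1)); rw [hpk] at this; rw [← this]; congr 1
    refine ⟨hp.pairingAct ha, ?_, ?_, ?_⟩
    · rw [blockAct, ← ht, loopAct]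
      simp only [hl, Nat.add_eq_left, ite_eq_right_iff, one_ne_zero, imp_false]
      intro e
      have := h1 (-a)
      rw [e, hpk] at this
      omega
    · simp [blockAct, loopAct, pairingAct]
    · intro x hx1 hx2
      have h5 := hsh x (by push_cast at hx1; omega) (by push_cast at hx2; omega)
      have h6 : s.1 x ≠ -(a + k + 2) := fun e => by
        have := g1 x; rw [e] at this
        apply hx1; rw [← this]; push_cast; rw [← hlev]; grind
      have h7 : s.1 x ≠ (a + k + 2) := fun e => by
        have := g1 x; rw [e] at this
        apply hx2; rw [← this]; push_cast
        have := g1 (-(a + (k + 1) + 1)); rw [hlev] at this; grind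
      -- Lengthening the block by `h_a` affects the relabelling only at `-a`, which now moves two
      -- places as well.
      have e1 : ∀ x : ℤ, x ≠ a + k + 2 → x ≠ -(a + k + 2) →
          blockShift a (a + (k + 1)) x = if x = -a then -((a : ℤ) + 2) else blockShift (a + 1) (a + 1 + k) x := by
        intro x hx1 hx2
        simp only [blockShift]
        push_cast
        grind
      have e2 : ∀ x : ℤ, x ≠ a + k + 2 → x ≠ -(a + k + 2) → x ≠ -a →
          blockShift (a + 1) (a + 1 + k) x ≠ -a ∧ blockShift (a + 1) (a + 1 + k) x ≠ -(a + 1) ∧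
          blockShift (a + 1) (a + 1 + k) x ≠ -(a + 2) := by
        intro x hx1 hx2 hx3
        simp only [blockShift]
        push_cast
        grind
      have e3 : blockShift (a + 1) (a + 1 + k) (-a) = -a := by
        simp only [blockShift]
        push_cast
        grind
      have hx1' : x ≠ a + k + 2 := by push_cast at hx1; omega
      have hx2' : x ≠ -(a + k + 2) := by push_cast at hx2; omega
      rw [e1 x hx1' hx2', e1 _ h7 h6]
      rw [blockAct, ← ht, loopAct]
      simp only [pairingAct]
      have g3 := hs.ne
      have k1 := e2 x hx1' hx2'
      have k2 := e2 (s.1 x) h7 h6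
      have k3 := h1 (-a)
      by_cases c1 : x = -a
      · subst c1
        have := g3 (-a) (by omega)
        grind
      · by_cases c2 : s.1 x = -a <;> grind

theorem PairingLevel.blockAct {s : (ℤ → ℤ) × ℕ} (hs : IsPairing s.1) {a k m : ℕ} (ha : 1 ≤ a)
    (hm : a + k ≤ m) (hlev : PairingLevel m s.1) :
    IsPairing (blockAct s a k).1 ∧ PairingLevel m (blockAct s a k).1 := by
  induction k generalizing a with
  | zero => exact ⟨hs, hlev⟩
  | succ k ih =>
    obtain ⟨h1, h2⟩ := ih (a := a + 1) (by omega) (by omega)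
    exact ⟨h1.pairingAct ha, h2.pairingAct h1 (by omega)⟩

/-- The pairing of a product of blocks. -/
def listAct (L : List (ℕ × ℕ)) : (ℤ → ℤ) × ℕ :=
  L.foldl (fun s B => blockAct s B.1 B.2) unitPairing

theorem listAct_concat (L : List (ℕ × ℕ)) (B : ℕ × ℕ) :
    listAct (L ++ [B]) = blockAct (listAct L) B.1 B.2 := by
  simp [listAct]

/-- The earlier blocks use only letters below the upper end `b` of the last one. Their pairing is
therefore vertical from `b + 1` on, which `blockAct_spec` requires. -/
theorem IsJonesList.of_concat {m : ℕ} {L : List (ℕ × ℕ)} {B : ℕ × ℕ}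
    (h : IsJonesList m (L ++ [B])) :
    IsJonesList (B.1 + B.2 - 1) L ∧ (∀ B' ∈ L, B'.1 < B.1) ∧ 1 ≤ B.1 ∧ 1 ≤ B.2 ∧ B.1 + B.2 ≤ m := by
  obtain ⟨h1, h2⟩ := h
  rw [List.pairwise_append] at h2
  have h3 : ∀ B' ∈ L, _ := fun B' hB' => h2.2.2 B' hB' B (by simp)
  refine ⟨⟨fun B' hB' => ?_, h2.1⟩, fun B' hB' => (h3 B' hB').1, h1 B (by simp)⟩
  have := h1 B' (by simp [hB'])
  have := (h3 B' hB').2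
  omega

/-- The last clause makes the cup of the last block the rightmost cup on neighbouring points. A cup
further right would come, through the relabelling, from such a cup two places further left in the
shorter product, which induction excludes, or it would meet a vertical thread. -/
theorem listAct_spec {m : ℕ} {L : List (ℕ × ℕ)} (hL : IsJonesList m L) :
    IsPairing (listAct L).1 ∧ PairingLevel m (listAct L).1 ∧ (listAct L).2 = 0 ∧
    ∀ i : ℕ, 1 ≤ i → (∀ B ∈ L, B.1 < i) → (listAct L).1 (-i) ≠ -(i + 1) := by
  induction L using List.reverseRecOn generalizing m with
  | nil =>
    exact ⟨isPairing_unitPairing, fun z _ => rfl, rfl, fun i hi _ => by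
      simp [listAct, unitPairing]; omega⟩
  | append_singleton L B ih =>
    obtain ⟨h1, h2, h3, h4, h5⟩ := hL.of_concat
    obtain ⟨i1, i2, i3, i4⟩ := ih h1
    obtain ⟨a, k⟩ := B
    simp only at h1 h2 h3 h4 h5 i2
    obtain ⟨k, rfl⟩ : ∃ k', k = k' + 1 := ⟨k - 1, by omega⟩
    have hlev : (listAct L).1 (-(a + k + 1)) = a + k + 1 := by
      rw [i2 _ (by rw [abs_neg, abs_of_nonneg] <;> omega), neg_neg]
    have hlev' : (listAct L).1 (a + k + 1) = -(a + k + 1) := by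
      have := i1.invol (-(a + k + 1)); rwa [hlev] at this
    obtain ⟨b1, b2, b3, b4⟩ := blockAct_spec i1 h3 hlev
    rw [listAct_concat]
    have hmlev := (PairingLevel.blockAct i1 h3 h5
        (fun z hz => i2 z (lt_of_le_of_lt (by omega) hz))).2
    refine ⟨b1, hmlev, b2.trans i3, ?_⟩
    intro i hi hB hcon
    have hai : a < i := hB (a, k + 1) (by simp)
    simp only at hcon b3 b4
    have key : ∀ j : ℕ, a ≤ j → (listAct L).1 (-j) ≠ -(j + 1) := fun j hj =>
      i4 j (by omega) fun B' hB' => by have := h2 B' hB'; omega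
    have c1 := b1.invol (-a)
    rw [b3] at c1
    obtain rfl | h6 := (show a + 1 ≤ i by omega).eq_or_lt
    · push_cast at hcon; rw [c1] at hcon; omega
    obtain ⟨j, rfl⟩ : ∃ j, i = j + 2 := ⟨i - 2, by omega⟩
    push_cast at hcon
    by_cases h7 : j + 1 ≤ a + k
    -- The top place `j + 2` carries the strand that was at place `j` before the block acted.
    · have c2 := b4 (-j) (by omega) (by omega)
      have c3 := key j (by omega)
      have c4 : blockShift a (a + k) (-j) = -(j + 2) := by
        simp only [blockShift]; push_cast; grind
      rw [c4, hcon] at c2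
      have c5 : (listAct L).1 (-j) ≠ -(a + k + 1) := fun e => by
        have := i1.invol (-j)
        rw [e, hlev] at this
        omega
      have c6 := i1.invol (-j)
      have c7 : (listAct L).1 (-j) ≠ -(a + k + 2) := fun e => by
        have := i1.invol (-j)
        rw [e, i2 _ (by rw [abs_neg, abs_of_nonneg] <;> omega)] at this
        omega
      generalize (listAct L).1 (-j) = w at *
      have c8 := blockShift_cases a (a + k) w
      omega
    · have c2 : (blockAct (listAct L) a (k + 1)).1 (-(j + 2 + 1)) = j + 2 + 1 := by
        have hm' := (PairingLevel.blockAct (m := a + (k + 1)) i1 h3 le_rfl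
          (fun z hz => i2 z (lt_of_le_of_lt (by omega) hz))).2
        rw [hm' _ (by rw [abs_neg, abs_of_nonneg] <;> omega), neg_neg]
      have := b1.invol (-(j + 2 : ℤ))
      rw [hcon, c2] at this
      omega

/-- The lower index of the last block is the place of the rightmost neighbouring cup, and its upper
end is one less than the last non-vertical place. As the relabelling is injective off the two points
at `b + 1`, the pairing before the last block can be recovered, and the argument is repeated. -/
theorem listAct_injective {m m' : ℕ} {L L' : List (ℕ × ℕ)} (hL : IsJonesList m L)
    (hL' : IsJonesList m' L') (h : (listAct L).1 = (listAct L').1) : L = L' := by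
  have aux : ∀ {m : ℕ} {L : List (ℕ × ℕ)} {B : ℕ × ℕ}, IsJonesList m (L ++ [B]) →
      IsPairing (listAct L).1 ∧ PairingLevel (B.1 + B.2 - 1) (listAct L).1 ∧
      PairingLevel (B.1 + B.2) (listAct (L ++ [B])).1 ∧
      (listAct (L ++ [B])).1 (-B.1) = -(B.1 + 1) ∧
      (∀ i : ℕ, B.1 < i → (listAct (L ++ [B])).1 (-i) ≠ -((i : ℤ) + 1)) ∧
      (listAct (L ++ [B])).1 (-(B.1 + B.2)) ≠ B.1 + B.2 ∧
      ∀ x : ℤ, x ≠ B.1 + B.2 → x ≠ -(B.1 + B.2) →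
        (listAct (L ++ [B])).1 (blockShift B.1 (B.1 + B.2 - 1) x) =
          blockShift B.1 (B.1 + B.2 - 1) ((listAct L).1 x) := by
    intro m L B hL
    obtain ⟨h1, h2, h3, h4, h5⟩ := hL.of_concat
    obtain ⟨i1, i2, i3, i4⟩ := listAct_spec h1
    obtain ⟨j1, j2, j3, j4⟩ := listAct_spec hL
    obtain ⟨a, k⟩ := B
    simp only at h1 h2 h3 h4 h5 i2 ⊢
    obtain ⟨k, rfl⟩ : ∃ k', k = k' + 1 := ⟨k - 1, by omega⟩
    have hlev : (listAct L).1 (-(a + k + 1)) = a + k + 1 := by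
      rw [i2 _ (by rw [abs_neg, abs_of_nonneg] <;> omega), neg_neg]
    obtain ⟨b1, b2, b3, b4⟩ := blockAct_spec i1 h3 hlev
    rw [listAct_concat] at j4 ⊢
    simp only at j4 b3 b4 ⊢
    refine ⟨i1, i2, (PairingLevel.blockAct i1 h3 le_rfl
        (fun z hz => i2 z (lt_of_le_of_lt (by omega) hz))).2, b3, ?_, ?_, ?_⟩
    · intro i hi
      refine j4 i (by omega) fun B' hB' => ?_
      rcases List.mem_append.1 hB' with hB' | hB'
      · exact (h2 B' hB').trans hi
      · obtain rfl := List.mem_singleton.1 hB'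
        exact hi
    -- The top point `b + 1` is not vertical. For a block of one letter it belongs to the new cup.
    -- Otherwise it carries the former strand of `b - 1`, and verticality would mean that `b - 1`
    -- and `b` had been joined by a cup.
    · intro hcon
      push_cast at hcon
      rcases Nat.eq_zero_or_pos k with rfl | hk
      · have := b1.invol (-a)
        rw [b3] at this
        simp only [Nat.cast_zero, zero_add] at hcon this
        rw [this] at hcon
        omega
      · have c2 := b4 (-(a + k - 1)) (by omega) (by omega)
        have c3 := b4 (-(a + k)) (by omega) (by omega)
        have c4 : blockShift a (a + k) (-(a + k - 1)) = -(a + (k + 1)) := by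
          simp only [blockShift]; push_cast; grind
        have c5 : blockShift a (a + k) (-(a + k)) = (a + (k + 1)) := by
          simp only [blockShift]; push_cast; grind
        have c6 := i4 (a + k - 1) (by omega) fun B' hB' => by have := h2 B' hB'; omega
        rw [c4, hcon] at c2
        have c7 : ((a + k - 1 : ℕ) : ℤ) = a + k - 1 := by omega
        rw [c7] at c6
        have d1 := i1.invol (-(a + k - 1))
        have hlev' : (listAct L).1 (a + k + 1) = -(a + k + 1) := by
          have := i1.invol (-(a + k + 1)); rwa [hlev] at this
        have d2 : (listAct L).1 (-(a + k - 1)) ≠ a + k + 1 := fun e => by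
          rw [e, hlev'] at d1; omega
        generalize (listAct L).1 (-(a + k - 1)) = w at *
        have c8 := blockShift_cases a (a + k) w
        omega
    · intro x hx1 hx2
      rw [show a + (k + 1) - 1 = a + k by omega]
      exact b4 x (by push_cast at hx1; omega) (by push_cast at hx2; omega)
  induction L using List.reverseRecOn generalizing m m' L' with
  | nil =>
    rcases List.eq_nil_or_concat L' with rfl | ⟨L'', B, rfl⟩
    · rfl
    rw [List.concat_eq_append] at *
    exact absurd (by rw [← h]; simp [listAct, unitPairing]) (aux hL').2.2.2.2.2.1
  | append_singleton L B ih =>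
    rcases List.eq_nil_or_concat L' with rfl | ⟨L'', B', rfl⟩
    · exact absurd (by rw [h]; simp [listAct, unitPairing]) (aux hL).2.2.2.2.2.1
    rw [List.concat_eq_append] at *
    obtain ⟨p1, p2, p3, p4, p5, p6, p7⟩ := aux hL
    obtain ⟨q1, q2, q3, q4, q5, q6, q7⟩ := aux hL'
    obtain ⟨r1, -, r3, r4, -⟩ := hL.of_concat
    obtain ⟨t1, -, t3, t4, -⟩ := hL'.of_concat
    obtain ⟨a, k⟩ := B
    obtain ⟨a', k'⟩ := B'
    simp only at *
    have hb : a + k = a' + k' := by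
      rcases lt_trichotomy (a + k) (a' + k') with hlt | heq | hlt
      · exact absurd (by rw [← h, p3 _ (by rw [abs_neg, abs_of_nonneg] <;> norm_cast <;> omega), neg_neg]) q6
      · exact heq
      · exact absurd (by rw [h, q3 _ (by rw [abs_neg, abs_of_nonneg] <;> norm_cast <;> omega), neg_neg]) p6
    have haa : a = a' := by
      rcases lt_trichotomy a a' with hlt | heq | hlt
      · exact absurd (by rw [h, q4]) (p5 a' hlt)
      · exact heq
      · exact absurd (by rw [← h, p4]) (q5 a hlt)
    subst haa
    obtain rfl : k = k' := by omega
    refine congrArg (· ++ _) (ih r1 t1 (funext fun x => ?_))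
    -- The points at place `a + k`, which is `b + 1`, are not reached by the relabelling, but both
    -- shorter pairings are vertical there.
    by_cases hx : x = a + k ∨ x = -(a + k)
    · have : ((a + k - 1 : ℕ) : ℤ) < |x| := by
        rcases hx with rfl | rfl
        · rw [abs_of_nonneg] <;> omega
        · rw [abs_neg, abs_of_nonneg] <;> omega
      rw [p2 x this, q2 x this]
    · push Not at hx
      have e := p7 x hx.1 hx.2
      rw [h, q7 x hx.1 hx.2] at e
      have d1 := p2 (a + k) (by rw [abs_of_nonneg] <;> omega)
      have d2 := q2 (a + k) (by rw [abs_of_nonneg] <;> omega)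
      have d3 := p2 (-(a + k)) (by rw [abs_neg, abs_of_nonneg] <;> omega)
      have d4 := q2 (-(a + k)) (by rw [abs_neg, abs_of_nonneg] <;> omega)
      have d5 := p1.invol x
      have d6 := q1.invol x
      have hnp : ∀ σ : ℤ → ℤ, σ (σ x) = x → σ (a + k) = -(a + k) → σ (-(a + k)) = -(-(a + k)) →
          σ x ≠ a + k ∧ σ x ≠ -(a + k) := by
        intro σ e1 e2 e3
        constructor
        · intro e; rw [e, e2] at e1; exact hx.2 e1.symm
        · intro e; rw [e, e3] at e1; apply hx.1; omega
      have n1 := hnp _ d5 d1 d3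
      have n2 := hnp _ d6 d2 d4
      generalize (listAct L).1 x = u at *
      generalize (listAct L'').1 x = v at *
      have hc : ((a + k - 1 : ℕ) : ℤ) = a + k - 1 := by omega
      have c8 := blockShift_cases a (a + k - 1) u
      have c9 := blockShift_cases a (a + k - 1) v
      omega

end KFrieze

/-! ### Non-crossing pairings are realised by words. -/

namespace KFrieze

/-- The pairing `σ` with the points `u` and `v` interchanged. -/
def swapPairing (u v : ℤ) (σ : ℤ → ℤ) (z : ℤ) : ℤ :=
  Equiv.swap u v (σ (Equiv.swap u v z))

theorem IsPairing.swapPairing {σ : ℤ → ℤ} (h : IsPairing σ) {u v : ℤ} (hu : u ≠ 0) (hv : v ≠ 0) :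
    IsPairing (swapPairing u v σ) := by
  have h0 : Equiv.swap u v 0 = 0 := Equiv.swap_apply_of_ne_of_ne hu.symm hv.symm
  refine ⟨fun z => by simp [KFrieze.swapPairing, h.invol], by
    simp [KFrieze.swapPairing, h0, h.zero], fun z hz e => ?_⟩
  refine h.ne (Equiv.swap u v z) (fun e' => hz ?_) ?_
  · rw [← h0] at e'; exact (Equiv.swap u v).injective e'
  · exact (Equiv.swap u v).injective (by rw [Equiv.swap_apply_self]; exact e)

theorem PairingLevel.swapPairing {σ : ℤ → ℤ} {m : ℕ} (hm : PairingLevel m σ) {u v : ℤ}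
    (hu : |u| ≤ m) (hv : |v| ≤ m) : PairingLevel m (swapPairing u v σ) := by
  intro z hz
  have h1 : z ≠ u := by rintro rfl; omega
  have h2 : z ≠ v := by rintro rfl; omega
  have h3 : -z ≠ u := by rintro rfl; rw [abs_neg] at hu; omega
  have h4 : -z ≠ v := by rintro rfl; rw [abs_neg] at hv; omega
  rw [KFrieze.swapPairing, Equiv.swap_apply_of_ne_of_ne h1 h2, hm z hz,
    Equiv.swap_apply_of_ne_of_ne h3 h4]

theorem swap_cases (u v z : ℤ) : (z = u ∧ Equiv.swap u v z = v) ∨ (z = v ∧ Equiv.swap u v z = u) ∨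
    (z ≠ u ∧ z ≠ v ∧ Equiv.swap u v z = z) := by
  rw [Equiv.swap_apply_def]
  split_ifs <;> simp_all

/-- The strand ending at the top place `a + 2` is moved across a cup on two neighbouring places.
Such a cup separates nothing, so no crossing arises; acting with `h_a` undoes the move. -/
theorem NonCrossing.slide {σ : ℤ → ℤ} (hσ : IsPairing σ) (hn : NonCrossing σ) {a : ℤ}
    (hpk : σ (-a) = -(a + 1)) : NonCrossing (swapPairing (-a) (-(a + 2)) σ) := by
  intro x y hxy
  have hpk' : σ (-(a + 1)) = -a := by rw [← hpk, hσ.invol]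
  have h1 := hn (Equiv.swap (-a) (-(a + 2)) x) (Equiv.swap (-a) (-(a + 2)) y)
  have i1 := hσ.invol (Equiv.swap (-a) (-(a + 2)) x)
  have i2 := hσ.invol (Equiv.swap (-a) (-(a + 2)) y)
  simp only [swapPairing] at hxy
  have s1 := swap_cases (-a) (-(a + 2)) x
  have s2 := swap_cases (-a) (-(a + 2)) y
  generalize Equiv.swap (-a) (-(a + 2)) x = x' at *
  generalize Equiv.swap (-a) (-(a + 2)) y = y' at *
  have s3 := swap_cases (-a) (-(a + 2)) (σ x')
  have s4 := swap_cases (-a) (-(a + 2)) (σ y')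
  have n1 : x' = -a → σ x' = -(a + 1) := by rintro rfl; exact hpk
  have n2 : y' = -a → σ y' = -(a + 1) := by rintro rfl; exact hpk
  have n3 : x' = -(a + 1) → σ x' = -a := by rintro rfl; exact hpk'
  have n4 : y' = -(a + 1) → σ y' = -a := by rintro rfl; exact hpk'
  have n5 : σ x' = -a → x' = -(a + 1) := by intro e; rw [e, hpk] at i1; omega
  have n6 : σ y' = -a → y' = -(a + 1) := by intro e; rw [e, hpk] at i2; omega
  have n7 : σ x' = -(a + 1) → x' = -a := by intro e; rw [e, hpk'] at i1; omega
  have n8 : σ y' = -(a + 1) → y' = -a := by intro e; rw [e, hpk'] at i2; omega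
  generalize σ x' = x'' at *
  generalize σ y' = y'' at *
  generalize Equiv.swap (-a) (-(a + 2)) x'' = p at *
  generalize Equiv.swap (-a) (-(a + 2)) y'' = q at *
  clear i1 i2 hpk hpk'
  omega

/-- All threads beyond `m + 1` are vertical, so for the remaining arcs the top and bottom points at
`m + 1` are neighbours. The cup at the edge can thus be turned into the vertical thread of `m + 1`.
-/
theorem NonCrossing.slide_last {σ : ℤ → ℤ} (hσ : IsPairing σ) (hn : NonCrossing σ) {m : ℕ}
    (hm : PairingLevel (m + 1) σ) (hm1 : 1 ≤ m) (hpk : σ (-m) = -(m + 1)) :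
    NonCrossing (swapPairing (-m) (m + 1) σ) := by
  intro x y hxy
  have hpk' : σ (-(m + 1)) = -m := by rw [← hpk, hσ.invol]
  have i1 := hσ.invol (Equiv.swap (-m : ℤ) (m + 1) x)
  have i2 := hσ.invol (Equiv.swap (-m : ℤ) (m + 1) y)
  simp only [swapPairing] at hxy
  have s1 := swap_cases (-m : ℤ) (m + 1) x
  have s2 := swap_cases (-m : ℤ) (m + 1) y
  generalize Equiv.swap (-m : ℤ) (m + 1) x = x' at *
  generalize Equiv.swap (-m : ℤ) (m + 1) y = y' at *
  have s3 := swap_cases (-m : ℤ) (m + 1) (σ x')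
  have s4 := swap_cases (-m : ℤ) (m + 1) (σ y')
  have h1 := hn x' y'
  have h3 := hn y' (σ x')
  rw [i1] at h3
  have n1 : x' = -m → σ x' = -(m + 1) := by rintro rfl; exact hpk
  have n2 : y' = -m → σ y' = -(m + 1) := by rintro rfl; exact hpk
  have n3 : x' = -(m + 1) → σ x' = -m := by rintro rfl; exact hpk'
  have n4 : y' = -(m + 1) → σ y' = -m := by rintro rfl; exact hpk'
  have n5 : σ x' = -m → x' = -(m + 1) := by intro e; rw [e, hpk] at i1; omega
  have n6 : σ y' = -m → y' = -(m + 1) := by intro e; rw [e, hpk] at i2; omega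
  have n7 : σ x' = -(m + 1) → x' = -m := by intro e; rw [e, hpk'] at i1; omega
  have n8 : σ y' = -(m + 1) → y' = -m := by intro e; rw [e, hpk'] at i2; omega
  have l1 := hm x'
  have l2 := hm y'
  have l3 := hm (σ x')
  have l4 := hm (σ y')
  rw [i1] at l3
  rw [i2] at l4
  have lt : ∀ z : ℤ, ((m + 1 : ℕ) : ℤ) < |z| ↔ (z < -(m + 1) ∨ m + 1 < z) := by
    intro z; rw [lt_abs]; push_cast; omega
  rw [lt] at l1 l2 l3 l4
  generalize σ x' = x'' at *
  generalize σ y' = y'' at *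
  generalize Equiv.swap (-m : ℤ) (m + 1) x'' = p at *
  generalize Equiv.swap (-m : ℤ) (m + 1) y'' = q at *
  clear i1 i2 hpk hpk' hm hn lt
  rcases s1 with s1 | s1 | s1 <;> rcases s2 with s2 | s2 | s2 <;> rcases s3 with s3 | s3 | s3 <;>
    omega

/-- An innermost arc joins neighbours: the partner of `i + 1` is enclosed between `i` and `j`, and
the search continues inside. -/
theorem NonCrossing.exists_adjacent {σ : ℤ → ℤ} (hσ : IsPairing σ) (hn : NonCrossing σ) {i j : ℕ}
    (hi : 1 ≤ i) (hij : i < j) (h : σ (-i) = -j) :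
    ∃ a : ℕ, 1 ≤ a ∧ a + 1 ≤ j ∧ σ (-a) = -(a + 1) := by
  induction hd : j - i using Nat.strong_induction_on generalizing i j with
  | _ d ih =>
  obtain rfl | hlt := (show i + 1 ≤ j from hij).eq_or_lt
  · exact ⟨i, hi, le_rfl, by rw [h]; push_cast; ring⟩
  have h' : σ (-j) = -i := by rw [← h, hσ.invol]
  have k1 := hn (-j) (-(i + 1))
  have k2 := hn (σ (-(i + 1))) (-j)
  have k3 := hσ.invol (-(i + 1))
  have k4 := hσ.ne (-(i + 1)) (by omega)
  have k5 : σ (-(i + 1)) ≠ -i := fun e => by rw [e, h] at k3; omega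
  have k6 : σ (-(i + 1)) ≠ -j := fun e => by rw [e, h'] at k3; omega
  rw [k3, h'] at k2
  rw [h'] at k1
  obtain ⟨l, hl⟩ : ∃ l : ℕ, σ (-(i + 1)) = -l :=
    ⟨(-σ (-(i + 1))).toNat, by omega⟩
  obtain ⟨a, h1, h2, h3⟩ := ih (l - (i + 1)) (by omega) (i := i + 1) (j := l) (by omega) (by omega)
    (by push_cast; exact hl) rfl
  exact ⟨a, h1, by omega, h3⟩

/-- Without a neighbouring cup every top point up to `m + 1` is joined to the bottom. Counting makes
this a bijection onto the bottom points up to `m + 1`, and the absence of crossings then forces the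
outermost thread to be vertical. -/
theorem NonCrossing.exists_peak {σ : ℤ → ℤ} (hσ : IsPairing σ) (hn : NonCrossing σ) {m : ℕ}
    (hm : PairingLevel (m + 1) σ) (hv : σ (m + 1) ≠ -(m + 1)) :
    ∃ a : ℕ, 1 ≤ a ∧ a ≤ m ∧ σ (-a) = -(a + 1) := by
  by_contra hcon
  have hrange : ∀ z : ℤ, |z| ≤ m + 1 → |σ z| ≤ m + 1 := by
    intro z hz
    by_contra hc
    have := hm (σ z) (by push_cast; omega)
    rw [hσ.invol] at this
    rw [← abs_neg, ← this] at hc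
    exact hc hz
  have hpos : ∀ i : ℕ, 1 ≤ i → i ≤ m + 1 → 0 < σ (-i) := by
    intro i hi him
    by_contra hc
    have h1 := hσ.ne_zero (z := -i) (by omega)
    obtain ⟨j, hj⟩ : ∃ j : ℕ, σ (-i) = -j := ⟨(-σ (-i)).toNat, by omega⟩
    have h2 := hrange (-i) (by rw [abs_neg, abs_of_nonneg] <;> omega)
    rw [hj, abs_neg, abs_of_nonneg (by omega)] at h2
    have h3 := hσ.ne (-i) (by omega)
    rcases lt_trichotomy i j with hlt | heq | hlt
    · obtain ⟨a, q1, q2, q3⟩ := hn.exists_adjacent hσ hi hlt hj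
      exact hcon ⟨a, q1, by omega, q3⟩
    · rw [hj] at h3; omega
    · obtain ⟨a, q1, q2, q3⟩ := hn.exists_adjacent hσ (i := j) (j := i) (by omega) hlt
        (by rw [← hj, hσ.invol])
      exact hcon ⟨a, q1, by omega, q3⟩
  have himg : (Finset.Icc (1 : ℤ) (m + 1)).image (fun z => σ (-z)) = Finset.Icc (1 : ℤ) (m + 1) := by
    refine Finset.eq_of_subset_of_card_le (fun w hw => ?_) ?_
    · obtain ⟨z, hz, rfl⟩ := Finset.mem_image.1 hw
      rw [Finset.mem_Icc] at hz ⊢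
      have := hpos z.toNat (by omega) (by omega)
      rw [Int.toNat_of_nonneg (by omega)] at this
      have h2 := hrange (-z) (by rw [abs_neg, abs_of_nonneg] <;> omega)
      rw [abs_of_pos this] at h2
      omega
    · rw [Finset.card_image_of_injective _ fun x y e => neg_injective (hσ.injective e)]
  have hmem : (m + 1 : ℤ) ∈ (Finset.Icc (1 : ℤ) (m + 1)).image (fun z => σ (-z)) := by
    rw [himg, Finset.mem_Icc]; omega
  obtain ⟨z, hz, hzm⟩ := Finset.mem_image.1 hmem
  rw [Finset.mem_Icc] at hz
  have h3 := hpos (m + 1) (by omega) le_rfl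
  have h4 := hrange (-(m + 1)) (by rw [abs_neg, abs_of_nonneg] <;> omega)
  push_cast at h3
  rw [abs_of_pos h3] at h4
  have h5 : σ (m + 1) = -z := by rw [← hzm, hσ.invol]
  have h6 : σ (-(m + 1)) ≠ m + 1 := fun e => by
    have := hσ.invol (-(m + 1)); rw [e] at this; exact hv this
  -- If the bottom point `m + 1` is joined to the top point `z` with `z < m + 1`, its arc crosses
  -- the one from the top point `m + 1`.
  have h7 := hn (-(m + 1)) (-z)
  have h8 : z ≠ m + 1 := by rintro rfl; exact h6 hzm
  omega

/-- A cup is slid to the right up to the edge, where the last slide makes the thread of `m + 1`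
vertical and lowers the level. Each slide is undone by one letter. That letter closes no loop, as in
the slid pairing the top places `a` and `a + 1` are not joined to each other. -/
theorem exists_word {σ : ℤ → ℤ} (hσ : IsPairing σ) (hn : NonCrossing σ) {m : ℕ}
    (hm : PairingLevel m σ) :
    ∃ w : List ℕ, (∀ i ∈ w, 1 ≤ i ∧ i < m) ∧ w.foldl loopAct unitPairing = (σ, 0) := by
  induction m generalizing σ with
  | zero =>
    refine ⟨[], by simp, Prod.ext (funext fun z => ?_) rfl⟩
    obtain rfl | hz := eq_or_ne z 0
    · simp [unitPairing, hσ.zero]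
    · exact (hm z (by simpa using hz)).symm
  | succ m ih =>
    have hrange : ∀ z : ℤ, |z| ≤ m + 1 → |σ z| ≤ m + 1 := by
      intro z hz
      by_contra hc
      have := hm (σ z) (by push_cast; omega)
      rw [hσ.invol] at this
      rw [← abs_neg, ← this] at hc
      exact hc hz
    have hdown : ∀ τ, IsPairing τ → PairingLevel (m + 1) τ → τ (m + 1) = -(m + 1) →
        PairingLevel m τ := by
      intro τ hτ hl e z hz
      rcases (show ((m + 1 : ℕ) : ℤ) ≤ |z| by push_cast; omega).eq_or_lt with h | h
      · rcases abs_choice z with h' | h'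
        · rw [h'] at h; push_cast at h; rw [← h, e]
        · rw [h'] at h
          obtain rfl : z = -(m + 1) := by push_cast at h; omega
          rw [← e, hτ.invol, e, neg_neg]
      · exact hl z h
    by_cases hv : σ (m + 1) = -(m + 1)
    · obtain ⟨w, hw, h⟩ := ih hσ hn (hdown σ hσ hm hv)
      exact ⟨w, fun i hi => by have := hw i hi; omega, h⟩
    obtain ⟨a, ha1, ham, hpk⟩ := hn.exists_peak hσ hm hv
    clear hv
    induction hd : m - a generalizing a σ with
    | zero =>
      obtain rfl : a = m := by omega
      have hpk' : σ (-(a + 1)) = -a := by rw [← hpk, hσ.invol]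
      set τ := swapPairing (-a) (a + 1) σ with hτ
      have hτp : IsPairing τ := hσ.swapPairing (by omega) (by omega)
      have hs : Equiv.swap (-a : ℤ) (a + 1) (-(a + 1)) = -(a + 1) :=
        Equiv.swap_apply_of_ne_of_ne (by omega) (by omega)
      have e1 : τ (a + 1) = -(a + 1) := by
        rw [hτ, swapPairing, Equiv.swap_apply_right, hpk, hs]
      have e2 : τ (-a) = Equiv.swap (-a : ℤ) (a + 1) (σ (a + 1)) := by
        rw [hτ, swapPairing, Equiv.swap_apply_left]
      obtain ⟨w, hw, h⟩ := ih hτp (hn.slide_last hσ hm ha1 hpk) (hdown τ hτp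
        (hm.swapPairing (by rw [abs_neg, abs_of_nonneg] <;> omega)
          (by rw [abs_of_nonneg] <;> omega)) e1)
      refine ⟨w ++ [a], fun i hi => ?_, ?_⟩
      · rcases List.mem_append.1 hi with hi | hi
        · have := hw i hi; omega
        · obtain rfl := List.mem_singleton.1 hi; omega
      · rw [List.foldl_append, h]
        have f1 : σ (a + 1) ≠ -(a + 1) := fun e => by
          have := hσ.invol (a + 1); rw [e, hpk'] at this; omega
        have f2 : σ (a + 1) ≠ -a := fun e => by
          have := hσ.invol (a + 1); rw [e, hpk] at this; omega
        have f3 := hσ.ne (a + 1) (by omega)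
        have e2' : τ (-a) = σ (a + 1) := by rw [e2, Equiv.swap_apply_of_ne_of_ne f2 f3]
        have e4 : τ (-(a + 1)) = a + 1 := by rw [← e1, hτp.invol]
        simp only [List.foldl_cons, List.foldl_nil, loopAct, e2', if_neg f1, zero_add]
        refine Prod.ext (funext fun z => ?_) rfl
        simp only [pairingAct, e2', e4]
        have g1 := hσ.invol z
        have g2 := hσ.invol (a + 1)
        split_ifs with c1 c2 c3 c4
        · rw [c1, hpk]
        · rw [c2, hpk']
        · rw [c3, g2]
        · rw [c4]
        · rw [hτ, swapPairing, Equiv.swap_apply_of_ne_of_ne c1 c4, Equiv.swap_apply_of_ne_of_ne]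
          · intro e; rw [e, hpk] at g1; omega
          · intro e; rw [e] at g1; exact c3 g1.symm
    | succ d ihd =>
      have hpk' : σ (-(a + 1)) = -a := by rw [← hpk, hσ.invol]
      set τ := swapPairing (-a) (-(a + 2)) σ with hτ
      have hτp : IsPairing τ := hσ.swapPairing (by omega) (by omega)
      have hs : Equiv.swap (-a : ℤ) (-(a + 2)) (-(a + 1)) = -(a + 1) :=
        Equiv.swap_apply_of_ne_of_ne (by omega) (by omega)
      have e1 : τ (-(a + 1)) = -(a + 2) := by
        rw [hτ, swapPairing, hs, hpk', Equiv.swap_apply_left]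
      have hl : PairingLevel (m + 1) τ := hm.swapPairing
        (by rw [abs_neg, abs_of_nonneg] <;> omega) (by rw [abs_neg, abs_of_nonneg] <;> omega)
      obtain ⟨w, hw, h⟩ := ihd hτp (hn.slide hσ hpk) hl (by
        intro z hz
        by_contra hc
        have := hl (τ z) (by push_cast; omega)
        rw [hτp.invol] at this
        rw [← abs_neg, ← this] at hc
        exact hc hz) (a + 1) (by omega) (by omega) (by push_cast; rw [e1]; ring) (by omega)
      refine ⟨w ++ [a], fun i hi => ?_, ?_⟩
      · rcases List.mem_append.1 hi with hi | hi
        · exact hw i hi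
        · obtain rfl := List.mem_singleton.1 hi; omega
      · rw [List.foldl_append, h]
        have f1 : σ (-(a + 2)) ≠ -(a + 1) := fun e => by
          have := hσ.invol (-(a + 2)); rw [e, hpk'] at this; omega
        have f2 : σ (-(a + 2)) ≠ -a := fun e => by
          have := hσ.invol (-(a + 2)); rw [e, hpk] at this; omega
        have f3 := hσ.ne (-(a + 2)) (by omega)
        have e2' : τ (-a) = σ (-(a + 2)) := by
          rw [hτ, swapPairing, Equiv.swap_apply_left, Equiv.swap_apply_of_ne_of_ne f2 f3]
        simp only [List.foldl_cons, List.foldl_nil, loopAct, e2', if_neg f1, zero_add]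
        refine Prod.ext (funext fun z => ?_) rfl
        simp only [pairingAct, e2', e1]
        have g1 := hσ.invol z
        have g2 := hσ.invol (-(a + 2))
        split_ifs with c1 c2 c3 c4
        · rw [c1, hpk]
        · rw [c2, hpk']
        · rw [c3, g2]
        · rw [c4]
        · rw [hτ, swapPairing, Equiv.swap_apply_of_ne_of_ne c1 c4, Equiv.swap_apply_of_ne_of_ne]
          · intro e; rw [e, hpk] at g1; omega
          · intro e; rw [e] at g1; exact c3 g1.symm

end KFrieze

/-! ### Paths in the strip with interleaved end points meet. -/

namespace KFrieze

/-- The values of `θ` form an interval, and two intervals on which the sine is non-negative are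
separated by values where it is negative. -/
theorem exists_int_of_sin_nonneg {θ : ℝ → ℝ} (hθ : Continuous θ) (h : ∀ t, 0 ≤ Real.sin (θ t)) :
    ∃ k : ℤ, ∀ t, 2 * Real.pi * k ≤ θ t ∧ θ t ≤ 2 * Real.pi * k + Real.pi := by
  have hpi := Real.pi_pos
  have hneg : ∀ (k : ℤ) (x : ℝ), 2 * Real.pi * k - Real.pi < x → x < 2 * Real.pi * k →
      Real.sin x < 0 := fun k x h1 h2 => by
    rw [← Real.sin_sub_int_mul_two_pi x k]
    exact Real.sin_neg_of_neg_of_neg_pi_lt (by linarith) (by linarith)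
  set k := ⌊θ 0 / (2 * Real.pi)⌋ with hk
  have h1 : 2 * Real.pi * k ≤ θ 0 := by
    have := (le_div_iff₀ (by positivity)).1 (Int.floor_le (θ 0 / (2 * Real.pi)))
    rw [mul_comm]; exact this
  have h2 : θ 0 < 2 * Real.pi * k + 2 * Real.pi := by
    have := (div_lt_iff₀ (by positivity)).1 (Int.lt_floor_add_one (θ 0 / (2 * Real.pi)))
    rw [← hk] at this
    linarith
  have h3 : θ 0 ≤ 2 * Real.pi * k + Real.pi := by
    by_contra hc
    have := hneg (k + 1) (θ 0) (by push_cast; linarith) (by push_cast; linarith)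
    linarith [h 0]
  have hivt : ∀ t x, x ∈ uIcc (θ 0) (θ t) → 0 ≤ Real.sin x := fun t x hx => by
    obtain ⟨s, -, rfl⟩ := intermediate_value_uIcc (a := 0) (b := t) hθ.continuousOn hx
    exact h s
  refine ⟨k, fun t => ⟨?_, ?_⟩⟩
  · by_contra hc
    have hx : max (θ t) (2 * Real.pi * k - Real.pi / 2) ∈ uIcc (θ 0) (θ t) := by
      rw [uIcc_of_ge (by linarith)]
      exact ⟨le_max_left _ _, max_le (by linarith) (by linarith)⟩
    have := hneg k (max (θ t) (2 * Real.pi * k - Real.pi / 2))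
      (lt_of_lt_of_le (by linarith) (le_max_right _ _))
      (max_lt (by linarith) (by linarith))
    linarith [hivt t _ hx]
  · by_contra hc
    have hx : min (θ t) (2 * Real.pi * k + 3 * Real.pi / 2) ∈ uIcc (θ 0) (θ t) := by
      rw [uIcc_of_le (by linarith)]
      exact ⟨le_min (by linarith) (by linarith), min_le_left _ _⟩
    have := hneg (k + 1) (min (θ t) (2 * Real.pi * k + 3 * Real.pi / 2))
      (lt_min (by push_cast; linarith) (by push_cast; linarith))
      (lt_of_le_of_lt (min_le_right _ _) (by push_cast; linarith))
    linarith [hivt t _ hx]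

/-- Along a path in the closed upper half plane between real points, the change of the argument is
determined by the signs of the end points. -/
theorem arg_change_of_im_nonneg {u : ℝ → ℂ} {l : ℝ → ℂ} (hl : Continuous l)
    (hexp : ∀ t, Complex.exp (l t) = u t) (him : ∀ t, 0 ≤ (u t).im) {x y : ℝ}
    (hx : u 0 = x) (hy : u 1 = y) :
    (0 < x → 0 < y → (l 1).im = (l 0).im) ∧ (x < 0 → 0 < y → (l 1).im = (l 0).im - Real.pi) := by
  have hpi := Real.pi_pos
  have himl : ∀ t, (u t).im = Real.exp (l t).re * Real.sin (l t).im := fun t => by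
    rw [← hexp, Complex.exp_im]
  have hrel : ∀ t, (u t).re = Real.exp (l t).re * Real.cos (l t).im := fun t => by
    rw [← hexp, Complex.exp_re]
  obtain ⟨k, hk⟩ := exists_int_of_sin_nonneg (θ := fun t => (l t).im)
    (Complex.continuous_im.comp hl) fun t => by
      have := him t
      rw [himl] at this
      exact nonneg_of_mul_nonneg_right this (Real.exp_pos _)
  -- Within the half turn selected by `k` the argument of a real number is determined by its sign.
  have key : ∀ t (z : ℝ), u t = z → (0 < z → (l t).im = 2 * Real.pi * k) ∧
      (z < 0 → (l t).im = 2 * Real.pi * k + Real.pi) := by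
    intro t z hz
    have h1 := himl t
    have h2 := hrel t
    rw [hz, Complex.ofReal_im] at h1
    rw [hz, Complex.ofReal_re] at h2
    have h3 : Real.sin (l t).im = 0 :=
      (mul_eq_zero.1 h1.symm).resolve_left (Real.exp_pos _).ne'
    have hkt := hk t
    set v := (l t).im - k * (2 * Real.pi) with hv
    have h4 : Real.sin v = 0 := by rw [hv, Real.sin_sub_int_mul_two_pi, h3]
    have h5 : Real.cos v = Real.cos (l t).im := by rw [hv, Real.cos_sub_int_mul_two_pi]
    have hcases : v = 0 ∨ v = Real.pi := by
      by_contra hc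
      push Not at hc
      have := Real.sin_pos_of_pos_of_lt_pi (x := v)
        (lt_of_le_of_ne (by linarith) (Ne.symm hc.1)) (lt_of_le_of_ne (by linarith) hc.2)
      linarith
    rw [← h5] at h2
    rcases hcases with h0 | h0
    · rw [h0, Real.cos_zero, mul_one] at h2
      exact ⟨fun _ => by linarith, fun hz => by linarith [Real.exp_pos (l t).re]⟩
    · rw [h0, Real.cos_pi] at h2
      exact ⟨fun hz => by linarith [Real.exp_pos (l t).re], fun _ => by linarith⟩
  refine ⟨fun h1 h2 => ?_, fun h1 h2 => ?_⟩
  · rw [(key 1 y hy).1 h2, (key 0 x hx).1 h1]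
  · rw [(key 1 y hy).1 h2, (key 0 x hx).2 h1]; ring

/-- If the paths were disjoint, `g t - f s` would have a continuous logarithm on the whole parameter
plane. Along each side of the unit square one path rests on the real axis, so the change of argument
there is fixed by the signs at the corners. Because the end points interleave, going once round the
square adds up to a full turn instead of zero. -/
theorem inter_nonempty_of_interleaved {A B : Set ℂ} (hA : ∀ z ∈ A, 0 ≤ z.im)
    (hB : ∀ z ∈ B, 0 ≤ z.im) {p r q w : ℝ} (h1 : p < r) (h2 : r < q) (h3 : q < w)
    (hpq : JoinedIn A p q) (hrw : JoinedIn B r w) : (A ∩ B).Nonempty := by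
  by_contra hcon
  have hf : Continuous hpq.somePath.extend := hpq.somePath.continuous_extend
  have hg : Continuous hrw.somePath.extend := hrw.somePath.continuous_extend
  set f := hpq.somePath.extend with hfdef
  set g := hrw.somePath.extend with hgdef
  have hfA : ∀ t, f t ∈ A := fun t => hpq.somePath_mem _
  have hgB : ∀ t, g t ∈ B := fun t => hrw.somePath_mem _
  have f0 : f 0 = p := by simp [hfdef]
  have f1 : f 1 = q := by simp [hfdef]
  have g0 : g 0 = r := by simp [hgdef]
  have g1 : g 1 = w := by simp [hgdef]
  have hne : ∀ s t, g t - f s ≠ 0 := fun s t e =>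
    hcon ⟨f s, hfA s, by rw [← sub_eq_zero.1 e]; exact hgB t⟩
  -- The parameter plane is simply connected, so a nowhere vanishing function on it lifts through
  -- the covering `exp`.
  obtain ⟨L, hLc, hL⟩ : ∃ L : ℝ × ℝ → ℂ, Continuous L ∧
      ∀ s t, Complex.exp (L (s, t)) = g t - f s := by
    obtain ⟨⟨L, hL⟩, ⟨-, h⟩, -⟩ := Complex.isCoveringMapOn_exp.existsUnique_continuousMap_lifts
      (A := ℝ × ℝ) ⟨fun x => g x.2 - f x.1, by fun_prop⟩ (a₀ := (0, 0))
      (e₀ := Complex.log (g 0 - f 0)) (Complex.exp_log (hne 0 0)) (fun x => hne x.1 x.2)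
    exact ⟨L, hL, fun s t => congrFun h (s, t)⟩
  have hfim : ∀ t, 0 ≤ (f t).im := fun t => hA _ (hfA t)
  have hgim : ∀ t, 0 ≤ (g t).im := fun t => hB _ (hgB t)
  have a1 := (arg_change_of_im_nonneg (u := fun t => g t - f 0) (l := fun t => L (0, t))
    (x := r - p) (y := w - p) (by fun_prop) (fun t => hL 0 t) (fun t => by simp [f0, hgim t])
    (by simp [f0, g0]) (by simp [f0, g1])).1 (by linarith) (by linarith)
  have a2 := (arg_change_of_im_nonneg (u := fun t => g t - f 1) (l := fun t => L (1, t))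
    (x := r - q) (y := w - q) (by fun_prop) (fun t => hL 1 t) (fun t => by simp [f1, hgim t])
    (by simp [f1, g0]) (by simp [f1, g1])).2 (by linarith) (by linarith)
  -- On the sides where `f` moves, the difference lies in the lower half plane, hence the
  -- conjugates. The side `t = 0` is run backwards so that the real value passes from negative to
  -- positive.
  have hconj : ∀ s t, Complex.exp ((starRingEnd ℂ) (L (s, t))) =
      (starRingEnd ℂ) (g t - f s) := fun s t => by rw [Complex.exp_conj, hL]
  have a3 := (arg_change_of_im_nonneg
    (u := fun s => (starRingEnd ℂ) (g 1 - f s)) (l := fun s => (starRingEnd ℂ) (L (s, 1)))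
    (x := w - p) (y := w - q) (by fun_prop) (fun s => hconj s 1) (fun s => by simp [g1, hfim s])
    (by simp [f0, g1]) (by simp [f1, g1])).1 (by linarith) (by linarith)
  have a4 := (arg_change_of_im_nonneg
    (u := fun s => (starRingEnd ℂ) (g 0 - f (1 - s)))
    (l := fun s => (starRingEnd ℂ) (L (1 - s, 0)))
    (x := r - q) (y := r - p) (by fun_prop) (fun s => hconj (1 - s) 0)
    (fun s => by simp [g0, hfim (1 - s)])
    (by simp [f1, g0]) (by simp [f0, g0])).2 (by linarith) (by linarith)
  simp only [Complex.conj_im, sub_zero, sub_self] at a1 a2 a3 a4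
  linarith [Real.pi_pos]

/-- The map taking the strip `ℝ × [0,a]` to the closed upper half plane. -/
noncomputable def stripExp (a : ℝ) (p : ℝ × ℝ) : ℂ :=
  Complex.exp ((Real.pi / a : ℝ) * (p.1 + p.2 * Complex.I))

theorem continuous_stripExp (a : ℝ) : Continuous (stripExp a) := by
  unfold stripExp; fun_prop

theorem stripExp_eq (a : ℝ) (p : ℝ × ℝ) : stripExp a p =
    Complex.exp ((Real.pi / a * p.1 : ℝ) + (Real.pi / a * p.2 : ℝ) * Complex.I) := by
  unfold stripExp; push_cast; ring_nf

theorem stripExp_bot (a x : ℝ) : stripExp a (x, 0) = (Real.exp (Real.pi / a * x) : ℝ) := by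
  rw [stripExp_eq]; simp

theorem stripExp_top {a : ℝ} (ha : 0 < a) (x : ℝ) :
    stripExp a (x, a) = (-Real.exp (Real.pi / a * x) : ℝ) := by
  rw [stripExp_eq, show Real.pi / a * (x, a).2 = Real.pi by field_simp, Complex.exp_add,
    Complex.exp_pi_mul_I]
  push_cast; ring

theorem stripExp_im_nonneg {a : ℝ} (ha : 0 < a) {p : ℝ × ℝ} (h0 : 0 ≤ p.2) (h1 : p.2 ≤ a) :
    0 ≤ (stripExp a p).im := by
  rw [stripExp_eq, Complex.exp_im]
  refine mul_nonneg (Real.exp_pos _).le (Real.sin_nonneg_of_nonneg_of_le_pi ?_ ?_) <;> simp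
  · positivity
  · rw [div_mul_eq_mul_div, div_le_iff₀ ha]; gcongr

theorem stripExp_injOn {a : ℝ} (ha : 0 < a) :
    InjOn (stripExp a) {p | 0 ≤ p.2 ∧ p.2 ≤ a} := by
  rintro ⟨x, y⟩ ⟨h1, h2⟩ ⟨x', y'⟩ ⟨h3, h4⟩ e
  rw [stripExp_eq, stripExp_eq, Complex.exp_eq_exp_iff_exists_int] at e
  obtain ⟨n, hn⟩ := e
  have hre := congrArg Complex.re hn
  have him := congrArg Complex.im hn
  simp only [Complex.add_re, Complex.ofReal_re, Complex.mul_re, Complex.ofReal_im, Complex.I_re,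
    Complex.I_im, Complex.add_im, Complex.mul_im, Complex.intCast_re, Complex.intCast_im] at hre him
  simp at hre him h1 h2 h3 h4
  have hpi := Real.pi_pos
  have hx : x = x' := by
    rcases hre with h | h
    · exact h
    · exact absurd h ha.ne'
  have hy : y = y' + n * (2 * a) := by
    field_simp at him
    linarith
  have hn0 : n = 0 := by
    have l1 : (n : ℝ) < 1 := by by_contra hc; push Not at hc; nlinarith
    have l2 : (-1 : ℝ) < n := by by_contra hc; push Not at hc; nlinarith
    have : n < 1 := by exact_mod_cast l1
    have : -1 < n := by exact_mod_cast l2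
    omega
  subst hn0
  simp at hy
  rw [hx, hy]

theorem JoinedIn.image {X Y : Type*} [TopologicalSpace X] [TopologicalSpace Y] {f : X → Y}
    (hf : Continuous f) {A : Set X} {x y : X} (h : JoinedIn A x y) :
    JoinedIn (f '' A) (f x) (f y) :=
  ⟨h.somePath.map hf, fun t => ⟨_, h.somePath_mem t, rfl⟩⟩

/-- Paths in a strip with interleaved end points meet. -/
theorem strip_inter_nonempty {a : ℝ} (ha : 0 < a) {A B : Set (ℝ × ℝ)}
    (hA : ∀ z ∈ A, 0 ≤ z.2 ∧ z.2 ≤ a) (hB : ∀ z ∈ B, 0 ≤ z.2 ∧ z.2 ≤ a) {P Q R W : ℝ × ℝ}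
    {p r q w : ℝ} (hp : stripExp a P = p) (hr : stripExp a R = r) (hq : stripExp a Q = q)
    (hw : stripExp a W = w) (h1 : p < r) (h2 : r < q) (h3 : q < w)
    (hPQ : JoinedIn A P Q) (hRW : JoinedIn B R W) : (A ∩ B).Nonempty := by
  have i1 := JoinedIn.image (continuous_stripExp a) hPQ
  have i2 := JoinedIn.image (continuous_stripExp a) hRW
  rw [hp, hq] at i1
  rw [hr, hw] at i2
  obtain ⟨_, ⟨z, hz, rfl⟩, ⟨z', hz', e⟩⟩ := inter_nonempty_of_interleaved
    (by rintro _ ⟨z, hz, rfl⟩; exact stripExp_im_nonneg ha (hA z hz).1 (hA z hz).2)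
    (by rintro _ ⟨z, hz, rfl⟩; exact stripExp_im_nonneg ha (hB z hz).1 (hB z hz).2) h1 h2 h3 i1 i2
  obtain rfl := stripExp_injOn ha (hB z' hz') (hA z hz) e
  exact ⟨z', hz, hz'⟩

theorem strip_inter_nonempty_of_vertical {a : ℝ} (ha : 0 < a) {A B : Set (ℝ × ℝ)}
    (hA : ∀ z ∈ A, 0 ≤ z.2 ∧ z.2 ≤ a) (hB : ∀ z ∈ B, 0 ≤ z.2 ∧ z.2 ≤ a) {x y j : ℝ} {P R : ℝ × ℝ}
    (hP : P = (x, 0) ∨ P = (x, a)) (hR : R = (y, 0) ∨ R = (y, a)) (hx : x < j) (hy : j < y)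
    (hj : JoinedIn A (j, 0) (j, a)) (hPR : JoinedIn B P R) : (A ∩ B).Nonempty := by
  have hmono : ∀ u v : ℝ, u < v → Real.exp (Real.pi / a * u) < Real.exp (Real.pi / a * v) :=
    fun u v h => Real.exp_lt_exp.2 (mul_lt_mul_of_pos_left h (div_pos Real.pi_pos ha))
  have m1 := hmono _ _ hx
  have m2 := hmono _ _ hy
  have e1 := Real.exp_pos (Real.pi / a * x)
  have e2 := Real.exp_pos (Real.pi / a * y)
  have kP : ∃ κ : ℝ, stripExp a P = κ ∧ |κ| = Real.exp (Real.pi / a * x) := by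
    rcases hP with rfl | rfl
    · exact ⟨_, stripExp_bot _ _, abs_of_pos e1⟩
    · exact ⟨_, stripExp_top ha _, by rw [abs_neg, abs_of_pos e1]⟩
  obtain ⟨κ, k1, k2⟩ := kP
  have k3 := (abs_lt.1 (k2.trans_lt m1))
  -- The vertical path ends in `±exp(πj/a)`. The image of `P` lies strictly between these two
  -- numbers and that of `R` outside, to the right or to the left according to the level of `R`.
  rcases hR with rfl | rfl
  · exact strip_inter_nonempty ha hA hB (stripExp_top ha _) k1 (stripExp_bot _ _)
      (stripExp_bot _ _) k3.1 k3.2 m2 hj.symm hPR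
  · rw [inter_comm]
    exact strip_inter_nonempty ha hB hA (stripExp_top ha _) (stripExp_top ha _) k1
      (stripExp_bot _ _) (neg_lt_neg m2) k3.1 k3.2 hPR.symm hj.symm

end KFrieze

/-! ### One-manifolds: how an open arc approaches its limit points. -/

namespace KFrieze

open Filter Topology

section Classification

variable {X : Type*} [TopologicalSpace X]

/-- A map `[0,1) → X` which is a homeomorphism from `(0,1)` onto an open set. -/
structure IsHalfChart (η : ℝ → X) : Prop where
  cont : ContinuousOn η (Ico 0 1)
  inj : InjOn η (Ico 0 1)
  isOpen_image : ∀ U, IsOpen U → U ⊆ Ioo 0 1 → IsOpen (η '' U)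

/-- An interior point has two half charts, one on each side; the sign of `s` selects the side. -/
theorem IsHalfChart.of_isOpenEmbedding {ψ : ℝ → X} (hψ : IsOpenEmbedding ψ) (y : ℝ) {s : ℝ}
    (hs : s ≠ 0) : IsHalfChart fun u => ψ (y + s * u) := by
  refine ⟨(hψ.continuous.comp (by fun_prop)).continuousOn, fun u _ v _ e => ?_, fun U hU _ => ?_⟩
  · have := hψ.injective e
    exact mul_left_cancel₀ hs (by linarith)
  · rw [show (fun u => ψ (y + s * u)) = ψ ∘ ((Homeomorph.mulLeft₀ s hs).trans
      (Homeomorph.addLeft y)) from rfl, image_comp]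
    exact hψ.isOpenMap _ (Homeomorph.isOpenMap _ _ hU)

theorem IsInteriorPoint.exists_isOpenEmbedding {x : X} (h : IsInteriorPoint x) :
    ∃ ψ : ℝ → X, IsOpenEmbedding ψ ∧ x ∈ range ψ := by
  obtain ⟨U, hU, hx, ⟨e⟩⟩ := h
  let e' : ℝ ≃ₜ U := (orderIsoIooNegOneOne ℝ).toHomeomorph.trans e.symm
  exact ⟨Subtype.val ∘ e', hU.isOpenEmbedding_subtypeVal.comp e'.isOpenEmbedding,
    ⟨e'.symm ⟨x, hx⟩, by simp⟩⟩

theorem IsOpenEmbedding.isInteriorPoint {ψ : ℝ → X} (hψ : IsOpenEmbedding ψ) (t : ℝ) :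
    IsInteriorPoint (ψ t) :=
  ⟨range ψ, hψ.isOpen_range, mem_range_self t,
    ⟨(hψ.toIsEmbedding.toHomeomorph).symm.trans (orderIsoIooNegOneOne ℝ).toHomeomorph⟩⟩

theorem IsBoundaryPoint.exists_isHalfChart {x : X} (h : IsBoundaryPoint x) :
    ∃ η : ℝ → X, IsHalfChart η ∧ η 0 = x ∧
      ∀ ε, 0 < ε → ε ≤ 1 → IsOpen (η '' Ico 0 ε) := by
  obtain ⟨U, hU, hx, e, he⟩ := h
  classical
  -- The value `x` outside `[0,1)` is a dummy.
  let η : ℝ → X := fun u => if hu : u ∈ Ico (0 : ℝ) 1 then e.symm ⟨u, hu⟩ else x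
  have hη : ∀ u : Ico (0 : ℝ) 1, η u = e.symm u := fun u => dif_pos u.2
  have himg : ∀ S : Set ℝ, S ⊆ Ico 0 1 → η '' S =
      (Subtype.val ∘ e.symm) '' (Subtype.val ⁻¹' S : Set (Ico (0 : ℝ) 1)) := by
    intro S hS
    ext z
    constructor
    · rintro ⟨u, hu, rfl⟩
      exact ⟨⟨u, hS hu⟩, hu, (hη ⟨u, hS hu⟩).symm⟩
    · rintro ⟨u, hu, rfl⟩
      exact ⟨u, hu, hη u⟩
  have hopen : IsOpenMap (Subtype.val ∘ e.symm : Ico (0 : ℝ) 1 → X) :=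
    (hU.isOpenEmbedding_subtypeVal.comp e.symm.isOpenEmbedding).isOpenMap
  refine ⟨η, ⟨?_, fun u hu v hv e' => ?_, fun V hV hV' => ?_⟩, ?_, fun ε h0 h1 => ?_⟩
  · rw [continuousOn_iff_continuous_domRestrict]
    have : (Ico (0 : ℝ) 1).domRestrict η = Subtype.val ∘ e.symm := funext hη
    rw [this]
    exact continuous_subtype_val.comp e.symm.continuous
  · rw [hη ⟨u, hu⟩, hη ⟨v, hv⟩] at e'
    exact congrArg Subtype.val (e.symm.injective (Subtype.ext e'))
  · rw [himg V (hV'.trans Ioo_subset_Ico_self)]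
    exact hopen _ (hV.preimage continuous_subtype_val)
  · have h0 : (0 : ℝ) ∈ Ico (0 : ℝ) 1 := ⟨le_rfl, one_pos⟩
    have : e.symm ⟨0, h0⟩ = ⟨x, hx⟩ := by rw [e.symm_apply_eq]; exact Subtype.ext he.symm
    rw [hη ⟨0, h0⟩, this]
  · rw [himg _ (Ico_subset_Ico_right h1)]
    refine hopen _ ?_
    have : (Subtype.val ⁻¹' Ico 0 ε : Set (Ico (0 : ℝ) 1)) = Subtype.val ⁻¹' Iio ε := by
      ext u
      simp [u.2.1]
    rw [this]
    exact isOpen_Iio.preimage continuous_subtype_val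

/-- Invariance of domain in dimension one. -/
theorem isOpenEmbedding_of_injective {φ : ℝ → X} (hc : Continuous φ)
    (hi : Function.Injective φ) (h : ∀ t, IsInteriorPoint (φ t)) : IsOpenEmbedding φ := by
  refine .of_continuous_injective_isOpenMap hc hi (isOpenMap_iff_nhds_le.2 fun t => ?_)
  obtain ⟨ψ, hψ, s, hs⟩ := (h t).exists_isOpenEmbedding
  intro N hN
  obtain ⟨δ, hδ, hδN⟩ := Metric.mem_nhds_iff.1 (inter_mem (mem_map.1 hN)
    (hc.continuousAt.preimage_mem_nhds (hψ.isOpen_range.mem_nhds ⟨s, hs⟩)))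
  set a := t - δ / 2
  set b := t + δ / 2
  have hab : a ≤ b := by simp only [a, b]; linarith
  have hsub : Icc a b ⊆ φ ⁻¹' N ∩ φ ⁻¹' range ψ := fun u hu => hδN (by
    rw [Real.ball_eq_Ioo]
    simp only [a, b, mem_Icc] at hu
    constructor <;> linarith [hu.1, hu.2])
  -- Read in the chart `ψ`, a piece of `φ` becomes a continuous injective real function on a closed
  -- interval. It is strictly monotone, so its image is a neighbourhood of the value at the inner
  -- point `t`.
  choose! g hg using fun u (hu : u ∈ Icc a b) => (hsub hu).2
  have hgc : ContinuousOn g (Icc a b) := by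
    rw [hψ.toIsEmbedding.continuousOn_iff]
    exact hc.continuousOn.congr hg
  have hgi : InjOn g (Icc a b) := fun u hu v hv e => hi (by rw [← hg u hu, ← hg v hv, e])
  have ht : t ∈ Icc a b := by simp only [a, b]; constructor <;> linarith
  have ha : a ∈ Icc a b := left_mem_Icc.2 hab
  have hb : b ∈ Icc a b := right_mem_Icc.2 hab
  have hta : a < t := by simp only [a]; linarith
  have htb : t < b := by simp only [b]; linarith
  have hnb : g '' Icc a b ∈ 𝓝 s := by
    have hgt : g t = s := hψ.injective (by rw [hg t ht, hs])
    rcases hgc.strictMonoOn_of_injOn_Icc' hab hgi with hm | hm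
    · refine mem_of_superset (Icc_mem_nhds ?_ ?_) (intermediate_value_Icc hab hgc)
      · rw [← hgt]; exact hm ha ht hta
      · rw [← hgt]; exact hm ht hb htb
    · refine mem_of_superset (Icc_mem_nhds ?_ ?_) (intermediate_value_Icc' hab hgc)
      · rw [← hgt]; exact hm ht hb htb
      · rw [← hgt]; exact hm ha ht hta
  have := hψ.isOpenMap.image_mem_nhds hnb
  rw [hs] at this
  refine mem_of_superset this ?_
  rintro _ ⟨_, ⟨u, hu, rfl⟩, rfl⟩
  rw [hg u hu]
  exact (hsub hu).1

/-- The limit of an arc at its upper end. -/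
theorem exists_clusterPt_atTop [CompactSpace X] {φ : ℝ → X} (hφ : IsOpenEmbedding φ) :
    ∃ x, x ∉ range φ ∧ MapClusterPt x atTop φ := by
  obtain ⟨x, hx⟩ := exists_clusterPt_of_compactSpace (map φ atTop)
  refine ⟨x, ?_, hx⟩
  rintro ⟨s, rfl⟩
  -- This is a neighbourhood of `φ s` which the arc leaves for good after `s + 1`, so no point of
  -- the arc is a cluster point of its end.
  have hN : φ '' Iio (s + 1) ∈ 𝓝 (φ s) := hφ.isOpenMap.image_mem_nhds (Iio_mem_nhds (by linarith))
  obtain ⟨t, ⟨u, hu, e⟩, ht⟩ :=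
    ((mapClusterPt_iff_frequently.1 hx _ hN).and_eventually (eventually_gt_atTop (s + 1))).exists
  rw [hφ.injective e] at hu
  exact lt_asymm hu ht

variable [T2Space X]

/-- Near a point other than the limit only a compact piece of the half arc matters, and its image is
closed. -/
theorem isClosed_insert_image_Ici {φ : ℝ → X} (hc : Continuous φ) {x : X}
    (hx : Tendsto φ atTop (𝓝 x)) (c : ℝ) : IsClosed (insert x (φ '' Ici c)) := by
  refine isOpen_compl_iff.1 (isOpen_iff_mem_nhds.2 fun z hz => ?_)
  have hzx : x ≠ z := fun h => hz (Or.inl h.symm)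
  obtain ⟨U, V, hU, hV, hxU, hzV, hUV⟩ := t2_separation hzx
  obtain ⟨d, hd⟩ := eventually_atTop.1 (hx.eventually (hU.mem_nhds hxU))
  have hK : IsClosed (φ '' Icc c d) := (isCompact_Icc.image hc).isClosed
  have hzK : z ∉ φ '' Icc c d := fun ⟨t, ht, e⟩ => hz (Or.inr ⟨t, ht.1, e⟩)
  filter_upwards [hV.mem_nhds hzV, hK.isOpen_compl.mem_nhds hzK] with w hwV hwK hw
  rcases hw with rfl | ⟨t, ht, rfl⟩
  · exact disjoint_left.1 hUV hxU hwV
  · rcases le_or_gt t d with h | h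
    · exact hwK ⟨t, ⟨ht, h⟩, rfl⟩
    · exact disjoint_left.1 hUV (hd t h.le) hwV

theorem isClosed_insert_image_Iic {φ : ℝ → X} (hc : Continuous φ) {x : X}
    (hx : Tendsto φ atBot (𝓝 x)) (c : ℝ) : IsClosed (insert x (φ '' Iic c)) := by
  have := isClosed_insert_image_Ici (φ := fun t => φ (-t)) (by fun_prop)
    (hx.comp tendsto_neg_atTop_atBot) (-c)
  convert! this using 2
  ext z
  constructor
  · rintro ⟨t, ht, rfl⟩; exact ⟨-t, by simpa using ht, by simp⟩
  · rintro ⟨t, ht, rfl⟩; exact ⟨-t, by simpa using neg_le.1 ht, rfl⟩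

theorem isClosed_insert_insert_range {φ : ℝ → X} (hc : Continuous φ) {x x' : X}
    (hx : Tendsto φ atTop (𝓝 x)) (hx' : Tendsto φ atBot (𝓝 x')) :
    IsClosed (insert x (insert x' (range φ))) := by
  have := (isClosed_insert_image_Ici hc hx 0).union (isClosed_insert_image_Iic hc hx' 0)
  convert! this using 1
  ext z
  constructor
  · rintro (rfl | rfl | ⟨t, rfl⟩)
    · simp
    · simp
    · rcases le_total 0 t with h | h
      · exact Or.inl (Or.inr ⟨t, h, rfl⟩)
      · exact Or.inr (Or.inr ⟨t, h, rfl⟩)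
  · rintro ((rfl | ⟨t, -, rfl⟩) | (rfl | ⟨t, -, rfl⟩)) <;> simp

/-- If an arc returns again and again to a half chart, it converges to its origin. -/
theorem IsHalfChart.tendsto {η : ℝ → X} (hη : IsHalfChart η) {φ : ℝ → X} (hc : Continuous φ)
    (hi : Function.Injective φ) (h0 : η 0 ∉ range φ)
    (hf : ∀ ε, 0 < ε → ε ≤ 1 → ∃ᶠ t in atTop, φ t ∈ η '' Ioo 0 ε) :
    (∀ ε, 0 < ε → ε ≤ 1 → ∀ᶠ t in atTop, φ t ∈ η '' Ioo 0 ε) ∧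
    ∀ c, ∃ ε, 0 < ε ∧ ε ≤ 1 ∧ η '' Ioo 0 ε ⊆ φ '' Ioi c := by
  -- After passing `η y` the arc is trapped in `η '' Ioo 0 y`. To leave, it would have to meet `η
  -- 0`, which is not on it, or `η y` a second time.
  have key : ∀ t y, y ∈ Ioo (0 : ℝ) 1 → φ t = η y → ∀ t' > t, φ t' ∈ η '' Ioo 0 y := by
    intro t y hy hty
    have hcl : IsClosed (η '' Icc 0 y) :=
      (isCompact_Icc.image_of_continuousOn (hη.cont.mono (Icc_subset_Ico_right hy.2))).isClosed
    have hop : IsOpen (η '' Ioo 0 y) :=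
      hη.isOpen_image _ isOpen_Ioo (Ioo_subset_Ioo_right hy.2.le)
    have hsub : ∀ t' ∈ Ioi t, φ t' ∈ η '' Icc 0 y → φ t' ∈ η '' Ioo 0 y := by
      rintro t' ht' ⟨u, hu, hut⟩
      refine ⟨u, ⟨lt_of_le_of_ne hu.1 ?_, lt_of_le_of_ne hu.2 ?_⟩, hut⟩
      · rintro rfl; exact h0 ⟨t', hut.symm⟩
      · rintro rfl; exact ht'.ne (hi (hty.trans hut))
    have hpre : IsPreconnected (φ '' Ioi t) := isPreconnected_Ioi.image _ hc.continuousOn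
    obtain ⟨t1, ht1, ht1'⟩ := ((hf y hy.1 hy.2.le).and_eventually (eventually_gt_atTop t)).exists
    have := hpre.subset_left_of_subset_union hop hcl.isOpen_compl
      (disjoint_left.2 fun z ⟨u, hu, e⟩ hz' => hz' ⟨u, Ioo_subset_Icc_self hu, e⟩)
      (by
        rintro _ ⟨t', ht', rfl⟩
        by_cases h : φ t' ∈ η '' Icc 0 y
        · exact Or.inl (hsub t' ht' h)
        · exact Or.inr h) ⟨φ t1, mem_image_of_mem φ ht1', ht1⟩
    exact fun t' ht' => this ⟨t', ht', rfl⟩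
  refine ⟨fun ε hε hε1 => ?_, fun c => ?_⟩
  · obtain ⟨t, y, hy, hty⟩ := (hf ε hε hε1).exists
    filter_upwards [eventually_gt_atTop t] with t' ht'
    exact image_mono (Ioo_subset_Ioo_right hy.2.le)
      (key t y ⟨hy.1, hy.2.trans_le hε1⟩ hty.symm t' ht')
  · obtain ⟨t, ⟨y, hy, hty⟩, htc⟩ :=
      ((hf 1 one_pos le_rfl).and_eventually (eventually_gt_atTop c)).exists
    refine ⟨y, hy.1, hy.2.le, ?_⟩
    rintro _ ⟨u, hu, rfl⟩
    -- A missed point `η u` would disconnect the piece of the arc from `η y` to a later point `η y2`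
    -- with `y2 < u < y`.
    by_contra hcon
    obtain ⟨t2, ⟨y2, hy2, hty2⟩, ht2⟩ :=
      ((hf u hu.1 (hu.2.le.trans hy.2.le)).and_eventually (eventually_gt_atTop t)).exists
    have hpre : IsPreconnected (φ '' Icc t t2) := isPreconnected_Icc.image _ hc.continuousOn
    have hu1 : u < 1 := hu.2.trans hy.2
    have := hpre.subset_left_of_subset_union
      (hη.isOpen_image (Ioo 0 u) isOpen_Ioo (Ioo_subset_Ioo_right hu1.le))
      (hη.isOpen_image (Ioo u 1) isOpen_Ioo (Ioo_subset_Ioo_left hu.1.le))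
      (by
        refine disjoint_left.2 ?_
        rintro _ ⟨v, hv, rfl⟩ ⟨w, hw, e⟩
        have := hη.inj ⟨hu.1.le.trans hw.1.le, hw.2⟩ ⟨hv.1.le, hv.2.trans hu1⟩ e
        subst this
        exact lt_asymm hv.2 hw.1)
      (by
        rintro _ ⟨t', ht', rfl⟩
        obtain ⟨v, hv, hvt⟩ : φ t' ∈ η '' Ioo 0 1 := by
          rcases ht'.1.eq_or_lt with rfl | h
          · exact ⟨y, hy, hty⟩
          · exact image_mono (Ioo_subset_Ioo_right hy.2.le) (key t y hy hty.symm t' h)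
        rcases lt_trichotomy v u with h | rfl | h
        · exact Or.inl ⟨v, ⟨hv.1, h⟩, hvt⟩
        · exact absurd ⟨t', htc.trans_le ht'.1, hvt.symm⟩ hcon
        · exact Or.inr ⟨v, ⟨h, hv.2⟩, hvt⟩)
      ⟨φ t2, mem_image_of_mem φ (right_mem_Icc.2 ht2.le), ⟨y2, hy2, hty2⟩⟩
    obtain ⟨v, hv, hvt⟩ := this ⟨t, ⟨le_rfl, ht2.le⟩, rfl⟩
    have := hη.inj ⟨hv.1.le, hv.2.trans hu1⟩ ⟨hy.1.le, hy.2⟩ (hvt.trans hty.symm)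
    subst this
    exact lt_asymm hv.2 hu.2

/-- At a boundary point all of a neighbourhood belongs to one half chart, so clustering there
already gives the recurrence that `IsHalfChart.tendsto` asks for. -/
theorem tendsto_of_boundary {φ : ℝ → X} (hc : Continuous φ) (hi : Function.Injective φ) {η : ℝ → X}
    (hη : IsHalfChart η) (hop : ∀ ε, 0 < ε → ε ≤ 1 → IsOpen (η '' Ico 0 ε))
    (h0 : η 0 ∉ range φ) (hcl : MapClusterPt (η 0) atTop φ) :
    Tendsto φ atTop (𝓝 (η 0)) ∧ ∀ c, ∃ ε, 0 < ε ∧ ε ≤ 1 ∧ η '' Ioo 0 ε ⊆ φ '' Ioi c := by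
  have := hη.tendsto hc hi h0 fun ε h1 h2 => by
    refine (mapClusterPt_iff_frequently.1 hcl _
      ((hop ε h1 h2).mem_nhds ⟨0, ⟨le_rfl, h1⟩, rfl⟩)).mono ?_
    rintro t ⟨u, hu, e⟩
    refine ⟨u, ⟨lt_of_le_of_ne hu.1 ?_, hu.2⟩, e⟩
    rintro rfl
    exact h0 ⟨t, e.symm⟩
  refine ⟨fun N hN => ?_, this.2⟩
  rw [mem_map]
  have hcw := (hη.cont 0 ⟨le_rfl, one_pos⟩) hN
  rw [mem_map] at hcw
  obtain ⟨δ, hδ, hδN⟩ := Metric.mem_nhdsWithin_iff.1 hcw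
  filter_upwards [this.1 (min δ 1) (lt_min hδ one_pos) (min_le_right _ _)] with t ht
  obtain ⟨u, hu, e⟩ := ht
  rw [mem_preimage, ← e]
  refine hδN ⟨?_, hu.1.le, hu.2.trans_le (min_le_right _ _)⟩
  rw [Metric.mem_ball, Real.dist_eq, sub_zero, abs_of_pos hu.1]
  exact hu.2.trans_le (min_le_left _ _)

/-- The arc returns infinitely often to at least one of the two sides of the cluster point, and
`IsHalfChart.tendsto` applies to that side; `s` records which one it is. -/
theorem tendsto_of_interior {φ : ℝ → X} (hc : Continuous φ) (hi : Function.Injective φ) {ψ : ℝ → X}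
    (hψ : IsOpenEmbedding ψ) {y : ℝ} (h0 : ψ y ∉ range φ) (hcl : MapClusterPt (ψ y) atTop φ) :
    ∃ s : ℝ, (s = 1 ∨ s = -1) ∧ Tendsto φ atTop (𝓝 (ψ y)) ∧
      (∀ ε, 0 < ε → ε ≤ 1 → ∀ᶠ t in atTop, φ t ∈ (fun u => ψ (y + s * u)) '' Ioo 0 ε) ∧
      ∀ c, ∃ ε, 0 < ε ∧ ε ≤ 1 ∧ (fun u => ψ (y + s * u)) '' Ioo 0 ε ⊆ φ '' Ioi c := by
  have hs : ∃ s : ℝ, (s = 1 ∨ s = -1) ∧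
      ∀ ε, 0 < ε → ε ≤ 1 → ∃ᶠ t in atTop, φ t ∈ (fun u => ψ (y + s * u)) '' Ioo 0 ε := by
    by_contra hcon
    push Not at hcon
    obtain ⟨ε1, p1, p2, p3⟩ := hcon 1 (Or.inl rfl)
    obtain ⟨ε2, q1, q2, q3⟩ := hcon (-1) (Or.inr rfl)
    have hm : 0 < min ε1 ε2 := lt_min p1 q1
    obtain ⟨t, ⟨u, hu, e⟩, h1, h2⟩ := ((mapClusterPt_iff_frequently.1 hcl _
      (hψ.isOpenMap.image_mem_nhds (Ioo_mem_nhds (sub_lt_self y hm) (lt_add_of_pos_right y hm)))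
      ).and_eventually (p3.and q3)).exists
    rcases lt_trichotomy u y with h | rfl | h
    · refine h2 ⟨y - u, ⟨by linarith, ?_⟩, by simp only; rw [← e]; congr 1; ring⟩
      linarith [hu.1, min_le_right ε1 ε2]
    · exact h0 ⟨t, e.symm⟩
    · refine h1 ⟨u - y, ⟨by linarith, ?_⟩, by simp only; rw [← e]; congr 1; ring⟩
      linarith [hu.2, min_le_left ε1 ε2]
  obtain ⟨s, hs, hf⟩ := hs
  have hs0 : s ≠ 0 := by rcases hs with rfl | rfl <;> norm_num
  have habs : |s| = 1 := by rcases hs with rfl | rfl <;> norm_num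
  have := (IsHalfChart.of_isOpenEmbedding hψ y hs0).tendsto hc hi (by simpa using h0) hf
  refine ⟨s, hs, fun N hN => ?_, this.1, this.2⟩
  rw [mem_map]
  obtain ⟨δ, hδ, hδN⟩ := Metric.mem_nhds_iff.1 (hψ.continuous.continuousAt.preimage_mem_nhds hN)
  filter_upwards [this.1 (min δ 1) (lt_min hδ one_pos) (min_le_right _ _)] with t ht
  obtain ⟨u, hu, e⟩ := ht
  rw [mem_preimage, ← e]
  refine hδN ?_
  rw [Metric.mem_ball, Real.dist_eq, add_sub_cancel_left, abs_mul, habs, one_mul, abs_of_pos hu.1]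
  exact hu.2.trans_le (min_le_left _ _)

end Classification

end KFrieze

/-! ### Arcs that close up to an interval or a circle. -/

namespace KFrieze

open Filter Topology

theorem nonempty_onePoint_homeomorph_circle : Nonempty (OnePoint ℝ ≃ₜ Circle) := by
  have h2 : Module.finrank ℝ ℝ + 1 = Fintype.card (Fin 2) := by simp
  let e := onePointEquivSphereOfFinrankEq (ι := Fin 2) (V := ℝ) h2
  let i : EuclideanSpace ℝ (Fin 2) ≃ₗᵢ[ℝ] ℂ := Complex.orthonormalBasisOneI.repr.symm
  refine ⟨e.trans (i.toHomeomorph.subtype fun z => ?_)⟩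
  change z ∈ Metric.sphere 0 1 ↔ i z ∈ Metric.sphere (0 : ℂ) 1
  simp

section Classification

variable {X : Type*}

/-- An arc prolonged beyond its upper end by a half-open arc. -/
noncomputable def prolong (φ ζ : ℝ → X) (t : ℝ) : X :=
  -- The function `t ↦ -log(-t)` maps the negative half line increasingly onto the real line, so the
  -- upper end of `φ` is placed at `0`.
  if t < 0 then φ (-Real.log (-t)) else ζ t

theorem range_prolong (φ ζ : ℝ → X) : range (prolong φ ζ) = range φ ∪ ζ '' Ici 0 := by
  ext z
  constructor
  · rintro ⟨t, rfl⟩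
    unfold prolong
    split_ifs with h
    · exact Or.inl ⟨_, rfl⟩
    · exact Or.inr ⟨t, not_lt.1 h, rfl⟩
  · rintro (⟨t, rfl⟩ | ⟨t, ht, rfl⟩)
    · refine ⟨-Real.exp (-t), ?_⟩
      rw [prolong, if_pos (by simp [Real.exp_pos])]
      simp
    · exact ⟨t, if_neg (not_lt.2 ht)⟩

theorem injective_prolong {φ ζ : ℝ → X} (hφ : Function.Injective φ) (hζ : InjOn ζ (Ici 0))
    (h : ∀ t, 0 ≤ t → ζ t ∉ range φ) : Function.Injective (prolong φ ζ) := by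
  intro t u e
  unfold prolong at e
  split_ifs at e with h1 h2 h2
  · have := hφ e
    have := Real.log_injOn_pos (x₁ := -t) (by simpa using h1) (x₂ := -u) (by simpa using h2)
      (neg_injective this)
    exact neg_injective this
  · exact absurd ⟨_, e⟩ (h u (not_lt.1 h2))
  · exact absurd ⟨_, e.symm⟩ (h t (not_lt.1 h1))
  · exact hζ (not_lt.1 h1) (not_lt.1 h2) e

variable [TopologicalSpace X]

theorem tendsto_neg_log_neg_atTop :
    Tendsto (fun t : ℝ => -Real.log (-t)) (𝓝[<] 0) atTop := by
  refine tendsto_neg_atBot_atTop.comp (Real.tendsto_log_nhdsGT_zero.comp ?_)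
  refine tendsto_nhdsWithin_iff.2 ⟨?_, ?_⟩
  · have : Tendsto (fun t : ℝ => -t) (𝓝 0) (𝓝 (-0)) := tendsto_neg 0
    rw [neg_zero] at this
    exact this.mono_left nhdsWithin_le_nhds
  · filter_upwards [self_mem_nhdsWithin] with t ht
    simpa using ht

theorem continuous_prolong {φ ζ : ℝ → X} (hφ : Continuous φ)
    (hζ : ContinuousOn ζ (Ici 0)) (h0 : Tendsto φ atTop (𝓝 (ζ 0))) :
    Continuous (prolong φ ζ) := by
  rw [continuous_iff_continuousAt]
  intro t
  rcases lt_trichotomy t 0 with ht | rfl | ht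
  · have : ContinuousAt (fun t => φ (-Real.log (-t))) t :=
      hφ.continuousAt.comp ((Real.continuousAt_log (by linarith)).comp
        continuous_neg.continuousAt).neg
    refine this.congr ?_
    filter_upwards [Iio_mem_nhds ht] with u hu
    exact (if_pos hu).symm
  · have hz : prolong φ ζ 0 = ζ 0 := if_neg (lt_irrefl 0)
    rw [ContinuousAt, hz, ← nhdsLT_sup_nhdsGE, tendsto_sup]
    constructor
    · refine (h0.comp tendsto_neg_log_neg_atTop).congr' ?_
      filter_upwards [self_mem_nhdsWithin] with u hu
      exact (if_pos hu).symm
    · refine (hζ 0 self_mem_Ici).congr' ?_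
      filter_upwards [self_mem_nhdsWithin] with u hu
      exact (if_neg (not_lt.2 hu)).symm
  · refine ((hζ t ht.le).continuousAt (Ici_mem_nhds ht)).congr ?_
    filter_upwards [Ioi_mem_nhds ht] with u hu
    exact (if_neg (not_lt.2 (le_of_lt hu))).symm

theorem tendsto_prolong_atBot {φ ζ : ℝ → X} {x : X} (h : Tendsto φ atBot (𝓝 x)) :
    Tendsto (prolong φ ζ) atBot (𝓝 x) := by
  have : Tendsto (fun t : ℝ => -Real.log (-t)) atBot atBot :=
    tendsto_neg_atTop_atBot.comp (Real.tendsto_log_atTop.comp tendsto_neg_atBot_atTop)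
  refine (h.comp this).congr' ?_
  filter_upwards [Iio_mem_atBot 0] with t ht
  exact (if_pos ht).symm

theorem isOpenEmbedding_comp_neg {φ : ℝ → X} (hφ : IsOpenEmbedding φ) :
    IsOpenEmbedding fun t => φ (-t) :=
  hφ.comp (Homeomorph.neg ℝ).isOpenEmbedding

theorem isOpen_insert_of_nhds {φ : ℝ → X} (hφ : IsOpenEmbedding φ) {S : Set X}
    (h : ∀ x ∈ S, range φ ∪ S ∈ 𝓝 x) : IsOpen (range φ ∪ S) := by
  refine isOpen_iff_mem_nhds.2 ?_
  rintro z (hz | hz)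
  · exact mem_of_superset (hφ.isOpen_range.mem_nhds hz) subset_union_left
  · exact h z hz

/-- An arc with two distinct ends covering the space makes it a closed interval. -/
theorem nonempty_homeomorph_Icc [T2Space X] [CompactSpace X] {φ : ℝ → X} (hφ : IsOpenEmbedding φ)
    {x y : X} (hx : x ∉ range φ) (hy : y ∉ range φ) (hxy : x ≠ y) (h1 : Tendsto φ atTop (𝓝 x))
    (h2 : Tendsto φ atBot (𝓝 y)) (huniv : range φ ∪ {x, y} = univ) :
    Nonempty (X ≃ₜ Icc (0 : ℝ) 1) := by
  have hpi : -(Real.pi / 2) < Real.pi / 2 := by linarith [Real.pi_pos]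
  -- The tangent moves the arc to a bounded open interval, to whose end points it extends by its two
  -- limits.
  let g : ℝ → X := fun s => φ (Real.tan s)
  have hg : ContinuousOn g (Ioo (-(Real.pi / 2)) (Real.pi / 2)) :=
    hφ.continuous.comp_continuousOn Real.continuousOn_tan_Ioo
  have hb : Tendsto g (𝓝[<] (Real.pi / 2)) (𝓝 x) := h1.comp Real.tendsto_tan_pi_div_two
  have ha : Tendsto g (𝓝[>] (-(Real.pi / 2))) (𝓝 y) := h2.comp Real.tendsto_tan_neg_pi_div_two
  have hcont := continuousOn_Icc_extendFrom_Ioo hg ha hb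
  set G := extendFrom (Ioo (-(Real.pi / 2)) (Real.pi / 2)) g with hG
  have hGb : G (Real.pi / 2) = x := eq_lim_at_right_extendFrom_Ioo hpi hb
  have hGa : G (-(Real.pi / 2)) = y := eq_lim_at_left_extendFrom_Ioo hpi ha
  have hGi : ∀ s ∈ Ioo (-(Real.pi / 2)) (Real.pi / 2), G s = φ (Real.tan s) := fun s hs =>
    extendFrom_extends hg s hs
  let f : Icc (-(Real.pi / 2)) (Real.pi / 2) → X := fun s => G s
  have hf : Continuous f := continuousOn_iff_continuous_domRestrict.1 hcont
  have hcases : ∀ s : Icc (-(Real.pi / 2)) (Real.pi / 2),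
      s.1 = -(Real.pi / 2) ∨ s.1 = Real.pi / 2 ∨ s.1 ∈ Ioo (-(Real.pi / 2)) (Real.pi / 2) := by
    rintro ⟨s, hs⟩
    rcases hs.1.eq_or_lt with h | h
    · exact Or.inl h.symm
    · rcases hs.2.eq_or_lt with h' | h'
      · exact Or.inr (Or.inl h')
      · exact Or.inr (Or.inr ⟨h, h'⟩)
  have hbij : Function.Bijective f := by
    constructor
    · intro u v e
      change G u = G v at e
      rcases hcases u with hu | hu | hu <;> rcases hcases v with hv | hv | hv
      · exact Subtype.ext (hu.trans hv.symm)
      · rw [hu, hv, hGa, hGb] at e; exact absurd e.symm hxy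
      · rw [hu, hGa, hGi v hv] at e; exact absurd ⟨_, e.symm⟩ hy
      · rw [hu, hv, hGa, hGb] at e; exact absurd e hxy
      · exact Subtype.ext (hu.trans hv.symm)
      · rw [hu, hGb, hGi v hv] at e; exact absurd ⟨_, e.symm⟩ hx
      · rw [hv, hGa, hGi u hu] at e; exact absurd ⟨_, e⟩ hy
      · rw [hv, hGb, hGi u hu] at e; exact absurd ⟨_, e⟩ hx
      · rw [hGi u hu, hGi v hv] at e
        exact Subtype.ext (Real.injOn_tan hu hv (hφ.injective e))
    · intro z
      rcases (huniv ▸ mem_univ z : z ∈ range φ ∪ {x, y}) with ⟨t, rfl⟩ | rfl | rfl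
      · obtain ⟨s, hs, rfl⟩ := Real.surjOn_tan (mem_univ t)
        exact ⟨⟨s, Ioo_subset_Icc_self hs⟩, hGi s hs⟩
      · exact ⟨⟨Real.pi / 2, right_mem_Icc.2 hpi.le⟩, hGb⟩
      · exact ⟨⟨-(Real.pi / 2), left_mem_Icc.2 hpi.le⟩, hGa⟩
  exact ⟨(hf.homeoOfEquivCompactToT2 (f := Equiv.ofBijective f hbij)).symm.trans
    (iccHomeoI _ _ hpi)⟩

variable [T2Space X] [ConnectedSpace X]

/-- An arc both ends of which have the same limit closes up to a circle. -/
theorem nonempty_homeomorph_circle (hX : IsOneManifold X) {φ : ℝ → X} (hφ : IsOpenEmbedding φ)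
    {x : X} (hx : x ∉ range φ) (h1 : Tendsto φ atTop (𝓝 x)) (h2 : Tendsto φ atBot (𝓝 x)) :
    Nonempty (X ≃ₜ Circle) := by
  have hφ' := isOpenEmbedding_comp_neg hφ
  have hx' : x ∉ range fun t => φ (-t) := fun ⟨t, e⟩ => hx ⟨-t, e⟩
  have h2' : Tendsto (fun t => φ (-t)) atTop (𝓝 x) := h2.comp tendsto_neg_atTop_atBot
  have hdisj : Disjoint (φ '' Ioi 0) ((fun t => φ (-t)) '' Ioi 0) := by
    rw [disjoint_left]
    rintro _ ⟨t, ht, rfl⟩ ⟨u, hu, e⟩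
    have := hφ.injective e
    simp only [mem_Ioi] at ht hu
    linarith
  -- The two halves of the arc are disjoint, and each fills one side of `x` near `x`. At an interior
  -- point the sides must differ, so a neighbourhood is covered. A boundary point has only one side,
  -- which is a contradiction.
  have hnhds : range φ ∪ {x} ∈ 𝓝 x := by
    rcases hX x with hint | hbd
    · obtain ⟨ψ, hψ, y, rfl⟩ := hint.exists_isOpenEmbedding
      obtain ⟨s, hs, -, -, hs'⟩ :=
        tendsto_of_interior hφ.continuous hφ.injective hψ hx h1.mapClusterPt
      obtain ⟨r, hr, -, -, hr'⟩ :=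
        tendsto_of_interior hφ'.continuous hφ'.injective hψ hx' h2'.mapClusterPt
      obtain ⟨ε, e1, e2, e3⟩ := hs' 0
      obtain ⟨δ, d1, d2, d3⟩ := hr' 0
      have hm : 0 < min ε δ := lt_min e1 d1
      have hsr : s ≠ r := by
        rintro rfl
        exact disjoint_left.1 hdisj
          (e3 ⟨min ε δ / 2, ⟨by linarith, by linarith [min_le_left ε δ]⟩, rfl⟩)
          (d3 ⟨min ε δ / 2, ⟨by linarith, by linarith [min_le_right ε δ]⟩, rfl⟩)
      have hcov : ∀ u, u ≠ 0 → |u| < min ε δ → ψ (y + u) ∈ range φ := by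
        intro u hu0 hu
        have hse : 0 < s * u → ψ (y + u) ∈ range φ := fun hpos => by
          obtain ⟨t, -, ht⟩ := e3 ⟨s * u, ⟨hpos, by
            rw [← abs_of_pos hpos, abs_mul]
            have : |s| = 1 := by rcases hs with rfl | rfl <;> norm_num
            rw [this, one_mul]; exact hu.trans_le (min_le_left _ _)⟩, rfl⟩
          refine ⟨t, ht.trans ?_⟩
          simp only
          rw [← mul_assoc, show s * s = 1 by rcases hs with rfl | rfl <;> norm_num, one_mul]
        have hre : 0 < r * u → ψ (y + u) ∈ range φ := fun hpos => by
          obtain ⟨t, -, ht⟩ := d3 ⟨r * u, ⟨hpos, by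
            rw [← abs_of_pos hpos, abs_mul]
            have : |r| = 1 := by rcases hr with rfl | rfl <;> norm_num
            rw [this, one_mul]; exact hu.trans_le (min_le_right _ _)⟩, rfl⟩
          refine ⟨-t, ht.trans ?_⟩
          simp only
          rw [← mul_assoc, show r * r = 1 by rcases hr with rfl | rfl <;> norm_num, one_mul]
        rcases lt_or_gt_of_ne hu0 with h | h
        · rcases hs with rfl | rfl <;> rcases hr with rfl | rfl
          · exact absurd rfl hsr
          · exact hre (by linarith)
          · exact hse (by linarith)
          · exact absurd rfl hsr
        · rcases hs with rfl | rfl <;> rcases hr with rfl | rfl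
          · exact absurd rfl hsr
          · exact hse (by linarith)
          · exact hre (by linarith)
          · exact absurd rfl hsr
      refine mem_of_superset (hψ.isOpenMap.image_mem_nhds (Metric.ball_mem_nhds y hm)) ?_
      rintro _ ⟨u, hu, rfl⟩
      rw [Metric.mem_ball, Real.dist_eq] at hu
      rcases eq_or_ne u y with rfl | hne
      · exact Or.inr rfl
      · have := hcov (u - y) (sub_ne_zero.2 hne) hu
        rw [add_sub_cancel] at this
        exact Or.inl this
    · obtain ⟨η, hη, rfl, hop⟩ := hbd.exists_isHalfChart
      obtain ⟨ε, e1, e2, e3⟩ :=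
        (tendsto_of_boundary hφ.continuous hφ.injective hη hop hx h1.mapClusterPt).2 0
      obtain ⟨δ, d1, d2, d3⟩ :=
        (tendsto_of_boundary hφ'.continuous hφ'.injective hη hop hx' h2'.mapClusterPt).2 0
      have hm : 0 < min ε δ := lt_min e1 d1
      exact absurd (d3 ⟨min ε δ / 2, ⟨by linarith, by linarith [min_le_right ε δ]⟩, rfl⟩)
        (disjoint_left.1 hdisj
          (e3 ⟨min ε δ / 2, ⟨by linarith, by linarith [min_le_left ε δ]⟩, rfl⟩))
  have huniv : range φ ∪ {x} = univ := by
    refine IsClopen.eq_univ ⟨?_, isOpen_insert_of_nhds hφ fun z hz => ?_⟩ ⟨x, Or.inr rfl⟩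
    · have := isClosed_insert_insert_range hφ.continuous h1 h2
      rwa [insert_idem, insert_eq, union_comm] at this
    · obtain rfl := mem_singleton_iff.1 hz
      exact hnhds
  -- The space is now the arc with one point added, that is, a continuous bijective image of the
  -- one-point compactification of the line.
  obtain ⟨e⟩ := nonempty_onePoint_homeomorph_circle
  let f : OnePoint ℝ → X := fun z => z.elim x φ
  have hf : Continuous f := by
    rw [OnePoint.continuous_iff]
    refine ⟨?_, hφ.continuous⟩
    rw [coclosedCompact_eq_cocompact, cocompact_eq_atBot_atTop]
    exact tendsto_sup.2 ⟨h2, h1⟩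
  have hbij : Function.Bijective f := by
    constructor
    · intro u v
      induction u using OnePoint.rec with
      | infty =>
        induction v using OnePoint.rec with
        | infty => exact fun _ => rfl
        | coe v => exact fun e => absurd ⟨v, e.symm⟩ hx
      | coe u =>
        induction v using OnePoint.rec with
        | infty => exact fun e => absurd ⟨u, e⟩ hx
        | coe v => exact fun e => congrArg _ (hφ.injective e)
    · intro z
      rcases (huniv ▸ mem_univ z : z ∈ range φ ∪ {x}) with ⟨t, rfl⟩ | hz
      · exact ⟨(t : OnePoint ℝ), rfl⟩
      · exact ⟨OnePoint.infty, (mem_singleton_iff.1 hz).symm⟩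
  exact ⟨(hf.homeoOfEquivCompactToT2 (f := Equiv.ofBijective f hbij)).symm.trans e⟩

end Classification

end KFrieze

/-! ### Classification of compact connected one-manifolds. -/

namespace KFrieze

open Filter Topology

section Classification

variable {X : Type*} [TopologicalSpace X]

theorem isOpenEmbedding_sigmoid : IsOpenEmbedding Real.sigmoid :=
  isOpenEmbedding_of_injective continuous_sigmoid Real.sigmoid_injective fun _ =>
    IsOpenEmbedding.isInteriorPoint (IsOpenEmbedding.id) _

theorem IsHalfChart.isOpenEmbedding_comp_sigmoid {η : ℝ → X} (hη : IsHalfChart η) :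
    IsOpenEmbedding (η ∘ Real.sigmoid) := by
  have hmem : ∀ t, Real.sigmoid t ∈ Ico (0 : ℝ) 1 := fun t =>
    ⟨Real.sigmoid_nonneg t, Real.sigmoid_lt_one t⟩
  refine .of_continuous_injective_isOpenMap
    (hη.cont.comp_continuous continuous_sigmoid hmem) (fun t u e =>
      Real.sigmoid_injective (hη.inj (hmem t) (hmem u) e)) fun U hU => ?_
  rw [image_comp]
  refine hη.isOpen_image _ (isOpenEmbedding_sigmoid.isOpenMap _ hU) ?_
  rintro _ ⟨t, -, rfl⟩
  exact ⟨Real.sigmoid_pos t, Real.sigmoid_lt_one t⟩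

/-- These neighbourhoods supply the finite cover in the classification. A point of `N` off the arc
`ψ` is a boundary point, and arcs may end there. -/
theorem exists_arc_nhds (hX : IsOneManifold X) (x : X) :
    ∃ ψ : ℝ → X, ∃ N : Set X, IsOpenEmbedding ψ ∧ IsOpen N ∧ x ∈ N ∧
      ∀ y ∈ N, y ∈ range ψ ∨ IsBoundaryPoint y := by
  rcases hX x with h | h
  · obtain ⟨ψ, hψ, hx⟩ := h.exists_isOpenEmbedding
    exact ⟨ψ, range ψ, hψ, hψ.isOpen_range, hx, fun y hy => Or.inl hy⟩
  · obtain ⟨η, hη, hη0, hop⟩ := h.exists_isHalfChart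
    refine ⟨_, _, hη.isOpenEmbedding_comp_sigmoid, hop 1 one_pos le_rfl,
      ⟨0, ⟨le_rfl, one_pos⟩, hη0⟩, ?_⟩
    rintro _ ⟨u, hu, rfl⟩
    rcases hu.1.eq_or_lt with rfl | hu0
    · exact Or.inr (hη0 ▸ h)
    · have : u ∈ range Real.sigmoid := by rw [Real.range_sigmoid]; exact ⟨hu0, hu.2⟩
      obtain ⟨t, rfl⟩ := this
      exact Or.inl ⟨t, rfl⟩

variable [T2Space X] [ConnectedSpace X]

/-- An arc one end of which lies in an open arc can be prolonged to contain that arc, unless the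
space is a circle. -/
theorem exists_prolongation (hX : IsOneManifold X) {φ : ℝ → X} (hφ : IsOpenEmbedding φ)
    {x x' : X} (hx : x ∉ range φ) (hne : x ≠ x') (h1 : MapClusterPt x atTop φ)
    (h2 : Tendsto φ atBot (𝓝 x')) {ψ : ℝ → X} (hψ : IsOpenEmbedding ψ) (hxψ : x ∈ range ψ) :
    Nonempty (X ≃ₜ Circle) ∨
      ∃ φ' : ℝ → X, IsOpenEmbedding φ' ∧ range φ ⊆ range φ' ∧ range ψ ⊆ range φ' := by
  obtain ⟨y, rfl⟩ := hxψ
  obtain ⟨s, hs, htop, E1, E2⟩ := tendsto_of_interior hφ.continuous hφ.injective hψ hx h1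
  have hs0 : s ≠ 0 := by rcases hs with rfl | rfl <;> norm_num
  -- Here `χ` is `ψ` reparametrised so that `φ` runs into `χ 0` from positive parameters.
  obtain ⟨χ, hχ, hχr, hχ0, F1⟩ : ∃ χ : ℝ → X, IsOpenEmbedding χ ∧ range χ = range ψ ∧
      χ 0 = ψ y ∧ ∀ᶠ t in atTop, φ t ∈ χ '' Ioo 0 1 := by
    let H := (Homeomorph.mulLeft₀ s hs0).trans (Homeomorph.addLeft y)
    refine ⟨ψ ∘ H, hψ.comp H.isOpenEmbedding, H.surjective.range_comp ψ, by simp [H],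
      E1 1 one_pos le_rfl⟩
  obtain ⟨ε, hε0, -, hε⟩ : ∃ ε, 0 < ε ∧ ε ≤ 1 ∧ _ := E2 0
  rw [← hχ0] at hx htop hne
  rw [← hχr]
  -- The initial part of `φ` together with its other limit `x'` is a closed set missing `χ 0`, and
  -- the final part of `φ` lies on the positive side of `χ`.
  obtain ⟨δ, hδ, hδ'⟩ : ∃ δ > 0, ∀ u, -δ < u → u < 0 → χ u ∉ range φ := by
    obtain ⟨c, hc⟩ := eventually_atTop.1 F1
    have hK := isClosed_insert_image_Iic hφ.continuous h2 c
    have hxK : χ 0 ∉ insert x' (φ '' Iic c) := by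
      rintro (h | ⟨t, -, h⟩)
      · exact hne h
      · exact hx ⟨t, h⟩
    obtain ⟨δ, hδ, hδK⟩ := Metric.mem_nhds_iff.1
      (hχ.continuous.continuousAt.preimage_mem_nhds (hK.isOpen_compl.mem_nhds hxK))
    refine ⟨δ, hδ, fun u hu hu0 ⟨t, ht⟩ => ?_⟩
    rcases le_total t c with htc | htc
    · refine hδK (?_ : u ∈ Metric.ball 0 δ) (Or.inr ⟨t, htc, ht⟩)
      rw [Metric.mem_ball, Real.dist_eq, sub_zero, abs_of_neg hu0]
      linarith
    · obtain ⟨v, hv, e⟩ := hc t htc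
      have := hχ.injective (e.trans ht)
      linarith [hv.1]
  by_cases hL : ∃ u < 0, χ u ∈ range φ
  -- The supremum `v` of the negative parameters of `χ` that lie on `φ` is not itself on `φ`, as the
  -- arc is open. Hence `χ v` is the other limit `x'`, and the piece of `χ` over `(v, 0]` closes `φ`
  -- up to a circle.
  · left
    set L := {u | u < 0 ∧ χ u ∈ range φ} with hLdef
    have hLne : L.Nonempty := hL
    have hLle : ∀ u ∈ L, u ≤ -δ := fun u hu => by
      by_contra hc
      exact hδ' u (not_le.1 hc) hu.1 hu.2
    have hLb : BddAbove L := ⟨-δ, hLle⟩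
    set v := sSup L with hv
    have hvδ : v ≤ -δ := csSup_le hLne hLle
    have hvL : ∀ u, v < u → u ≤ 0 → χ u ∉ range φ := fun u hu hu0 hmem => by
      rcases hu0.eq_or_lt with rfl | hu0
      · exact hx hmem
      · exact absurd (le_csSup hLb ⟨hu0, hmem⟩) (not_le.2 hu)
    have hvr : χ v ∉ range φ := fun hmem => by
      obtain ⟨d, hd, hd'⟩ := Metric.mem_nhds_iff.1
        (hχ.continuous.continuousAt.preimage_mem_nhds (hφ.isOpen_range.mem_nhds hmem))
      have hm : 0 < min d δ := lt_min hd hδ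
      refine hvL (v + min d δ / 2) (by linarith) (by linarith [min_le_right d δ]) (hd' ?_)
      rw [Metric.mem_ball, Real.dist_eq, add_sub_cancel_left, abs_of_pos (by linarith)]
      linarith [min_le_left d δ]
    have hvx : χ v = x' := by
      have hcl := isClosed_insert_insert_range hφ.continuous htop h2
      have : χ v ∈ insert (χ 0) (insert x' (range φ)) :=
        hcl.closure_subset_iff.2 (by
          rintro _ ⟨u, hu, rfl⟩
          exact Or.inr (Or.inr hu.2))
          (image_closure_subset_closure_image hχ.continuous ⟨v, csSup_mem_closure hLne hLb, rfl⟩)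
      rcases this with h | h | h
      · have := hχ.injective h; linarith
      · exact h
      · exact absurd h hvr
    -- As `t` runs from `0` to infinity, `ρ` runs from `0` to `v`; this turns the closing piece into
    -- a half-open arc to which `prolong` applies.
    let ρ : ℝ → ℝ := fun t => v * (t / (1 + t))
    have hρ0 : ρ 0 = 0 := by simp [ρ]
    have hfrac : ∀ t : ℝ, 0 ≤ t → 0 ≤ t / (1 + t) ∧ t / (1 + t) < 1 := fun t ht =>
      ⟨by positivity, (div_lt_one (by linarith)).2 (by linarith)⟩
    have hρ : ∀ t, 0 ≤ t → v < ρ t ∧ ρ t ≤ 0 := fun t ht => by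
      have := hfrac t ht
      constructor <;> simp only [ρ] <;> nlinarith
    have hρc : ContinuousOn ρ (Ici 0) := by
      refine continuousOn_const.mul (continuousOn_id.div (by fun_prop) fun t ht => ?_)
      have : (0 : ℝ) ≤ t := ht
      positivity
    have hρi : InjOn ρ (Ici 0) := by
      intro t ht u hu e
      have ht' : (0 : ℝ) ≤ t := ht
      have hu' : (0 : ℝ) ≤ u := hu
      have := mul_left_cancel₀ (by linarith : v ≠ 0) e
      rw [div_eq_div_iff (by positivity) (by positivity)] at this
      linarith
    have hρt : Tendsto ρ atTop (𝓝 v) := by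
      have h0 : Tendsto (fun t : ℝ => v * (1 - (1 + t)⁻¹)) atTop (𝓝 (v * (1 - 0))) :=
        ((tendsto_inv_atTop_zero.comp (tendsto_atTop_add_const_left _ 1 tendsto_id)).const_sub
          1).const_mul v
      rw [sub_zero, mul_one] at h0
      refine h0.congr' ?_
      filter_upwards [eventually_ge_atTop 0] with t ht
      simp only [ρ]
      field_simp
      ring
    have hζ : ∀ t, 0 ≤ t → (χ ∘ ρ) t ∉ range φ := fun t ht => hvL _ (hρ t ht).1 (hρ t ht).2
    have hφ' : IsOpenEmbedding (prolong φ (χ ∘ ρ)) := by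
      refine isOpenEmbedding_of_injective
        (continuous_prolong hφ.continuous (hχ.continuous.comp_continuousOn hρc) ?_)
        (injective_prolong hφ.injective (hχ.injective.comp_injOn hρi) hζ) fun t => ?_
      · rwa [Function.comp_apply, hρ0]
      · unfold prolong
        split_ifs
        · exact IsOpenEmbedding.isInteriorPoint hφ _
        · exact IsOpenEmbedding.isInteriorPoint hχ _
    refine nonempty_homeomorph_circle hX hφ' (x := x') ?_ ?_ (tendsto_prolong_atBot h2)
    · rw [range_prolong, ← hvx]
      rintro (h | ⟨t, ht, h⟩)
      · exact hvr h
      · exact (hρ t ht).1.ne (hχ.injective h).symm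
    · rw [← hvx]
      refine ((hχ.continuous.tendsto v).comp hρt).congr' ?_
      filter_upwards [eventually_ge_atTop 0] with t ht
      exact (if_neg (not_lt.2 ht)).symm
  · right
    push Not at hL
    -- If some `χ u` with `u > 0` is off `φ`, then `φ` is confined to `χ '' Ioo 0 u` and `χ` itself
    -- serves. Otherwise the non-positive half of `χ` is attached to `φ`.
    by_cases hR : ∃ u > 0, χ u ∉ range φ
    · obtain ⟨u, hu, hur⟩ := hR
      refine ⟨χ, hχ, ?_, le_rfl⟩
      have hcl : IsClosed (χ '' Icc 0 u) := (isCompact_Icc.image hχ.continuous).isClosed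
      obtain ⟨c, hc⟩ := eventually_atTop.1 F1
      have hpre : IsPreconnected (range φ) := by
        rw [← image_univ]
        exact isPreconnected_univ.image _ hφ.continuous.continuousOn
      have hnon : (range φ ∩ χ '' Ioo 0 u).Nonempty := by
        obtain ⟨N, hN⟩ := eventually_atTop.1
          (htop.eventually ((hχ.isOpenMap.image_mem_nhds (Iio_mem_nhds hu))))
        obtain ⟨w, hw, e⟩ := hN (max N c) (le_max_left _ _)
        obtain ⟨w', hw', e'⟩ := hc (max N c) (le_max_right _ _)
        obtain rfl := hχ.injective (e.trans e'.symm)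
        exact ⟨_, mem_range_self (max N c), w, ⟨hw'.1, hw⟩, e⟩
      refine (hpre.subset_left_of_subset_union (hχ.isOpenMap _ isOpen_Ioo) hcl.isOpen_compl
        (disjoint_left.2 fun z ⟨w, hw, e⟩ hz => hz ⟨w, Ioo_subset_Icc_self hw, e⟩) ?_ hnon).trans
        (image_subset_range _ _)
      rintro z hz
      by_cases h : z ∈ χ '' Icc 0 u
      · left
        obtain ⟨w, hw, rfl⟩ := h
        refine ⟨w, ⟨lt_of_le_of_ne hw.1 ?_, lt_of_le_of_ne hw.2 ?_⟩, rfl⟩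
        · rintro rfl; exact hx hz
        · rintro rfl; exact hur hz
      · exact Or.inr h
    · push Not at hR
      let ζ : ℝ → X := fun t => χ (-t)
      have hζ : ∀ t, 0 ≤ t → ζ t ∉ range φ := fun t ht => by
        rcases ht.eq_or_lt with rfl | ht
        · simpa [ζ] using hx
        · exact hL _ (by linarith)
      refine ⟨prolong φ ζ, isOpenEmbedding_of_injective
        (continuous_prolong hφ.continuous (hχ.continuous.comp continuous_neg).continuousOn ?_)
        (injective_prolong hφ.injective ((hχ.injective.comp neg_injective).injOn) hζ)
        fun t => ?_, ?_, ?_⟩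
      · simpa [ζ] using htop
      · unfold prolong
        split_ifs
        · exact IsOpenEmbedding.isInteriorPoint hφ _
        · exact IsOpenEmbedding.isInteriorPoint hχ _
      · rw [range_prolong]; exact subset_union_left
      · rw [range_prolong]
        rintro _ ⟨u, rfl⟩
        rcases le_or_gt u 0 with h | h
        · exact Or.inr ⟨-u, by simpa using h, by simp [ζ]⟩
        · exact Or.inl (hR u h)

/-- A compact connected one-manifold with boundary is a closed interval or a circle. -/
theorem IsOneManifold.nonempty_homeomorph [CompactSpace X] (hX : IsOneManifold X) :
    Nonempty (X ≃ₜ Icc (0 : ℝ) 1) ∨ Nonempty (X ≃ₜ Circle) := by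
  classical
  by_contra hcon
  push Not at hcon
  have hnI : ¬ Nonempty (X ≃ₜ Icc (0 : ℝ) 1) := fun h => h.elim hcon.1.elim
  have hnC : ¬ Nonempty (X ≃ₜ Circle) := fun h => h.elim hcon.2.elim
  choose ψ N hψ hN hxN hcov using exists_arc_nhds hX
  obtain ⟨F, hF⟩ := isCompact_univ.elim_finite_subcover N hN
    (fun x _ => mem_iUnion.2 ⟨x, hxN x⟩)
  -- An open arc is chosen that contains a maximal set of arcs of the finite cover; no Zorn argument
  -- is needed.
  let P : Finset X → Prop := fun S => ∃ φ : ℝ → X, IsOpenEmbedding φ ∧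
    ∀ x ∈ S, range (ψ x) ⊆ range φ
  obtain ⟨x₀⟩ : Nonempty X := inferInstance
  obtain ⟨S, hS⟩ := (F.powerset.filter P).exists_maximal
    ⟨∅, by simp only [Finset.mem_filter, Finset.mem_powerset, Finset.empty_subset, true_and]
           exact ⟨ψ x₀, hψ x₀, by simp⟩⟩
  obtain ⟨hSF, φ, hφ, hφS⟩ : S ⊆ F ∧ P S := by
    have := hS.prop
    rwa [Finset.mem_filter, Finset.mem_powerset] at this
  have hmax : ∀ φ' : ℝ → X, IsOpenEmbedding φ' → range φ ⊆ range φ' → ∀ x ∈ F,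
      range (ψ x) ⊆ range φ' → x ∈ S := by
    intro φ' hφ' hsub x hxF hx
    have : insert x S ∈ F.powerset.filter P := by
      rw [Finset.mem_filter, Finset.mem_powerset]
      refine ⟨Finset.insert_subset hxF hSF, φ', hφ', fun z hz => ?_⟩
      rcases Finset.mem_insert.1 hz with rfl | hz
      · exact hx
      · exact (hφS z hz).trans hsub
    exact hS.le_of_ge this (Finset.subset_insert x S) (Finset.mem_insert_self x S)
  have htend : ∀ φ : ℝ → X, IsOpenEmbedding φ → ∀ x, x ∉ range φ → MapClusterPt x atTop φ →
      Tendsto φ atTop (𝓝 x) := by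
    intro φ hφ x hx hcl
    rcases hX x with h | h
    · obtain ⟨χ, hχ, y, rfl⟩ := h.exists_isOpenEmbedding
      exact (tendsto_of_interior hφ.continuous hφ.injective hχ hx hcl).choose_spec.2.1
    · obtain ⟨η, hη, rfl, hop⟩ := h.exists_isHalfChart
      exact (tendsto_of_boundary hφ.continuous hφ.injective hη hop hx hcl).1
  have hφ' := isOpenEmbedding_comp_neg hφ
  have hrange : range (fun t => φ (-t)) = range φ := neg_surjective.range_comp φ
  obtain ⟨x, hx, hxc⟩ := exists_clusterPt_atTop hφ
  obtain ⟨y, hy, hyc⟩ := exists_clusterPt_atTop hφ'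
  have hxt := htend φ hφ x hx hxc
  have hyt' := htend _ hφ' y hy hyc
  have hyt : Tendsto φ atBot (𝓝 y) := by
    have := hyt'.comp tendsto_neg_atBot_atTop
    simpa [Function.comp_def] using this
  have hxt' : Tendsto (fun t => φ (-t)) atBot (𝓝 x) := hxt.comp tendsto_neg_atBot_atTop
  rw [hrange] at hy
  by_cases hxy : x = y
  · subst hxy
    exact hnC (nonempty_homeomorph_circle hX hφ hx hxt hyt)
  -- If the end `x` lay on an arc of the cover, a prolongation would contain that arc too. By
  -- maximality `φ` would already contain it, and with it `x`.
  have hxb : IsBoundaryPoint x := by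
    obtain ⟨j, hj, hxj⟩ := mem_iUnion₂.1 (hF (mem_univ x))
    refine (hcov j x hxj).resolve_left fun hmem => ?_
    rcases exists_prolongation hX hφ hx hxy hxc hyt (hψ j) hmem with h | ⟨φ', h1, h2, h3⟩
    · exact hnC h
    · exact hx (hφS j (hmax φ' h1 h2 j hj h3) hmem)
  have hyb : IsBoundaryPoint y := by
    obtain ⟨j, hj, hyj⟩ := mem_iUnion₂.1 (hF (mem_univ y))
    refine (hcov j y hyj).resolve_left fun hmem => ?_
    rcases exists_prolongation hX hφ' (by rwa [hrange]) (Ne.symm hxy) hyc hxt' (hψ j) hmem with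
      h | ⟨φ', h1, h2, h3⟩
    · exact hnC h
    · rw [hrange] at h2
      exact hy (hφS j (hmax φ' h1 h2 j hj h3) hmem)
  have hnear : ∀ φ : ℝ → X, IsOpenEmbedding φ → ∀ x, x ∉ range φ → MapClusterPt x atTop φ →
      IsBoundaryPoint x → ∃ V ∈ 𝓝 x, V ⊆ insert x (range φ) := by
    intro φ hφ x hx hcl hb
    obtain ⟨η, hη, rfl, hop⟩ := hb.exists_isHalfChart
    obtain ⟨ε, h1, h2, h3⟩ := (tendsto_of_boundary hφ.continuous hφ.injective hη hop hx hcl).2 0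
    refine ⟨_, (hop ε h1 h2).mem_nhds ⟨0, ⟨le_rfl, h1⟩, rfl⟩, ?_⟩
    rintro _ ⟨u, hu, rfl⟩
    rcases hu.1.eq_or_lt with rfl | h0
    · exact Or.inl rfl
    · exact Or.inr (image_subset_range _ _ (h3 ⟨u, ⟨h0, hu.2⟩, rfl⟩))
  have huniv : range φ ∪ {x, y} = univ := by
    refine IsClopen.eq_univ ⟨?_, isOpen_insert_of_nhds hφ fun z hz => ?_⟩ ⟨x, Or.inr (Or.inl rfl)⟩
    · have := isClosed_insert_insert_range hφ.continuous hxt hyt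
      convert! this using 1
      ext z; simp only [mem_union, mem_insert_iff, mem_singleton_iff]; tauto
    · rcases hz with rfl | hz
      · obtain ⟨V, hV, hsub⟩ := hnear φ hφ z hx hxc hxb
        refine mem_of_superset hV (hsub.trans ?_)
        rintro w (rfl | hw)
        · exact Or.inr (Or.inl rfl)
        · exact Or.inl hw
      · obtain rfl := mem_singleton_iff.1 hz
        obtain ⟨V, hV, hsub⟩ := hnear _ hφ' z (by rwa [hrange]) hyc hyb
        refine mem_of_superset hV (hsub.trans ?_)
        rw [hrange]
        rintro w (rfl | hw)
        · exact Or.inr (Or.inr rfl)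
        · exact Or.inl hw
  exact hnI (nonempty_homeomorph_Icc hφ hx hy hxy hxt hyt huniv)

end Classification

end KFrieze

/-! ### Interior and boundary points under open embeddings. -/

namespace KFrieze

open Filter Topology

section LocalStructure

variable {X Y : Type*} [TopologicalSpace X] [TopologicalSpace Y]

/-- The end point of `[0,1)`. -/
def icoZero : Ico (0 : ℝ) 1 := ⟨0, le_rfl, one_pos⟩

theorem isInteriorPoint_iff {x : X} :
    IsInteriorPoint x ↔ ∃ ψ : ℝ → X, IsOpenEmbedding ψ ∧ ψ 0 = x := by
  constructor
  · intro h
    obtain ⟨ψ, hψ, y, rfl⟩ := h.exists_isOpenEmbedding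
    exact ⟨fun t => ψ (y + t), hψ.comp (Homeomorph.addLeft y).isOpenEmbedding, by simp⟩
  · rintro ⟨ψ, hψ, rfl⟩
    exact IsOpenEmbedding.isInteriorPoint hψ 0

theorem isBoundaryPoint_iff {x : X} :
    IsBoundaryPoint x ↔ ∃ f : Ico (0 : ℝ) 1 → X, IsOpenEmbedding f ∧ f icoZero = x := by
  constructor
  · rintro ⟨U, hU, hx, e, he⟩
    refine ⟨Subtype.val ∘ e.symm, hU.isOpenEmbedding_subtypeVal.comp e.symm.isOpenEmbedding, ?_⟩
    have : e.symm icoZero = ⟨x, hx⟩ := by rw [e.symm_apply_eq]; exact Subtype.ext he.symm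
    rw [Function.comp_apply, this]
  · rintro ⟨f, hf, rfl⟩
    refine ⟨range f, hf.isOpen_range, mem_range_self _, hf.toIsEmbedding.toHomeomorph.symm, ?_⟩
    have : hf.toIsEmbedding.toHomeomorph.symm ⟨f icoZero, mem_range_self _⟩ = icoZero := by
      rw [Homeomorph.symm_apply_eq]; rfl
    rw [this]; rfl

theorem IsInteriorPoint.map {f : X → Y} (hf : IsOpenEmbedding f) {x : X} (h : IsInteriorPoint x) :
    IsInteriorPoint (f x) := by
  obtain ⟨ψ, hψ, rfl⟩ := isInteriorPoint_iff.1 h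
  exact isInteriorPoint_iff.2 ⟨f ∘ ψ, hf.comp hψ, rfl⟩

theorem IsBoundaryPoint.map {f : X → Y} (hf : IsOpenEmbedding f) {x : X} (h : IsBoundaryPoint x) :
    IsBoundaryPoint (f x) := by
  obtain ⟨ψ, hψ, rfl⟩ := isBoundaryPoint_iff.1 h
  exact isBoundaryPoint_iff.2 ⟨f ∘ ψ, hf.comp hψ, rfl⟩

theorem exists_lift_of_range_subset {Z : Type*} [TopologicalSpace Z] {f : X → Y}
    (hf : IsOpenEmbedding f) {h : Z → Y} (hh : IsOpenEmbedding h) (hsub : range h ⊆ range f) :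
    ∃ h' : Z → X, IsOpenEmbedding h' ∧ ∀ z, f (h' z) = h z := by
  choose h' hh' using fun z => hsub (mem_range_self z)
  refine ⟨h', IsOpenEmbedding.of_comp h' hf ?_, hh'⟩
  rwa [show f ∘ h' = h from funext hh']

theorem isOpenEmbedding_ico_mul {ε : ℝ} (h0 : 0 < ε) (h1 : ε ≤ 1) :
    IsOpenEmbedding (fun u : Ico (0 : ℝ) 1 =>
      (⟨ε * u, mul_nonneg h0.le u.2.1, by nlinarith [u.2.1, u.2.2]⟩ : Ico (0 : ℝ) 1)) := by
  refine ⟨.of_comp (by fun_prop) continuous_subtype_val ?_, ?_⟩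
  · exact (Homeomorph.mulLeft₀ ε h0.ne').isEmbedding.comp .subtypeVal
  · have : range (fun u : Ico (0 : ℝ) 1 =>
        (⟨ε * u, mul_nonneg h0.le u.2.1, by nlinarith [u.2.1, u.2.2]⟩ : Ico (0 : ℝ) 1)) =
        Subtype.val ⁻¹' Iio ε := by
      ext v
      constructor
      · rintro ⟨u, rfl⟩
        have := u.2.2
        simp only [mem_preimage, mem_Iio]
        nlinarith
      · intro hv
        refine ⟨⟨v / ε, div_nonneg v.2.1 h0.le, (div_lt_one h0).2 hv⟩, Subtype.ext ?_⟩
        simp only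
        field_simp
    rw [this]
    exact isOpen_Iio.preimage continuous_subtype_val

theorem IsInteriorPoint.of_map {f : X → Y} (hf : IsOpenEmbedding f) {x : X}
    (h : IsInteriorPoint (f x)) : IsInteriorPoint x := by
  obtain ⟨ψ, hψ, hx⟩ := isInteriorPoint_iff.1 h
  obtain ⟨δ, hδ, hδf⟩ := Metric.mem_nhds_iff.1
    (hψ.continuous.continuousAt.preimage_mem_nhds (hf.isOpen_range.mem_nhds ⟨x, hx.symm⟩))
  -- A homeomorphism of the line onto `(-δ, δ)` which fixes `0`.
  let ρ : ℝ → ℝ := fun t => δ * (2 * Real.sigmoid t - 1)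
  have hρ : IsOpenEmbedding ρ :=
    (((Homeomorph.mulLeft₀ (2 : ℝ) two_ne_zero).trans (Homeomorph.addRight (-1))).trans
      (Homeomorph.mulLeft₀ δ hδ.ne')).isOpenEmbedding.comp isOpenEmbedding_sigmoid
  have hρr : ∀ t, ρ t ∈ Metric.ball (0 : ℝ) δ := fun t => by
    rw [Metric.mem_ball, Real.dist_eq, sub_zero, abs_lt]
    have h1 := Real.sigmoid_pos t
    have h2 := Real.sigmoid_lt_one t
    constructor <;> simp only [ρ] <;> nlinarith
  obtain ⟨h', hh', hh''⟩ := exists_lift_of_range_subset hf (hψ.comp hρ)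
    (by rintro _ ⟨t, rfl⟩; exact hδf (hρr t))
  refine isInteriorPoint_iff.2 ⟨h', hh', hf.injective ?_⟩
  rw [hh'', ← hx, Function.comp_apply]
  congr 1
  simp [ρ, Real.sigmoid_zero]

theorem IsBoundaryPoint.exists_small {x : X} (h : IsBoundaryPoint x) {V : Set X} (hV : V ∈ 𝓝 x) :
    ∃ f : Ico (0 : ℝ) 1 → X, IsOpenEmbedding f ∧ f icoZero = x ∧ range f ⊆ V := by
  obtain ⟨ψ, hψ, rfl⟩ := isBoundaryPoint_iff.1 h
  obtain ⟨δ, hδ, hδf⟩ := Metric.mem_nhds_iff.1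
    (hψ.continuous.continuousAt.preimage_mem_nhds hV)
  have hm : 0 < min δ 1 := lt_min hδ one_pos
  refine ⟨_, hψ.comp (isOpenEmbedding_ico_mul hm (min_le_right _ _)), ?_, ?_⟩
  · rw [Function.comp_apply]
    congr 1
    exact Subtype.ext (by simp [icoZero])
  · rintro _ ⟨u, rfl⟩
    refine hδf ?_
    rw [Metric.mem_ball, Subtype.dist_eq, Real.dist_eq]
    simp only [icoZero, sub_zero]
    rw [abs_of_nonneg (mul_nonneg hm.le u.2.1)]
    have := u.2.2
    have := min_le_left δ 1
    nlinarith [u.2.1]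

theorem IsBoundaryPoint.of_map {f : X → Y} (hf : IsOpenEmbedding f) {x : X}
    (h : IsBoundaryPoint (f x)) : IsBoundaryPoint x := by
  obtain ⟨ψ, hψ, hx, hr⟩ := h.exists_small (hf.isOpen_range.mem_nhds ⟨x, rfl⟩)
  obtain ⟨h', hh', hh''⟩ := exists_lift_of_range_subset hf hψ hr
  exact isBoundaryPoint_iff.2 ⟨h', hh', hf.injective (by rw [hh'', hx])⟩

/-- Comparing the two charts gives a continuous injective real function on an interval. It is
strictly monotone, yet its value at an inner point is the least possible value `0`. -/
theorem IsInteriorPoint.not_isBoundaryPoint {x : X} (h : IsInteriorPoint x) :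
    ¬ IsBoundaryPoint x := by
  classical
  intro hb
  obtain ⟨ψ, hψ, rfl⟩ := isInteriorPoint_iff.1 h
  obtain ⟨U, hU, hx, e, he⟩ := hb
  obtain ⟨δ, hδ, hδU⟩ := Metric.mem_nhds_iff.1
    (hψ.continuous.continuousAt.preimage_mem_nhds (hU.mem_nhds hx))
  have hsub : ∀ t ∈ Icc (-(δ / 2)) (δ / 2), ψ t ∈ U := fun t ht => hδU (by
    rw [Metric.mem_ball, Real.dist_eq, sub_zero, abs_lt]
    constructor <;> linarith [ht.1, ht.2])
  let g : ℝ → ℝ := fun t => if ht : ψ t ∈ U then e ⟨ψ t, ht⟩ else 0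
  have hg : ∀ t (ht : t ∈ Icc (-(δ / 2)) (δ / 2)), g t = e ⟨ψ t, hsub t ht⟩ := fun t ht =>
    dif_pos (hsub t ht)
  have hgc : ContinuousOn g (Icc (-(δ / 2)) (δ / 2)) := by
    rw [continuousOn_iff_continuous_domRestrict]
    have : (Icc (-(δ / 2)) (δ / 2)).domRestrict g =
        fun t : Icc (-(δ / 2)) (δ / 2) => (e ⟨ψ t, hsub t t.2⟩ : ℝ) :=
      funext fun t => hg t t.2
    rw [this]
    exact continuous_subtype_val.comp (e.continuous.comp
      ((hψ.continuous.comp continuous_subtype_val).subtype_mk _))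
  have hgi : InjOn g (Icc (-(δ / 2)) (δ / 2)) := by
    intro t ht u hu htu
    rw [hg t ht, hg u hu] at htu
    exact hψ.injective (congrArg Subtype.val (e.injective (Subtype.ext htu)))
  have m0 : (0 : ℝ) ∈ Icc (-(δ / 2)) (δ / 2) := by constructor <;> linarith
  have ma : -(δ / 2) ∈ Icc (-(δ / 2)) (δ / 2) := by constructor <;> linarith
  have mb : δ / 2 ∈ Icc (-(δ / 2)) (δ / 2) := by constructor <;> linarith
  have h0 : g 0 = 0 := by rw [hg 0 m0]; exact he
  have hn : ∀ t ∈ Icc (-(δ / 2)) (δ / 2), 0 ≤ g t := fun t ht => by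
    rw [hg t ht]; exact (e _).2.1
  rcases hgc.strictMonoOn_of_injOn_Icc' (by linarith) hgi with hm | hm
  · have := hm ma m0 (by linarith)
    linarith [hn _ ma]
  · have := hm m0 mb (by linarith)
    linarith [hn _ mb]

theorem IsOneManifold.of_isOpenEmbedding {f : X → Y} (hf : IsOpenEmbedding f)
    (hY : IsOneManifold Y) : IsOneManifold X := fun x =>
  (hY (f x)).imp (IsInteriorPoint.of_map hf) (IsBoundaryPoint.of_map hf)

theorem IsOneManifold.isOpen_connectedComponent (hX : IsOneManifold X) (x : X) :
    IsOpen (connectedComponent x) := by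
  refine isOpen_iff_mem_nhds.2 fun y hy => ?_
  rw [connectedComponent_eq hy]
  rcases hX y with h | h
  · obtain ⟨ψ, hψ, rfl⟩ := isInteriorPoint_iff.1 h
    exact mem_of_superset (hψ.isOpen_range.mem_nhds (mem_range_self 0))
      ((isPreconnected_range hψ.continuous).subset_connectedComponent (mem_range_self 0))
  · obtain ⟨ψ, hψ, rfl⟩ := isBoundaryPoint_iff.1 h
    have : PreconnectedSpace (Ico (0 : ℝ) 1) :=
      Subtype.preconnectedSpace isPreconnected_Ico
    exact mem_of_superset (hψ.isOpen_range.mem_nhds (mem_range_self icoZero))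
      ((isPreconnected_range hψ.continuous).subset_connectedComponent (mem_range_self icoZero))

theorem isBoundaryPoint_Icc_zero : IsBoundaryPoint (⟨0, le_rfl, zero_le_one⟩ : Icc (0 : ℝ) 1) := by
  refine isBoundaryPoint_iff.2 ⟨fun u => ⟨u, u.2.1, u.2.2.le⟩, ⟨.of_comp (by fun_prop)
    continuous_subtype_val .subtypeVal, ?_⟩, rfl⟩
  have : range (fun u : Ico (0 : ℝ) 1 => (⟨u, u.2.1, u.2.2.le⟩ : Icc (0 : ℝ) 1)) =
      Subtype.val ⁻¹' Iio 1 := by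
    ext v
    constructor
    · rintro ⟨u, rfl⟩; exact u.2.2
    · intro hv; exact ⟨⟨v, v.2.1, hv⟩, rfl⟩
  rw [this]
  exact isOpen_Iio.preimage continuous_subtype_val

theorem isBoundaryPoint_Icc_one : IsBoundaryPoint (⟨1, zero_le_one, le_rfl⟩ : Icc (0 : ℝ) 1) := by
  have := isBoundaryPoint_Icc_zero.map (unitInterval.symmHomeomorph.isOpenEmbedding)
  convert this
  exact Subtype.ext (by simp)

theorem isInteriorPoint_Icc {u : Icc (0 : ℝ) 1} (h0 : (u : ℝ) ≠ 0) (h1 : (u : ℝ) ≠ 1) :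
    IsInteriorPoint u := by
  have hmem : ∀ t, Real.sigmoid t ∈ Icc (0 : ℝ) 1 := fun t =>
    ⟨Real.sigmoid_nonneg t, Real.sigmoid_le_one t⟩
  have hop : IsOpenEmbedding fun t => (⟨Real.sigmoid t, hmem t⟩ : Icc (0 : ℝ) 1) := by
    refine ⟨.of_comp (continuous_sigmoid.subtype_mk _) continuous_subtype_val
      isOpenEmbedding_sigmoid.isEmbedding, ?_⟩
    have : range (fun t => (⟨Real.sigmoid t, hmem t⟩ : Icc (0 : ℝ) 1)) =
        Subtype.val ⁻¹' Ioo 0 1 := by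
      ext v
      rw [← Real.range_sigmoid]
      constructor
      · rintro ⟨t, rfl⟩; exact ⟨t, rfl⟩
      · rintro ⟨t, ht⟩; exact ⟨t, Subtype.ext ht⟩
    rw [this]
    exact isOpen_Ioo.preimage continuous_subtype_val
  obtain ⟨t, ht⟩ : (u : ℝ) ∈ range Real.sigmoid := by
    rw [Real.range_sigmoid]
    exact ⟨lt_of_le_of_ne u.2.1 (Ne.symm h0), lt_of_le_of_ne u.2.2 h1⟩
  have : u = ⟨Real.sigmoid t, hmem t⟩ := Subtype.ext ht.symm
  rw [this]
  exact IsOpenEmbedding.isInteriorPoint hop t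

theorem isBoundaryPoint_Icc_iff (u : Icc (0 : ℝ) 1) :
    IsBoundaryPoint u ↔ (u : ℝ) = 0 ∨ (u : ℝ) = 1 := by
  constructor
  · intro h
    by_contra hc
    push Not at hc
    exact (isInteriorPoint_Icc hc.1 hc.2).not_isBoundaryPoint h
  · rintro (h | h)
    · rw [show u = ⟨0, le_rfl, zero_le_one⟩ from Subtype.ext h]
      exact isBoundaryPoint_Icc_zero
    · rw [show u = ⟨1, zero_le_one, le_rfl⟩ from Subtype.ext h]
      exact isBoundaryPoint_Icc_one

/-- One point is interior because the circle is the one-point compactification of the line;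
rotations carry it to all others. -/
theorem isInteriorPoint_circle (z : Circle) : IsInteriorPoint z := by
  obtain ⟨e⟩ := nonempty_onePoint_homeomorph_circle
  let w : Circle := e (0 : ℝ)
  let R : Circle ≃ₜ Circle := Homeomorph.mulLeft (z * w⁻¹)
  have h0 : IsInteriorPoint (((0 : ℝ) : OnePoint ℝ)) :=
    IsOpenEmbedding.isInteriorPoint OnePoint.isOpenEmbedding_coe 0
  have h1 : IsInteriorPoint w := h0.map e.isOpenEmbedding
  have h2 := h1.map R.isOpenEmbedding
  have : R w = z := by simp [R]
  rwa [this] at h2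

end LocalStructure

end KFrieze

/-! ### Relatively clopen subsets. -/

namespace KFrieze

open Filter Topology

section RelClopen

/-- `M` is a relatively open and closed subset of `F`. -/
def IsRelClopen {X : Type*} [TopologicalSpace X] (M F : Set X) : Prop :=
  M ⊆ F ∧ ∃ s t : Set X, IsClosed s ∧ IsClosed t ∧ F ∩ s = M ∧ F ∩ t = F \ M

variable {X : Type*} [TopologicalSpace X] {F M N S A B : Set X}

theorem IsRelClopen.union (h : IsRelClopen M F) (h' : IsRelClopen N F) :
    IsRelClopen (M ∪ N) F := by
  obtain ⟨hM, s, t, hs, ht, h1, h2⟩ := h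
  obtain ⟨hN, s', t', hs', ht', h1', h2'⟩ := h'
  refine ⟨union_subset hM hN, s ∪ s', t ∩ t', hs.union hs', ht.inter ht', ?_, ?_⟩
  · rw [inter_union_distrib_left, h1, h1']
  · rw [inter_inter_distrib_left, h2, h2', sdiff_inter_sdiff]

theorem isRelClopen_empty (F : Set X) : IsRelClopen ∅ F :=
  ⟨empty_subset _, ∅, univ, isClosed_empty, isClosed_univ, by simp, by simp⟩

theorem IsRelClopen.biUnion {ι : Type*} {s : Set ι} (hs : s.Finite) {M : ι → Set X}
    (h : ∀ i ∈ s, IsRelClopen (M i) F) : IsRelClopen (⋃ i ∈ s, M i) F := by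
  induction s, hs using Set.Finite.induction_on with
  | empty => simpa using isRelClopen_empty F
  | insert _ _ ih =>
    rw [biUnion_insert]
    exact (h _ (mem_insert _ _)).union (ih fun i hi => h i (mem_insert_of_mem _ hi))

/-- Only closed sets of the ambient space occur in the definition, so both conditions can be tested
on two closed parts. For compositions these are the half planes below and above the middle line. -/
theorem IsRelClopen.paste (hA : IsClosed A) (hB : IsClosed B) (hF : F ⊆ A ∪ B) (hMF : M ⊆ F)
    (h : IsRelClopen (M ∩ A) (F ∩ A)) (h' : IsRelClopen (M ∩ B) (F ∩ B)) : IsRelClopen M F := by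
  obtain ⟨-, s, t, hs, ht, h1, h2⟩ := h
  obtain ⟨-, s', t', hs', ht', h1', h2'⟩ := h'
  refine ⟨hMF, (s ∩ A) ∪ (s' ∩ B), (t ∩ A) ∪ (t' ∩ B), (hs.inter hA).union (hs'.inter hB),
    (ht.inter hA).union (ht'.inter hB), ?_, ?_⟩ <;> ext x
  · have e1 := Set.ext_iff.1 h1 x
    have e2 := Set.ext_iff.1 h1' x
    have e3 := @hF x
    have e4 := @hMF x
    rw [mem_inter_iff, mem_inter_iff, mem_inter_iff] at e1 e2
    rw [mem_union] at e3
    simp only [mem_inter_iff, mem_union]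
    by_cases a1 : x ∈ A <;> by_cases a2 : x ∈ B <;> simp only [a1, a2] at * <;> tauto
  · have e1 := Set.ext_iff.1 h2 x
    have e2 := Set.ext_iff.1 h2' x
    have e3 := @hF x
    rw [mem_inter_iff, Set.mem_sdiff, mem_inter_iff, mem_inter_iff] at e1 e2
    rw [mem_union] at e3
    rw [mem_inter_iff, mem_union, mem_inter_iff, mem_inter_iff, Set.mem_sdiff]
    clear hA hB hF h1 h1' h2 h2' hs ht hs' ht'
    grind

theorem IsRelClopen.subset_of_isPreconnected (h : IsRelClopen M F) (hS : IsPreconnected S)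
    (hSF : S ⊆ F) (hne : (S ∩ M).Nonempty) : S ⊆ M := by
  obtain ⟨hM, s, t, hs, ht, h1, h2⟩ := h
  intro x hx
  by_contra hxM
  have hcov : S ⊆ s ∪ t := fun y hy => by
    by_cases hyM : y ∈ M
    · exact Or.inl (h1.symm.subset hyM).2
    · exact Or.inr (h2.symm.subset ⟨hSF hy, hyM⟩).2
  obtain ⟨y, hy, hyM⟩ := hne
  obtain ⟨z, hz, hzs, hzt⟩ := isPreconnected_closed_iff.1 hS s t hs ht hcov
    ⟨y, hy, (h1.symm.subset hyM).2⟩ ⟨x, hx, (h2.symm.subset ⟨hSF hx, hxM⟩).2⟩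
  exact (h2.subset ⟨hSF hz, hzt⟩).2 (h1.subset ⟨hSF hz, hzs⟩)

theorem IsRelClopen.of_isClopen (hM : M ⊆ F) (h : IsClopen (Subtype.val ⁻¹' M : Set F)) :
    IsRelClopen M F := by
  obtain ⟨s, hs, h1⟩ := isClosed_induced_iff.1 h.1
  obtain ⟨t, ht, h2⟩ := isClosed_induced_iff.1 h.compl.1
  refine ⟨hM, s, t, hs, ht, ?_, ?_⟩ <;> ext x
  · constructor
    · rintro ⟨hxF, hxs⟩
      exact (Set.ext_iff.1 h1 ⟨x, hxF⟩).1 hxs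
    · intro hx
      exact ⟨hM hx, (Set.ext_iff.1 h1 ⟨x, hM hx⟩).2 hx⟩
  · constructor
    · rintro ⟨hxF, hxs⟩
      exact ⟨hxF, (Set.ext_iff.1 h2 ⟨x, hxF⟩).1 hxs⟩
    · rintro ⟨hxF, hx⟩
      exact ⟨hxF, (Set.ext_iff.1 h2 ⟨x, hxF⟩).2 hx⟩

theorem IsRelClopen.isClopen (h : IsRelClopen M F) : IsClopen (Subtype.val ⁻¹' M : Set F) := by
  obtain ⟨hM, s, t, hs, ht, h1, h2⟩ := h
  refine ⟨isClosed_induced_iff.2 ⟨s, hs, ?_⟩,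
    isClosed_compl_iff.1 (isClosed_induced_iff.2 ⟨t, ht, ?_⟩)⟩ <;> ext x
  · exact ⟨fun hx => h1.subset ⟨x.2, hx⟩, fun hx => (h1.symm.subset hx).2⟩
  · exact ⟨fun hx => (h2.subset ⟨x.2, hx⟩).2, fun hx => (h2.symm.subset ⟨x.2, hx⟩).2⟩

theorem IsRelClopen.image {Y : Type*} [TopologicalSpace Y] (f : X ≃ₜ Y) (h : IsRelClopen M F) :
    IsRelClopen (f '' M) (f '' F) := by
  obtain ⟨hM, s, t, hs, ht, h1, h2⟩ := h
  refine ⟨image_mono hM, f '' s, f '' t, f.isClosed_image.2 hs, f.isClosed_image.2 ht, ?_, ?_⟩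
  · rw [← image_inter f.injective, h1]
  · rw [← image_inter f.injective, h2, image_sdiff f.injective]

theorem isRelClopen_of_isOpen {U V : Set X} (hU : IsOpen U) (hV : IsOpen V) (hF : F ⊆ U ∪ V)
    (hUV : F ∩ (U ∩ V) = ∅) : IsRelClopen (F ∩ U) F := by
  refine ⟨inter_subset_left, Vᶜ, Uᶜ, hV.isClosed_compl, hU.isClosed_compl, ?_, ?_⟩ <;> ext x
  · have e1 := @hF x
    have e2 := Set.ext_iff.1 hUV x
    simp only [mem_inter_iff, mem_union, mem_empty_iff_false, mem_compl_iff] at *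
    tauto
  · simp only [mem_inter_iff, Set.mem_sdiff, mem_compl_iff]
    tauto

theorem IsOneManifold.isRelClopen_connectedComponentIn (h : IsOneManifold F) {p : X} (hp : p ∈ F) :
    IsRelClopen (connectedComponentIn F p) F := by
  refine .of_isClopen (connectedComponentIn_subset F p) ?_
  rw [connectedComponentIn_eq_image hp, preimage_image_eq _ Subtype.val_injective]
  exact ⟨isClosed_connectedComponent, h.isOpen_connectedComponent _⟩

theorem IsRelClopen.isOpenEmbedding (h : IsRelClopen M F) :
    IsOpenEmbedding (inclusion h.1) := by
  refine ⟨.inclusion h.1, ?_⟩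
  rw [range_inclusion]
  exact h.isClopen.2

end RelClopen

/-! ### Diagrams and their components -/

namespace PlaneSet

/-- The marked point with label `z`: `(z,0)` for positive `z` and `(-z,a)` for negative `z`. -/
noncomputable def mark (D : PlaneSet) (z : ℤ) : ℝ × ℝ := if 0 < z then (z, 0) else (-z, D.height)

theorem mark_natCast (D : PlaneSet) {i : ℕ} (hi : 1 ≤ i) : D.mark i = botPt i := by
  rw [mark, if_pos (by omega)]; simp [botPt]

theorem mark_neg_natCast (D : PlaneSet) {i : ℕ} (hi : 1 ≤ i) : D.mark (-i) = D.topPt i := by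
  rw [mark, if_neg (by omega)]; simp [topPt]

theorem int_cases {z : ℤ} (hz : z ≠ 0) : ∃ i : ℕ, 1 ≤ i ∧ (z = i ∨ z = -i) :=
  ⟨z.natAbs, by omega, by omega⟩

theorem mem_marks_iff (D : PlaneSet) {p : ℝ × ℝ} :
    p ∈ D.topPts ∪ botPts ↔ ∃ z, z ≠ 0 ∧ p = D.mark z := by
  constructor
  · rintro (⟨i, hi, rfl⟩ | ⟨i, hi, rfl⟩)
    · exact ⟨-i, by omega, (D.mark_neg_natCast hi).symm⟩
    · exact ⟨i, by omega, (D.mark_natCast hi).symm⟩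
  · rintro ⟨z, hz, rfl⟩
    obtain ⟨i, hi, rfl | rfl⟩ := int_cases hz
    · exact Or.inr ⟨i, hi, D.mark_natCast hi⟩
    · exact Or.inl ⟨i, hi, D.mark_neg_natCast hi⟩

theorem mark_injOn {D : PlaneSet} (h : 0 < D.height) {z w : ℤ} (hzw : D.mark z = D.mark w) :
    z = w := by
  have h1 := congrArg Prod.fst hzw
  have h2 := congrArg Prod.snd hzw
  unfold mark at h1 h2
  split_ifs at h1 h2 <;> simp only at h1 h2
  · exact_mod_cast h1
  · exact absurd h2 h.ne
  · exact absurd h2 h.ne'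
  · have : (z : ℝ) = w := by linarith
    exact_mod_cast this

/-- The topological part of the definition of an `ω`-diagram that concerns single components. -/
structure IsDiagram (D : PlaneSet) : Prop where
  height_pos : 0 < D.height
  subset_strip : D.carrier ⊆ strip D.height
  inter_top : D.carrier ∩ {p | 0 ≤ p.1 ∧ p.2 = D.height} = D.topPts
  inter_bot : D.carrier ∩ {p | 0 ≤ p.1 ∧ p.2 = 0} = botPts
  manifold : IsOneManifold D.carrier
  boundary : ∀ p : D.carrier, IsBoundaryPoint p ↔ (p : ℝ × ℝ) ∈ D.topPts ∪ botPts
  compact_components : ∀ T ∈ D.components, IsCompact T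

theorem IsOmegaDiagram.isDiagram {D : PlaneSet} (h : D.IsOmegaDiagram) : D.IsDiagram :=
  { h with }

/-- The component of `D` that contains `p`. -/
def compAt (D : PlaneSet) (p : ℝ × ℝ) : Set (ℝ × ℝ) := connectedComponentIn D.carrier p

variable {D : PlaneSet}

theorem IsDiagram.mark_mem (hD : D.IsDiagram) {z : ℤ} (hz : z ≠ 0) : D.mark z ∈ D.carrier := by
  rcases D.mem_marks_iff.2 ⟨z, hz, rfl⟩ with h | h
  · exact (hD.inter_top.symm.subset h).1
  · exact (hD.inter_bot.symm.subset h).1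

theorem compAt_mem_components {p : ℝ × ℝ} (hp : p ∈ D.carrier) : D.compAt p ∈ D.components :=
  ⟨p, hp, rfl⟩

theorem mem_compAt {p : ℝ × ℝ} (hp : p ∈ D.carrier) : p ∈ D.compAt p :=
  mem_connectedComponentIn hp

theorem compAt_subset (p : ℝ × ℝ) : D.compAt p ⊆ D.carrier := connectedComponentIn_subset _ _

theorem compAt_eq {p q : ℝ × ℝ} (h : q ∈ D.compAt p) : D.compAt q = D.compAt p :=
  (connectedComponentIn_eq h).symm

theorem compAt_symm {p q : ℝ × ℝ} (h : q ∈ D.compAt p) : p ∈ D.compAt q := by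
  rw [compAt_eq h]
  refine mem_connectedComponentIn ?_
  by_contra hp
  rw [compAt, connectedComponentIn_eq_empty hp] at h
  exact h

theorem compAt_trans {p q r : ℝ × ℝ} (h : q ∈ D.compAt p) (h' : r ∈ D.compAt q) :
    r ∈ D.compAt p := by
  rwa [compAt_eq h] at h'

theorem components_eq {S T : Set (ℝ × ℝ)} (hS : S ∈ D.components) (hT : T ∈ D.components)
    {p : ℝ × ℝ} (hpS : p ∈ S) (hpT : p ∈ T) : S = T := by
  obtain ⟨q, hq, rfl⟩ := hS
  obtain ⟨r, hr, rfl⟩ := hT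
  exact (connectedComponentIn_eq hpS).trans (connectedComponentIn_eq hpT).symm

theorem components_nonempty {S : Set (ℝ × ℝ)} (hS : S ∈ D.components) : S.Nonempty := by
  obtain ⟨q, hq, rfl⟩ := hS
  exact ⟨q, mem_compAt hq⟩

theorem components_subset {S : Set (ℝ × ℝ)} (hS : S ∈ D.components) : S ⊆ D.carrier := by
  obtain ⟨q, hq, rfl⟩ := hS
  exact compAt_subset q

theorem components_isPreconnected {S : Set (ℝ × ℝ)} (hS : S ∈ D.components) :
    IsPreconnected S := by
  obtain ⟨q, hq, rfl⟩ := hS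
  exact isPreconnected_connectedComponentIn

theorem eq_compAt {S : Set (ℝ × ℝ)} (hS : S ∈ D.components) {p : ℝ × ℝ} (hp : p ∈ S) :
    S = D.compAt p :=
  components_eq hS (compAt_mem_components (components_subset hS hp)) hp
    (mem_compAt (components_subset hS hp))

theorem IsDiagram.isRelClopen (hD : D.IsDiagram) {S : Set (ℝ × ℝ)} (hS : S ∈ D.components) :
    IsRelClopen S D.carrier := by
  obtain ⟨q, hq, rfl⟩ := hS
  exact hD.manifold.isRelClopen_connectedComponentIn hq

/-- Either a component is a circle without marked points, or it is an arc whose end points are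
its only marked points. -/
theorem IsDiagram.component_cases (hD : D.IsDiagram) {S : Set (ℝ × ℝ)} (hS : S ∈ D.components) :
    (Nonempty (S ≃ₜ Circle) ∧ ∀ z, z ≠ 0 → D.mark z ∉ S) ∨
    ∃ (e : Icc (0 : ℝ) 1 ≃ₜ S) (z w : ℤ), z ≠ 0 ∧ w ≠ 0 ∧ z ≠ w ∧
      (e ⟨0, le_rfl, zero_le_one⟩ : ℝ × ℝ) = D.mark z ∧
      (e ⟨1, zero_le_one, le_rfl⟩ : ℝ × ℝ) = D.mark w ∧
      ∀ v, v ≠ 0 → D.mark v ∈ S → v = z ∨ v = w := by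
  have hcl := hD.isRelClopen hS
  have hemb := hcl.isOpenEmbedding
  have hconn : ConnectedSpace S := by
    rw [← isConnected_iff_connectedSpace]
    exact ⟨components_nonempty hS, components_isPreconnected hS⟩
  have hcomp : CompactSpace S := isCompact_iff_compactSpace.1 (hD.compact_components S hS)
  have hman : IsOneManifold S := IsOneManifold.of_isOpenEmbedding hemb hD.manifold
  -- A component is open in the diagram, so its boundary points as a manifold are the marked points
  -- on it.
  have hbd : ∀ x : S, IsBoundaryPoint x ↔ ∃ z, z ≠ 0 ∧ (x : ℝ × ℝ) = D.mark z := fun x => by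
    rw [← D.mem_marks_iff]
    exact (⟨IsBoundaryPoint.map hemb, IsBoundaryPoint.of_map hemb⟩ :
      IsBoundaryPoint x ↔ _).trans (hD.boundary (inclusion hcl.1 x))
  rcases hman.nonempty_homeomorph with ⟨⟨e⟩⟩ | ⟨⟨e⟩⟩
  · right
    have hb' : ∀ u, IsBoundaryPoint (e.symm u) ↔ (u : ℝ) = 0 ∨ (u : ℝ) = 1 := fun u => by
      rw [← isBoundaryPoint_Icc_iff]
      exact ⟨fun h => by simpa using h.map e.isOpenEmbedding,
        fun h => h.map e.symm.isOpenEmbedding⟩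
    obtain ⟨z, hz, hez⟩ := (hbd _).1 ((hb' ⟨0, le_rfl, zero_le_one⟩).2 (Or.inl rfl))
    obtain ⟨w, hw, hew⟩ := (hbd _).1 ((hb' ⟨1, zero_le_one, le_rfl⟩).2 (Or.inr rfl))
    refine ⟨e.symm, z, w, hz, hw, ?_, hez, hew, fun v hv hvS => ?_⟩
    · rintro rfl
      have := e.symm.injective (Subtype.ext (hez.trans hew.symm))
      exact zero_ne_one (congrArg Subtype.val this)
    · have h1 : IsBoundaryPoint (e.symm (e ⟨D.mark v, hvS⟩)) := by
        rw [e.symm_apply_apply]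
        exact (hbd _).2 ⟨v, hv, rfl⟩
      rcases (hb' _).1 h1 with h | h
      · left
        have : e ⟨D.mark v, hvS⟩ = ⟨0, le_rfl, zero_le_one⟩ := Subtype.ext h
        rw [← this, e.symm_apply_apply] at hez
        exact mark_injOn hD.height_pos hez
      · right
        have : e ⟨D.mark v, hvS⟩ = ⟨1, zero_le_one, le_rfl⟩ := Subtype.ext h
        rw [← this, e.symm_apply_apply] at hew
        exact mark_injOn hD.height_pos hew
  · left
    refine ⟨⟨e⟩, fun z hz hzS => ?_⟩
    have h1 : IsBoundaryPoint (⟨D.mark z, hzS⟩ : S) := (hbd _).2 ⟨z, hz, rfl⟩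
    exact (isInteriorPoint_circle _).not_isBoundaryPoint (h1.map e.isOpenEmbedding)

theorem not_nonempty_Icc_homeomorph_circle : ¬ Nonempty (Icc (0 : ℝ) 1 ≃ₜ Circle) := fun ⟨e⟩ =>
  (isInteriorPoint_circle _).not_isBoundaryPoint (isBoundaryPoint_Icc_zero.map e.isOpenEmbedding)

theorem IsDiagram.mem_threads_iff (hD : D.IsDiagram) {S : Set (ℝ × ℝ)} :
    S ∈ D.threads ↔ ∃ z, z ≠ 0 ∧ S = D.compAt (D.mark z) := by
  constructor
  · rintro ⟨hS, ⟨e⟩⟩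
    rcases hD.component_cases hS with ⟨⟨e'⟩, -⟩ | ⟨e', z, w, hz, -, -, h0, -⟩
    · exact absurd ⟨e.symm.trans e'⟩ not_nonempty_Icc_homeomorph_circle
    · refine ⟨z, hz, eq_compAt hS ?_⟩
      rw [← h0]; exact Subtype.coe_prop _
  · rintro ⟨z, hz, rfl⟩
    have hc := compAt_mem_components (hD.mark_mem hz)
    rcases hD.component_cases hc with ⟨-, h⟩ | ⟨e', -⟩
    · exact absurd (mem_compAt (hD.mark_mem hz)) (h z hz)
    · exact ⟨hc, ⟨e'.symm⟩⟩

theorem IsDiagram.mem_circularComponents_iff (hD : D.IsDiagram) {S : Set (ℝ × ℝ)} :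
    S ∈ D.circularComponents ↔ S ∈ D.components ∧ ∀ z, z ≠ 0 → D.mark z ∉ S := by
  constructor
  · rintro ⟨hS, ⟨e⟩⟩
    rcases hD.component_cases hS with ⟨-, h⟩ | ⟨e', -⟩
    · exact ⟨hS, h⟩
    · exact absurd ⟨e'.trans e⟩ not_nonempty_Icc_homeomorph_circle
  · rintro ⟨hS, h⟩
    rcases hD.component_cases hS with ⟨he, -⟩ | ⟨e', z, w, hz, -, -, h0, -⟩
    · exact ⟨hS, he⟩
    · refine absurd ?_ (h z hz)
      rw [← h0]; exact Subtype.coe_prop _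

theorem IsDiagram.compAt_mark_mem_threads (hD : D.IsDiagram) {z : ℤ} (hz : z ≠ 0) :
    D.compAt (D.mark z) ∈ D.threads :=
  hD.mem_threads_iff.2 ⟨z, hz, rfl⟩

theorem IsDiagram.mem_threads_or_circular (hD : D.IsDiagram) {S : Set (ℝ × ℝ)}
    (hS : S ∈ D.components) : S ∈ D.threads ∨ S ∈ D.circularComponents := by
  rcases hD.component_cases hS with ⟨he, -⟩ | ⟨e', -⟩
  · exact Or.inr ⟨hS, he⟩
  · exact Or.inl ⟨hS, ⟨e'.symm⟩⟩

/-- The thread that starts in a marked point ends in exactly one other marked point. -/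
theorem IsDiagram.exists_partner (hD : D.IsDiagram) {z : ℤ} (hz : z ≠ 0) :
    ∃ w, w ≠ 0 ∧ w ≠ z ∧ D.mark w ∈ D.compAt (D.mark z) ∧
      (∀ v, v ≠ 0 → D.mark v ∈ D.compAt (D.mark z) → v = z ∨ v = w) ∧
      ∃ e : Icc (0 : ℝ) 1 ≃ₜ D.compAt (D.mark z),
        (e ⟨0, le_rfl, zero_le_one⟩ : ℝ × ℝ) = D.mark z ∧
        (e ⟨1, zero_le_one, le_rfl⟩ : ℝ × ℝ) = D.mark w := by
  have hm := hD.mark_mem hz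
  rcases hD.component_cases (compAt_mem_components hm) with
    ⟨-, h⟩ | ⟨e, x, y, hx, hy, hxy, hex, hey, h⟩
  · exact absurd (mem_compAt hm) (h z hz)
  · have hx' : D.mark x ∈ D.compAt (D.mark z) := by rw [← hex]; exact Subtype.coe_prop _
    have hy' : D.mark y ∈ D.compAt (D.mark z) := by rw [← hey]; exact Subtype.coe_prop _
    rcases h z hz (mem_compAt hm) with rfl | rfl
    · exact ⟨y, hy, hxy.symm, hy', h, e, hex, hey⟩
    · refine ⟨x, hx, hxy, hx', fun v hv hvS => (h v hv hvS).symm,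
        unitInterval.symmHomeomorph.trans e, ?_, ?_⟩
      · refine Eq.trans ?_ hey
        exact congrArg (fun u => (e u : ℝ × ℝ)) (Subtype.ext (by simp [unitInterval.symm]))
      · refine Eq.trans ?_ hex
        exact congrArg (fun u => (e u : ℝ × ℝ)) (Subtype.ext (by simp [unitInterval.symm]))

end PlaneSet

/-! ### The invariant of a diagram and K-equivalence. -/

theorem isHomeomorph_sigma_of_pieces {X ι : Type*} [TopologicalSpace X] {P : ι → Set X}
    (hP : ∀ i, IsOpen (P i)) (hd : ∀ i j x, x ∈ P i → x ∈ P j → i = j)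
    (hc : ∀ x, ∃ i, x ∈ P i) : IsHomeomorph (fun x : Σ i, P i => (x.2 : X)) := by
  refine ⟨continuous_sigma fun i => continuous_subtype_val,
    isOpenMap_sigma.2 fun i => (hP i).isOpenMap_subtype_val, ?_, fun x => ?_⟩
  · rintro ⟨i, x, hx⟩ ⟨j, y, hy⟩ (rfl : x = y)
    obtain rfl := hd i j x hx hy
    rfl
  · obtain ⟨i, hi⟩ := hc x
    exact ⟨⟨i, x, hi⟩, rfl⟩

/-- Open pieces make each space the topological sum of its parts, so a homeomorphism of friezes may
be built component by component. -/
theorem exists_homeomorph_of_pieces {X Y ι : Type*} [TopologicalSpace X] [TopologicalSpace Y]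
    {P : ι → Set X} {Q : ι → Set Y} (hP : ∀ i, IsOpen (P i)) (hQ : ∀ i, IsOpen (Q i))
    (hPd : ∀ i j x, x ∈ P i → x ∈ P j → i = j) (hQd : ∀ i j x, x ∈ Q i → x ∈ Q j → i = j)
    (hPc : ∀ x, ∃ i, x ∈ P i) (hQc : ∀ x, ∃ i, x ∈ Q i) (h : ∀ i, P i ≃ₜ Q i) :
    ∃ f : X ≃ₜ Y, ∀ i x (hx : x ∈ P i), f x = h i ⟨x, hx⟩ := by
  let eP := (isHomeomorph_sigma_of_pieces hP hPd hPc).homeomorph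
  let eQ := (isHomeomorph_sigma_of_pieces hQ hQd hQc).homeomorph
  let m : (Σ i, P i) ≃ₜ Σ i, Q i :=
    { toFun := fun x => ⟨x.1, h x.1 x.2⟩
      invFun := fun x => ⟨x.1, (h x.1).symm x.2⟩
      left_inv := fun x => by simp
      right_inv := fun x => by simp
      continuous_toFun := continuous_sigma fun i => continuous_sigmaMk.comp (h i).continuous
      continuous_invFun := continuous_sigma fun i => continuous_sigmaMk.comp (h i).symm.continuous }
  refine ⟨(eP.symm.trans m).trans eQ, fun i x hx => ?_⟩
  have : eP.symm x = ⟨i, x, hx⟩ := by rw [eP.symm_apply_eq]; rfl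
  simp only [Homeomorph.trans_apply, this]
  rfl

namespace PlaneSet

/-- The pairing of marked points given by the threads of `D`, and the number of circular
components of `D`. -/
structure HasInvariant (D : PlaneSet) (s : (ℤ → ℤ) × ℕ) : Prop where
  pairing : IsPairing s.1
  mark_mem : ∀ z, z ≠ 0 → D.mark (s.1 z) ∈ D.compAt (D.mark z)
  ncard : D.circularComponents.ncard = s.2

variable {D E : PlaneSet} {s : (ℤ → ℤ) × ℕ}

theorem HasInvariant.eq_or_eq (h : D.HasInvariant s) (hD : D.IsDiagram) {z v : ℤ} (hz : z ≠ 0)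
    (hv : v ≠ 0) (hvz : D.mark v ∈ D.compAt (D.mark z)) : v = z ∨ v = s.1 z := by
  obtain ⟨w, -, -, -, hw, -⟩ := hD.exists_partner hz
  have h1 := h.pairing.ne z hz
  rcases hw _ (h.pairing.ne_zero hz) (h.mark_mem z hz) with h2 | h2
  · exact absurd h2 h1
  · rw [h2]; exact hw v hv hvz

theorem HasInvariant.eq (h : D.HasInvariant s) (hD : D.IsDiagram) {s' : (ℤ → ℤ) × ℕ}
    (h' : D.HasInvariant s') : s = s' := by
  refine Prod.ext (funext fun z => ?_) (h.ncard.symm.trans h'.ncard)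
  by_cases hz : z = 0
  · rw [hz, h.pairing.zero, h'.pairing.zero]
  · exact (h'.eq_or_eq hD hz (h.pairing.ne_zero hz) (h.mark_mem z hz)).resolve_left
      (h.pairing.ne z hz)

theorem IsDiagram.exists_hasInvariant (hD : D.IsDiagram) :
    ∃ σ, D.HasInvariant (σ, D.circularComponents.ncard) := by
  classical
  choose w h0 hne hmem hun _ using fun z : {z : ℤ // z ≠ 0} => hD.exists_partner z.2
  obtain ⟨σ, hσ0, hσ⟩ : ∃ σ : ℤ → ℤ, σ 0 = 0 ∧ ∀ z (hz : z ≠ 0), σ z = w ⟨z, hz⟩ :=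
    ⟨fun z => if hz : z ≠ 0 then w ⟨z, hz⟩ else 0, by simp, fun z hz => dif_pos hz⟩
  refine ⟨σ, ⟨fun z => ?_, hσ0, fun z hz => ?_⟩, fun z hz => ?_, rfl⟩
  · by_cases hz : z = 0
    · simp only [hz, hσ0]
    · have hw0 : σ z ≠ 0 := by rw [hσ z hz]; exact h0 ⟨z, hz⟩
      have hm : D.mark z ∈ D.compAt (D.mark (σ z)) := by
        rw [hσ z hz]; exact compAt_symm (hmem ⟨z, hz⟩)
      rcases hun ⟨_, hw0⟩ z hz hm with h | h
      · exact absurd (h.trans (hσ z hz)).symm (hne ⟨z, hz⟩)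
      · exact (hσ _ hw0).trans h.symm
  · simp only [hσ z hz]; exact hne ⟨z, hz⟩
  · simp only [hσ z hz]; exact hmem ⟨z, hz⟩

/-- This is the reason for the labelling: the top points from right to left, followed by the bottom
points from left to right, run along the boundary of the strip, which `stripExp` unrolls onto the
real line. -/
theorem stripExp_mark (hD : 0 < D.height) : ∃ κ : ℤ → ℝ,
    (∀ z, stripExp D.height (D.mark z) = κ z) ∧ ∀ z w, z ≠ 0 → w ≠ 0 → z < w → κ z < κ w := by
  refine ⟨fun z => if 0 < z then Real.exp (Real.pi / D.height * z)
    else -Real.exp (Real.pi / D.height * (-z : ℤ)), fun z => ?_, fun z w hz hw hzw => ?_⟩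
  · unfold mark
    simp only
    split_ifs
    · rw [stripExp_bot]
    · rw [show (-(z : ℝ), D.height) = (((-z : ℤ) : ℝ), D.height) by push_cast; rfl,
        stripExp_top hD]
  · have hpos : 0 < Real.pi / D.height := div_pos Real.pi_pos hD
    simp only
    split_ifs with h1 h2 h2
    · exact Real.exp_lt_exp.2 (mul_lt_mul_of_pos_left (by exact_mod_cast hzw) hpos)
    · omega
    · exact (neg_lt_zero.2 (Real.exp_pos _)).trans (Real.exp_pos _)
    · exact neg_lt_neg (Real.exp_lt_exp.2 (mul_lt_mul_of_pos_left
        (by exact_mod_cast neg_lt_neg hzw) hpos))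

theorem HasInvariant.exists_arc (h : D.HasInvariant s) (hD : D.IsDiagram) {z : ℤ} (hz : z ≠ 0) :
    ∃ e : Icc (0 : ℝ) 1 ≃ₜ D.compAt (D.mark z),
      (e ⟨0, le_rfl, zero_le_one⟩ : ℝ × ℝ) = D.mark z ∧
      (e ⟨1, zero_le_one, le_rfl⟩ : ℝ × ℝ) = D.mark (s.1 z) := by
  obtain ⟨w, hw, hwz, hwm, -, e, h0, h1⟩ := hD.exists_partner hz
  obtain rfl := (h.eq_or_eq hD hz hw hwm).resolve_left hwz
  exact ⟨e, h0, h1⟩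

theorem HasInvariant.joinedIn (h : D.HasInvariant s) (hD : D.IsDiagram) {z : ℤ} (hz : z ≠ 0) :
    JoinedIn (D.compAt (D.mark z)) (D.mark z) (D.mark (s.1 z)) := by
  obtain ⟨e, h0, h1⟩ := h.exists_arc hD hz
  exact ⟨⟨⟨fun t => e t, continuous_subtype_val.comp e.continuous⟩, h0, h1⟩,
    fun t => Subtype.coe_prop _⟩

/-- Two threads with interleaved ends meet by `strip_inter_nonempty`, hence are one component, which
would then have more than two marked points. -/
theorem HasInvariant.nonCrossing (h : D.HasInvariant s) (hD : D.IsDiagram) : NonCrossing s.1 := by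
  rintro x y ⟨h1, h2, h3⟩
  have hx : x ≠ 0 := by
    rintro rfl; rw [h.pairing.zero] at h2; omega
  have hy : y ≠ 0 := by
    rintro rfl; rw [h.pairing.zero] at h3; omega
  obtain ⟨κ, k1, k2⟩ := stripExp_mark hD.height_pos
  have hs : ∀ z, ∀ p ∈ D.compAt (D.mark z), 0 ≤ p.2 ∧ p.2 ≤ D.height := fun z p hp =>
    (hD.subset_strip (compAt_subset _ hp)).2
  have hx' := h.pairing.ne_zero hx
  have hy' := h.pairing.ne_zero hy
  obtain ⟨p, hp, hp'⟩ := strip_inter_nonempty hD.height_pos (hs x) (hs y) (k1 x) (k1 y)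
    (k1 (s.1 x)) (k1 (s.1 y)) (k2 _ _ hx hy h1) (k2 _ _ hy hx' h2) (k2 _ _ hx' hy' h3)
    (h.joinedIn hD hx) (h.joinedIn hD hy)
  have hinv := h.pairing.invol y
  have := h.eq_or_eq hD hy hx (by
    rw [← compAt_eq hp', compAt_eq hp]; exact mem_compAt (hD.mark_mem hx))
  rcases this with h | h
  · omega
  · rw [h, hinv] at h2; omega

theorem HasInvariant.exists_arc_homeomorph {D E : PlaneSet} (h : D.HasInvariant s)
    (hD : D.IsDiagram) (h' : E.HasInvariant s) (hE : E.IsDiagram) {z : ℤ} (hz : z ≠ 0) :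
    ∃ f : D.compAt (D.mark z) ≃ₜ E.compAt (E.mark z), ∀ v, v ≠ 0 →
      ∀ hv : D.mark v ∈ D.compAt (D.mark z), (f ⟨D.mark v, hv⟩ : ℝ × ℝ) = E.mark v := by
  obtain ⟨e1, h10, h11⟩ := h.exists_arc hD hz
  obtain ⟨e2, h20, h21⟩ := h'.exists_arc hE hz
  refine ⟨e1.symm.trans e2, fun v hv hvm => ?_⟩
  rw [Homeomorph.trans_apply]
  rcases h.eq_or_eq hD hz hv hvm with rfl | rfl
  · refine Eq.trans (congrArg (fun u => (e2 u : ℝ × ℝ)) ?_) h20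
    rw [e1.symm_apply_eq]; exact Subtype.ext h10.symm
  · refine Eq.trans (congrArg (fun u => (e2 u : ℝ × ℝ)) ?_) h21
    rw [e1.symm_apply_eq]; exact Subtype.ext h11.symm

/-- Threads starting at the same label end at the same label and are matched as intervals. The
circles are equal in number and are matched arbitrarily. As components are open, the pieces fit
together. -/
theorem HasInvariant.kEquiv {D E : PlaneSet} (hDf : D.IsFrieze) (hEf : E.IsFrieze)
    (h : D.HasInvariant s) (h' : E.HasInvariant s) : D.KEquiv E := by
  have hD := hDf.isDiagram
  have hE := hEf.isDiagram
  obtain ⟨eD⟩ : Nonempty (D.circularComponents ≃ Fin s.2) := by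
    have := hDf.finite_circular.to_subtype
    exact ⟨Finite.equivFinOfCardEq h.ncard⟩
  obtain ⟨eE⟩ : Nonempty (E.circularComponents ≃ Fin s.2) := by
    have := hEf.finite_circular.to_subtype
    exact ⟨Finite.equivFinOfCardEq h'.ncard⟩
  -- Each thread is indexed once, by the smaller of its two labels.
  let ι := {z : ℤ // z ≠ 0 ∧ z < s.1 z} ⊕ Fin s.2
  let P (D : PlaneSet) (e : D.circularComponents ≃ Fin s.2) : ι → Set (ℝ × ℝ) :=
    Sum.elim (fun z => D.compAt (D.mark z)) (fun m => e.symm m)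
  have hPc : ∀ {D : PlaneSet} (hD : D.IsDiagram) (e : D.circularComponents ≃ Fin s.2) i,
      P D e i ∈ D.components := by
    rintro D hD e (z | m)
    · exact compAt_mem_components (hD.mark_mem z.2.1)
    · exact (e.symm m).2.1
  have hPo : ∀ {D : PlaneSet} (hD : D.IsDiagram) (e : D.circularComponents ≃ Fin s.2) i,
      IsOpen (Subtype.val ⁻¹' P D e i : Set D.carrier) :=
    fun hD e i => (hD.isRelClopen (hPc hD e i)).isClopen.2
  have hPd : ∀ {D : PlaneSet} (hD : D.IsDiagram) (_ : D.HasInvariant s)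
      (e : D.circularComponents ≃ Fin s.2) i j x, x ∈ P D e i → x ∈ P D e j → i = j := by
    intro D hD h e i j x hi hj
    have heq := components_eq (hPc hD e i) (hPc hD e j) hi hj
    rcases i with z | m <;> rcases j with w | k
    · have := h.eq_or_eq hD w.2.1 z.2.1 (by
        rw [show D.compAt (D.mark w) = D.compAt (D.mark z) from heq.symm]
        exact mem_compAt (hD.mark_mem z.2.1))
      rcases this with h1 | h1
      · rw [Subtype.ext h1]
      · have h2 := z.2.2
        have h3 := w.2.2
        rw [h1, h.pairing.invol] at h2
        omega
    · have := ((hD.mem_circularComponents_iff).1 (e.symm k).2).2 z z.2.1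
      exact absurd (heq.subset (mem_compAt (hD.mark_mem z.2.1))) this
    · have := ((hD.mem_circularComponents_iff).1 (e.symm m).2).2 w w.2.1
      exact absurd (heq.symm.subset (mem_compAt (hD.mark_mem w.2.1))) this
    · exact congrArg Sum.inr (e.symm.injective (Subtype.ext heq))
  have hPcov : ∀ {D : PlaneSet} (hD : D.IsDiagram) (_ : D.HasInvariant s)
      (e : D.circularComponents ≃ Fin s.2) (x : D.carrier), ∃ i, (x : ℝ × ℝ) ∈ P D e i := by
    intro D hD h e x
    have hx := mem_compAt x.2
    rcases hD.mem_threads_or_circular (compAt_mem_components x.2) with ht | hc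
    · obtain ⟨z, hz, hze⟩ := hD.mem_threads_iff.1 ht
      rw [hze] at hx
      rcases lt_or_gt_of_ne (h.pairing.ne z hz) with h1 | h1
      · refine ⟨Sum.inl ⟨s.1 z, h.pairing.ne_zero hz, by rwa [h.pairing.invol]⟩, ?_⟩
        change _ ∈ D.compAt _
        rw [compAt_eq (h.mark_mem z hz)]
        exact hx
      · exact ⟨Sum.inl ⟨z, hz, h1⟩, hx⟩
    · refine ⟨Sum.inr (e ⟨_, hc⟩), ?_⟩
      change _ ∈ ((e.symm (e ⟨_, hc⟩) : D.circularComponents) : Set (ℝ × ℝ))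
      rw [e.symm_apply_apply]
      exact hx
  have hom : ∀ i, ∃ f : P D eD i ≃ₜ P E eE i, ∀ z, z ≠ 0 → ∀ hz : D.mark z ∈ P D eD i,
      (f ⟨D.mark z, hz⟩ : ℝ × ℝ) = E.mark z := by
    rintro (z | m)
    · exact h.exists_arc_homeomorph hD h' hE z.2.1
    · obtain ⟨f1⟩ := (eD.symm m).2.2
      obtain ⟨f2⟩ := (eE.symm m).2.2
      refine ⟨f1.trans f2.symm, fun v hv hvm => ?_⟩
      exact absurd hvm (((hD.mem_circularComponents_iff).1 (eD.symm m).2).2 v hv)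
  choose g hg using hom
  have emb : ∀ {D : PlaneSet} (hD : D.IsDiagram) (e : D.circularComponents ≃ Fin s.2) i,
      ∃ f : (Subtype.val ⁻¹' P D e i : Set D.carrier) ≃ₜ P D e i,
        ∀ x, (f x : ℝ × ℝ) = x := by
    intro D hD e i
    have hsub := components_subset (hPc hD e i)
    exact ⟨⟨⟨fun x => ⟨x, x.2⟩, fun x => ⟨⟨x, hsub x.2⟩, x.2⟩, fun x => rfl, fun x => rfl⟩,
      by fun_prop, by fun_prop⟩, fun x => rfl⟩
  choose e1 he1 using emb hD eD
  choose e2 he2 using emb hE eE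
  obtain ⟨f, hf⟩ := exists_homeomorph_of_pieces (hPo hD eD) (hPo hE eE)
    (fun i j x => hPd hD h eD i j x) (fun i j x => hPd hE h' eE i j x)
    (hPcov hD h eD) (hPcov hE h' eE) (fun i => ((e1 i).trans (g i)).trans (e2 i).symm)
  have hfm : ∀ z, z ≠ 0 → ∀ p : D.carrier, (p : ℝ × ℝ) = D.mark z → (f p : ℝ × ℝ) = E.mark z := by
    rintro z hz ⟨p, hp⟩ rfl
    obtain ⟨i, hi⟩ := hPcov hD h eD ⟨_, hp⟩
    rw [hf i _ hi, ← hg i z hz hi, ← he2]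
    simp only [Homeomorph.trans_apply, Homeomorph.apply_symm_apply]
    congr 2
    exact Subtype.ext (he1 i _)
  refine ⟨f, fun i hi p => ⟨fun hp => ?_, fun hp => ?_⟩⟩
  · rw [← E.mark_natCast hi]
    exact hfm i (by omega) p (by rw [hp, D.mark_natCast hi])
  · rw [← E.mark_neg_natCast hi]
    exact hfm (-i) (by omega) p (by rw [hp, D.mark_neg_natCast hi])

/-- A homeomorphism induces the bijection `F` of components. It respects the marked points they
contain, so partners stay partners, and components without marked points, the circles, correspond.
-/
theorem KEquiv.hasInvariant {D E : PlaneSet} (hD : D.IsDiagram) (hE : E.IsDiagram)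
    (hDE : D.KEquiv E) (h : D.HasInvariant s) : E.HasInvariant s := by
  obtain ⟨f, hf⟩ := hDE
  have hfm : ∀ z, z ≠ 0 → ∀ p : D.carrier, (p : ℝ × ℝ) = D.mark z → (f p : ℝ × ℝ) = E.mark z := by
    intro z hz p hp
    obtain ⟨i, hi, rfl | rfl⟩ := int_cases hz
    · rw [E.mark_natCast hi]; exact (hf i hi p).1 (by rw [hp, D.mark_natCast hi])
    · rw [E.mark_neg_natCast hi]; exact (hf i hi p).2 (by rw [hp, D.mark_neg_natCast hi])
  let F : Set (ℝ × ℝ) → Set (ℝ × ℝ) := fun T => Subtype.val '' (f '' (Subtype.val ⁻¹' T))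
  have hF : ∀ p : D.carrier, F (D.compAt p) = E.compAt (f p) := fun p => by
    simp only [F, compAt]
    rw [connectedComponentIn_eq_image p.2, connectedComponentIn_eq_image (f p).2,
      preimage_image_eq _ Subtype.val_injective]
    congr 1
    exact f.continuous.image_connectedComponent_subset _ |>.antisymm (by
      have := f.symm.continuous.image_connectedComponent_subset (f p)
      rw [f.symm_apply_apply] at this
      intro y hy
      exact ⟨f.symm y, this ⟨y, hy, rfl⟩, f.apply_symm_apply y⟩)
  have hFm : ∀ (T : Set (ℝ × ℝ)) z, z ≠ 0 → (E.mark z ∈ F T ↔ D.mark z ∈ T) := by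
    intro T z hz
    constructor
    · rintro ⟨_, ⟨p, hp, rfl⟩, hpz⟩
      have : f p = f ⟨D.mark z, hD.mark_mem hz⟩ := Subtype.ext (by
        rw [hpz, hfm z hz _ rfl])
      rw [f.injective this] at hp
      exact hp
    · intro hz'
      exact ⟨_, ⟨⟨D.mark z, hD.mark_mem hz⟩, hz', rfl⟩, hfm z hz _ rfl⟩
  refine ⟨h.pairing, fun z hz => ?_, ?_⟩
  · have := (hFm _ _ (h.pairing.ne_zero hz)).2 (h.mark_mem z hz)
    rwa [hF ⟨_, hD.mark_mem hz⟩, hfm z hz _ rfl] at this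
  · rw [← h.ncard]
    have himg : E.circularComponents = F '' D.circularComponents := by
      ext S
      rw [hE.mem_circularComponents_iff]
      constructor
      · rintro ⟨⟨q, hq, rfl⟩, hS⟩
        have hFq : F (D.compAt (f.symm ⟨q, hq⟩)) = E.compAt q := by
          rw [hF, f.apply_symm_apply]
        refine ⟨D.compAt (f.symm ⟨q, hq⟩), hD.mem_circularComponents_iff.2
          ⟨compAt_mem_components (Subtype.coe_prop _), fun z hz hzm => hS z hz ?_⟩, hFq⟩
        change _ ∈ E.compAt q
        rw [← hFq]
        exact (hFm _ z hz).2 hzm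
      · rintro ⟨T, hT, rfl⟩
        obtain ⟨⟨p, hp, rfl⟩, hTm⟩ := hD.mem_circularComponents_iff.1 hT
        refine ⟨?_, fun z hz hzm => hTm z hz ((hFm _ z hz).1 hzm)⟩
        have := hF ⟨p, hp⟩
        exact ⟨f ⟨p, hp⟩, Subtype.coe_prop _, this⟩
    rw [himg]
    refine InjOn.ncard_image fun S hS T hT hST => ?_
    have h1 := f.injective.image_injective (Subtype.val_injective.image_injective hST)
    have h2 : ∀ T ∈ D.circularComponents, T = Subtype.val '' (Subtype.val ⁻¹' T : Set D.carrier) :=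
      fun T hT => by
        rw [Subtype.image_preimage_coe, inter_eq_right.2 (components_subset hT.1)]
    rw [h2 S hS, h2 T hT, h1]

end PlaneSet

/-! ### Recognising `n`-friezes; diagrams given by arcs and circles. -/

namespace PlaneSet

variable {D : PlaneSet} {s : (ℤ → ℤ) × ℕ} {n : ℕ}

/-- Components are disjoint non-empty open subsets of a separable space. -/
theorem IsDiagram.countable_components (hD : D.IsDiagram) : D.components.Countable := by
  refine PairwiseDisjoint.countable_of_isOpen
    (s := fun T : Set (ℝ × ℝ) => (Subtype.val ⁻¹' T : Set D.carrier)) ?_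
    (fun T hT => (hD.isRelClopen hT).isClopen.2) fun T hT => ?_
  · intro S hS T hT hST
    refine disjoint_left.2 fun p hp hp' => hST (components_eq hS hT hp hp')
  · obtain ⟨p, hp⟩ := components_nonempty hT
    exact ⟨⟨p, components_subset hT hp⟩, hp⟩

theorem IsNFrieze.isDiagram (h : D.IsNFrieze n) : D.IsDiagram := h.toIsOmegaDiagram.isDiagram

theorem IsNFrieze.mark_mem (h : D.IsNFrieze n) {k : ℕ} (hk : n + 1 ≤ k) :
    D.mark (-k) ∈ D.compAt (D.mark k) := by
  obtain ⟨T, hT, h1, h2⟩ := h.vertical k hk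
  have hk1 : 1 ≤ k := by omega
  rw [D.mark_natCast hk1, D.mark_neg_natCast hk1, ← eq_compAt hT.1 h1]
  exact h2

theorem HasInvariant.pairingLevel (h : D.HasInvariant s) (hD : D.IsDiagram)
    (hv : ∀ k : ℕ, n + 1 ≤ k → D.mark (-k) ∈ D.compAt (D.mark k)) : PairingLevel n s.1 := by
  have key : ∀ k : ℕ, n + 1 ≤ k → s.1 k = -k := fun k hk =>
    ((h.eq_or_eq hD (by omega) (by omega) (hv k hk)).resolve_left (by omega)).symm
  intro z hz
  rcases le_total 0 z with h0 | h0
  · lift z to ℕ using h0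
    rw [abs_of_nonneg (by positivity)] at hz
    exact key z (by omega)
  · rw [abs_of_nonpos h0] at hz
    obtain ⟨k, rfl⟩ : ∃ k : ℕ, z = -k := ⟨z.natAbs, by omega⟩
    rw [← key k (by omega), h.pairing.invol, key k (by omega), neg_neg]

theorem IsNFrieze.exists_hasInvariant (h : D.IsNFrieze n) : ∃ s : (ℤ → ℤ) × ℕ,
    D.HasInvariant s ∧ IsPairing s.1 ∧ NonCrossing s.1 ∧ PairingLevel n s.1 := by
  obtain ⟨σ, hσ⟩ := h.isDiagram.exists_hasInvariant
  exact ⟨_, hσ, hσ.pairing, hσ.nonCrossing h.isDiagram,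
    hσ.pairingLevel h.isDiagram fun k => h.mark_mem⟩

/-- The other requirements are automatic. Cups and caps are not vertical and hence start at labels
between `-n` and `n`; the vertical threads already provide infinitely many components. -/
theorem IsDiagram.isNFrieze (hD : D.IsDiagram)
    (hv : ∀ k : ℕ, n + 1 ≤ k → D.mark (-k) ∈ D.compAt (D.mark k))
    (hfin : D.circularComponents.Finite)
    (hno : ∀ k : ℕ, n + 2 ≤ k → ∀ S ∈ D.circularComponents,
      ¬ S ⊆ D.regionAt ((k : ℝ) - 1 / 2, 0)) : D.IsNFrieze n := by
  obtain ⟨σ, hσ⟩ := hD.exists_hasInvariant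
  have hl : PairingLevel n σ := hσ.pairingLevel hD hv
  have harc : ∀ T ∈ D.threads, ∀ z w : ℤ, z ≠ 0 → w ≠ 0 → z ≠ w → z ≠ -w → D.mark z ∈ T →
      D.mark w ∈ T → T ∈ (fun z => D.compAt (D.mark z)) '' Icc (-n : ℤ) n := by
    intro T hT z w hz hw hzw hzw' h1 h2
    rw [eq_compAt hT.1 h1] at h2
    have h3 : w = σ z := (hσ.eq_or_eq hD hz hw h2).resolve_left hzw.symm
    refine ⟨z, ?_, (eq_compAt hT.1 h1).symm⟩
    by_contra hzn
    rw [mem_Icc, ← abs_le, not_le] at hzn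
    rw [hl z hzn] at h3
    omega
  refine ⟨⟨⟨hD.height_pos, hD.subset_strip, hD.inter_top, hD.inter_bot, hD.manifold, hD.boundary,
    hD.compact_components, hD.countable_components, ?_⟩, ?_, ?_, hfin⟩, fun k hk => ?_, hno⟩
  · refine infinite_of_injective_forall_mem (f := fun k : ℕ => D.compAt (D.mark ((n + 1 + k : ℕ))))
      (fun k l hkl => ?_) fun k => compAt_mem_components (hD.mark_mem (by omega))
    have h1 := hσ.eq_or_eq hD (z := ((n + 1 + l : ℕ) : ℤ)) (v := ((n + 1 + k : ℕ) : ℤ))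
      (by omega) (by omega) (by
        rw [← show D.compAt _ = D.compAt _ from hkl]
        exact mem_compAt (hD.mark_mem (by omega)))
    have h2 := hl ((n + 1 + l : ℕ) : ℤ) (by rw [abs_of_nonneg] <;> omega)
    simp only [h2] at h1
    omega
  · refine ((finite_Icc (-n : ℤ) n).image fun z => D.compAt (D.mark z)).subset ?_
    rintro T ⟨hT, i, j, hi, hj, hij, h1, h2⟩
    rw [← D.mark_neg_natCast hi] at h1
    rw [← D.mark_neg_natCast hj] at h2
    exact harc T hT _ _ (by omega) (by omega) (by omega) (by omega) h1 h2
  · refine ((finite_Icc (-n : ℤ) n).image fun z => D.compAt (D.mark z)).subset ?_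
    rintro T ⟨hT, i, j, hi, hj, hij, h1, h2⟩
    rw [← D.mark_natCast hi] at h1
    rw [← D.mark_natCast hj] at h2
    exact harc T hT _ _ (by omega) (by omega) (by omega) (by omega) h1 h2
  · have hk1 : 1 ≤ k := by omega
    have hk0 : (k : ℤ) ≠ 0 := by omega
    refine ⟨_, hD.compAt_mark_mem_threads hk0, ?_, ?_⟩
    · rw [← D.mark_natCast hk1]; exact mem_compAt (hD.mark_mem hk0)
    · rw [← D.mark_neg_natCast hk1]; exact hv k hk

/-! ### Diagrams given as disjoint unions of arcs and circles -/

/-- A decomposition of a planar set into separated arcs and circles. -/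
structure IsPieces {ι : Type*} (D : PlaneSet) (P U : ι → Set (ℝ × ℝ)) : Prop where
  height_pos : 0 < D.height
  subset_strip : D.carrier ⊆ strip D.height
  inter_top : D.carrier ∩ {p | 0 ≤ p.1 ∧ p.2 = D.height} = D.topPts
  inter_bot : D.carrier ∩ {p | 0 ≤ p.1 ∧ p.2 = 0} = botPts
  cover : ∀ p ∈ D.carrier, ∃ i, p ∈ P i
  subset : ∀ i, P i ⊆ D.carrier
  isOpen : ∀ i, IsOpen (U i)
  subset_nhd : ∀ i, P i ⊆ U i
  separated : ∀ i j p, p ∈ P i → p ∈ U j → i = j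
  arc_or_circle : ∀ i,
    (∃ (e : Icc (0 : ℝ) 1 ≃ₜ P i) (z w : ℤ), z ≠ 0 ∧ w ≠ 0 ∧
      (e ⟨0, le_rfl, zero_le_one⟩ : ℝ × ℝ) = D.mark z ∧
      (e ⟨1, zero_le_one, le_rfl⟩ : ℝ × ℝ) = D.mark w ∧
      ∀ v, v ≠ 0 → D.mark v ∈ P i → v = z ∨ v = w) ∨
    (Nonempty (Circle ≃ₜ P i) ∧ ∀ v, v ≠ 0 → D.mark v ∉ P i)

variable {ι : Type*} {P U : ι → Set (ℝ × ℝ)}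

/-- On the carrier, `U i` cuts out exactly the piece `P i`, and the union of the other
neighbourhoods cuts out the rest. -/
theorem IsPieces.isRelClopen (h : D.IsPieces P U) (i : ι) : IsRelClopen (P i) D.carrier := by
  have := isRelClopen_of_isOpen (F := D.carrier) (h.isOpen i)
    (isOpen_biUnion (s := {j | j ≠ i}) fun j _ => h.isOpen j) (fun p hp => ?_) ?_
  · rwa [show D.carrier ∩ U i = P i from ?_] at this
    ext p
    refine ⟨fun ⟨hp, hpi⟩ => ?_, fun hp => ⟨h.subset i hp, h.subset_nhd i hp⟩⟩
    obtain ⟨j, hj⟩ := h.cover p hp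
    rwa [h.separated j i p hj hpi] at hj
  · obtain ⟨j, hj⟩ := h.cover p hp
    by_cases hji : j = i
    · exact Or.inl (h.subset_nhd i (hji ▸ hj))
    · exact Or.inr (mem_biUnion hji (h.subset_nhd j hj))
  · ext p
    simp only [mem_inter_iff, mem_iUnion, mem_empty_iff_false, iff_false]
    rintro ⟨hp, hpi, k, hki, hpk⟩
    obtain ⟨j, hj⟩ := h.cover p hp
    exact hki ((h.separated j k p hj hpk).symm.trans (h.separated j i p hj hpi))

theorem IsPieces.isPreconnected (h : D.IsPieces P U) (i : ι) : IsPreconnected (P i) := by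
  rw [← Subtype.range_coe (s := P i)]
  rcases h.arc_or_circle i with ⟨e, -⟩ | ⟨⟨e⟩, -⟩
  · have : PreconnectedSpace (Icc (0 : ℝ) 1) := Subtype.preconnectedSpace isPreconnected_Icc
    rw [show range (Subtype.val : P i → ℝ × ℝ) = range (Subtype.val ∘ e) from
      (e.surjective.range_comp _).symm]
    exact isPreconnected_range (continuous_subtype_val.comp e.continuous)
  · have : PreconnectedSpace Circle := by
      have : IsPreconnected (range Circle.exp) := isPreconnected_range Circle.exp.continuous
      rw [Circle.exp_surjective.range_eq] at this
      exact ⟨this⟩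
    rw [show range (Subtype.val : P i → ℝ × ℝ) = range (Subtype.val ∘ e) from
      (e.surjective.range_comp _).symm]
    exact isPreconnected_range (continuous_subtype_val.comp e.continuous)

theorem IsPieces.isCompact (h : D.IsPieces P U) (i : ι) : IsCompact (P i) := by
  rw [isCompact_iff_compactSpace]
  rcases h.arc_or_circle i with ⟨e, -⟩ | ⟨⟨e⟩, -⟩ <;> exact e.compactSpace

theorem IsPieces.compAt_eq (h : D.IsPieces P U) {i : ι} {p : ℝ × ℝ} (hp : p ∈ P i) :
    D.compAt p = P i := by
  have hp' := h.subset i hp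
  exact ((h.isRelClopen i).subset_of_isPreconnected isPreconnected_connectedComponentIn
    (compAt_subset p) ⟨p, mem_compAt hp', hp⟩).antisymm
    ((h.isPreconnected i).subset_connectedComponentIn hp (h.subset i))

theorem IsPieces.isDiagram (h : D.IsPieces P U) : D.IsDiagram := by
  have key : ∀ p : D.carrier, (IsInteriorPoint p ∧ ¬ ∃ z, z ≠ 0 ∧ (p : ℝ × ℝ) = D.mark z) ∨
      (IsBoundaryPoint p ∧ ∃ z, z ≠ 0 ∧ (p : ℝ × ℝ) = D.mark z) := by
    intro p
    obtain ⟨i, hi⟩ := h.cover p p.2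
    have hemb := (h.isRelClopen i).isOpenEmbedding
    have hp : inclusion (h.isRelClopen i).1 ⟨p, hi⟩ = p := rfl
    rcases h.arc_or_circle i with ⟨e, z, w, hz, hw, h0, h1, hv⟩ | ⟨⟨e⟩, hv⟩
    · have hemb' := hemb.comp e.isOpenEmbedding
      obtain ⟨u, hu⟩ := e.surjective ⟨p, hi⟩
      have hu' : (inclusion (h.isRelClopen i).1 ∘ e) u = p := by
        rw [Function.comp_apply, hu, hp]
      by_cases hu0 : (u : ℝ) = 0 ∨ (u : ℝ) = 1
      · right
        refine ⟨hu' ▸ ((isBoundaryPoint_Icc_iff u).2 hu0).map hemb', ?_⟩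
        rcases hu0 with hu0 | hu0
        · rw [show u = ⟨0, le_rfl, zero_le_one⟩ from Subtype.ext hu0] at hu
          rw [hu] at h0
          exact ⟨z, hz, h0⟩
        · rw [show u = ⟨1, zero_le_one, le_rfl⟩ from Subtype.ext hu0] at hu
          rw [hu] at h1
          exact ⟨w, hw, h1⟩
      · left
        push Not at hu0
        refine ⟨hu' ▸ (isInteriorPoint_Icc hu0.1 hu0.2).map hemb', ?_⟩
        rintro ⟨v, hv0, hvp⟩
        rcases hv v hv0 (hvp ▸ hi) with rfl | rfl
        · have := e.injective (hu.trans (Subtype.ext (hvp.trans h0.symm)))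
          exact hu0.1 (congrArg Subtype.val this)
        · have := e.injective (hu.trans (Subtype.ext (hvp.trans h1.symm)))
          exact hu0.2 (congrArg Subtype.val this)
    · left
      have hemb' := hemb.comp e.isOpenEmbedding
      obtain ⟨u, hu⟩ := e.surjective ⟨p, hi⟩
      have hu' : (inclusion (h.isRelClopen i).1 ∘ e) u = p := by
        rw [Function.comp_apply, hu, hp]
      refine ⟨hu' ▸ (isInteriorPoint_circle u).map hemb', ?_⟩
      rintro ⟨v, hv0, hvp⟩
      exact hv v hv0 (hvp ▸ hi)
  refine ⟨h.height_pos, h.subset_strip, h.inter_top, h.inter_bot,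
    fun p => (key p).imp And.left And.left, fun p => ?_, ?_⟩
  · rw [D.mem_marks_iff]
    rcases key p with ⟨h1, h2⟩ | ⟨h1, h2⟩
    · exact ⟨fun hb => absurd hb h1.not_isBoundaryPoint, fun hm => absurd hm h2⟩
    · exact ⟨fun _ => h2, fun _ => h1⟩
  · rintro _ ⟨p, hp, rfl⟩
    obtain ⟨i, hi⟩ := h.cover p hp
    rw [show connectedComponentIn D.carrier p = P i from h.compAt_eq hi]
    exact h.isCompact i

theorem IsPieces.mem_components_iff (h : D.IsPieces P U) {S : Set (ℝ × ℝ)} :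
    S ∈ D.components ↔ ∃ i, S = P i := by
  constructor
  · rintro ⟨p, hp, rfl⟩
    obtain ⟨i, hi⟩ := h.cover p hp
    exact ⟨i, h.compAt_eq hi⟩
  · rintro ⟨i, rfl⟩
    have hne : Nonempty (P i) := by
      rcases h.arc_or_circle i with ⟨e, -⟩ | ⟨⟨e⟩, -⟩
      · exact ⟨e ⟨0, le_rfl, zero_le_one⟩⟩
      · exact ⟨e 1⟩
    obtain ⟨p, hp⟩ := hne
    exact ⟨p, h.subset i hp, (h.compAt_eq hp).symm⟩

/-- A continuous injective map from a compact space is a homeomorphism onto its image. -/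
theorem exists_homeomorph_of_injective {X Y : Type*} [TopologicalSpace X] [CompactSpace X]
    [TopologicalSpace Y] [T2Space Y] {f : X → Y} (hf : Continuous f) (hi : Function.Injective f)
    {S : Set Y} (hS : range f = S) : ∃ e : X ≃ₜ S, ∀ x, (e x : Y) = f x := by
  subst hS
  exact ⟨(hf.isClosedEmbedding hi).isEmbedding.toHomeomorph, fun x => rfl⟩

end PlaneSet

/-! ### Vertical segments; the unit and the circular frieze. -/

namespace PlaneSet

theorem mark_cases (D : PlaneSet) {z : ℤ} (hz : z ≠ 0) : ∃ i : ℕ, 1 ≤ i ∧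
    ((z = i ∧ D.mark z = (↑i, 0)) ∨ (z = -i ∧ D.mark z = (↑i, D.height))) := by
  obtain ⟨i, hi, rfl | rfl⟩ := int_cases hz
  · exact ⟨i, hi, Or.inl ⟨rfl, D.mark_natCast hi⟩⟩
  · exact ⟨i, hi, Or.inr ⟨rfl, D.mark_neg_natCast hi⟩⟩

/-- The vertical segment over `(i,0)` of height `a`. -/
def verticalSegment (a : ℝ) (i : ℕ) : Set (ℝ × ℝ) := {p | p.1 = i ∧ 0 ≤ p.2 ∧ p.2 ≤ a}

theorem verticalSegment_arc {D : PlaneSet} (hD : 0 < D.height) {i : ℕ} (hi : 1 ≤ i) :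
    ∃ (e : Icc (0 : ℝ) 1 ≃ₜ verticalSegment D.height i) (z w : ℤ), z ≠ 0 ∧ w ≠ 0 ∧
      (e ⟨0, le_rfl, zero_le_one⟩ : ℝ × ℝ) = D.mark z ∧
      (e ⟨1, zero_le_one, le_rfl⟩ : ℝ × ℝ) = D.mark w ∧
      ∀ v, v ≠ 0 → D.mark v ∈ verticalSegment D.height i → v = z ∨ v = w := by
  obtain ⟨e, he⟩ := exists_homeomorph_of_injective
    (f := fun u : Icc (0 : ℝ) 1 => ((i : ℝ), D.height * (u : ℝ))) (by fun_prop)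
    (fun u v huv => Subtype.ext (mul_left_cancel₀ hD.ne' (congrArg Prod.snd huv)))
    (S := verticalSegment D.height i) (by
      ext ⟨x, y⟩
      constructor
      · rintro ⟨u, hu⟩
        obtain ⟨rfl, rfl⟩ := Prod.mk.injEq .. ▸ hu
        exact ⟨rfl, mul_nonneg hD.le u.2.1, mul_le_of_le_one_right hD.le u.2.2⟩
      · rintro ⟨h1, h2, h3⟩
        simp only at h1 h2 h3
        exact ⟨⟨y / D.height, div_nonneg h2 hD.le, (div_le_one hD).2 h3⟩,
          Prod.ext h1.symm (mul_div_cancel₀ y hD.ne')⟩)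
  refine ⟨e, i, -i, by omega, by omega, ?_, ?_, fun v hv hm => ?_⟩
  · rw [he, D.mark_natCast hi]; simp [botPt]
  · rw [he, D.mark_neg_natCast hi]; simp [topPt]
  · obtain ⟨j, hj, ⟨rfl, h⟩ | ⟨rfl, h⟩⟩ := D.mark_cases hv <;> rw [h] at hm <;>
      have hji : j = i := Nat.cast_injective (R := ℝ) hm.1
    · exact Or.inl (by rw [hji])
    · exact Or.inr (by rw [hji])

theorem natCast_eq_of_abs_sub_lt {i j : ℕ} {x : ℝ} (h : x = i) (h' : |x - j| < 1 / 8) : i = j := by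
  subst h
  rw [abs_lt] at h'
  have h1 : (i : ℝ) < j + 1 := by linarith
  have h2 : (j : ℝ) < i + 1 := by linarith
  have h1' : i < j + 1 := by exact_mod_cast h1
  have h2' : j < i + 1 := by exact_mod_cast h2
  omega

theorem isOpen_abs_sub_lt (c r : ℝ) : IsOpen {p : ℝ × ℝ | |p.1 - c| < r} :=
  isOpen_lt (by fun_prop) (by fun_prop)

theorem mem_verticalSegment_mark {D : PlaneSet} (hD : 0 < D.height) {z : ℤ} {i : ℕ} (hi : 1 ≤ i)
    (h : z = i ∨ z = -i) : D.mark z ∈ verticalSegment D.height i := by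
  rcases h with rfl | rfl
  · rw [D.mark_natCast hi]; exact ⟨rfl, le_rfl, hD.le⟩
  · rw [D.mark_neg_natCast hi]; exact ⟨rfl, hD.le, le_rfl⟩

/-! ### The unit frieze -/

theorem unit_isPieces : unit.IsPieces (fun i : {i : ℕ // 1 ≤ i} => verticalSegment 1 i)
    (fun i => {p | |p.1 - i| < 1 / 8}) where
  height_pos := one_pos
  subset_strip := by
    rintro p ⟨⟨i, -, hi⟩, h0, h1⟩
    exact ⟨by rw [hi]; positivity, h0, h1⟩
  inter_top := by
    ext ⟨x, y⟩
    constructor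
    · rintro ⟨⟨⟨i, hi, hx⟩, -, -⟩, -, hy⟩
      exact ⟨i, hi, Prod.ext hx hy⟩
    · rintro ⟨i, hi, h⟩
      rw [h]
      exact ⟨⟨⟨i, hi, rfl⟩, zero_le_one, le_rfl⟩, by simp [topPt], rfl⟩
  inter_bot := by
    ext ⟨x, y⟩
    constructor
    · rintro ⟨⟨⟨i, hi, hx⟩, -, -⟩, -, hy⟩
      exact ⟨i, hi, Prod.ext hx hy⟩
    · rintro ⟨i, hi, h⟩
      rw [h]
      exact ⟨⟨⟨i, hi, rfl⟩, le_rfl, zero_le_one⟩, by simp [botPt], rfl⟩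
  cover := by
    rintro p ⟨⟨i, hi, hx⟩, h⟩
    exact ⟨⟨i, hi⟩, hx, h⟩
  subset := by
    rintro ⟨i, hi⟩ p ⟨hx, h⟩
    exact ⟨⟨i, hi, hx⟩, h⟩
  isOpen := fun i => isOpen_abs_sub_lt _ _
  subset_nhd := by
    rintro ⟨i, hi⟩ p ⟨hx, h⟩
    simp [hx]
  separated := by
    rintro ⟨i, hi⟩ ⟨j, hj⟩ p ⟨hx, h⟩ hp
    exact Subtype.ext (natCast_eq_of_abs_sub_lt hx hp)
  arc_or_circle := fun i => Or.inl (verticalSegment_arc (D := unit) one_pos i.2)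

theorem unit_circularComponents : unit.circularComponents = ∅ := by
  ext S
  rw [unit_isPieces.isDiagram.mem_circularComponents_iff, unit_isPieces.mem_components_iff]
  simp only [mem_empty_iff_false, iff_false, not_and]
  rintro ⟨i, rfl⟩ h
  exact h i (by have := i.2; omega) (mem_verticalSegment_mark (D := unit) one_pos i.2 (Or.inl rfl))

theorem unit_hasInvariant : unit.HasInvariant unitPairing where
  pairing := isPairing_unitPairing
  mark_mem := fun z hz => by
    obtain ⟨i, hi, h⟩ := int_cases hz
    rw [unit_isPieces.compAt_eq (i := ⟨i, hi⟩) (mem_verticalSegment_mark (D := unit) one_pos hi h)]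
    exact mem_verticalSegment_mark (D := unit) one_pos hi (by simp only [unitPairing]; omega)
  ncard := by rw [unit_circularComponents, ncard_empty]; rfl

theorem unit_isNFrieze (n : ℕ) : unit.IsNFrieze n := by
  refine unit_isPieces.isDiagram.isNFrieze
    (fun k hk => unit_hasInvariant.mark_mem k (by omega)) ?_ ?_ <;> rw [unit_circularComponents]
  · exact finite_empty
  · simp

/-! ### The circular frieze -/

/-- The circle of radius `1/4` with centre `(1/2,1/2)`. -/
def smallCircle : Set (ℝ × ℝ) := {p | (p.1 - 1 / 2) ^ 2 + (p.2 - 1 / 2) ^ 2 = (1 / 4) ^ 2}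

theorem nonempty_circle_homeomorph_smallCircle : Nonempty (Circle ≃ₜ smallCircle) := by
  obtain ⟨e, -⟩ := exists_homeomorph_of_injective
    (f := fun z : Circle => (1 / 2 + (z : ℂ).re / 4, 1 / 2 + (z : ℂ).im / 4)) (by fun_prop)
    (fun u v huv => by
      obtain ⟨h1, h2⟩ := Prod.mk.injEq .. ▸ huv
      exact Circle.ext (Complex.ext (by linarith) (by linarith)))
    (S := smallCircle) (by
      ext ⟨x, y⟩
      constructor
      · rintro ⟨u, hu⟩
        obtain ⟨rfl, rfl⟩ := Prod.mk.injEq .. ▸ hu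
        have : (u : ℂ).re ^ 2 + (u : ℂ).im ^ 2 = 1 := by
          have := Circle.normSq_coe u
          rw [Complex.normSq_apply] at this
          linarith
        simp only [smallCircle, mem_ofPred_eq]
        linarith
      · intro h
        simp only [smallCircle, mem_ofPred_eq] at h
        refine ⟨⟨⟨4 * (x - 1 / 2), 4 * (y - 1 / 2)⟩, ?_⟩, Prod.ext ?_ ?_⟩
        · change _ ∈ Metric.sphere (0 : ℂ) 1
          rw [mem_sphere_zero_iff_norm, ← sq_eq_sq₀ (norm_nonneg _) zero_le_one, Complex.sq_norm, Complex.normSq_mk]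
          linarith
        · simp only; ring
        · simp only; ring)
  exact ⟨e⟩

theorem smallCircle_bounds {p : ℝ × ℝ} (hp : p ∈ smallCircle) :
    1 / 4 ≤ p.1 ∧ p.1 ≤ 3 / 4 ∧ 1 / 4 ≤ p.2 ∧ p.2 ≤ 3 / 4 := by
  simp only [smallCircle, mem_ofPred_eq] at hp
  have h1 := abs_le_of_sq_le_sq' (a := p.1 - 1 / 2) (b := 1 / 4) (by nlinarith) (by norm_num)
  have h2 := abs_le_of_sq_le_sq' (a := p.2 - 1 / 2) (b := 1 / 4) (by nlinarith) (by norm_num)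
  exact ⟨by linarith, by linarith, by linarith, by linarith⟩

theorem circular_isPieces : circular.IsPieces
    (fun i : Option {i : ℕ // 1 ≤ i} => i.elim smallCircle fun i => verticalSegment 1 i)
    -- The circle has abscissae at most `3/4`, and the neighbourhood of the first thread begins at
    -- `1 - 1/8 = 7/8`.
    (fun i => i.elim {p | p.1 < 7 / 8} fun i => {p | |p.1 - i| < 1 / 8}) where
  height_pos := one_pos
  subset_strip := by
    rintro p (hp | hp)
    · exact unit_isPieces.subset_strip hp
    · obtain ⟨h1, h2, h3, h4⟩ := smallCircle_bounds hp
      exact ⟨by linarith, by linarith, h4.trans (by change (3 / 4 : ℝ) ≤ 1; norm_num)⟩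
  inter_top := by
    refine Subset.antisymm ?_ fun p hp => ?_
    · rintro p ⟨hp | hp, h⟩
      · exact unit_isPieces.inter_top.subset ⟨hp, h⟩
      · have h1 := (smallCircle_bounds hp).2.2.2
        have h2 : p.2 = 1 := h.2
        linarith
    · have := unit_isPieces.inter_top.symm.subset hp
      exact ⟨Or.inl this.1, this.2⟩
  inter_bot := by
    refine Subset.antisymm ?_ fun p hp => ?_
    · rintro p ⟨hp | hp, h⟩
      · exact unit_isPieces.inter_bot.subset ⟨hp, h⟩
      · have h1 := (smallCircle_bounds hp).2.2.1
        have h2 : p.2 = 0 := h.2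
        linarith
    · have := unit_isPieces.inter_bot.symm.subset hp
      exact ⟨Or.inl this.1, this.2⟩
  cover := by
    rintro p (hp | hp)
    · obtain ⟨i, hi⟩ := unit_isPieces.cover p hp
      exact ⟨some i, hi⟩
    · exact ⟨none, hp⟩
  subset := by
    rintro (_ | i) p hp
    · exact Or.inr hp
    · exact Or.inl (unit_isPieces.subset i hp)
  isOpen := by
    rintro (_ | i)
    · exact isOpen_lt (by fun_prop) (by fun_prop)
    · exact isOpen_abs_sub_lt _ _
  subset_nhd := by
    rintro (_ | i) p hp
    · change p.1 < 7 / 8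
      linarith [(smallCircle_bounds hp).2.1]
    · exact unit_isPieces.subset_nhd i hp
  separated := by
    rintro (_ | i) (_ | j) p hp hp'
    · rfl
    · have h1 := (smallCircle_bounds hp).2.1
      have h2 : (1 : ℝ) ≤ j := by exact_mod_cast j.2
      have h3 := (abs_lt.1 (show |p.1 - j| < 1 / 8 from hp')).1
      linarith
    · have h1 : p.1 < 7 / 8 := hp'
      have h2 : (1 : ℝ) ≤ i := by exact_mod_cast i.2
      have h3 : p.1 = i := hp.1
      linarith
    · rw [unit_isPieces.separated i j p hp hp']
  arc_or_circle := by
    rintro (_ | i)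
    · refine Or.inr ⟨nonempty_circle_homeomorph_smallCircle, fun v hv hm => ?_⟩
      have h1 := (smallCircle_bounds hm).2.1
      obtain ⟨j, hj, ⟨-, h⟩ | ⟨-, h⟩⟩ := circular.mark_cases hv <;> rw [h] at h1 <;>
        have h2 : (1 : ℝ) ≤ j := by exact_mod_cast hj
      · simp only at h1; linarith
      · simp only at h1; linarith
    · exact Or.inl (verticalSegment_arc (D := circular) one_pos i.2)

theorem circular_circularComponents : circular.circularComponents = {smallCircle} := by
  ext S
  rw [circular_isPieces.isDiagram.mem_circularComponents_iff, circular_isPieces.mem_components_iff,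
    mem_singleton_iff]
  constructor
  · rintro ⟨⟨_ | i, rfl⟩, h⟩
    · rfl
    · exact absurd (mem_verticalSegment_mark (D := circular) one_pos i.2 (Or.inl rfl))
        (h i (by have := i.2; omega))
  · rintro rfl
    refine ⟨⟨none, rfl⟩, ?_⟩
    rcases circular_isPieces.arc_or_circle none with ⟨e, -⟩ | ⟨-, h⟩
    · obtain ⟨e'⟩ := nonempty_circle_homeomorph_smallCircle
      exact absurd ⟨e.trans e'.symm⟩ not_nonempty_Icc_homeomorph_circle
    · exact h

theorem circular_hasInvariant : circular.HasInvariant (unitPairing.1, 1) where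
  pairing := isPairing_unitPairing
  mark_mem := fun z hz => by
    obtain ⟨i, hi, h⟩ := int_cases hz
    rw [circular_isPieces.compAt_eq (i := some ⟨i, hi⟩)
      (mem_verticalSegment_mark (D := circular) one_pos hi h)]
    exact mem_verticalSegment_mark (D := circular) one_pos hi (by simp only [unitPairing]; omega)
  ncard := by rw [circular_circularComponents, ncard_singleton]

theorem circular_isNFrieze (n : ℕ) : circular.IsNFrieze n := by
  have hD := circular_isPieces.isDiagram
  refine hD.isNFrieze
    (fun k hk => circular_hasInvariant.mark_mem k (by omega)) ?_ ?_ <;>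
    rw [circular_circularComponents]
  · exact finite_singleton _
  · rintro k hk S rfl hS
    have hp : ((3 / 4, 1 / 2) : ℝ × ℝ) ∈ smallCircle := by
      simp only [smallCircle, mem_ofPred_eq]; norm_num
    have hk2 : (2 : ℝ) ≤ k := by
      have : 2 ≤ k := by omega
      exact_mod_cast this
    have hbase : ((k : ℝ) - 1 / 2, (0 : ℝ)) ∈ circular.regionAt ((k : ℝ) - 1 / 2, 0) := by
      refine mem_connectedComponentIn ?_
      by_contra hne
      rw [regionAt, connectedComponentIn_eq_empty hne] at hS
      exact hS hp
    have hpre : IsPreconnected (circular.regionAt ((k : ℝ) - 1 / 2, 0)) :=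
      isPreconnected_connectedComponentIn
    -- The region is connected. If it contained the circle it would have points of abscissa `3/4`
    -- and `k - 1/2 ≥ 3/2`, hence one of abscissa `1`, which lies on the first thread.
    obtain ⟨q, hq, hq1⟩ := (hpre.image Prod.fst continuous_fst.continuousOn).ordConnected.out
      ⟨_, hS hp, rfl⟩ ⟨_, hbase, rfl⟩ (show (1 : ℝ) ∈ Icc (3 / 4) ((k : ℝ) - 1 / 2) by
        constructor <;> linarith)
    obtain ⟨⟨-, h0, h1⟩, hq3⟩ := connectedComponentIn_subset _ _ hq
    refine hq3 ⟨_, hD.compAt_mark_mem_threads (z := 1) (by omega), ?_⟩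
    rw [circular_isPieces.compAt_eq (p := circular.mark 1) (i := some ⟨1, le_rfl⟩)
      (mem_verticalSegment_mark (D := circular) one_pos le_rfl (Or.inl rfl))]
    exact ⟨by rw [hq1]; simp, h0, h1⟩

end PlaneSet

/-! ### The diapsidal friezes `H_k`. -/

namespace PlaneSet

/-- The semicircular cup of `H_k` (for `ε = true`) and its semicircular cap. -/
def semicircle (k : ℕ) : Bool → Set (ℝ × ℝ)
  | true => {p | (p.1 - (k + 1 / 2)) ^ 2 + (p.2 - 2) ^ 2 = (1 / 2) ^ 2 ∧ p.2 ≤ 2}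
  | false => {p | (p.1 - (k + 1 / 2)) ^ 2 + p.2 ^ 2 = (1 / 2) ^ 2 ∧ 0 ≤ p.2}

/-- The index set of the components of `H_k`. -/
abbrev DiapsidalIndex (k : ℕ) := {i : ℕ // 1 ≤ i ∧ i ≠ k ∧ i ≠ k + 1} ⊕ Bool

/-- The components of `H_k`. -/
def diapsidalPiece (k : ℕ) : DiapsidalIndex k → Set (ℝ × ℝ)
  | .inl i => verticalSegment 2 i
  | .inr ε => semicircle k ε

/-- Separating neighbourhoods of the components of `H_k`. -/
def diapsidalNhd (k : ℕ) : DiapsidalIndex k → Set (ℝ × ℝ)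
  | .inl i => {p | |p.1 - i| < 1 / 8}
  | .inr true => {p | k - 1 / 8 < p.1 ∧ p.1 < k + 9 / 8 ∧ 1 < p.2}
  | .inr false => {p | k - 1 / 8 < p.1 ∧ p.1 < k + 9 / 8 ∧ p.2 < 1}

theorem semicircle_bounds {k : ℕ} {ε : Bool} {p : ℝ × ℝ} (hp : p ∈ semicircle k ε) :
    k ≤ p.1 ∧ p.1 ≤ k + 1 ∧ ((ε = true ∧ 3 / 2 ≤ p.2 ∧ p.2 ≤ 2) ∨
      (ε = false ∧ 0 ≤ p.2 ∧ p.2 ≤ 1 / 2)) := by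
  rcases ε with _ | _ <;> obtain ⟨h, h'⟩ := hp
  · have h1 := abs_le_of_sq_le_sq' (a := p.1 - (k + 1 / 2)) (b := 1 / 2) (by nlinarith)
      (by norm_num)
    have h2 := abs_le_of_sq_le_sq' (a := p.2) (b := 1 / 2) (by nlinarith) (by norm_num)
    exact ⟨by linarith, by linarith, Or.inr ⟨rfl, h', h2.2⟩⟩
  · have h1 := abs_le_of_sq_le_sq' (a := p.1 - (k + 1 / 2)) (b := 1 / 2) (by nlinarith)
      (by norm_num)
    have h2 := abs_le_of_sq_le_sq' (a := p.2 - 2) (b := 1 / 2) (by nlinarith) (by norm_num)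
    exact ⟨by linarith, by linarith, Or.inl ⟨rfl, by linarith, h'⟩⟩

theorem mem_diapsidal {k : ℕ} {p : ℝ × ℝ} :
    p ∈ (diapsidal k).carrier ↔ ∃ i, p ∈ diapsidalPiece k i := by
  constructor
  · rintro ((⟨⟨i, h1, h2, h3, h4⟩, h5⟩ | h) | h)
    · exact ⟨.inl ⟨i, h1, h2, h3⟩, h4, h5⟩
    · exact ⟨.inr true, h⟩
    · exact ⟨.inr false, h⟩
  · rintro ⟨⟨i, h1, h2, h3⟩ | ε, h⟩
    · exact Or.inl (Or.inl ⟨⟨i, h1, h2, h3, h.1⟩, h.2⟩)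
    · rcases ε with _ | _
      · exact Or.inr h
      · exact Or.inl (Or.inr h)

/-- The height of the unit semicircle over `[0,1]`. -/
theorem sqrt_semicircle (u : Icc (0 : ℝ) 1) :
    Real.sqrt ((u : ℝ) * (1 - u)) ^ 2 = (u : ℝ) * (1 - u) :=
  Real.sq_sqrt (mul_nonneg u.2.1 (sub_nonneg.2 u.2.2))

theorem semicircle_arc {k : ℕ} (hk : 1 ≤ k) (ε : Bool) :
    ∃ (e : Icc (0 : ℝ) 1 ≃ₜ semicircle k ε) (z w : ℤ), z ≠ 0 ∧ w ≠ 0 ∧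
      (e ⟨0, le_rfl, zero_le_one⟩ : ℝ × ℝ) = (diapsidal k).mark z ∧
      (e ⟨1, zero_le_one, le_rfl⟩ : ℝ × ℝ) = (diapsidal k).mark w ∧
      ∀ v, v ≠ 0 → (diapsidal k).mark v ∈ semicircle k ε → v = z ∨ v = w := by
  have hcase : ∀ j : ℕ, (k : ℝ) ≤ j → (j : ℝ) ≤ k + 1 → j = k ∨ j = k + 1 := fun j h1 h2 => by
    have h1' : k ≤ j := by exact_mod_cast h1
    have h2' : j ≤ k + 1 := by exact_mod_cast h2
    omega
  have hh : (diapsidal k).height = 2 := rfl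
  rcases ε with _ | _
  -- With `u = x - k` the equation of the circle becomes `y² = u(1 - u)`.
  · obtain ⟨e, he⟩ := exists_homeomorph_of_injective
      (f := fun u : Icc (0 : ℝ) 1 => ((k : ℝ) + u, Real.sqrt ((u : ℝ) * (1 - u)))) (by fun_prop)
      (fun u v huv => Subtype.ext (add_left_cancel (congrArg Prod.fst huv)))
      (S := semicircle k false) (by
        ext ⟨x, y⟩
        constructor
        · rintro ⟨u, hu⟩
          obtain ⟨rfl, rfl⟩ := Prod.mk.injEq .. ▸ hu
          have := sqrt_semicircle u
          exact ⟨by simp only; nlinarith, Real.sqrt_nonneg _⟩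
        · intro h
          have hb := semicircle_bounds h
          have h1 := h.1
          have h2 := h.2
          simp only at hb h1 h2
          refine ⟨⟨x - k, by linarith [hb.1], by linarith [hb.2.1]⟩, Prod.ext (by simp) ?_⟩
          simp only
          rw [show (x - k) * (1 - (x - k)) = y ^ 2 by nlinarith, Real.sqrt_sq h2])
    refine ⟨e, k, (k + 1 : ℕ), by omega, by omega, ?_, ?_, fun v hv hm => ?_⟩
    · rw [he, mark_natCast _ hk]; simp [botPt]
    · rw [he, mark_natCast _ (by omega)]; simp [botPt]
    · have hb := semicircle_bounds hm
      obtain ⟨j, hj, ⟨rfl, h⟩ | ⟨rfl, h⟩⟩ := (diapsidal k).mark_cases hv <;> rw [h] at hb <;>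
        simp only at hb
      · rcases hcase j hb.1 hb.2.1 with rfl | rfl
        · exact Or.inl rfl
        · exact Or.inr rfl
      · rw [hh] at hb; norm_num at hb
  · obtain ⟨e, he⟩ := exists_homeomorph_of_injective
      (f := fun u : Icc (0 : ℝ) 1 => ((k : ℝ) + u, 2 - Real.sqrt ((u : ℝ) * (1 - u))))
      (by fun_prop)
      (fun u v huv => Subtype.ext (add_left_cancel (congrArg Prod.fst huv)))
      (S := semicircle k true) (by
        ext ⟨x, y⟩
        constructor
        · rintro ⟨u, hu⟩
          obtain ⟨rfl, rfl⟩ := Prod.mk.injEq .. ▸ hu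
          have := sqrt_semicircle u
          exact ⟨by simp only; nlinarith, by simp only; linarith [Real.sqrt_nonneg ((u : ℝ) * (1 - u))]⟩
        · intro h
          have hb := semicircle_bounds h
          have h1 := h.1
          have h2 := h.2
          simp only at hb h1 h2
          refine ⟨⟨x - k, by linarith [hb.1], by linarith [hb.2.1]⟩, Prod.ext (by simp) ?_⟩
          simp only
          rw [show (x - k) * (1 - (x - k)) = (2 - y) ^ 2 by nlinarith, Real.sqrt_sq (by linarith)]
          ring)
    refine ⟨e, -k, -(k + 1 : ℕ), by omega, by omega, ?_, ?_, fun v hv hm => ?_⟩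
    · rw [he, mark_neg_natCast _ hk]; simp [topPt, hh]
    · rw [he, mark_neg_natCast _ (by omega)]; simp [topPt, hh]
    · have hb := semicircle_bounds hm
      obtain ⟨j, hj, ⟨rfl, h⟩ | ⟨rfl, h⟩⟩ := (diapsidal k).mark_cases hv <;> rw [h] at hb <;>
        simp only at hb
      · norm_num at hb
      · rcases hcase j hb.1 hb.2.1 with rfl | rfl
        · exact Or.inl rfl
        · exact Or.inr rfl

theorem mem_semicircle_mark {k : ℕ} (hk : 1 ≤ k) :
    (diapsidal k).mark k ∈ semicircle k false ∧ (diapsidal k).mark (k + 1) ∈ semicircle k false ∧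
    (diapsidal k).mark (-k) ∈ semicircle k true ∧
    (diapsidal k).mark (-(k + 1)) ∈ semicircle k true := by
  have h1 : 1 ≤ k + 1 := by omega
  have e1 := (diapsidal k).mark_natCast h1
  have e2 := (diapsidal k).mark_neg_natCast h1
  push_cast at e1 e2
  rw [mark_natCast _ hk, mark_neg_natCast _ hk, e1, e2]
  have hh : (diapsidal k).height = 2 := rfl
  simp only [semicircle, mem_ofPred_eq, botPt, topPt, hh]
  push_cast
  refine ⟨⟨?_, ?_⟩, ⟨?_, ?_⟩, ⟨?_, ?_⟩, ⟨?_, ?_⟩⟩ <;> first | exact le_rfl | ring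

theorem diapsidal_mark_mem_piece {k : ℕ} (hk : 1 ≤ k) {z : ℤ} (hz : z ≠ 0) :
    ∃ i, (diapsidal k).mark z ∈ diapsidalPiece k i ∧
      ((z = k ∧ i = .inr false) ∨ (z = k + 1 ∧ i = .inr false) ∨ (z = -k ∧ i = .inr true) ∨
      (z = -(k + 1) ∧ i = .inr true) ∨
      ∃ j, i = .inl j ∧ (z = (j : ℕ) ∨ z = -(j : ℕ))) := by
  obtain ⟨j, hj, h⟩ := int_cases hz
  by_cases h1 : j = k
  · subst h1
    rcases h with rfl | rfl
    · exact ⟨.inr false, (mem_semicircle_mark hj).1, Or.inl ⟨rfl, rfl⟩⟩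
    · exact ⟨.inr true, (mem_semicircle_mark hj).2.2.1, Or.inr (Or.inr (Or.inl ⟨rfl, rfl⟩))⟩
  by_cases h2 : j = k + 1
  · subst h2
    rcases h with rfl | rfl <;> push_cast
    · exact ⟨.inr false, (mem_semicircle_mark hk).2.1, Or.inr (Or.inl ⟨rfl, rfl⟩)⟩
    · exact ⟨.inr true, (mem_semicircle_mark hk).2.2.2, Or.inr (Or.inr (Or.inr (Or.inl ⟨rfl, rfl⟩)))⟩
  · exact ⟨.inl ⟨j, hj, h1, h2⟩, mem_verticalSegment_mark (D := diapsidal k) two_pos hj h,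
      Or.inr (Or.inr (Or.inr (Or.inr ⟨_, rfl, h⟩)))⟩

theorem diapsidal_isPieces {k : ℕ} (hk : 1 ≤ k) :
    (diapsidal k).IsPieces (diapsidalPiece k) (diapsidalNhd k) where
  height_pos := two_pos
  subset_strip := by
    intro p hp
    obtain ⟨i | ε, hi⟩ := mem_diapsidal.1 hp
    · exact ⟨by rw [hi.1]; positivity, hi.2⟩
    · have hb := semicircle_bounds hi
      have hk0 : (0 : ℝ) ≤ k := k.cast_nonneg
      refine ⟨by linarith, ?_, ?_⟩ <;> [skip; change p.2 ≤ 2] <;> rcases hb.2.2 with h | h <;>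
        linarith [h.2.1, h.2.2]
  inter_top := by
    ext p
    constructor
    · rintro ⟨hp, h0, h1⟩
      have h1 : p.2 = 2 := h1
      obtain ⟨i | ε, hi⟩ := mem_diapsidal.1 hp
      · exact ⟨i, i.2.1, Prod.ext hi.1 h1⟩
      · have hb := semicircle_bounds hi
        rcases ε with _ | _
        · norm_num [h1] at hb
        · have h2 := hi.1
          rw [h1] at h2
          -- On the edge of the strip the equation of the semicircle leaves only its two end points.
          have h3 : (p.1 - k) * (p.1 - (k + 1)) = 0 := by nlinarith
          rcases mul_eq_zero.1 h3 with h3 | h3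
          · exact ⟨k, hk, Prod.ext (sub_eq_zero.1 h3) h1⟩
          · exact ⟨k + 1, by omega, Prod.ext (by simpa [topPt] using sub_eq_zero.1 h3) h1⟩
    · rintro ⟨i, hi, rfl⟩
      refine ⟨?_, by simp [topPt], rfl⟩
      rw [← mark_neg_natCast _ hi]
      obtain ⟨j, hj, -⟩ := diapsidal_mark_mem_piece hk (z := -i) (by omega)
      exact mem_diapsidal.2 ⟨j, hj⟩
  inter_bot := by
    ext p
    constructor
    · rintro ⟨hp, h0, h1⟩
      have h1 : p.2 = 0 := h1
      obtain ⟨i | ε, hi⟩ := mem_diapsidal.1 hp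
      · exact ⟨i, i.2.1, Prod.ext hi.1 h1⟩
      · have hb := semicircle_bounds hi
        rcases ε with _ | _
        · have h2 := hi.1
          rw [h1] at h2
          have h3 : (p.1 - k) * (p.1 - (k + 1)) = 0 := by nlinarith
          rcases mul_eq_zero.1 h3 with h3 | h3
          · exact ⟨k, hk, Prod.ext (sub_eq_zero.1 h3) h1⟩
          · exact ⟨k + 1, by omega, Prod.ext (by simpa [botPt] using sub_eq_zero.1 h3) h1⟩
        · norm_num [h1] at hb
    · rintro ⟨i, hi, rfl⟩
      refine ⟨?_, by simp [botPt], rfl⟩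
      rw [← mark_natCast (diapsidal k) hi]
      obtain ⟨j, hj, -⟩ := diapsidal_mark_mem_piece hk (z := i) (by omega)
      exact mem_diapsidal.2 ⟨j, hj⟩
  cover := fun p hp => mem_diapsidal.1 hp
  subset := fun i p hp => mem_diapsidal.2 ⟨i, hp⟩
  isOpen := by
    have h1 : IsOpen {p : ℝ × ℝ | k - 1 / 8 < p.1} := isOpen_lt (by fun_prop) (by fun_prop)
    have h2 : IsOpen {p : ℝ × ℝ | p.1 < k + 9 / 8} := isOpen_lt (by fun_prop) (by fun_prop)
    have h3 : IsOpen {p : ℝ × ℝ | 1 < p.2} := isOpen_lt (by fun_prop) (by fun_prop)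
    have h4 : IsOpen {p : ℝ × ℝ | p.2 < 1} := isOpen_lt (by fun_prop) (by fun_prop)
    rintro (i | _ | _)
    · exact isOpen_abs_sub_lt _ _
    · exact h1.inter (h2.inter h4)
    · exact h1.inter (h2.inter h3)
  subset_nhd := by
    rintro (i | _ | _) p hp
    · change |p.1 - (i : ℕ)| < 1 / 8
      rw [hp.1]; norm_num
    · have hb := semicircle_bounds (ε := false) hp
      simp only [reduceCtorEq, false_and, true_and, false_or] at hb
      exact ⟨by linarith, by linarith, by linarith⟩
    · have hb := semicircle_bounds (ε := true) hp
      simp only [reduceCtorEq, false_and, true_and, or_false] at hb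
      exact ⟨by linarith, by linarith, by linarith⟩
  separated := by
    -- The boxes around the cup and the cap reach `1/8` beyond `k` and `k + 1`, while the remaining
    -- segments are at distance at least `1` from both.
    have key : ∀ (i : {i : ℕ // 1 ≤ i ∧ i ≠ k ∧ i ≠ k + 1}) (x : ℝ), |x - (i : ℕ)| < 1 / 8 →
        k - 1 / 8 < x → x < k + 9 / 8 → False := by
      rintro ⟨i, h1, h2, h3⟩ x h4 h5 h6
      rw [abs_lt] at h4
      rcases lt_or_gt_of_ne h2 with h | h
      · have : (i : ℝ) + 1 ≤ k := by exact_mod_cast h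
        simp only at h4
        linarith
      · have : (k : ℝ) + 2 ≤ i := by exact_mod_cast (by omega : k + 2 ≤ i)
        simp only at h4
        linarith
    rintro (i | ε) (j | ε') p hp hp'
    · exact congrArg _ (Subtype.ext (natCast_eq_of_abs_sub_lt hp.1 hp'))
    · have h : |p.1 - (i : ℕ)| < 1 / 8 := by rw [hp.1]; norm_num
      rcases ε' with _ | _ <;> exact (key i p.1 h hp'.1 hp'.2.1).elim
    · have hb := semicircle_bounds hp
      exact (key j p.1 hp' (by linarith) (by linarith)).elim
    · have hb := semicircle_bounds hp
      rcases ε with _ | _ <;> rcases ε' with _ | _ <;> first | rfl | skip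
      · simp only [reduceCtorEq, false_and, true_and, false_or] at hb
        linarith [hp'.2.2]
      · simp only [reduceCtorEq, false_and, true_and, or_false] at hb
        linarith [hp'.2.2]
  arc_or_circle := by
    rintro (i | ε)
    · exact Or.inl (verticalSegment_arc (D := diapsidal k) two_pos i.2.1)
    · exact Or.inl (semicircle_arc hk ε)

theorem diapsidal_circularComponents {k : ℕ} (hk : 1 ≤ k) :
    (diapsidal k).circularComponents = ∅ := by
  ext S
  rw [(diapsidal_isPieces hk).isDiagram.mem_circularComponents_iff,
    (diapsidal_isPieces hk).mem_components_iff]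
  simp only [mem_empty_iff_false, iff_false, not_and]
  rintro ⟨i, rfl⟩ h
  rcases (diapsidal_isPieces hk).arc_or_circle i with ⟨e, z, w, hz, -, h0, -⟩ | ⟨⟨e⟩, -⟩
  · refine h z hz ?_
    rw [← h0]; exact Subtype.coe_prop _
  · rcases i with i | ε
    · exact h i (by have := i.2.1; omega)
        (mem_verticalSegment_mark (D := diapsidal k) two_pos i.2.1 (Or.inl rfl))
    · rcases ε with _ | _
      · exact h k (by omega) (mem_semicircle_mark hk).1
      · exact h (-k) (by omega) (mem_semicircle_mark hk).2.2.1

theorem diapsidal_hasInvariant {k : ℕ} (hk : 1 ≤ k) :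
    (diapsidal k).HasInvariant (loopAct unitPairing k) where
  pairing := isPairing_unitPairing.pairingAct hk
  mark_mem := fun z hz => by
    obtain ⟨i, hi, h⟩ := diapsidal_mark_mem_piece hk hz
    rw [(diapsidal_isPieces hk).compAt_eq hi]
    have hm := mem_semicircle_mark hk
    rcases h with ⟨rfl, rfl⟩ | ⟨rfl, rfl⟩ | ⟨rfl, rfl⟩ | ⟨rfl, rfl⟩ | ⟨j, rfl, hj⟩
    · rw [show (loopAct unitPairing k).1 k = k + 1 by
        simp only [loopAct, pairingAct, unitPairing]; split_ifs <;> omega]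
      exact hm.2.1
    · rw [show (loopAct unitPairing k).1 (k + 1) = k by
        simp only [loopAct, pairingAct, unitPairing]; split_ifs <;> omega]
      exact hm.1
    · rw [show (loopAct unitPairing k).1 (-k) = -(k + 1) by
        simp only [loopAct, pairingAct, unitPairing]; split_ifs <;> omega]
      exact hm.2.2.2
    · rw [show (loopAct unitPairing k).1 (-(k + 1)) = -k by
        simp only [loopAct, pairingAct, unitPairing]; split_ifs <;> omega]
      exact hm.2.2.1
    · have h1 := j.2
      rw [show (loopAct unitPairing k).1 z = -z by
        simp only [loopAct, pairingAct, unitPairing]; split_ifs <;> omega]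
      exact mem_verticalSegment_mark (D := diapsidal k) two_pos h1.1 (by omega)
  ncard := by
    rw [diapsidal_circularComponents hk, ncard_empty]
    simp [loopAct, unitPairing]
    omega

theorem diapsidal_isNFrieze {n k : ℕ} (hk : 1 ≤ k) (hkn : k < n) : (diapsidal k).IsNFrieze n := by
  refine (diapsidal_isPieces hk).isDiagram.isNFrieze (fun l hl => ?_) ?_ ?_
  · rw [(diapsidal_isPieces hk).compAt_eq (i := .inl ⟨l, by omega⟩) (p := (diapsidal k).mark l)
      (mem_verticalSegment_mark (D := diapsidal k) (i := l) two_pos (by omega) (Or.inl rfl))]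
    exact mem_verticalSegment_mark (D := diapsidal k) (i := l) two_pos (by omega) (Or.inr rfl)
  · rw [diapsidal_circularComponents hk]; exact finite_empty
  · rw [diapsidal_circularComponents hk]; simp

end PlaneSet

/-! ### Gluing two arcs in a common end point. -/

section Glue

variable {Z : Type*} [TopologicalSpace Z] {X Y F A B W : Set Z} {p : Z}

theorem isOpenEmbedding_inclusion_of_inter_eq (hW : IsOpen W) (hXY : X ∩ W = Y ∩ W) :
    IsOpenEmbedding (inclusion (hXY ▸ inter_subset_left : X ∩ W ⊆ Y)) :=
  ⟨.inclusion _, by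
    rw [range_inclusion]
    refine isOpen_induced_iff.2 ⟨W, hW, ?_⟩
    ext x
    simp only [mem_preimage]
    rw [hXY]
    exact ⟨fun hx => ⟨x.2, hx⟩, fun hx => hx.2⟩⟩

/-- The notion is local: the common part `X ∩ W` is embedded openly in both spaces. -/
theorem IsInteriorPoint.of_inter_eq (hW : IsOpen W) (hXY : X ∩ W = Y ∩ W) (hpW : p ∈ W)
    (hX : p ∈ X) (hY : p ∈ Y) (h : IsInteriorPoint (⟨p, hX⟩ : X)) :
    IsInteriorPoint (⟨p, hY⟩ : Y) :=
  IsInteriorPoint.map (isOpenEmbedding_inclusion_of_inter_eq hW hXY) (x := ⟨p, hX, hpW⟩)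
    (.of_map (isOpenEmbedding_inclusion_of_inter_eq hW rfl) h)

theorem IsBoundaryPoint.of_inter_eq (hW : IsOpen W) (hXY : X ∩ W = Y ∩ W) (hpW : p ∈ W)
    (hX : p ∈ X) (hY : p ∈ Y) (h : IsBoundaryPoint (⟨p, hX⟩ : X)) :
    IsBoundaryPoint (⟨p, hY⟩ : Y) :=
  IsBoundaryPoint.map (isOpenEmbedding_inclusion_of_inter_eq hW hXY) (x := ⟨p, hX, hpW⟩)
    (.of_map (isOpenEmbedding_inclusion_of_inter_eq hW rfl) h)

/-- Two half-open arcs that meet in their end point form an open arc. -/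
theorem isInteriorPoint_glue [T2Space Z] (hA : IsClosed A) (hB : IsClosed B) (hF : F ⊆ A ∪ B)
    (hFA : F ∩ A = X) (hFB : F ∩ B = Y) (hW : IsOpen W) (hpW : p ∈ W)
    (hXY : ∀ q ∈ W, q ∈ X → q ∈ Y → q = p) (hX : p ∈ X) (hY : p ∈ Y) (hpF : p ∈ F)
    (h : IsBoundaryPoint (⟨p, hX⟩ : X)) (h' : IsBoundaryPoint (⟨p, hY⟩ : Y)) :
    IsInteriorPoint (⟨p, hpF⟩ : F) := by
  obtain ⟨f, hf, hf0, hfW⟩ := h.exists_small (V := Subtype.val ⁻¹' W)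
    ((hW.preimage continuous_subtype_val).mem_nhds hpW)
  obtain ⟨g, hg, hg0, hgW⟩ := h'.exists_small (V := Subtype.val ⁻¹' W)
    ((hW.preimage continuous_subtype_val).mem_nhds hpW)
  have hXF : X ⊆ F := hFA ▸ inter_subset_left
  have hYF : Y ⊆ F := hFB ▸ inter_subset_left
  have hfW' : ∀ u, (f u : Z) ∈ W := fun u => hfW (mem_range_self u)
  have hgW' : ∀ u, (g u : Z) ∈ W := fun u => hgW (mem_range_self u)
  have hfp : ∀ u, (f u : Z) = p → u = icoZero := fun u hu =>
    hf.injective ((Subtype.ext hu).trans hf0.symm)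
  have hgp : ∀ u, (g u : Z) = p → u = icoZero := fun u hu =>
    hg.injective ((Subtype.ext hu).trans hg0.symm)
  let I := Icc (-(1 / 2) : ℝ) (1 / 2)
  let φ : I → Ico (0 : ℝ) 1 := fun t => ⟨max t 0, le_max_right _ _, max_lt (by linarith [t.2.2])
    one_pos⟩
  let φ' : I → Ico (0 : ℝ) 1 := fun t => ⟨max (-t) 0, le_max_right _ _,
    max_lt (by linarith [t.2.1]) one_pos⟩
  have hφ : Continuous φ := by fun_prop
  have hφ' : Continuous φ' := by fun_prop
  -- The glued arc runs through the `Y`-arc backwards to `p` and then through the `X`-arc forwards.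
  let k : I → F := fun t => if 0 ≤ (t : ℝ) then inclusion hXF (f (φ t)) else inclusion hYF (g (φ' t))
  have hk1 : ∀ t : I, 0 ≤ (t : ℝ) → (k t : Z) = f (φ t) := fun t ht => by simp only [k, if_pos ht]
  have hk2 : ∀ t : I, ¬ 0 ≤ (t : ℝ) → (k t : Z) = g (φ' t) := fun t ht => by
    simp only [k, if_neg ht]
  have hkc : Continuous k := by
    refine Continuous.if_le ((continuous_inclusion hXF).comp (hf.continuous.comp hφ))
      ((continuous_inclusion hYF).comp (hg.continuous.comp hφ')) continuous_const
      continuous_subtype_val fun t ht => Subtype.ext ?_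
    have e1 : φ t = icoZero := Subtype.ext (by simp [φ, icoZero, ← ht])
    have e2 : φ' t = icoZero := Subtype.ext (by simp [φ', icoZero, ← ht])
    change (f (φ t) : Z) = g (φ' t)
    rw [e1, e2, hf0, hg0]
  have hcross : ∀ t u : I, 0 ≤ (t : ℝ) → ¬ 0 ≤ (u : ℝ) → (k t : Z) = k u → False := by
    intro t u ht hu htu
    rw [hk1 t ht, hk2 u hu] at htu
    have e := hXY _ (hfW' _) (Subtype.coe_prop _) (htu ▸ Subtype.coe_prop (g (φ' u)))
    have e2 := congrArg Subtype.val (hgp _ (htu.symm.trans e))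
    simp only [φ', icoZero] at e2
    have := le_max_left (-(u : ℝ)) 0
    linarith
  have hki : Function.Injective k := by
    intro t u htu
    have htu' := congrArg Subtype.val htu
    by_cases ht : 0 ≤ (t : ℝ) <;> by_cases hu : 0 ≤ (u : ℝ)
    · rw [hk1 t ht, hk1 u hu] at htu'
      have := congrArg Subtype.val (hf.injective (Subtype.ext htu'))
      simp only [φ, max_eq_left ht, max_eq_left hu] at this
      exact Subtype.ext this
    · exact (hcross t u ht hu htu').elim
    · exact (hcross u t hu ht htu'.symm).elim
    · rw [hk2 t ht, hk2 u hu] at htu'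
      have := congrArg Subtype.val (hg.injective (Subtype.ext htu'))
      simp only [φ', max_eq_left (neg_nonneg.2 (not_le.1 ht).le),
        max_eq_left (neg_nonneg.2 (not_le.1 hu).le)] at this
      exact Subtype.ext (neg_injective this)
  have hj : ∀ t, Real.sigmoid t - 1 / 2 ∈ I := fun t => by
    constructor <;> linarith [Real.sigmoid_pos t, Real.sigmoid_lt_one t]
  let j : ℝ → I := fun t => ⟨Real.sigmoid t - 1 / 2, hj t⟩
  have hjc : Continuous j := (continuous_sigmoid.sub continuous_const).subtype_mk _
  have hje : IsEmbedding j := .of_comp hjc continuous_subtype_val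
    ((Homeomorph.addRight (-(1 / 2 : ℝ))).isEmbedding.comp isOpenEmbedding_sigmoid.isEmbedding)
  have hjr : ∀ u : I, (u : ℝ) < 1 / 2 → -(1 / 2) < (u : ℝ) → u ∈ range j := fun u h1 h2 => by
    obtain ⟨t, ht⟩ : (u : ℝ) + 1 / 2 ∈ range Real.sigmoid := by
      rw [Real.range_sigmoid]; constructor <;> linarith
    exact ⟨t, Subtype.ext (by simp [j, ht])⟩
  have hkj : IsEmbedding (k ∘ j) := (hkc.isClosedEmbedding hki).isEmbedding.comp hje
  have hhalf : IsOpen {u : Ico (0 : ℝ) 1 | (u : ℝ) < 1 / 2} :=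
    isOpen_lt continuous_subtype_val continuous_const
  obtain ⟨O, hO, hOe⟩ := isOpen_induced_iff.1 (hf.isOpenMap _ hhalf)
  obtain ⟨O', hO', hOe'⟩ := isOpen_induced_iff.1 (hg.isOpenMap _ hhalf)
  -- A point of `F` in `A` has to lie on the half arc cut out by `O`, and one in `B` on that cut out
  -- by `O'`. In this form the image of the glued arc is visibly open in `F`.
  have hrange : range (k ∘ j) = Subtype.val ⁻¹' ((O ∪ Aᶜ) ∩ (O' ∪ Bᶜ) ) := by
    have hpO : p ∈ O := (Set.ext_iff.1 hOe ⟨p, hX⟩).2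
      ⟨icoZero, by simp [icoZero], hf0⟩
    have hpO' : p ∈ O' := (Set.ext_iff.1 hOe' ⟨p, hY⟩).2
      ⟨icoZero, by simp [icoZero], hg0⟩
    ext q
    constructor
    · rintro ⟨t, rfl⟩
      rw [Function.comp_apply]
      have hb := (hj t).2
      have hs1 := Real.sigmoid_pos t
      have hs2 := Real.sigmoid_lt_one t
      by_cases ht : 0 ≤ (j t : ℝ)
      · have e := hk1 _ ht
        have hmX : (k (j t) : Z) ∈ X := by rw [e]; exact Subtype.coe_prop _
        have hmO : (k (j t) : Z) ∈ O := by
          refine (Set.ext_iff.1 hOe ⟨_, hmX⟩).2 ⟨φ (j t), ?_, Subtype.ext e.symm⟩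
          change max (Real.sigmoid t - 1 / 2) 0 < 1 / 2
          exact max_lt (by linarith) (by norm_num)
        refine ⟨Or.inl hmO, ?_⟩
        by_cases hm : (k (j t) : Z) ∈ B
        · left
          have : (k (j t) : Z) = p := hXY _ (by rw [e]; exact hfW' _) hmX
            (hFB ▸ ⟨Subtype.coe_prop _, hm⟩)
          rw [this]; exact hpO'
        · exact Or.inr hm
      · have e := hk2 _ ht
        have hmX : (k (j t) : Z) ∈ Y := by rw [e]; exact Subtype.coe_prop _
        have hmO : (k (j t) : Z) ∈ O' := by
          refine (Set.ext_iff.1 hOe' ⟨_, hmX⟩).2 ⟨φ' (j t), ?_, Subtype.ext e.symm⟩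
          change max (-(Real.sigmoid t - 1 / 2)) 0 < 1 / 2
          exact max_lt (by linarith) (by norm_num)
        refine ⟨?_, Or.inl hmO⟩
        by_cases hm : (k (j t) : Z) ∈ A
        · left
          have : (k (j t) : Z) = p := hXY _ (by rw [e]; exact hgW' _)
            (hFA ▸ ⟨Subtype.coe_prop _, hm⟩) hmX
          rw [this]; exact hpO
        · exact Or.inr hm
    · rintro ⟨h1, h2⟩
      by_cases hqA : (q : Z) ∈ A
      · have hqX : (q : Z) ∈ X := hFA ▸ ⟨q.2, hqA⟩
        obtain ⟨u, hu, hue⟩ := (Set.ext_iff.1 hOe ⟨q, hqX⟩).1 (h1.resolve_right (fun h => h hqA))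
        have hu : (u : ℝ) < 1 / 2 := hu
        have hu0 := u.2.1
        have hm : (u : ℝ) ∈ I := ⟨by linarith, hu.le⟩
        obtain ⟨t, ht⟩ := hjr ⟨u, hm⟩ hu (by linarith : -(1 / 2) < (u : ℝ))
        refine ⟨t, Subtype.ext ?_⟩
        rw [Function.comp_apply, ht, hk1 _ hu0]
        rw [show φ ⟨u, hm⟩ = u from Subtype.ext (max_eq_left hu0), hue]
      · have hqB : (q : Z) ∈ B := (hF q.2).resolve_left hqA
        have hqX : (q : Z) ∈ Y := hFB ▸ ⟨q.2, hqB⟩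
        obtain ⟨u, hu, hue⟩ := (Set.ext_iff.1 hOe' ⟨q, hqX⟩).1
          (h2.resolve_right (fun h => h hqB))
        have hu : (u : ℝ) < 1 / 2 := hu
        have hu0 : 0 < (u : ℝ) := by
          refine lt_of_le_of_ne u.2.1 fun h0 => hqA ?_
          have : u = icoZero := Subtype.ext h0.symm
          rw [this, hg0] at hue
          rw [← show p = q from congrArg Subtype.val hue]
          exact (hFA.symm ▸ hX : p ∈ F ∩ A).2
        have hm : -(u : ℝ) ∈ I := ⟨by linarith, by linarith⟩
        obtain ⟨t, ht⟩ := hjr ⟨-u, hm⟩ (by linarith : -(u : ℝ) < 1 / 2)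
          (by linarith : -(1 / 2) < -(u : ℝ))
        refine ⟨t, Subtype.ext ?_⟩
        rw [Function.comp_apply, ht, hk2 _ (by simp only; linarith)]
        rw [show φ' ⟨-u, hm⟩ = u from Subtype.ext (by
          simp only [φ', neg_neg]; exact max_eq_left hu0.le), hue]
  refine isInteriorPoint_iff.2 ⟨k ∘ j, ⟨hkj, ?_⟩, ?_⟩
  · rw [hrange]
    exact ((hO.union hA.isOpen_compl).inter (hO'.union hB.isOpen_compl)).preimage
      continuous_subtype_val
  · refine Subtype.ext ?_
    have h0 : (j 0 : ℝ) = 0 := by simp [j, Real.sigmoid_zero]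
    rw [Function.comp_apply, hk1 _ h0.ge,
      show φ (j 0) = icoZero from Subtype.ext (by simp [φ, icoZero, h0]), hf0]

end Glue

end KFrieze

/-! ### Compositions: the two halves and the middle line. -/

namespace KFrieze

open Filter Topology

theorem IsRelClopen.isCompact {X : Type*} [TopologicalSpace X] {M F K : Set X}
    (h : IsRelClopen M F) (hK : IsCompact K) (hMK : M ⊆ K) (hKF : K ⊆ F) : IsCompact M := by
  obtain ⟨-, s, -, hs, -, h1, -⟩ := h
  rw [show M = K ∩ s from ?_]
  · exact hK.inter_right hs
  · refine Subset.antisymm (fun x hx => ⟨hMK hx, (h1.symm.subset hx).2⟩) fun x hx => ?_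
    exact h1.subset ⟨hKF hx.1, hx.2⟩

/-- The vertical translation of the plane by `b`. -/
def shiftUp (b : ℝ) : ℝ × ℝ ≃ₜ ℝ × ℝ := (Homeomorph.refl ℝ).prodCongr (Homeomorph.addRight b)

theorem shiftUp_apply (b : ℝ) (p : ℝ × ℝ) : shiftUp b p = (p.1, p.2 + b) := rfl

namespace PlaneSet

/-- The upper half of the composition `E ∘ D`. -/
def upper (E D : PlaneSet) : Set (ℝ × ℝ) := shiftUp E.height '' D.carrier

variable {E D : PlaneSet}

theorem comp_carrier : (E.comp D).carrier = E.upper D ∪ E.carrier := by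
  ext q
  simp only [comp, upper, mem_union, mem_ofPred_eq, mem_image, shiftUp_apply]
  exact or_congr_left (exists_congr fun p => and_congr_right fun _ => eq_comm)

theorem subset_comp : E.carrier ⊆ (E.comp D).carrier := comp_carrier (D := D) ▸ subset_union_right

theorem upper_subset_comp : E.upper D ⊆ (E.comp D).carrier :=
  comp_carrier (D := D) ▸ subset_union_left

theorem comp_mark_pos {z : ℤ} (hz : 0 < z) : (E.comp D).mark z = E.mark z := by
  rw [mark, mark, if_pos hz, if_pos hz]

theorem comp_mark_neg {z : ℤ} (hz : z < 0) :
    (E.comp D).mark z = shiftUp E.height (D.mark z) := by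
  rw [mark, mark, if_neg hz.not_gt, if_neg hz.not_gt]; rfl

theorem shiftUp_mark {z : ℤ} (hz : 0 < z) : shiftUp E.height (D.mark z) = E.mark (-z) := by
  rw [mark, mark, if_pos hz, if_neg (by omega)]
  simp [shiftUp_apply]

theorem IsDiagram.eq_mark_of_bot (hD : D.IsDiagram) {p : ℝ × ℝ} (hp : p ∈ D.carrier)
    (h : p.2 = 0) : ∃ z : ℤ, 0 < z ∧ p = D.mark z := by
  obtain ⟨i, hi, rfl⟩ := hD.inter_bot.subset ⟨hp, (hD.subset_strip hp).1, h⟩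
  exact ⟨i, by omega, (D.mark_natCast hi).symm⟩

theorem IsDiagram.eq_mark_of_top (hD : D.IsDiagram) {p : ℝ × ℝ} (hp : p ∈ D.carrier)
    (h : p.2 = D.height) : ∃ z : ℤ, 0 < z ∧ p = D.mark (-z) := by
  obtain ⟨i, hi, rfl⟩ := hD.inter_top.subset ⟨hp, (hD.subset_strip hp).1, h⟩
  exact ⟨i, by omega, (D.mark_neg_natCast hi).symm⟩

theorem IsDiagram.le_of_mem_upper (hD : D.IsDiagram) {p : ℝ × ℝ} (hp : p ∈ E.upper D) :
    E.height ≤ p.2 := by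
  obtain ⟨q, hq, rfl⟩ := hp
  have := (hD.subset_strip hq).2.1
  rw [shiftUp_apply]; simp only; linarith

/-- The lowest points of the shifted upper frieze are its marked points, and these are the top
points of the lower one. -/
theorem comp_inter_le (hE : E.IsDiagram) (hD : D.IsDiagram) :
    (E.comp D).carrier ∩ {p | p.2 ≤ E.height} = E.carrier := by
  refine Subset.antisymm ?_ fun p hp => ⟨subset_comp hp, (hE.subset_strip hp).2.2⟩
  rintro p ⟨hp, hpb⟩
  rw [comp_carrier] at hp
  rcases hp with ⟨q, hq, rfl⟩ | hp
  · have h0 : q.2 = 0 := le_antisymm (by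
      have : q.2 + E.height ≤ E.height := hpb
      linarith) (hD.subset_strip hq).2.1
    obtain ⟨z, hz, rfl⟩ := hD.eq_mark_of_bot hq h0
    rw [shiftUp_mark hz]
    exact hE.mark_mem (by omega)
  · exact hp

theorem comp_inter_ge (hE : E.IsDiagram) (hD : D.IsDiagram) :
    (E.comp D).carrier ∩ {p | E.height ≤ p.2} = E.upper D := by
  refine Subset.antisymm ?_ fun p hp => ⟨upper_subset_comp hp, hD.le_of_mem_upper hp⟩
  rintro p ⟨hp, hpb⟩
  rw [comp_carrier] at hp
  rcases hp with hp | hp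
  · exact hp
  · obtain ⟨z, hz, rfl⟩ := hE.eq_mark_of_top hp (le_antisymm (hE.subset_strip hp).2.2 hpb)
    exact ⟨D.mark z, hD.mark_mem (by omega), shiftUp_mark hz⟩

theorem isClosed_snd_le (b : ℝ) : IsClosed {p : ℝ × ℝ | p.2 ≤ b} :=
  isClosed_le continuous_snd continuous_const

theorem isClosed_le_snd (b : ℝ) : IsClosed {p : ℝ × ℝ | b ≤ p.2} :=
  isClosed_le continuous_const continuous_snd

theorem comp_isRelClopen (hE : E.IsDiagram) (hD : D.IsDiagram) {M : Set (ℝ × ℝ)}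
    (hM : M ⊆ (E.comp D).carrier) (h : IsRelClopen (M ∩ {p | p.2 ≤ E.height}) E.carrier)
    (h' : IsRelClopen (M ∩ {p | E.height ≤ p.2}) (E.upper D)) :
    IsRelClopen M (E.comp D).carrier :=
  .paste (isClosed_snd_le E.height) (isClosed_le_snd E.height)
    (fun p _ => le_total p.2 E.height) hM (by rwa [comp_inter_le hE hD])
    (by rwa [comp_inter_ge hE hD])

theorem mem_comp_compAt {p q : ℝ × ℝ} (h : q ∈ E.compAt p) : q ∈ (E.comp D).compAt p :=
  connectedComponentIn_mono p subset_comp h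

theorem image_compAt {p : ℝ × ℝ} (hp : p ∈ D.carrier) :
    shiftUp E.height '' D.compAt p = connectedComponentIn (E.upper D) (shiftUp E.height p) :=
  (shiftUp E.height).image_connectedComponentIn hp

theorem shiftUp_mem_comp_compAt {p q : ℝ × ℝ} (h : q ∈ D.compAt p) :
    shiftUp E.height q ∈ (E.comp D).compAt (shiftUp E.height p) := by
  have hp : p ∈ D.carrier := compAt_subset _ (compAt_symm h)
  exact connectedComponentIn_mono _ upper_subset_comp ((image_compAt hp).subset ⟨q, h, rfl⟩)

/-! ### The composition is a diagram -/

/-- Away from the middle line the composition agrees locally with one of the two diagrams. On that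
line a marked point ends one thread above and one below, and the two glue to an open arc. -/
theorem comp_point_cases (hE : E.IsDiagram) (hD : D.IsDiagram) (p : (E.comp D).carrier) :
    (IsInteriorPoint p ∧ ¬ ∃ z, z ≠ 0 ∧ (p : ℝ × ℝ) = (E.comp D).mark z) ∨
      (IsBoundaryPoint p ∧ ∃ z, z ≠ 0 ∧ (p : ℝ × ℝ) = (E.comp D).mark z) := by
  obtain ⟨p, hp⟩ := p
  have hb := hE.height_pos
  have ha := hD.height_pos
  have mark_pos : ∀ {z : ℤ}, 0 < z → ∀ D : PlaneSet, (D.mark z).2 = 0 := fun hz D => by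
    rw [mark, if_pos hz]
  have mark_neg : ∀ {z : ℤ}, z < 0 → ∀ D : PlaneSet, (D.mark z).2 = D.height := fun hz D => by
    rw [mark, if_neg hz.not_gt]
  have hup : ∀ z < 0, ((E.comp D).mark z).2 = D.height + E.height := fun z hz => mark_neg hz _
  rcases lt_trichotomy p.2 E.height with h | h | h
  · have hpE : p ∈ E.carrier := (comp_inter_le hE hD).subset ⟨hp, h.le⟩
    have hW : IsOpen {p : ℝ × ℝ | p.2 < E.height} := isOpen_lt continuous_snd continuous_const
    have heq : E.carrier ∩ {p | p.2 < E.height} = (E.comp D).carrier ∩ {p | p.2 < E.height} := by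
      rw [← comp_inter_le hE hD, inter_assoc]
      congr 1
      exact inter_eq_right.2 fun q hq => show q.2 ≤ E.height from le_of_lt hq
    have hiff : (∃ z, z ≠ 0 ∧ p = (E.comp D).mark z) ↔ ∃ z, z ≠ 0 ∧ p = E.mark z := by
      refine exists_congr fun z => and_congr_right fun hz => ?_
      rcases lt_or_gt_of_ne hz with hz | hz
      · refine iff_of_false ?_ ?_ <;> rintro rfl
        · rw [hup z hz] at h; linarith
        · rw [mark_neg hz] at h; linarith
      · rw [comp_mark_pos hz]
    rw [hiff, ← E.mem_marks_iff, ← hE.boundary ⟨p, hpE⟩]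
    rcases hE.manifold ⟨p, hpE⟩ with h1 | h1
    · exact Or.inl ⟨h1.of_inter_eq hW heq h hpE hp, h1.not_isBoundaryPoint⟩
    · exact Or.inr ⟨h1.of_inter_eq hW heq h hpE hp, h1⟩
  · left
    have hpE : p ∈ E.carrier := (comp_inter_le hE hD).subset ⟨hp, h.le⟩
    have hpU : p ∈ E.upper D := (comp_inter_ge hE hD).subset ⟨hp, h.ge⟩
    obtain ⟨z, hz, rfl⟩ := hE.eq_mark_of_top hpE h
    constructor
    · refine isInteriorPoint_glue (isClosed_snd_le E.height) (isClosed_le_snd E.height)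
        (fun p _ => le_total p.2 E.height) (comp_inter_le hE hD) (comp_inter_ge hE hD)
        (W := {p | |p.1 - (z : ℝ)| < 1}) (isOpen_abs_sub_lt _ _) ?_ ?_ hpE hpU hp ?_ ?_
      · simp only [mem_ofPred_eq]; rw [mark, if_neg (by omega)]; simp
      · intro q hq hqE hqU
        obtain ⟨w, hw, rfl⟩ := hE.eq_mark_of_top hqE
          (le_antisymm (hE.subset_strip hqE).2.2 (hD.le_of_mem_upper hqU))
        simp only [mem_ofPred_eq] at hq
        rw [mark, if_neg (by omega), abs_lt] at hq
        push_cast at hq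
        have h1 : (w : ℝ) < z + 1 := by linarith [hq.2]
        have h2 : (z : ℝ) < w + 1 := by linarith [hq.1]
        have h1' : w < z + 1 := by exact_mod_cast h1
        have h2' : z < w + 1 := by exact_mod_cast h2
        rw [show w = z by omega]
      · exact (hE.boundary _).2 (E.mem_marks_iff.2 ⟨-z, by omega, rfl⟩)
      · have h1 : IsBoundaryPoint (⟨D.mark z, hD.mark_mem (by omega)⟩ : D.carrier) :=
          (hD.boundary _).2 (D.mem_marks_iff.2 ⟨z, by omega, rfl⟩)
        have h2 := h1.map ((shiftUp E.height).image D.carrier).isOpenEmbedding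
        have h3 : ((shiftUp E.height).image D.carrier ⟨D.mark z, hD.mark_mem (by omega)⟩) =
            (⟨E.mark (-z), hpU⟩ : E.upper D) := Subtype.ext (shiftUp_mark hz)
        rwa [h3] at h2
    · rintro ⟨w, hw, hwz⟩
      have h1 := congrArg Prod.snd hwz
      rw [mark_neg (by omega)] at h1
      rcases lt_or_gt_of_ne hw with hw | hw
      · rw [hup w hw] at h1; linarith
      · rw [mark_pos hw] at h1; linarith
  · have hpU : p ∈ E.upper D := (comp_inter_ge hE hD).subset ⟨hp, h.le⟩
    obtain ⟨q, hq, rfl⟩ := hpU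
    have hW : IsOpen {p : ℝ × ℝ | E.height < p.2} := isOpen_lt continuous_const continuous_snd
    have heq : E.upper D ∩ {p | E.height < p.2} = (E.comp D).carrier ∩ {p | E.height < p.2} := by
      rw [← comp_inter_ge hE hD, inter_assoc]
      congr 1
      exact inter_eq_right.2 fun q hq => show E.height ≤ q.2 from le_of_lt hq
    have hpU : shiftUp E.height q ∈ E.upper D := ⟨q, hq, rfl⟩
    have hq0 : q.2 ≠ 0 := by
      have : E.height < q.2 + E.height := h
      intro h0; linarith
    have hiff : (∃ z, z ≠ 0 ∧ shiftUp E.height q = (E.comp D).mark z) ↔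
        ∃ z, z ≠ 0 ∧ q = D.mark z := by
      refine exists_congr fun z => and_congr_right fun hz => ?_
      rcases lt_or_gt_of_ne hz with hz | hz
      · rw [comp_mark_neg hz, (shiftUp E.height).injective.eq_iff]
      · refine iff_of_false (fun e => ?_) ?_
        · rw [e, comp_mark_pos hz, mark_pos hz] at h; linarith
        · rintro rfl; exact hq0 (mark_pos hz _)
    simp only
    rw [hiff, ← D.mem_marks_iff, ← hD.boundary ⟨q, hq⟩]
    have hemb := ((shiftUp E.height).image D.carrier).isOpenEmbedding
    rcases hD.manifold ⟨q, hq⟩ with h1 | h1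
    · have h2 : IsInteriorPoint (⟨shiftUp E.height q, hpU⟩ : E.upper D) := h1.map hemb
      exact Or.inl ⟨h2.of_inter_eq hW heq h hpU hp, h1.not_isBoundaryPoint⟩
    · have h2 : IsBoundaryPoint (⟨shiftUp E.height q, hpU⟩ : E.upper D) := h1.map hemb
      exact Or.inr ⟨h2.of_inter_eq hW heq h hpU hp, h1⟩

theorem comp_isOneManifold (hE : E.IsDiagram) (hD : D.IsDiagram) :
    IsOneManifold (E.comp D).carrier :=
  fun p => (comp_point_cases hE hD p).imp And.left And.left

theorem comp_compAt_eq_of_lower (hE : E.IsDiagram) (hD : D.IsDiagram) {T : Set (ℝ × ℝ)}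
    (hT : T ∈ E.components) (hTb : ∀ p ∈ T, p.2 < E.height) {p : ℝ × ℝ} (hp : p ∈ T) :
    (E.comp D).compAt p = T := by
  have hpE := components_subset hT hp
  have hcl : IsRelClopen T (E.comp D).carrier := by
    refine comp_isRelClopen hE hD ((components_subset hT).trans subset_comp) ?_ ?_
    · rw [inter_eq_left.2 (show T ⊆ {p | p.2 ≤ E.height} from fun p hp => (hTb p hp).le)]
      exact hE.isRelClopen hT
    · rw [show T ∩ {p | E.height ≤ p.2} = ∅ from ?_]
      · exact isRelClopen_empty _
      · ext q
        simp only [mem_inter_iff, mem_ofPred_eq, mem_empty_iff_false, iff_false, not_and, not_le]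
        exact hTb q
  refine Subset.antisymm (hcl.subset_of_isPreconnected isPreconnected_connectedComponentIn
    (compAt_subset p) ⟨p, mem_compAt (subset_comp hpE), hp⟩) ?_
  exact (components_isPreconnected hT).subset_connectedComponentIn hp
    ((components_subset hT).trans subset_comp)

theorem comp_compAt_eq_of_upper (hE : E.IsDiagram) (hD : D.IsDiagram) {T : Set (ℝ × ℝ)}
    (hT : T ∈ D.components) (hTb : ∀ p ∈ T, 0 < p.2) {p : ℝ × ℝ} (hp : p ∈ T) :
    (E.comp D).compAt (shiftUp E.height p) = shiftUp E.height '' T := by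
  have hpD := components_subset hT hp
  have hsub : shiftUp E.height '' T ⊆ (E.comp D).carrier :=
    (image_mono (components_subset hT)).trans upper_subset_comp
  have hTb' : ∀ q ∈ shiftUp E.height '' T, E.height < q.2 := by
    rintro _ ⟨q, hq, rfl⟩
    change E.height < q.2 + E.height
    linarith [hTb q hq]
  have hcl : IsRelClopen (shiftUp E.height '' T) (E.comp D).carrier := by
    refine comp_isRelClopen hE hD hsub ?_ ?_
    · rw [show shiftUp E.height '' T ∩ {p | p.2 ≤ E.height} = ∅ from ?_]
      · exact isRelClopen_empty _
      · ext q
        simp only [mem_inter_iff, mem_ofPred_eq, mem_empty_iff_false, iff_false, not_and, not_le]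
        exact hTb' q
    · rw [inter_eq_left.2 (show shiftUp E.height '' T ⊆ {p | E.height ≤ p.2} from
        fun p hp => (hTb' p hp).le)]
      exact (hD.isRelClopen hT).image _
  refine Subset.antisymm (hcl.subset_of_isPreconnected isPreconnected_connectedComponentIn
    (compAt_subset _) ⟨_, mem_compAt (hsub ⟨p, hp, rfl⟩), ⟨p, hp, rfl⟩⟩) ?_
  exact ((components_isPreconnected hT).image _
    (shiftUp E.height).continuous.continuousOn).subset_connectedComponentIn ⟨p, hp, rfl⟩ hsub

/-- A component of `E ∘ D` meets the middle line, or is a component of `E` or of `D`. -/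
theorem comp_component_cases (hE : E.IsDiagram) (hD : D.IsDiagram) {S : Set (ℝ × ℝ)}
    (hS : S ∈ (E.comp D).components) : (∃ z : ℤ, 0 < z ∧ E.mark (-z) ∈ S) ∨
      (S ∈ E.components ∧ ∀ p ∈ S, p.2 < E.height) ∨
      ∃ T ∈ D.components, S = shiftUp E.height '' T ∧ ∀ p ∈ T, 0 < p.2 := by
  by_cases hmid : ∃ p ∈ S, p.2 = E.height
  · obtain ⟨p, hp, hpb⟩ := hmid
    have hpE := (comp_inter_le hE hD).subset ⟨components_subset hS hp, hpb.le⟩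
    obtain ⟨z, hz, rfl⟩ := hE.eq_mark_of_top hpE hpb
    exact Or.inl ⟨z, hz, hp⟩
  · push Not at hmid
    right
    have hpre := ((components_isPreconnected hS).image Prod.snd
      continuous_snd.continuousOn).ordConnected
    obtain ⟨p, hp⟩ := components_nonempty hS
    have hpc := components_subset hS hp
    rcases lt_or_gt_of_ne (hmid p hp) with h | h
    · left
      have hlow : ∀ q ∈ S, q.2 < E.height := fun q hq => by
        by_contra hge
        obtain ⟨r, hr, hrb⟩ := hpre.out ⟨p, hp, rfl⟩ ⟨q, hq, rfl⟩ ⟨h.le, not_lt.1 hge⟩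
        exact hmid r hr hrb
      have hpE := (comp_inter_le hE hD).subset ⟨hpc, h.le⟩
      have hSE : S = E.compAt p := by
        refine Subset.antisymm ?_ ?_
        · exact (components_isPreconnected hS).subset_connectedComponentIn hp fun q hq =>
            (comp_inter_le hE hD).subset ⟨components_subset hS hq, (hlow q hq).le⟩
        · rw [eq_compAt hS hp]
          exact fun q hq => mem_comp_compAt hq
      exact ⟨hSE ▸ compAt_mem_components hpE, hlow⟩
    · right
      have hlow : ∀ q ∈ S, E.height < q.2 := fun q hq => by
        by_contra hge
        obtain ⟨r, hr, hrb⟩ := hpre.out ⟨q, hq, rfl⟩ ⟨p, hp, rfl⟩ ⟨not_lt.1 hge, h.le⟩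
        exact hmid r hr hrb
      obtain ⟨q, hq, rfl⟩ := (comp_inter_ge hE hD).subset ⟨hpc, h.le⟩
      have hSE : S = shiftUp E.height '' D.compAt q := by
        rw [image_compAt hq]
        refine Subset.antisymm ?_ ?_
        · exact (components_isPreconnected hS).subset_connectedComponentIn hp fun q hq =>
            (comp_inter_ge hE hD).subset ⟨components_subset hS hq, (hlow q hq).le⟩
        · rw [eq_compAt hS hp]
          exact connectedComponentIn_mono _ upper_subset_comp
      refine ⟨_, compAt_mem_components hq, hSE, fun r hr => ?_⟩
      have : E.height < r.2 + E.height := hlow (shiftUp E.height r) (hSE ▸ ⟨r, hr, rfl⟩)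
      linarith

theorem IsDiagram.partner_of_level (hD : D.IsDiagram) {n : ℕ}
    (hv : ∀ k : ℕ, n + 1 ≤ k → D.mark (-k) ∈ D.compAt (D.mark k)) {z w : ℤ} (hz : z ≠ 0)
    (hw : w ≠ 0) (h : D.mark w ∈ D.compAt (D.mark z)) (hwn : (n : ℤ) < |w|) :
    w = z ∨ w = -z := by
  obtain ⟨σ, hσ⟩ := hD.exists_hasInvariant
  rcases hσ.eq_or_eq hD hz hw h with h1 | h1
  · exact Or.inl h1
  · right
    have h2 := (hσ.pairingLevel hD hv) w hwn
    rw [h1] at h2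
    have h3 := hσ.pairing.invol z
    simp only at h1 h2 h3
    rw [h3] at h2
    omega

/-- Matching parts of `E` and `D` form a part of `E ∘ D`. -/
theorem comp_union_inter (hE : E.IsDiagram) (hD : D.IsDiagram) {K L : Set (ℝ × ℝ)}
    (hK : K ⊆ E.carrier) (hL : L ⊆ D.carrier)
    (h : ∀ w : ℤ, 0 < w → (E.mark (-w) ∈ K ↔ D.mark w ∈ L)) :
    (K ∪ shiftUp E.height '' L) ∩ {p | p.2 ≤ E.height} = K ∧
    (K ∪ shiftUp E.height '' L) ∩ {p | E.height ≤ p.2} = shiftUp E.height '' L := by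
  constructor
  · refine Subset.antisymm ?_ fun p hp => ⟨Or.inl hp, (hE.subset_strip (hK hp)).2.2⟩
    rintro p ⟨hp | ⟨q, hq, rfl⟩, hpb⟩
    · exact hp
    · have hpb : q.2 + E.height ≤ E.height := hpb
      obtain ⟨w, hw, rfl⟩ := hD.eq_mark_of_bot (hL hq)
        (le_antisymm (by linarith) (hD.subset_strip (hL hq)).2.1)
      rw [shiftUp_mark hw]
      exact (h w hw).2 hq
  · refine Subset.antisymm ?_ fun p hp => ⟨Or.inr hp, hD.le_of_mem_upper (image_mono hL hp)⟩
    rintro p ⟨hp | hp, hpb⟩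
    · obtain ⟨w, hw, rfl⟩ := hE.eq_mark_of_top (hK hp)
        (le_antisymm (hE.subset_strip (hK hp)).2.2 hpb)
      exact ⟨_, (h w hw).1 hp, shiftUp_mark hw⟩
    · exact hp

theorem comp_union_subset {K L : Set (ℝ × ℝ)} (hK : K ⊆ E.carrier) (hL : L ⊆ D.carrier) :
    K ∪ shiftUp E.height '' L ⊆ (E.comp D).carrier :=
  union_subset (hK.trans subset_comp) ((image_mono hL).trans upper_subset_comp)

theorem comp_union_isRelClopen (hE : E.IsDiagram) (hD : D.IsDiagram) {K L : Set (ℝ × ℝ)}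
    (hK : IsRelClopen K E.carrier) (hL : IsRelClopen L D.carrier)
    (h : ∀ w : ℤ, 0 < w → (E.mark (-w) ∈ K ↔ D.mark w ∈ L)) :
    IsRelClopen (K ∪ shiftUp E.height '' L) (E.comp D).carrier := by
  obtain ⟨h1, h2⟩ := comp_union_inter hE hD hK.1 hL.1 h
  exact comp_isRelClopen hE hD (comp_union_subset hK.1 hL.1) (by rwa [h1])
    (by rw [h2]; exact hL.image _)

/-- As `N ≥ n` and threads beyond `n` are vertical, the threads of `E` and of `D` through the first
`N` middle points meet the middle line in exactly these points. Their union is compact and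
relatively clopen in the composition, so it contains the component. -/
theorem comp_isCompact_of_mid (hE : E.IsDiagram) (hD : D.IsDiagram) {n : ℕ}
    (hvE : ∀ k : ℕ, n + 1 ≤ k → E.mark (-k) ∈ E.compAt (E.mark k))
    (hvD : ∀ k : ℕ, n + 1 ≤ k → D.mark (-k) ∈ D.compAt (D.mark k)) {z : ℤ} (hz : 0 < z) :
    IsCompact ((E.comp D).compAt (E.mark (-z))) := by
  set N := max z n
  have hzN : z ≤ N := le_max_left _ _
  have hnN : (n : ℤ) ≤ N := le_max_right _ _
  set K := ⋃ w ∈ Icc 1 N, E.compAt (E.mark (-w))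
  set L := ⋃ w ∈ Icc 1 N, D.compAt (D.mark w)
  have hKE : K ⊆ E.carrier := iUnion₂_subset fun w _ => compAt_subset _
  have hLD : L ⊆ D.carrier := iUnion₂_subset fun w _ => compAt_subset _
  have hKc : IsRelClopen K E.carrier := .biUnion (finite_Icc _ _) fun w hw =>
    hE.isRelClopen (compAt_mem_components (hE.mark_mem (by have := hw.1; omega)))
  have hLc : IsRelClopen L D.carrier := .biUnion (finite_Icc _ _) fun w hw =>
    hD.isRelClopen (compAt_mem_components (hD.mark_mem (by have := hw.1; omega)))
  have hK : IsCompact K := (finite_Icc _ _).isCompact_biUnion fun w hw =>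
    hE.compact_components _ (compAt_mem_components (hE.mark_mem (by have := hw.1; omega)))
  have hL : IsCompact L := (finite_Icc _ _).isCompact_biUnion fun w hw =>
    hD.compact_components _ (compAt_mem_components (hD.mark_mem (by have := hw.1; omega)))
  have hKmid : ∀ w : ℤ, 0 < w → (E.mark (-w) ∈ K ↔ w ≤ N) := fun w hw => by
    constructor
    · intro h
      obtain ⟨v, hv, hwv⟩ := mem_iUnion₂.1 h
      obtain ⟨hv1, hv2⟩ := mem_Icc.1 hv
      by_contra hlt
      have := hE.partner_of_level hvE (z := -v) (w := -w) (by omega) (by omega) hwv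
        (by rw [abs_neg, abs_of_pos hw]; omega)
      omega
    · intro h
      exact mem_biUnion (mem_Icc.2 ⟨hw, h⟩) (mem_compAt (hE.mark_mem (by omega)))
  have hLmid : ∀ w : ℤ, 0 < w → (D.mark w ∈ L ↔ w ≤ N) := fun w hw => by
    constructor
    · intro h
      obtain ⟨v, hv, hwv⟩ := mem_iUnion₂.1 h
      obtain ⟨hv1, hv2⟩ := mem_Icc.1 hv
      by_contra hlt
      have := hD.partner_of_level hvD (z := v) (w := w) (by omega) (by omega) hwv
        (by rw [abs_of_pos hw]; omega)
      omega
    · intro h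
      exact mem_biUnion (mem_Icc.2 ⟨hw, h⟩) (mem_compAt (hD.mark_mem (by omega)))
  have hsub := comp_union_subset hKE hLD
  have hcl := comp_union_isRelClopen hE hD hKc hLc
    fun w hw => (hKmid w hw).trans (hLmid w hw).symm
  have hm : E.mark (-z) ∈ (E.comp D).carrier := subset_comp (hE.mark_mem (by omega))
  refine ((comp_isOneManifold hE hD).isRelClopen_connectedComponentIn hm).isCompact
    (hK.union (hL.image (shiftUp E.height).continuous)) ?_ hsub
  exact hcl.subset_of_isPreconnected isPreconnected_connectedComponentIn
    (compAt_subset _) ⟨_, mem_compAt hm, Or.inl ((hKmid z hz).2 hzN)⟩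

theorem comp_isDiagram (hE : E.IsDiagram) (hD : D.IsDiagram) {n : ℕ}
    (hvE : ∀ k : ℕ, n + 1 ≤ k → E.mark (-k) ∈ E.compAt (E.mark k))
    (hvD : ∀ k : ℕ, n + 1 ≤ k → D.mark (-k) ∈ D.compAt (D.mark k)) : (E.comp D).IsDiagram := by
  have ha := hD.height_pos
  have hb := hE.height_pos
  have hh : (E.comp D).height = D.height + E.height := rfl
  refine ⟨add_pos ha hb, ?_, ?_, ?_, comp_isOneManifold hE hD, fun p => ?_, fun S hS => ?_⟩
  · rw [comp_carrier]
    rintro p (⟨q, hq, rfl⟩ | hp)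
    · obtain ⟨h1, h2, h3⟩ := hD.subset_strip hq
      refine ⟨h1, ?_, ?_⟩ <;> rw [shiftUp_apply] <;> simp only <;> linarith
    · obtain ⟨h1, h2, h3⟩ := hE.subset_strip hp
      exact ⟨h1, h2, by linarith⟩
  · refine Subset.antisymm ?_ ?_
    · rintro p ⟨hp, h0, h1⟩
      have h1 : p.2 = D.height + E.height := h1
      obtain ⟨q, hq, rfl⟩ := (comp_inter_ge hE hD).subset
        ⟨hp, show E.height ≤ p.2 by linarith⟩
      rw [shiftUp_apply] at h1
      obtain ⟨i, hi, rfl⟩ := hD.inter_top.subset ⟨hq, h0, by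
        show q.2 = D.height
        simp only at h1; linarith⟩
      exact ⟨i, hi, rfl⟩
    · rintro p ⟨i, hi, rfl⟩
      refine ⟨upper_subset_comp ⟨D.topPt i, ?_, rfl⟩, by simp [topPt], rfl⟩
      exact (hD.inter_top.symm.subset ⟨i, hi, rfl⟩).1
  · refine Subset.antisymm ?_ ?_
    · rintro p ⟨hp, h0, h1⟩
      have h1 : p.2 = 0 := h1
      have := (comp_inter_le hE hD).subset ⟨hp, show p.2 ≤ E.height by linarith⟩
      exact hE.inter_bot.subset ⟨this, h0, h1⟩
    · intro p hp
      have := hE.inter_bot.symm.subset hp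
      exact ⟨subset_comp this.1, this.2⟩
  · rw [mem_marks_iff]
    rcases comp_point_cases hE hD p with ⟨h1, h2⟩ | ⟨h1, h2⟩
    · exact ⟨fun hb => absurd hb h1.not_isBoundaryPoint, fun hm => absurd hm h2⟩
    · exact ⟨fun _ => h2, fun _ => h1⟩
  · rcases comp_component_cases hE hD hS with ⟨z, hz, hm⟩ | ⟨h, -⟩ | ⟨T, hT, rfl, -⟩
    · rw [eq_compAt hS hm]
      exact comp_isCompact_of_mid hE hD hvE hvD hz
    · exact hE.compact_components S h
    · exact (hD.compact_components T hT).image (shiftUp E.height).continuous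

/-! ### Threads and circular components of a composition -/

theorem comp_vertical {k : ℕ} (hk : 1 ≤ k) (hE : E.mark (-k) ∈ E.compAt (E.mark k))
    (hD : D.mark (-k) ∈ D.compAt (D.mark k)) :
    (E.comp D).mark (-k) ∈ (E.comp D).compAt ((E.comp D).mark k) := by
  have h1 := shiftUp_mem_comp_compAt (E := E) hD
  have hk' : (0 : ℤ) < k := by omega
  rw [shiftUp_mark hk'] at h1
  rw [comp_mark_neg (neg_lt_zero.2 hk'), comp_mark_pos hk']
  exact compAt_trans (mem_comp_compAt hE) h1

/-- A component missing the middle line lies in one half and is a component there. Having no outer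
marked points and not touching the middle line, it is circular in `E` or in `D`. -/
theorem comp_circular_cases (hE : E.IsDiagram) (hD : D.IsDiagram) (hED : (E.comp D).IsDiagram)
    {S : Set (ℝ × ℝ)} (hS : S ∈ (E.comp D).circularComponents) :
    (∃ z : ℤ, 0 < z ∧ S = (E.comp D).compAt (E.mark (-z))) ∨ S ∈ E.circularComponents ∨
      S ∈ (fun T => shiftUp E.height '' T) '' D.circularComponents := by
  obtain ⟨hSc, hSm⟩ := hED.mem_circularComponents_iff.1 hS
  rcases comp_component_cases hE hD hSc with ⟨z, hz, hm⟩ | ⟨h, h'⟩ | ⟨T, hT, rfl, hT'⟩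
  · exact Or.inl ⟨z, hz, eq_compAt hSc hm⟩
  · refine Or.inr (Or.inl (hE.mem_circularComponents_iff.2 ⟨h, fun z hz hzS => ?_⟩))
    rcases lt_or_gt_of_ne hz with hz' | hz'
    · have := h' _ hzS
      rw [mark, if_neg hz'.not_gt] at this
      exact lt_irrefl _ this
    · exact hSm z hz (by rwa [comp_mark_pos hz'])
  · refine Or.inr (Or.inr ⟨T, hD.mem_circularComponents_iff.2 ⟨hT, fun z hz hzS => ?_⟩, rfl⟩)
    rcases lt_or_gt_of_ne hz with hz' | hz'
    · exact hSm z hz (by rw [comp_mark_neg hz']; exact ⟨_, hzS, rfl⟩)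
    · have := hT' _ hzS
      rw [mark, if_pos hz'] at this
      exact lt_irrefl _ this

theorem circular_snd_lt (hE : E.IsDiagram) {S : Set (ℝ × ℝ)} (hS : S ∈ E.circularComponents) :
    ∀ p ∈ S, 0 < p.2 ∧ p.2 < E.height := by
  obtain ⟨hSc, hSm⟩ := hE.mem_circularComponents_iff.1 hS
  intro p hp
  have hpE := components_subset hSc hp
  obtain ⟨-, h0, h1⟩ := hE.subset_strip hpE
  refine ⟨lt_of_le_of_ne h0 fun h => ?_, lt_of_le_of_ne h1 fun h => ?_⟩
  · obtain ⟨z, hz, rfl⟩ := hE.eq_mark_of_bot hpE h.symm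
    exact hSm z (by omega) hp
  · obtain ⟨z, hz, rfl⟩ := hE.eq_mark_of_top hpE h
    exact hSm (-z) (by omega) hp

theorem mem_comp_circular_of_lower (hE : E.IsDiagram) (hD : D.IsDiagram)
    (hED : (E.comp D).IsDiagram) {S : Set (ℝ × ℝ)} (hS : S ∈ E.circularComponents) :
    S ∈ (E.comp D).circularComponents := by
  have hlt := circular_snd_lt hE hS
  obtain ⟨p, hp⟩ := components_nonempty hS.1
  refine hED.mem_circularComponents_iff.2
    ⟨⟨p, subset_comp (components_subset hS.1 hp),
      (comp_compAt_eq_of_lower hE hD hS.1 (fun q hq => (hlt q hq).2) hp).symm⟩, fun z hz hzS => ?_⟩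
  obtain ⟨h1, h2⟩ := hlt _ hzS
  have := hD.height_pos
  rw [mark] at h1 h2
  split_ifs at h1 h2
  · exact lt_irrefl _ h1
  · change D.height + E.height < _ at h2
    linarith

theorem mem_comp_circular_of_upper (hE : E.IsDiagram) (hD : D.IsDiagram)
    (hED : (E.comp D).IsDiagram) {S : Set (ℝ × ℝ)} (hS : S ∈ D.circularComponents) :
    shiftUp E.height '' S ∈ (E.comp D).circularComponents := by
  have hlt := circular_snd_lt hD hS
  obtain ⟨p, hp⟩ := components_nonempty hS.1
  refine hED.mem_circularComponents_iff.2
    ⟨⟨_, upper_subset_comp ⟨p, components_subset hS.1 hp, rfl⟩,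
      (comp_compAt_eq_of_upper hE hD hS.1 (fun q hq => (hlt q hq).1) hp).symm⟩, ?_⟩
  rintro z hz ⟨q, hq, hqz⟩
  obtain ⟨h1, h2⟩ := hlt _ hq
  have := hE.height_pos
  have h3 := congrArg Prod.snd hqz
  rw [shiftUp_apply, mark] at h3
  split_ifs at h3
  · simp only at h3; linarith
  · change q.2 + E.height = D.height + E.height at h3
    linarith

end PlaneSet

/-! ### Gaps between neighbouring vertical threads; closure of `n`-friezes under composition. -/

/-- A small ball around a point off `T` meets `C` in a convex set disjoint from `T`, so both a path
component and its complement are relatively open. -/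
theorem isRelClopen_pathComponentIn {C T : Set (ℝ × ℝ)} (hC : Convex ℝ C) (hT : IsClosed T)
    {p : ℝ × ℝ} : IsRelClopen (pathComponentIn (C \ T) p) (C \ T) := by
  have hsub : pathComponentIn (C \ T) p ⊆ C \ T := fun q hq => hq.target_mem
  have key : ∀ q ∈ C \ T, ∃ U, IsOpen U ∧ q ∈ U ∧ ∀ r ∈ U ∩ (C \ T), JoinedIn (C \ T) q r := by
    intro q hq
    obtain ⟨ε, hε, hεT⟩ := Metric.isOpen_iff.1 hT.isOpen_compl q hq.2
    refine ⟨Metric.ball q ε, Metric.isOpen_ball, Metric.mem_ball_self hε, fun r hr => ?_⟩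
    have hcv : Convex ℝ (Metric.ball q ε ∩ C) := (convex_ball q ε).inter hC
    have hqm : q ∈ Metric.ball q ε ∩ C := ⟨Metric.mem_ball_self hε, hq.1⟩
    exact ((hcv.isPathConnected ⟨q, hqm⟩).joinedIn q hqm r ⟨hr.1, hr.2.1⟩).mono
      fun s hs => ⟨hs.2, hεT hs.1⟩
  refine .of_isClopen hsub ⟨⟨?_⟩, ?_⟩ <;> refine isOpen_iff_mem_nhds.2 fun q hq => ?_ <;>
    obtain ⟨U, hU, hqU, h⟩ := key q q.2
  · refine mem_of_superset ((hU.preimage continuous_subtype_val).mem_nhds hqU) fun r hr hr' => hq ?_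
    exact JoinedIn.trans hr' (h r ⟨hr, r.2⟩).symm
  · refine mem_of_superset ((hU.preimage continuous_subtype_val).mem_nhds hqU) fun r hr => ?_
    exact JoinedIn.trans hq (h r ⟨hr, r.2⟩)

theorem convex_strip (a : ℝ) : Convex ℝ (strip a) := by
  have : strip a = Ici 0 ×ˢ Icc 0 a := by ext p; simp [strip]
  rw [this]
  exact (convex_Ici 0).prod (convex_Icc 0 a)

namespace PlaneSet

variable {E D : PlaneSet} {k : ℤ}

/-- The strip without the threads that start in `(k-1,0)` and `(k,0)`. -/
def gapStrip (D : PlaneSet) (k : ℤ) : Set (ℝ × ℝ) :=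
  strip D.height \ (D.compAt (D.mark (k - 1)) ∪ D.compAt (D.mark k))

/-- The part of the strip that can be reached from `(k-1/2,0)` without meeting the threads that
start in `(k-1,0)` and `(k,0)`. -/
def gap (D : PlaneSet) (k : ℤ) : Set (ℝ × ℝ) := pathComponentIn (D.gapStrip k) ((k : ℝ) - 1 / 2, 0)

/-- The marked points `k-1` and `k` are joined vertically. -/
structure IsVerticalAt (D : PlaneSet) (k : ℤ) : Prop where
  two_le : 2 ≤ k
  left : D.mark (-(k - 1)) ∈ D.compAt (D.mark (k - 1))
  right : D.mark (-k) ∈ D.compAt (D.mark k)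

theorem mark_fst (D : PlaneSet) (z : ℤ) : (D.mark z).1 = |z| := by
  rw [mark]
  split_ifs with h
  · simp [abs_of_pos h]
  · simp [abs_of_nonpos (not_lt.1 h)]

theorem mark_snd (D : PlaneSet) (z : ℤ) : (D.mark z).2 = 0 ∨ (D.mark z).2 = D.height := by
  rw [mark]
  split_ifs with h
  · exact Or.inl rfl
  · exact Or.inr rfl

theorem IsDiagram.isPathConnected_compAt (hD : D.IsDiagram) {z : ℤ} (hz : z ≠ 0) :
    IsPathConnected (D.compAt (D.mark z)) := by
  obtain ⟨-, -, -, -, -, e, -⟩ := hD.exists_partner hz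
  rw [isPathConnected_iff_pathConnectedSpace]
  have : PathConnectedSpace (Icc (0 : ℝ) 1) := by
    rw [← isPathConnected_iff_pathConnectedSpace]
    exact (convex_Icc 0 1).isPathConnected ⟨0, by simp⟩
  exact e.surjective.pathConnectedSpace e.continuous

theorem IsDiagram.isClosed_compAt (hD : D.IsDiagram) {z : ℤ} (hz : z ≠ 0) :
    IsClosed (D.compAt (D.mark z)) :=
  (hD.compact_components _ (compAt_mem_components (hD.mark_mem hz))).isClosed

theorem IsDiagram.joinedIn_vertical (hD : D.IsDiagram) {j : ℤ} (hj : 0 < j)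
    (h : D.mark (-j) ∈ D.compAt (D.mark j)) :
    JoinedIn (D.compAt (D.mark j)) ((j : ℝ), 0) ((j : ℝ), D.height) := by
  have h1 := (hD.isPathConnected_compAt hj.ne').joinedIn _ (mem_compAt (hD.mark_mem hj.ne')) _ h
  rw [mark, if_pos hj, mark, if_neg (by omega)] at h1
  rw [mark, if_pos hj]
  simpa using h1

theorem IsDiagram.eq_mark_of_level (hD : D.IsDiagram) {p : ℝ × ℝ} (hp : p ∈ D.carrier)
    (h : p.2 = 0 ∨ p.2 = D.height) : ∃ z : ℤ, z ≠ 0 ∧ p = D.mark z := by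
  rcases h with h | h
  · obtain ⟨z, hz, rfl⟩ := hD.eq_mark_of_bot hp h
    exact ⟨z, by omega, rfl⟩
  · obtain ⟨z, hz, rfl⟩ := hD.eq_mark_of_top hp h
    exact ⟨-z, by omega, rfl⟩

/-- A point of the gap at the bottom or at the top lies strictly between `k-1` and `k`. -/
theorem IsVerticalAt.mem_Ioo_of_mem_gap (hk : D.IsVerticalAt k) (hD : D.IsDiagram) {q : ℝ × ℝ}
    (hq : q ∈ D.gap k) (hq2 : q.2 = 0 ∨ q.2 = D.height) : (k : ℝ) - 1 < q.1 ∧ q.1 < k := by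
  have hk2 := hk.two_le
  have ha := hD.height_pos
  have hs : ∀ z, ∀ p ∈ D.compAt z, 0 ≤ p.2 ∧ p.2 ≤ D.height := fun z p hp =>
    (hD.subset_strip (compAt_subset z hp)).2
  have hg : ∀ p ∈ D.gapStrip k, 0 ≤ p.2 ∧ p.2 ≤ D.height := fun p hp => hp.1.2
  have hqm : q = (q.1, 0) ∨ q = (q.1, D.height) :=
    hq2.imp (fun h => Prod.ext rfl h) (fun h => Prod.ext rfl h)
  have hvert : ∀ j : ℤ, 0 < j → (j = k - 1 ∨ j = k) → q.1 ≠ j := by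
    intro j hj hjk hqj
    have hmem : q ∈ D.compAt (D.mark j) := by
      rcases hqm with h | h
      · rw [h, hqj, show (((j : ℝ), (0 : ℝ)) : ℝ × ℝ) = D.mark j by rw [mark, if_pos hj]]
        exact mem_compAt (hD.mark_mem hj.ne')
      · rw [h, hqj, show (((j : ℝ), D.height) : ℝ × ℝ) = D.mark (-j) by
          rw [mark, if_neg (by omega)]; simp]
        rcases hjk with rfl | rfl
        · exact hk.left
        · exact hk.right
    rcases hjk with rfl | rfl
    · exact hq.target_mem.2 (Or.inl hmem)
    · exact hq.target_mem.2 (Or.inr hmem)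
  have hdis : ∀ j : ℤ, (j = k - 1 ∨ j = k) → ¬ (D.compAt (D.mark j) ∩ D.gapStrip k).Nonempty := by
    rintro j (rfl | rfl) ⟨p, hp, hp'⟩
    · exact hp'.2 (Or.inl hp)
    · exact hp'.2 (Or.inr hp)
  -- A path leaving the base point and returning to the top or bottom outside `(k - 1, k)` would
  -- have to cross one of the two vertical threads.
  constructor
  · by_contra hlt
    have hlt : q.1 < (k : ℝ) - 1 := lt_of_le_of_ne (not_lt.1 hlt) (by
      have := hvert (k - 1) (by omega) (Or.inl rfl)
      push_cast at this; exact this)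
    refine hdis (k - 1) (Or.inl rfl) (strip_inter_nonempty_of_vertical ha (hs _) hg hqm
      (Or.inl rfl) (j := ((k - 1 : ℤ) : ℝ)) (by push_cast; exact hlt)
      (y := (k : ℝ) - 1 / 2) (by push_cast; linarith)
      (hD.joinedIn_vertical (by omega) hk.left) hq.symm)
  · by_contra hlt
    have hlt : (k : ℝ) < q.1 := lt_of_le_of_ne (not_lt.1 hlt)
      (hvert k (by omega) (Or.inr rfl)).symm
    exact hdis k (Or.inr rfl) (strip_inter_nonempty_of_vertical ha (hs _) hg
      (Or.inl rfl) hqm (x := (k : ℝ) - 1 / 2) (by linarith) hlt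
      (hD.joinedIn_vertical (by omega) hk.right) hq)

/-- The diagram meets the edges of the strip only in marked points, whose abscissae are integers, so
the segment itself is a path. -/
theorem IsVerticalAt.joinedIn_level (hk : D.IsVerticalAt k) (hD : D.IsDiagram) {y : ℝ}
    (hy : y = 0 ∨ y = D.height) {x x' : ℝ} (h1 : (k : ℝ) - 1 < x) (h2 : x < k)
    (h1' : (k : ℝ) - 1 < x') (h2' : x' < k) : JoinedIn (D.gapStrip k) (x, y) (x', y) := by
  have hk2 : (2 : ℝ) ≤ k := by exact_mod_cast hk.two_le
  have ha := hD.height_pos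
  have hc : Convex ℝ (Ioo ((k : ℝ) - 1) k ×ˢ {y}) := (convex_Ioo _ _).prod (convex_singleton y)
  refine ((hc.isPathConnected ⟨(x, y), ⟨h1, h2⟩, rfl⟩).joinedIn (x, y) ⟨⟨h1, h2⟩, rfl⟩ (x', y)
    ⟨⟨h1', h2'⟩, rfl⟩).mono ?_
  rintro ⟨u, v⟩ ⟨⟨hu1, hu2⟩, hv⟩
  obtain rfl : v = y := hv
  simp only at hu1 hu2
  refine ⟨⟨by simp only; linarith, ?_, ?_⟩, ?_⟩
  · rcases hy with rfl | rfl
    · exact le_rfl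
    · exact ha.le
  · rcases hy with rfl | rfl
    · exact ha.le
    · exact le_rfl
  · intro h
    have hmem : (u, v) ∈ D.carrier := h.elim (fun h => compAt_subset _ h) fun h => compAt_subset _ h
    obtain ⟨z, hz, hzm⟩ := hD.eq_mark_of_level hmem hy
    have h3 := congrArg Prod.fst hzm
    rw [mark_fst] at h3
    simp only at h3
    rw [h3] at hu1 hu2
    have e1 : k - 1 < |z| := by exact_mod_cast hu1
    have e2 : |z| < k := by exact_mod_cast hu2
    omega

theorem IsVerticalAt.mem_gap_level (hk : D.IsVerticalAt k) (hD : D.IsDiagram) {x y x' : ℝ}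
    (hy : y = 0 ∨ y = D.height) (h : (x, y) ∈ D.gap k) (h1 : (k : ℝ) - 1 < x') (h2 : x' < k) :
    (x', y) ∈ D.gap k := by
  obtain ⟨h3, h4⟩ := hk.mem_Ioo_of_mem_gap hD h hy
  exact JoinedIn.trans h (hk.joinedIn_level hD hy h3 h4 h1 h2)

theorem IsVerticalAt.base_mem (hk : D.IsVerticalAt k) (hD : D.IsDiagram) :
    ((k : ℝ) - 1 / 2, (0 : ℝ)) ∈ D.gap k :=
  hk.joinedIn_level hD (Or.inl rfl) (by linarith) (by linarith) (by linarith) (by linarith)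

/-- In `gapStrip` only two threads are removed, so that the removed set is closed. Nothing is lost:
a further thread meeting the gap would lie in it entirely, and its end would be a marked point
strictly between `k - 1` and `k`. -/
theorem IsVerticalAt.gap_subset_regionAt (hk : D.IsVerticalAt k) (hD : D.IsDiagram) :
    D.gap k ⊆ D.regionAt ((k : ℝ) - 1 / 2, 0) := by
  have hbase := hk.base_mem hD
  have hk2 := hk.two_le
  have hpc : IsPathConnected (D.gap k) := isPathConnected_pathComponentIn hbase.source_mem
  refine hpc.isConnected.isPreconnected.subset_connectedComponentIn hbase ?_
  refine fun q hq => ⟨hq.target_mem.1, ?_⟩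
  rintro ⟨S, hS, hqS⟩
  obtain ⟨z, hz, rfl⟩ := hD.mem_threads_iff.1 hS
  have hSF : D.compAt (D.mark z) ⊆ D.gapStrip k := by
    refine fun r hr => ⟨hD.subset_strip (compAt_subset _ hr), fun h => hq.target_mem.2 ?_⟩
    refine h.imp (fun h => ?_) fun h => ?_
    · rwa [← compAt_eq h, compAt_eq hr]
    · rwa [← compAt_eq h, compAt_eq hr]
  have hzg : D.mark z ∈ D.gap k := JoinedIn.trans hq
    (((hD.isPathConnected_compAt hz).joinedIn q hqS _ (mem_compAt (hD.mark_mem hz))).mono hSF)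
  obtain ⟨h1, h2⟩ := hk.mem_Ioo_of_mem_gap hD hzg (D.mark_snd z)
  rw [mark_fst] at h1 h2
  have e1 : k - 1 < |z| := by exact_mod_cast h1
  have e2 : |z| < k := by exact_mod_cast h2
  omega

theorem IsVerticalAt.isRelClopen_gap (hk : D.IsVerticalAt k) (hD : D.IsDiagram) :
    IsRelClopen (D.gap k) (D.gapStrip k) := by
  have hk2 := hk.two_le
  exact isRelClopen_pathComponentIn (convex_strip _)
    ((hD.isClosed_compAt (by omega)).union (hD.isClosed_compAt (by omega)))

/-! ### Gaps in a composition -/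

/-- Each of the two vertical threads meets the middle line only at `j`. Their union is therefore
relatively clopen, and it is connected through that point. -/
theorem comp_compAt_vertical (hE : E.IsDiagram) (hD : D.IsDiagram) {j : ℤ} (hj : 0 < j)
    (hEj : E.mark (-j) ∈ E.compAt (E.mark j)) (hDj : D.mark (-j) ∈ D.compAt (D.mark j)) :
    (E.comp D).compAt ((E.comp D).mark j) ∩ {p | p.2 ≤ E.height} = E.compAt (E.mark j) ∧
    (E.comp D).compAt ((E.comp D).mark j) ∩ {p | E.height ≤ p.2} =
      shiftUp E.height '' D.compAt (D.mark j) := by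
  have hEc := compAt_mem_components (hE.mark_mem hj.ne')
  have hDc := compAt_mem_components (hD.mark_mem hj.ne')
  have hlevel : ∀ w : ℤ, 0 < w → (E.mark (-w) ∈ E.compAt (E.mark j) ↔ w = j) := by
    intro w hw
    refine ⟨fun h => ?_, by rintro rfl; exact hEj⟩
    obtain ⟨σ, hσ⟩ := hE.exists_hasInvariant
    have h1 := hσ.eq_or_eq hE hj.ne' (by omega) h
    have h2 := hσ.eq_or_eq hE hj.ne' (by omega) hEj
    omega
  have hlevel' : ∀ w : ℤ, 0 < w → (D.mark w ∈ D.compAt (D.mark j) ↔ w = j) := by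
    intro w hw
    refine ⟨fun h => ?_, by rintro rfl; exact mem_compAt (hD.mark_mem hw.ne')⟩
    obtain ⟨σ, hσ⟩ := hD.exists_hasInvariant
    have h1 := hσ.eq_or_eq hD hj.ne' (by omega) h
    have h2 := hσ.eq_or_eq hD hj.ne' (by omega) hDj
    omega
  set K := E.compAt (E.mark j)
  set L := D.compAt (D.mark j)
  have hKE : K ⊆ E.carrier := compAt_subset _
  have hLD : L ⊆ D.carrier := compAt_subset _
  have hsub := comp_union_subset hKE hLD
  have hmid : ∀ w : ℤ, 0 < w → (E.mark (-w) ∈ K ↔ D.mark w ∈ L) := fun w hw =>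
    (hlevel w hw).trans (hlevel' w hw).symm
  have hcl := comp_union_isRelClopen hE hD (hE.isRelClopen hEc) (hD.isRelClopen hDc) hmid
  have hm : E.mark j ∈ K := mem_compAt (hE.mark_mem hj.ne')
  have heq : (E.comp D).compAt ((E.comp D).mark j) = K ∪ shiftUp E.height '' L := by
    rw [comp_mark_pos hj]
    refine Subset.antisymm ?_ (union_subset (fun q hq => mem_comp_compAt hq) ?_)
    · exact hcl.subset_of_isPreconnected isPreconnected_connectedComponentIn
        (compAt_subset _) ⟨_, mem_compAt (hsub (Or.inl hm)), Or.inl hm⟩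
    · rintro _ ⟨q, hq, rfl⟩
      have h1 := shiftUp_mem_comp_compAt (E := E) hq
      rw [shiftUp_mark hj] at h1
      exact compAt_trans (mem_comp_compAt hEj) h1
  rw [heq]
  exact comp_union_inter hE hD hKE hLD hmid

theorem comp_gapStrip (hE : E.IsDiagram) (hD : D.IsDiagram) (hEk : E.IsVerticalAt k)
    (hDk : D.IsVerticalAt k) :
    (E.comp D).gapStrip k ∩ {p | p.2 ≤ E.height} = E.gapStrip k ∧
    (E.comp D).gapStrip k ∩ {p | E.height ≤ p.2} = shiftUp E.height '' D.gapStrip k := by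
  have hk := hEk.two_le
  obtain ⟨h1, h2⟩ := comp_compAt_vertical hE hD (j := k - 1) (by omega) hEk.left hDk.left
  obtain ⟨h3, h4⟩ := comp_compAt_vertical hE hD (j := k) (by omega) hEk.right hDk.right
  have ha := hD.height_pos
  have hb := hE.height_pos
  have hh : (E.comp D).height = D.height + E.height := rfl
  have hE' : ∀ p ∈ strip E.height, p.2 ≤ E.height := fun p hp => hp.2.2
  unfold gapStrip
  constructor
  · ext p
    have e1 := Set.ext_iff.1 h1 p
    have e3 := Set.ext_iff.1 h3 p
    simp only [mem_inter_iff, mem_ofPred_eq, Set.mem_sdiff, mem_union] at e1 e3 ⊢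
    rw [← e1, ← e3]
    simp only [strip, mem_ofPred_eq, hh]
    constructor
    · rintro ⟨⟨⟨h5, h6, h7⟩, h8⟩, h9⟩
      exact ⟨⟨h5, h6, h9⟩, by tauto⟩
    · rintro ⟨⟨h5, h6, h7⟩, h8⟩
      exact ⟨⟨⟨h5, h6, by linarith⟩, by tauto⟩, h7⟩
  · rw [image_sdiff (shiftUp E.height).injective, image_union, ← h2, ← h4]
    have hs : ∀ p : ℝ × ℝ, p ∈ shiftUp E.height '' strip D.height ↔
        p ∈ strip (E.comp D).height ∧ E.height ≤ p.2 := by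
      intro p
      constructor
      · rintro ⟨q, ⟨h5, h6, h7⟩, rfl⟩
        rw [shiftUp_apply]
        exact ⟨⟨h5, by simp only; linarith, by simp only; linarith⟩, by simp only; linarith⟩
      · rintro ⟨⟨h5, h6, h7⟩, h8⟩
        exact ⟨(p.1, p.2 - E.height), ⟨h5, by simp only; linarith, by simp only; linarith⟩,
          Prod.ext rfl (by simp [shiftUp_apply])⟩
    ext p
    simp only [mem_inter_iff, mem_ofPred_eq, Set.mem_sdiff, mem_union, hs]
    tauto

theorem IsVerticalAt.regionAt_subset_gapStrip (hk : D.IsVerticalAt k) (hD : D.IsDiagram) :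
    D.regionAt ((k : ℝ) - 1 / 2, 0) ⊆ D.gapStrip k := by
  have hk2 := hk.two_le
  refine fun q hq => ?_
  obtain ⟨h1, h2⟩ := connectedComponentIn_subset _ _ hq
  refine ⟨h1, fun h => h2 ?_⟩
  rcases h with h | h
  · exact ⟨_, hD.compAt_mark_mem_threads (by omega), h⟩
  · exact ⟨_, hD.compAt_mark_mem_threads (by omega), h⟩

/-- The region of `E ∘ D` reaching the bottom between `k-1` and `k` is covered by the
corresponding gaps of `E` and `D`. -/
theorem comp_regionAt_subset (hE : E.IsDiagram) (hD : D.IsDiagram) (hED : (E.comp D).IsDiagram)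
    (hEk : E.IsVerticalAt k) (hDk : D.IsVerticalAt k) (hEDk : (E.comp D).IsVerticalAt k)
    {p : ℝ × ℝ} (hp : p ∈ (E.comp D).regionAt ((k : ℝ) - 1 / 2, 0)) :
    (p.2 ≤ E.height → p ∈ E.gap k) ∧
    (E.height < p.2 → p ∈ shiftUp E.height '' D.gap k) := by
  obtain ⟨hlow, hup⟩ := comp_gapStrip hE hD hEk hDk
  have hbE := hEk.base_mem hE
  have hbD := hDk.base_mem hD
  have hEg : ∀ q ∈ E.gap k, q.2 ≤ E.height := fun q hq => hq.target_mem.1.2.2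
  have hDg : ∀ q ∈ shiftUp E.height '' D.gap k, E.height ≤ q.2 := by
    rintro _ ⟨q, hq, rfl⟩
    have := hq.target_mem.1.2.1
    rw [shiftUp_apply]; simp only; linarith
  have hEs : E.gap k ⊆ (E.comp D).gapStrip k := fun q hq => (hlow.symm.subset hq.target_mem).1
  have hDs : shiftUp E.height '' D.gap k ⊆ (E.comp D).gapStrip k := by
    rintro _ ⟨q, hq, rfl⟩
    exact (hup.symm.subset ⟨q, hq.target_mem, rfl⟩).1
  -- A relatively clopen part of the gap strip of the composition that contains the base point
  -- contains the whole region.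
  have hmain : ∀ M : Set (ℝ × ℝ), E.gap k ⊆ M → M ⊆ (E.comp D).gapStrip k →
      M ∩ {p | p.2 ≤ E.height} = E.gap k →
      IsRelClopen (M ∩ {p | E.height ≤ p.2}) (shiftUp E.height '' D.gapStrip k) → p ∈ M := by
    intro M hM hMs h1 h2
    have hcl : IsRelClopen M ((E.comp D).gapStrip k) :=
      .paste (isClosed_snd_le E.height) (isClosed_le_snd E.height)
        (fun p _ => le_total p.2 E.height) hMs
        (by rw [h1, hlow]; exact hEk.isRelClopen_gap hE) (by rwa [hup])
    refine hcl.subset_of_isPreconnected isPreconnected_connectedComponentIn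
      (hEDk.regionAt_subset_gapStrip hED) ⟨_, ?_, hM hbE⟩ hp
    refine mem_connectedComponentIn ?_
    by_contra hne
    rw [regionAt, connectedComponentIn_eq_empty hne] at hp
    exact hp
  -- Whether the gap of `E` reaches the middle line need not be decided. If it does, the gap of `D`
  -- is attached along the open segment there; if not, the gap of `E` is relatively clopen by
  -- itself.
  by_cases htop : ((k : ℝ) - 1 / 2, E.height) ∈ E.gap k
  · have hM1 : (E.gap k ∪ shiftUp E.height '' D.gap k) ∩ {p | p.2 ≤ E.height} = E.gap k := by
      refine Subset.antisymm ?_ fun q hq => ⟨Or.inl hq, hEg q hq⟩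
      rintro q ⟨hq | ⟨r, hr, rfl⟩, hqb⟩
      · exact hq
      · have hqb : r.2 + E.height ≤ E.height := hqb
        have hr0 : r.2 = 0 := le_antisymm (by linarith) hr.target_mem.1.2.1
        obtain ⟨h1, h2⟩ := hDk.mem_Ioo_of_mem_gap hD hr (Or.inl hr0)
        rw [shiftUp_apply, hr0, zero_add]
        exact hEk.mem_gap_level hE (Or.inr rfl) htop h1 h2
    have hM2 : (E.gap k ∪ shiftUp E.height '' D.gap k) ∩ {p | E.height ≤ p.2} =
        shiftUp E.height '' D.gap k := by
      refine Subset.antisymm ?_ fun q hq => ⟨Or.inr hq, hDg q hq⟩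
      rintro q ⟨hq | hq, hqb⟩
      · have hqb : q.2 = E.height := le_antisymm (hEg q hq) hqb
        obtain ⟨h1, h2⟩ := hEk.mem_Ioo_of_mem_gap hE hq (Or.inr hqb)
        exact ⟨(q.1, 0), hDk.mem_gap_level hD (Or.inl rfl) hbD h1 h2,
          Prod.ext rfl (by rw [shiftUp_apply]; simp [hqb])⟩
      · exact hq
    have hpM := hmain (E.gap k ∪ shiftUp E.height '' D.gap k) subset_union_left
      (union_subset hEs hDs) hM1 (by rw [hM2]; exact (hDk.isRelClopen_gap hD).image _)
    exact ⟨fun h => hM1.subset ⟨hpM, h⟩, fun h => hM2.subset ⟨hpM, h.le⟩⟩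
  · have hpM := hmain (E.gap k) Subset.rfl hEs (inter_eq_left.2 hEg) (by
      rw [show E.gap k ∩ {p | E.height ≤ p.2} = ∅ from ?_]
      · exact isRelClopen_empty _
      · refine eq_empty_of_forall_notMem ?_
        rintro q ⟨hq, hqb⟩
        have hqb : q.2 = E.height := le_antisymm (hEg q hq) hqb
        refine htop (hEk.mem_gap_level hE (x := q.1) (Or.inr rfl) ?_ (by linarith) (by linarith))
        rwa [← hqb])
    exact ⟨fun _ => hpM, fun h => absurd (hEg p hpM) h.not_ge⟩

theorem IsNFrieze.isVerticalAt {n : ℕ} (h : D.IsNFrieze n) {k : ℕ} (hk : n + 2 ≤ k) :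
    D.IsVerticalAt k := by
  refine ⟨by omega, ?_, h.mark_mem (by omega)⟩
  have := h.mark_mem (k := k - 1) (by omega)
  rwa [Nat.cast_sub (by omega), Nat.cast_one] at this

/-- The composition of two `n`-friezes is an `n`-frieze. -/
theorem comp_isNFrieze {n : ℕ} (hEn : E.IsNFrieze n) (hDn : D.IsNFrieze n) :
    (E.comp D).IsNFrieze n := by
  have hE := hEn.isDiagram
  have hD := hDn.isDiagram
  have hED := comp_isDiagram hE hD (fun k => hEn.mark_mem) (fun k => hDn.mark_mem)
  have hv : ∀ k : ℕ, n + 1 ≤ k →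
      (E.comp D).mark (-k) ∈ (E.comp D).compAt ((E.comp D).mark k) := fun k hk =>
    comp_vertical (by omega) (hEn.mark_mem hk) (hDn.mark_mem hk)
  refine hED.isNFrieze hv ?_ fun k hk S hS hSR => ?_
  -- A circle through the middle point `z` with `z > n` is impossible: the vertical thread of `E`
  -- leads from there to a marked point at the bottom.
  · refine ((((finite_Icc (1 : ℤ) n).image fun z => (E.comp D).compAt (E.mark (-z))).union
      (hEn.finite_circular.union (hDn.finite_circular.image
        fun T => shiftUp E.height '' T)))).subset fun S hS => ?_
    rcases comp_circular_cases hE hD hED hS with ⟨z, hz, rfl⟩ | h | h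
    · refine Or.inl ⟨z, ⟨hz, ?_⟩, rfl⟩
      by_contra hzn
      obtain ⟨k, rfl⟩ := Int.eq_ofNat_of_zero_le hz.le
      refine (hED.mem_circularComponents_iff.1 hS).2 k hz.ne' ?_
      rw [comp_mark_pos hz]
      exact mem_comp_compAt (compAt_symm (hEn.mark_mem (by omega)))
    · exact Or.inr (Or.inl h)
    · exact Or.inr (Or.inr h)
  · have hEk := hEn.isVerticalAt hk
    have hDk := hDn.isVerticalAt hk
    have hEDk : (E.comp D).IsVerticalAt k := by
      refine ⟨by omega, ?_, hv k (by omega)⟩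
      have := hv (k - 1) (by omega)
      rwa [Nat.cast_sub (by omega), Nat.cast_one] at this
    have hsub : ∀ p ∈ S, (p.2 ≤ E.height → p ∈ E.gap k) ∧
        (E.height < p.2 → p ∈ shiftUp E.height '' D.gap k) := fun p hp =>
      comp_regionAt_subset hE hD hED hEk hDk hEDk (by rw [Int.cast_natCast]; exact hSR hp)
    -- A circle through the middle point `z` would need `k - 1 < z < k`. A circle of `E` or of `D`
    -- would lie in the corresponding gap and so violate the condition on that factor.
    rcases comp_circular_cases hE hD hED hS with ⟨z, hz, rfl⟩ | h | ⟨T, hT, rfl⟩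
    · have hm : E.mark (-z) ∈ (E.comp D).compAt (E.mark (-z)) :=
        mem_compAt (subset_comp (hE.mark_mem (by omega)))
      have h2 : (E.mark (-z)).2 = E.height := by rw [mark, if_neg (by omega)]
      obtain ⟨h3, h4⟩ := hEk.mem_Ioo_of_mem_gap hE ((hsub _ hm).1 h2.le) (Or.inr h2)
      rw [mark_fst] at h3 h4
      have e1 : (k : ℤ) - 1 < |-z| := by exact_mod_cast h3
      have e2 : |-z| < (k : ℤ) := by exact_mod_cast h4
      omega
    · refine hEn.no_circular k hk S h fun p hp => ?_
      have := hEk.gap_subset_regionAt hE ((hsub p hp).1 (circular_snd_lt hE h p hp).2.le)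
      rwa [Int.cast_natCast] at this
    · refine hDn.no_circular k hk T hT fun p hp => ?_
      have h1 := (circular_snd_lt hD hT p hp).1
      obtain ⟨q, hq, hqp⟩ := (hsub _ ⟨p, hp, rfl⟩).2 (by
        rw [shiftUp_apply]; simp only; linarith)
      rw [(shiftUp E.height).injective hqp] at hq
      have := hDk.gap_subset_regionAt hD hq
      rwa [Int.cast_natCast] at this

end PlaneSet

/-! ### The invariant of a composition; composition of classes. -/

namespace PlaneSet

variable {E D : PlaneSet} {s : (ℤ → ℤ) × ℕ} {n : ℕ}

theorem comp_circularComponents (hE : E.IsDiagram) (hD : D.IsDiagram)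
    (hED : (E.comp D).IsDiagram) : (E.comp D).circularComponents =
      E.circularComponents ∪ (fun T => shiftUp E.height '' T) '' D.circularComponents ∪
      {S | S ∈ (E.comp D).circularComponents ∧
        ∃ z : ℤ, 0 < z ∧ S = (E.comp D).compAt (E.mark (-z))} := by
  ext S
  constructor
  · intro hS
    rcases comp_circular_cases hE hD hED hS with h | h | h
    · exact Or.inr ⟨hS, h⟩
    · exact Or.inl (Or.inl h)
    · exact Or.inl (Or.inr h)
  · rintro ((h | ⟨T, hT, rfl⟩) | h)
    · exact mem_comp_circular_of_lower hE hD hED h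
    · exact mem_comp_circular_of_upper hE hD hED hT
    · exact h.1

theorem IsDiagram.not_circular_of_mark (hD : D.IsDiagram) {z : ℤ} (hz : z ≠ 0) {p : ℝ × ℝ}
    (h : D.mark z ∈ D.compAt p) : D.compAt p ∉ D.circularComponents := fun hS =>
  (hD.mem_circularComponents_iff.1 hS).2 z hz h

/-- A vertical thread of the upper frieze prolongs a thread of `E` upwards and keeps its label;
bottom labels are not affected at all. -/
theorem comp_mark_mem_of_vertical {z : ℤ} (hE : E.IsDiagram) (hz : z ≠ 0)
    (hv : z < 0 → D.mark z ∈ D.compAt (D.mark (-z))) :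
    (E.comp D).mark z ∈ (E.comp D).compAt (E.mark z) := by
  rcases lt_or_gt_of_ne hz with h | h
  · have h1 := shiftUp_mem_comp_compAt (E := E) (hv h)
    rw [shiftUp_mark (by omega), neg_neg] at h1
    rwa [comp_mark_neg h]
  · rw [comp_mark_pos h]
    exact mem_compAt (subset_comp (hE.mark_mem hz))

/-- Putting a frieze with only vertical threads on top adds its circles. -/
theorem HasInvariant.comp_of_vertical (hE : E.IsFrieze) (hD : D.IsFrieze)
    (hED : (E.comp D).IsDiagram) (h : E.HasInvariant s)
    {c : ℕ} (h' : D.HasInvariant (unitPairing.1, c)) :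
    (E.comp D).HasInvariant (s.1, s.2 + c) := by
  have hEd := hE.isDiagram
  have hDd := hD.isDiagram
  have hv : ∀ z : ℤ, z ≠ 0 → (E.comp D).mark z ∈ (E.comp D).compAt (E.mark z) := fun z hz =>
    comp_mark_mem_of_vertical hEd hz fun _ => by
      have := h'.mark_mem (-z) (by omega)
      simp only [unitPairing, neg_neg] at this
      exact this
  refine ⟨h.pairing, fun z hz => ?_, ?_⟩
  · exact compAt_trans (compAt_symm (hv z hz))
      (compAt_trans (mem_comp_compAt (h.mark_mem z hz)) (hv _ (h.pairing.ne_zero hz)))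
  · rw [comp_circularComponents hEd hDd hED, show {S | S ∈ (E.comp D).circularComponents ∧
        ∃ z : ℤ, 0 < z ∧ S = (E.comp D).compAt (E.mark (-z))} = ∅ from ?_, union_empty]
    · rw [ncard_union_eq ?_ hE.finite_circular (hD.finite_circular.image _), h.ncard,
        ncard_image_of_injective _ (shiftUp E.height).injective.image_injective, h'.ncard]
      refine disjoint_left.2 ?_
      rintro _ hS ⟨T, hT, rfl⟩
      obtain ⟨p, hp⟩ := components_nonempty hT.1
      have h1 := (circular_snd_lt hEd hS _ ⟨p, hp, rfl⟩).2
      have h2 := (circular_snd_lt hDd hT p hp).1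
      rw [shiftUp_apply] at h1
      simp only at h1
      linarith
    · refine eq_empty_of_forall_notMem ?_
      rintro _ ⟨hS, z, hz, rfl⟩
      exact hED.not_circular_of_mark (by omega) (hv (-z) (by omega)) hS

/-- Putting `H_i` on top. -/
theorem HasInvariant.comp_diapsidal (hE : E.IsFrieze) {i : ℕ} (hi : 1 ≤ i)
    (hED : (E.comp (diapsidal i)).IsDiagram) (h : E.HasInvariant s) :
    (E.comp (diapsidal i)).HasInvariant (loopAct s i) := by
  have hEd := hE.isDiagram
  have hDd := (diapsidal_isPieces hi).isDiagram
  have h' := diapsidal_hasInvariant hi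
  have e0 : (-((i : ℤ) + 1)) ≠ 0 := by omega
  have e1 : (-(i : ℤ)) ≠ 0 := by omega
  -- Away from `i` and `i + 1` the frieze `H_i` only prolongs threads vertically. Its cap joins the
  -- top points `i, i + 1` of `E`, and its cup joins the new top points there.
  have hv : ∀ z : ℤ, z ≠ 0 → z ≠ -i → z ≠ -(i + 1) →
      (E.comp (diapsidal i)).mark z ∈ (E.comp (diapsidal i)).compAt (E.mark z) :=
    fun z hz h1 h2 => comp_mark_mem_of_vertical hEd hz fun hz0 => by
      have := h'.mark_mem (-z) (by omega)
      rwa [show (loopAct unitPairing i).1 (-z) = z by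
        simp only [loopAct, pairingAct, unitPairing]; split_ifs <;> omega] at this
  have hcap : E.mark (-(i + 1)) ∈ (E.comp (diapsidal i)).compAt (E.mark (-i)) := by
    have := h'.mark_mem i (by omega)
    rw [show (loopAct unitPairing i).1 i = i + 1 by
      simp only [loopAct, pairingAct, unitPairing]; split_ifs <;> omega] at this
    have := shiftUp_mem_comp_compAt (E := E) this
    rwa [shiftUp_mark (by omega), shiftUp_mark (by omega)] at this
  have hcup : (E.comp (diapsidal i)).mark (-(i + 1)) ∈
      (E.comp (diapsidal i)).compAt ((E.comp (diapsidal i)).mark (-i)) := by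
    have := h'.mark_mem (-i) (by omega)
    rw [show (loopAct unitPairing i).1 (-i) = -(i + 1) by
      simp only [loopAct, pairingAct, unitPairing]; split_ifs <;> omega] at this
    rw [comp_mark_neg (by omega), comp_mark_neg (by omega)]
    exact shiftUp_mem_comp_compAt this
  have hs : ∀ z : ℤ, z ≠ 0 → E.mark (s.1 z) ∈ (E.comp (diapsidal i)).compAt (E.mark z) :=
    fun z hz => mem_comp_compAt (h.mark_mem z hz)
  have i1 := h.pairing.ne _ e0
  have i2 := h.pairing.ne _ e1
  have i3 := h.pairing.invol (-i)
  have i4 := h.pairing.invol (-(i + 1))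
  have i5 := h.pairing.ne_zero e0
  have i6 := h.pairing.ne_zero e1
  refine ⟨h.pairing.pairingAct hi, fun z hz => ?_, ?_⟩
  · by_cases z1 : z = -i
    · rw [show (loopAct s i).1 z = -(i + 1) by simp only [loopAct, pairingAct, if_pos z1], z1]
      exact hcup
    by_cases z2 : z = -(i + 1)
    · rw [show (loopAct s i).1 z = -i by simp only [loopAct, pairingAct, if_pos z2, if_neg z1], z2]
      exact compAt_symm hcup
    by_cases z3 : z = s.1 (-i)
    · rw [show (loopAct s i).1 z = s.1 (-(i + 1)) by
        simp only [loopAct, pairingAct, if_pos z3, if_neg z1, if_neg z2]]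
      have hne : s.1 (-(i + 1)) ≠ -i := fun e => z2 (by rw [z3, ← e, i4])
      have h1 := compAt_symm (hv z hz z1 z2)
      have h2 := hs z hz
      rw [show s.1 z = -i by rw [z3, i3]] at h2
      exact compAt_trans h1 (compAt_trans h2 (compAt_trans hcap
        (compAt_trans (hs _ e0) (hv _ i5 hne i1))))
    by_cases z4 : z = s.1 (-(i + 1))
    · rw [show (loopAct s i).1 z = s.1 (-i) by
        simp only [loopAct, pairingAct, if_pos z4, if_neg z1, if_neg z2, if_neg z3]]
      have hne : s.1 (-i) ≠ -(i + 1) := fun e => z1 (by rw [z4, ← e, i3])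
      have h1 := compAt_symm (hv z hz z1 z2)
      have h2 := hs z hz
      rw [show s.1 z = -(i + 1) by rw [z4, i4]] at h2
      exact compAt_trans h1 (compAt_trans h2 (compAt_trans (compAt_symm hcap)
        (compAt_trans (hs _ e1) (hv _ i6 i2 hne))))
    · rw [show (loopAct s i).1 z = s.1 z by
        simp only [loopAct, pairingAct, if_neg z4, if_neg z1, if_neg z2, if_neg z3]]
      have h1 := h.pairing.invol z
      have hne1 : s.1 z ≠ -i := fun e => z3 (by rw [← e, h1])
      have hne2 : s.1 z ≠ -(i + 1) := fun e => z4 (by rw [← e, h1])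
      exact compAt_trans (compAt_symm (hv z hz z1 z2))
        (compAt_trans (hs z hz) (hv _ (h.pairing.ne_zero hz) hne1 hne2))
  -- A circle through a middle point must contain the cap of `H_i`, as every other middle point is
  -- connected to a marked point at the top. So at most one new circle arises.
  · have hmid : ∀ z : ℤ, 0 < z →
        (E.comp (diapsidal i)).compAt (E.mark (-z)) ∈ (E.comp (diapsidal i)).circularComponents →
        (E.comp (diapsidal i)).compAt (E.mark (-z)) =
          (E.comp (diapsidal i)).compAt (E.mark (-i)) := fun z hz hS => by
      by_cases z1 : -z = -i
      · rw [z1]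
      by_cases z2 : -z = -(i + 1)
      · rw [z2, compAt_eq hcap]
      exact absurd hS (hED.not_circular_of_mark (by omega) (hv _ (by omega) z1 z2))
    rw [comp_circularComponents hEd hDd hED, diapsidal_circularComponents hi, image_empty,
      union_empty]
    simp only [loopAct]
    split_ifs with hloop
    -- A thread of `E` joining its top points `i` and `i + 1` together with the cap of `H_i` forms a
    -- relatively clopen set without outer marked points.
    · have hcirc : (E.comp (diapsidal i)).compAt (E.mark (-i)) ∈
          (E.comp (diapsidal i)).circularComponents := by
        have hmE : E.mark (-i) ∈ E.carrier := hEd.mark_mem e1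
        have hmD : (diapsidal i).mark i ∈ (diapsidal i).carrier := hDd.mark_mem (by omega)
        have hcl := comp_union_isRelClopen hEd hDd
          (hEd.isRelClopen (compAt_mem_components hmE))
          (hDd.isRelClopen (compAt_mem_components hmD)) (fun w hw => by
            have j1 : E.mark (-w) ∈ E.compAt (E.mark (-i)) ↔ w = i ∨ w = i + 1 := by
              constructor
              · intro hw'
                have := h.eq_or_eq hEd e1 (by omega) hw'
                omega
              · rintro (rfl | rfl)
                · exact mem_compAt hmE
                · rw [← hloop]; exact h.mark_mem _ e1
            have hp : (loopAct unitPairing i).1 i = i + 1 := by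
              simp only [loopAct, pairingAct, unitPairing]; split_ifs <;> omega
            have j2 : (diapsidal i).mark w ∈ (diapsidal i).compAt ((diapsidal i).mark i) ↔
                w = i ∨ w = i + 1 := by
              constructor
              · intro hw'
                have := h'.eq_or_eq hDd (z := i) (by omega) (by omega) hw'
                omega
              · rintro (rfl | rfl)
                · exact mem_compAt hmD
                · rw [← hp]; exact h'.mark_mem _ (by omega)
            exact j1.trans j2.symm)
        refine hED.mem_circularComponents_iff.2
          ⟨compAt_mem_components (subset_comp hmE), fun v hv0 hvm => ?_⟩
        have hsub := hcl.subset_of_isPreconnected isPreconnected_connectedComponentIn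
          (compAt_subset _) ⟨_, mem_compAt (subset_comp hmE), Or.inl (mem_compAt hmE)⟩
        have hp : (loopAct unitPairing i).1 i = i + 1 := by
          simp only [loopAct, pairingAct, unitPairing]; split_ifs <;> omega
        have ha := hDd.height_pos
        have hb := hEd.height_pos
        rcases hsub hvm with hvE | ⟨q, hq, hqv⟩
        · rcases lt_or_gt_of_ne hv0 with hlt | hgt
          · have h1 := (hEd.subset_strip (compAt_subset _ hvE)).2.2
            rw [mark, if_neg hlt.not_gt] at h1
            change (diapsidal i).height + E.height ≤ E.height at h1
            linarith
          · rw [comp_mark_pos hgt] at hvE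
            have := h.eq_or_eq hEd e1 hv0 hvE
            omega
        · rcases lt_or_gt_of_ne hv0 with hlt | hgt
          · rw [comp_mark_neg hlt] at hqv
            rw [(shiftUp E.height).injective hqv] at hq
            have := h'.eq_or_eq hDd (z := i) (by omega) hv0 hq
            omega
          · have h1 := hDd.le_of_mem_upper (E := E) ⟨q, compAt_subset _ hq, rfl⟩
            rw [hqv, mark, if_pos hgt] at h1
            simp only at h1
            linarith
      rw [show {S | S ∈ (E.comp (diapsidal i)).circularComponents ∧
          ∃ z : ℤ, 0 < z ∧ S = (E.comp (diapsidal i)).compAt (E.mark (-z))} =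
          {(E.comp (diapsidal i)).compAt (E.mark (-i))} from ?_]
      · rw [union_singleton, ncard_insert_of_notMem ?_ hE.finite_circular, h.ncard]
        intro hmem
        have h1 := (circular_snd_lt hEd hmem _ (mem_compAt (subset_comp (hEd.mark_mem e1)))).2
        rw [mark, if_neg (by omega)] at h1
        exact lt_irrefl _ h1
      · ext S
        constructor
        · rintro ⟨hS, z, hz, rfl⟩
          exact hmid z hz hS
        · rintro rfl
          exact ⟨hcirc, i, by omega, rfl⟩
    · rw [show {S | S ∈ (E.comp (diapsidal i)).circularComponents ∧
          ∃ z : ℤ, 0 < z ∧ S = (E.comp (diapsidal i)).compAt (E.mark (-z))} = ∅ from ?_,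
        union_empty, h.ncard, add_zero]
      refine eq_empty_of_forall_notMem ?_
      rintro _ ⟨hS, z, hz, rfl⟩
      rw [hmid z hz hS] at hS
      exact hED.not_circular_of_mark i6 (compAt_trans (hs _ e1) (hv _ i6 i2 hloop)) hS

/-! ### Composition respects `K`-equivalence and is associative -/

/-- This is equality of the plane sets themselves, so associativity for classes needs no
homeomorphism. -/
theorem comp_assoc (F E D : PlaneSet) : F.comp (E.comp D) = (F.comp E).comp D := by
  have hh : ((F.comp E).comp D).height = (F.comp (E.comp D)).height := (add_assoc _ _ _).symm
  have hc : ((F.comp E).comp D).carrier = (F.comp (E.comp D)).carrier := by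
    rw [comp_carrier, comp_carrier, comp_carrier, upper, upper, upper, comp_carrier, upper,
      image_union, ← union_assoc, image_image]
    congr 2
    refine image_congr fun p _ => ?_
    simp only [shiftUp_apply, comp]
    exact Prod.ext rfl (add_assoc _ _ _).symm
  generalize (F.comp E).comp D = X at hh hc
  generalize F.comp (E.comp D) = Y at hh hc
  cases X; cases Y
  simp only at hh hc
  rw [hh, hc]

theorem _root_.ContinuousOn.paste {X Y : Type*} [TopologicalSpace X] [TopologicalSpace Y]
    {F A B : Set X} {f : X → Y} (hA : IsClosed A) (hB : IsClosed B) (hF : F ⊆ A ∪ B)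
    (h : ContinuousOn f (F ∩ A)) (h' : ContinuousOn f (F ∩ B)) : ContinuousOn f F := by
  intro p hp
  have key : ∀ {A : Set X}, IsClosed A → ContinuousOn f (F ∩ A) →
      ContinuousWithinAt f (F ∩ A) p := by
    intro A hA h
    by_cases hpA : p ∈ A
    · exact h p ⟨hp, hpA⟩
    · exact continuousWithinAt_of_notMem_closure fun hc =>
        hpA (hA.closure_subset (closure_mono inter_subset_right hc))
  have := (key hA h).union (key hB h')
  rwa [← inter_union_distrib_left, inter_eq_left.2 hF] at this

/-- A map of the plane whose restriction is a map of diagrams preserving marked points. -/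
structure IsMarkedMap (D E : PlaneSet) (g : ℝ × ℝ → ℝ × ℝ) : Prop where
  continuousOn : ContinuousOn g D.carrier
  mapsTo : MapsTo g D.carrier E.carrier
  mark : ∀ z, z ≠ 0 → g (D.mark z) = E.mark z

theorem KEquiv.exists_isMarkedMap (hD : D.IsDiagram) (h : D.KEquiv E) :
    ∃ g g', IsMarkedMap D E g ∧ IsMarkedMap E D g' ∧ LeftInvOn g' g D.carrier ∧
      LeftInvOn g g' E.carrier := by
  classical
  obtain ⟨f, hf⟩ := h
  let g : ℝ × ℝ → ℝ × ℝ := fun p => if hp : p ∈ D.carrier then f ⟨p, hp⟩ else p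
  let g' : ℝ × ℝ → ℝ × ℝ := fun p => if hp : p ∈ E.carrier then f.symm ⟨p, hp⟩ else p
  have hg : ∀ p : D.carrier, g p = f p := fun p => dif_pos p.2
  have hg' : ∀ p : E.carrier, g' p = f.symm p := fun p => dif_pos p.2
  have hm : ∀ z, z ≠ 0 → g (D.mark z) = E.mark z := by
    intro z hz
    rw [hg ⟨_, hD.mark_mem hz⟩]
    obtain ⟨i, hi, rfl | rfl⟩ := int_cases hz
    · rw [E.mark_natCast hi]; exact (hf i hi _).1 (D.mark_natCast hi)
    · rw [E.mark_neg_natCast hi]; exact (hf i hi _).2 (D.mark_neg_natCast hi)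
  have hl : LeftInvOn g' g D.carrier := fun p hp => by
    rw [hg ⟨p, hp⟩, hg', f.symm_apply_apply]
  refine ⟨g, g', ⟨?_, fun p hp => ?_, hm⟩, ⟨?_, fun p hp => ?_, fun z hz => ?_⟩, hl,
    fun p hp => ?_⟩
  · rw [continuousOn_iff_continuous_domRestrict]
    exact (continuous_subtype_val.comp f.continuous).congr fun p => (hg p).symm
  · rw [hg ⟨p, hp⟩]; exact Subtype.coe_prop _
  · rw [continuousOn_iff_continuous_domRestrict]
    exact (continuous_subtype_val.comp f.symm.continuous).congr fun p => (hg' p).symm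
  · rw [hg' ⟨p, hp⟩]; exact Subtype.coe_prop _
  · rw [← hm z hz, hl (hD.mark_mem hz)]
  · rw [hg' ⟨p, hp⟩, hg, f.apply_symm_apply]

theorem KEquiv.of_isMarkedMap {g g' : ℝ × ℝ → ℝ × ℝ}
    (hg : IsMarkedMap D E g) (hg' : IsMarkedMap E D g') (h : LeftInvOn g' g D.carrier)
    (h' : LeftInvOn g g' E.carrier) : D.KEquiv E := by
  refine ⟨⟨⟨fun p => ⟨g p, hg.mapsTo p.2⟩, fun p => ⟨g' p, hg'.mapsTo p.2⟩,
    fun p => Subtype.ext (h p.2), fun p => Subtype.ext (h' p.2)⟩,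
    (continuousOn_iff_continuous_domRestrict.1 hg.continuousOn).subtype_mk _,
    (continuousOn_iff_continuous_domRestrict.1 hg'.continuousOn).subtype_mk _⟩,
    fun i hi p => ⟨fun hp => ?_, fun hp => ?_⟩⟩
  · exact (congrArg g (hp.trans (D.mark_natCast hi).symm)).trans
      ((hg.mark _ (by omega)).trans (E.mark_natCast hi))
  · exact (congrArg g (hp.trans (D.mark_neg_natCast hi).symm)).trans
      ((hg.mark _ (by omega)).trans (E.mark_neg_natCast hi))

/-- The two maps agree on the middle line because both preserve the marked points, so they paste
along the closed halves. -/
theorem IsMarkedMap.exists_comp {E' D' : PlaneSet} (hE : E.IsDiagram) (hD : D.IsDiagram)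
    {g f : ℝ × ℝ → ℝ × ℝ} (hg : IsMarkedMap E E' g) (hf : IsMarkedMap D D' f) :
    ∃ F, IsMarkedMap (E.comp D) (E'.comp D') F ∧ EqOn F g E.carrier ∧
      ∀ p ∈ D.carrier, F (shiftUp E.height p) = shiftUp E'.height (f p) := by
  classical
  let F : ℝ × ℝ → ℝ × ℝ := fun p =>
    if p.2 ≤ E.height then g p else shiftUp E'.height (f ((shiftUp E.height).symm p))
  have h1 : EqOn F g E.carrier := fun p hp => if_pos (hE.subset_strip hp).2.2
  have h2 : ∀ p ∈ D.carrier, F (shiftUp E.height p) = shiftUp E'.height (f p) := by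
    intro p hp
    by_cases hpb : (shiftUp E.height p).2 ≤ E.height
    · have hpb' : p.2 + E.height ≤ E.height := hpb
      obtain ⟨z, hz, rfl⟩ := hD.eq_mark_of_bot hp
        (le_antisymm (by linarith) (hD.subset_strip hp).2.1)
      rw [shiftUp_mark hz, h1 (hE.mark_mem (by omega)), hg.mark _ (by omega), hf.mark _ (by omega),
        shiftUp_mark hz]
    · simp only [F, if_neg hpb, Homeomorph.symm_apply_apply]
  refine ⟨F, ⟨?_, ?_, fun z hz => ?_⟩, h1, h2⟩
  · refine ContinuousOn.paste (isClosed_snd_le E.height) (isClosed_le_snd E.height)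
      (fun p _ => le_total p.2 E.height) ?_ ?_
    · rw [comp_inter_le hE hD]
      exact hg.continuousOn.congr h1
    · rw [comp_inter_ge hE hD]
      have hc : ContinuousOn (fun p => shiftUp E'.height (f ((shiftUp E.height).symm p)))
          (E.upper D) := by
        refine (shiftUp E'.height).continuous.comp_continuousOn (hf.continuousOn.comp
          (shiftUp E.height).symm.continuous.continuousOn ?_)
        rintro _ ⟨q, hq, rfl⟩
        rwa [Homeomorph.symm_apply_apply]
      refine hc.congr ?_
      rintro _ ⟨q, hq, rfl⟩
      rw [h2 q hq]
      simp only [Homeomorph.symm_apply_apply]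
  · intro p hp
    rw [comp_carrier] at hp
    rcases hp with ⟨q, hq, rfl⟩ | hp
    · rw [h2 q hq]
      exact upper_subset_comp ⟨_, hf.mapsTo hq, rfl⟩
    · rw [h1 hp]
      exact subset_comp (hg.mapsTo hp)
  · rcases lt_or_gt_of_ne hz with h | h
    · rw [comp_mark_neg h, comp_mark_neg h, h2 _ (hD.mark_mem hz), hf.mark z hz]
    · rw [comp_mark_pos h, comp_mark_pos h, h1 (hE.mark_mem hz), hg.mark z hz]

theorem KEquiv.comp {E' D' : PlaneSet} (hE : E.IsDiagram) (hD : D.IsDiagram)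
    (hE' : E'.IsDiagram) (hD' : D'.IsDiagram)
    (h : E.KEquiv E') (h' : D.KEquiv D') : (E.comp D).KEquiv (E'.comp D') := by
  obtain ⟨g, g', hg, hg', hl, hr⟩ := h.exists_isMarkedMap hE
  obtain ⟨f, f', hf, hf', hl', hr'⟩ := h'.exists_isMarkedMap hD
  obtain ⟨F, hF, hF1, hF2⟩ := hg.exists_comp hE hD hf
  obtain ⟨F', hF', hF1', hF2'⟩ := hg'.exists_comp hE' hD' hf'
  refine .of_isMarkedMap hF hF' (fun p hp => ?_) fun p hp => ?_ <;> rw [comp_carrier] at hp <;>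
    rcases hp with ⟨q, hq, rfl⟩ | hp
  · rw [hF2 q hq, hF2' _ (hf.mapsTo hq), hl' hq]
  · rw [hF1 hp, hF1' (hg.mapsTo hp), hl hp]
  · rw [hF2' q hq, hF2 _ (hf'.mapsTo hq), hr' hq]
  · rw [hF1' hp, hF1 (hg'.mapsTo hp), hr hp]

end PlaneSet

end KFrieze

/-! ### The relations of `K_n` for the action on pairings. -/

namespace KFrieze

/-- The pairing obtained by joining `u` to `v` and the partner of `u` to that of `v`. -/
def joinPairing (u v : ℤ) (σ : ℤ → ℤ) (z : ℤ) : ℤ :=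
  if z = u then v
  else if z = v then u
  else if z = σ u then σ v
  else if z = σ v then σ u
  else σ z

theorem joinPairing_swap {σ : ℤ → ℤ} (h : ∀ z, σ (σ z) = z) (u v z : ℤ) :
    joinPairing u v σ z = joinPairing v u σ z := by
  have hu := h u
  have hv := h v
  simp only [joinPairing]
  grind

theorem joinPairing_comm {σ : ℤ → ℤ} (h : ∀ z, σ (σ z) = z) {u v w x : ℤ} (huv : u ≠ v)
    (hwx : w ≠ x) (huw : u ≠ w) (hux : u ≠ x) (hvw : v ≠ w) (hvx : v ≠ x) (hu' : σ u ≠ u)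
    (hv' : σ v ≠ v) (hw' : σ w ≠ w) (hx' : σ x ≠ x) (z : ℤ) :
    joinPairing w x (joinPairing u v σ) z = joinPairing u v (joinPairing w x σ) z := by
  have hu := h u
  have hv := h v
  have hw := h w
  have hx := h x
  have hz := h z
  clear h
  simp only [joinPairing, huw, hux, hvw, hvx, huw.symm, hux.symm, hvw.symm, hvx.symm, if_false]
  grind (splits := 40)

/-- Joining `v` to `w` in the middle step joins `u` to the partner of `w`; the last step restores
that pair along with the pair `u, v`. Both forms of `(h2)` are instances. -/
theorem joinPairing_joinPairing {σ : ℤ → ℤ} (h : ∀ z, σ (σ z) = z) {u v w : ℤ}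
    (huw : u ≠ w) (huv : u ≠ v) (hvw : v ≠ w) (z : ℤ) :
    joinPairing u v (joinPairing v w (joinPairing u v σ)) z = joinPairing u v σ z := by
  have hu := h u
  have hv := h v
  have hw := h w
  have hz := h z
  clear h
  simp only [joinPairing, huw, hvw, huv, huw.symm, hvw.symm, huv.symm, if_false, if_true]
  grind (splits := 40)

theorem joinPairing_self {σ : ℤ → ℤ} (h : ∀ z, σ (σ z) = z) {u v : ℤ} (huv : u ≠ v) (z : ℤ) :
    joinPairing u v (joinPairing u v σ) z = joinPairing u v σ z := by
  have hu := h u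
  have hv := h v
  have hz := h z
  clear h
  simp only [joinPairing, huv, huv.symm, if_false, if_true]
  grind

theorem pairingAct_eq_joinPairing (i : ℕ) (σ : ℤ → ℤ) :
    pairingAct i σ = joinPairing (-i) (-(i + 1)) σ := rfl

/-- The letters act at disjoint pairs of points. If `σ` joins the two pairs to each other, the order
decides which letter closes the loop, but not the number of loops. -/
theorem loopAct_comm {s : (ℤ → ℤ) × ℕ} (hs : IsPairing s.1) {i j : ℕ} (hi : 1 ≤ i)
    (hij : i + 2 ≤ j) : loopAct (loopAct s i) j = loopAct (loopAct s j) i := by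
  have h1 := hs.invol
  have h2 := hs.ne
  refine Prod.ext (funext fun z => joinPairing_comm h1 (by omega) (by omega) (by omega) (by omega)
    (by omega) (by omega) (h2 _ (by omega)) (h2 _ (by omega)) (h2 _ (by omega))
    (h2 _ (by omega)) z) ?_
  have e1 := h1 (-i)
  have e2 := h1 (-(i + 1))
  have e3 := h1 (-j)
  have e4 := h1 (-(j + 1))
  have g1 := h2 (-i) (by omega)
  have g3 := h2 (-j) (by omega)
  obtain ⟨u, hu⟩ : ∃ u : ℤ, u = -i := ⟨_, rfl⟩
  obtain ⟨v, hv⟩ : ∃ u : ℤ, u = -(i + 1) := ⟨_, rfl⟩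
  obtain ⟨w, hw⟩ : ∃ u : ℤ, u = -j := ⟨_, rfl⟩
  obtain ⟨x, hx⟩ : ∃ u : ℤ, u = -(j + 1) := ⟨_, rfl⟩
  have d1 : u ≠ w := by omega
  have d2 : u ≠ x := by omega
  have d3 : v ≠ w := by omega
  have d4 : v ≠ x := by omega
  simp only [loopAct, pairingAct, ← hu, ← hv, ← hw, ← hx] at *
  clear hu hv hw hx h1 h2
  grind (splits := 30)

theorem loopAct_up {s : (ℤ → ℤ) × ℕ} (hs : IsPairing s.1) (i : ℕ) :
    loopAct (loopAct (loopAct s i) (i + 1)) i = loopAct s i := by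
  have h1 := hs.invol
  have h2 := hs.ne
  refine Prod.ext (funext fun z => ?_) ?_
  · simp only [loopAct, pairingAct_eq_joinPairing, Nat.cast_add, Nat.cast_one]
    exact joinPairing_joinPairing h1 (by omega) (by omega) (by omega) z
  · simp only [loopAct, pairingAct]
    push_cast
    grind

theorem loopAct_down {s : (ℤ → ℤ) × ℕ} (hs : IsPairing s.1) {i : ℕ} (hi : 1 ≤ i) :
    loopAct (loopAct (loopAct s (i + 1)) i) (i + 1) = loopAct s (i + 1) := by
  have h1 := hs.invol
  have h2 := hs.ne
  refine Prod.ext (funext fun z => ?_) ?_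
  · have e : ∀ {τ : ℤ → ℤ}, IsPairing τ → ∀ j, pairingAct j τ = joinPairing (-(j + 1)) (-j) τ :=
      fun hτ j => funext fun z => joinPairing_swap hτ.invol _ _ z
    simp only [loopAct]
    rw [e ((hs.pairingAct (by omega)).pairingAct hi), e (hs.pairingAct (by omega)), e hs]
    push_cast
    exact joinPairing_joinPairing h1 (by omega) (by omega) (by omega) z
  · simp only [loopAct, pairingAct]
    push_cast
    grind

theorem loopAct_loopAct {s : (ℤ → ℤ) × ℕ} (hs : IsPairing s.1) (i : ℕ) :
    loopAct (loopAct s i) i = loopAct (s.1, s.2 + 1) i := by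
  refine Prod.ext (funext fun z => joinPairing_self hs.invol (by omega) z) ?_
  simp only [loopAct, pairingAct]
  grind

end KFrieze

/-! ### The action of terms: soundness, completeness and normal forms. -/

namespace KFrieze

/-- The action of a generator on pairings with a number of loops. -/
def Gen.act {n : ℕ} : Gen n → (ℤ → ℤ) × ℕ → (ℤ → ℤ) × ℕ
  | .h i _, s => loopAct s i
  | .c, s => (s.1, s.2 + 1)

/-- The action of a term on pairings with a number of loops, from the right. -/
def KTerm.act {n : ℕ} : KTerm n → (ℤ → ℤ) × ℕ → (ℤ → ℤ) × ℕ
  | .gen g, s => g.act s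
  | .one, s => s
  | .mul t u, s => u.act (t.act s)

theorem IsPairing.gen_act {n : ℕ} (g : Gen n) {s : (ℤ → ℤ) × ℕ} (hs : IsPairing s.1) :
    IsPairing (g.act s).1 := by
  rcases g with ⟨i, hi⟩ | _
  · exact hs.pairingAct hi.1
  · exact hs

theorem IsPairing.act {n : ℕ} (t : KTerm n) {s : (ℤ → ℤ) × ℕ} (hs : IsPairing s.1) :
    IsPairing (t.act s).1 := by
  induction t generalizing s with
  | gen g => exact hs.gen_act g
  | one => exact hs
  | mul t u iht ihu => exact ihu (iht hs)

theorem loopAct_add_count (s : (ℤ → ℤ) × ℕ) (i l : ℕ) :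
    loopAct (s.1, s.2 + l) i = ((loopAct s i).1, (loopAct s i).2 + l) :=
  Prod.ext rfl (add_right_comm _ _ _)

/-- Soundness is verified relation by relation on pairings, not on friezes. Pairings are required
throughout, as the relations use the involution. -/
theorem KTerm.Eqv.act_eq {n : ℕ} {t u : KTerm n} (h : t.Eqv u) {s : (ℤ → ℤ) × ℕ}
    (hs : IsPairing s.1) : t.act s = u.act s := by
  induction h generalizing s with
  | refl t => rfl
  | symm _ ih => exact (ih hs).symm
  | trans _ _ ih ih' => exact (ih hs).trans (ih' hs)
  | @mul_congr t t' u u' _ _ ih ih' =>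
    exact (ih' (hs.act t)).trans (congrArg u'.act (ih hs))
  | one_mul t => rfl
  | mul_one t => rfl
  | mul_assoc t u v => rfl
  | h1 i j hi hj hij => exact loopAct_comm hs hi.1 (by omega)
  | h2_up i hi hi' => exact loopAct_up hs i
  | h2_down i hi hi' =>
    -- The side condition `1 ≤ i - 1` excludes truncation of the subtraction.
    obtain ⟨i, rfl⟩ : ∃ j, i = j + 1 := ⟨i - 1, by omega⟩
    exact loopAct_down hs hi'.1
  | hc1 i hi => exact (loopAct_add_count s i 1).symm
  | hc2 i hi => exact loopAct_loopAct hs i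

namespace PlaneSet

theorem delta_isNFrieze {n : ℕ} (t : KTerm n) : (delta t).IsNFrieze n := by
  induction t with
  | gen g =>
    rcases g with ⟨i, hi⟩ | _
    · exact diapsidal_isNFrieze hi.1 hi.2
    · exact circular_isNFrieze n
  | one => exact unit_isNFrieze n
  | mul t u iht ihu => exact comp_isNFrieze iht ihu

/-- In `δ(tu)` the frieze of `u` lies on top, so the letters of a term are stacked upwards from left
to right; hence the action from the right. -/
theorem HasInvariant.comp_delta {n : ℕ} {D : PlaneSet} {s : (ℤ → ℤ) × ℕ} (h : D.HasInvariant s)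
    (hD : D.IsNFrieze n) (t : KTerm n) : (D.comp (delta t)).HasInvariant (t.act s) := by
  induction t generalizing D s with
  | gen g =>
    have hc := comp_isNFrieze hD (delta_isNFrieze (KTerm.gen g))
    rcases g with ⟨i, hi⟩ | _
    · exact h.comp_diapsidal hD.toIsFrieze hi.1 hc.isDiagram
    · exact h.comp_of_vertical hD.toIsFrieze (circular_isNFrieze n).toIsFrieze hc.isDiagram
        circular_hasInvariant
  | one =>
    exact h.comp_of_vertical hD.toIsFrieze (unit_isNFrieze n).toIsFrieze
      (comp_isNFrieze hD (unit_isNFrieze n)).isDiagram (c := 0) unit_hasInvariant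
  | mul t u iht ihu =>
    have := ihu (iht h hD) (comp_isNFrieze hD (delta_isNFrieze t))
    rwa [← comp_assoc] at this

theorem delta_hasInvariant {n : ℕ} (t : KTerm n) :
    (delta t).HasInvariant (t.act unitPairing) := by
  induction t with
  | gen g =>
    rcases g with ⟨i, hi⟩ | _
    · exact diapsidal_hasInvariant hi.1
    · exact circular_hasInvariant
  | one => exact unit_hasInvariant
  | mul t u iht ihu => exact iht.comp_delta (delta_isNFrieze t) u

end PlaneSet

/-- The element `h_i` of `K_n` (and `1` if `i` is not an admissible index). -/
noncomputable def KMonoid.h (n i : ℕ) : KMonoid n :=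
  if hi : 1 ≤ i ∧ i < n then KMonoid.mk (KTerm.h i hi) else 1

namespace KMonoid

variable {n : ℕ}

theorem h_eq {i : ℕ} (hi : 1 ≤ i ∧ i < n) : KMonoid.h n i = mk (KTerm.h i hi) := dif_pos hi

theorem mk_eq_mk {t u : KTerm n} : mk t = mk u ↔ t.Eqv u :=
  ⟨fun h => Quotient.exact h, fun h => Quotient.sound h⟩

theorem mk_mul (t u : KTerm n) : mk (t.mul u) = mk t * mk u := rfl

theorem mk_one : mk (KTerm.one : KTerm n) = 1 := rfl

theorem jonesRelations (n : ℕ) : JonesRelations n (KMonoid.h n) (mk KTerm.c) where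
  comm i j h1 h2 h3 := by
    obtain ⟨j, rfl⟩ : ∃ j', j = j' + 2 := ⟨j - 2, by omega⟩
    rw [h_eq ⟨h1, by omega⟩, h_eq ⟨by omega, h3⟩]
    exact Quotient.sound (KTerm.Eqv.h1 i j _ _ (by omega))
  up i h1 h2 := by
    rw [h_eq ⟨h1, by omega⟩, h_eq ⟨by omega, h2⟩]
    exact Quotient.sound (KTerm.Eqv.h2_up i _ _)
  down i h1 h2 := by
    rw [h_eq ⟨h1, by omega⟩, h_eq ⟨by omega, h2⟩]
    exact Quotient.sound (KTerm.Eqv.h2_down (i + 1) ⟨by omega, h2⟩ ⟨h1, by omega⟩)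
  comm_c i h1 h2 := by
    rw [h_eq ⟨h1, h2⟩]
    exact Quotient.sound (KTerm.Eqv.hc1 i _)
  sq i h1 h2 := by
    rw [h_eq ⟨h1, h2⟩]
    exact Quotient.sound (KTerm.Eqv.hc2 i _)

theorem mk_mem_jonesSubmonoid (t : KTerm n) :
    mk t ∈ jonesSubmonoid (KMonoid.h n) (mk KTerm.c) n := by
  induction t with
  | gen g =>
    rcases g with ⟨i, hi⟩ | _
    · exact h_eq hi ▸ JonesRelations.h_mem hi.1 hi.2
    · exact JonesRelations.c_mem
  | one => exact one_mem _
  | mul t u iht ihu => exact mul_mem iht ihu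

theorem mk_ofWord (w : List (Gen n)) :
    mk (KTerm.ofWord w) = (w.map fun g => mk (KTerm.gen g)).prod := by
  have aux : ∀ (w : List (Gen n)) (t : KTerm n),
      mk (w.foldl (fun t g => t.mul (.gen g)) t) = mk t * (w.map fun g => mk (KTerm.gen g)).prod := by
    intro w
    induction w with
    | nil => simp
    | cons g w ih => intro t; simp [ih, mk_mul, mul_assoc]
  cases w with
  | nil => simp [KTerm.ofWord, mk_one]
  | cons g w => simp [KTerm.ofWord, aux]

end KMonoid

theorem KTerm.act_ofWord {n : ℕ} (w : List (Gen n)) (s : (ℤ → ℤ) × ℕ) :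
    (KTerm.ofWord w).act s = w.foldl (fun s g => g.act s) s := by
  have aux : ∀ (w : List (Gen n)) (t : KTerm n),
      (w.foldl (fun t g => t.mul (.gen g)) t).act s = w.foldl (fun s g => g.act s) (t.act s) := by
    intro w
    induction w with
    | nil => simp
    | cons g w ih => intro t; simp [ih, KTerm.act]
  cases w with
  | nil => rfl
  | cons g w => simp [KTerm.ofWord, aux, KTerm.act]

namespace Block

variable {n : ℕ}

/-- The first index and the length of a block. -/
def toPair (B : Block n) : ℕ × ℕ := (B.a, B.b + 1 - B.a)

theorem map_word {α : Type*} (B : Block n) (F : Gen n → α) (G : ℕ → α)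
    (h : ∀ i hi, F (.h i hi) = G i) :
    B.word.map F = (List.range (B.b + 1 - B.a)).map fun m => G (B.b - m) := by
  rw [word, List.map_ofFn]
  refine List.ext_getElem (by simp) fun i h1 h2 => ?_
  simp [h]

theorem prod_range_map {M : Type*} [Monoid M] (G : ℕ → M) (a k : ℕ) :
    ((List.range k).map fun m => G (a + k - 1 - m)).prod = descProd G a k := by
  induction k generalizing a with
  | zero => rfl
  | succ k ih =>
    rw [JonesRelations.descProd_succ, ← ih, List.range_succ]
    simp only [List.map_append, List.prod_append, List.map_cons, List.map_nil, List.prod_singleton]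
    congr 3 <;> (try funext) <;> grind

theorem foldl_range (s : (ℤ → ℤ) × ℕ) (a k : ℕ) :
    (List.range k).foldl (fun s m => loopAct s (a + k - 1 - m)) s = blockAct s a k := by
  induction k generalizing a with
  | zero => rfl
  | succ k ih =>
    rw [blockAct, ← ih, List.range_succ, List.foldl_append]
    simp only [List.foldl_cons, List.foldl_nil]
    congr 1
    · congr 1
      funext s m
      congr 1
      omega
    · omega

theorem foldl_word (B : Block n) (s : (ℤ → ℤ) × ℕ) :
    B.word.foldl (fun s g => g.act s) s = blockAct s B.a (B.b + 1 - B.a) := by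
  have h := B.map_word (fun g s => g.act s) (fun i s => loopAct s i) fun _ _ => rfl
  have h' := congrArg (List.foldl (fun s f => f s) s) h
  rw [List.foldl_map, List.foldl_map] at h'
  rw [h', ← foldl_range, Nat.add_sub_cancel' (Nat.le_succ_of_le B.le)]
  rfl

theorem prod_word (B : Block n) :
    (B.word.map fun g => KMonoid.mk (KTerm.gen g)).prod =
      descProd (KMonoid.h n) B.a (B.b + 1 - B.a) := by
  rw [B.map_word _ (KMonoid.h n) fun i hi => (KMonoid.h_eq hi).symm, ← prod_range_map]
  rw [Nat.add_sub_cancel' (Nat.le_succ_of_le B.le)]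
  rfl

theorem toPair_injective : Function.Injective (toPair (n := n)) := by
  rintro ⟨b, a, h1, h2, h3⟩ ⟨b', a', h1', h2', h3'⟩ h
  simp only [toPair, Prod.mk.injEq] at h
  obtain ⟨rfl, h⟩ := h
  obtain rfl : b = b' := by omega
  rfl

theorem isJonesList {L : List (Block n)}
    (hL : L.Pairwise fun B B' => B.a < B'.a ∧ B.b < B'.b) : IsJonesList n (L.map toPair) := by
  refine ⟨fun B hB => ?_, List.pairwise_map.2 (hL.imp fun {B B'} h => ?_)⟩
  · obtain ⟨B, -, rfl⟩ := List.mem_map.1 hB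
    have h1 := B.one_le
    have h2 := B.le
    have h3 := B.lt
    simp only [toPair]
    omega
  · have h2 := B.le
    have h2' := B'.le
    simp only [toPair]
    omega

theorem exists_map_toPair {L : List (ℕ × ℕ)} (hL : IsJonesList n L) :
    ∃ L' : List (Block n), L'.map toPair = L ∧
      L'.Pairwise fun B B' => B.a < B'.a ∧ B.b < B'.b := by
  have h : L ∈ Set.range (List.map (toPair (n := n))) := by
    rw [Set.range_list_map]
    intro B hB
    obtain ⟨h1, h2, h3⟩ := hL.1 B hB
    exact ⟨⟨B.1 + B.2 - 1, B.1, h1, by omega, by omega⟩, Prod.ext rfl (by simp only [toPair]; omega)⟩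
  obtain ⟨L', rfl⟩ := h
  refine ⟨L', rfl, (List.pairwise_map.1 hL.2).imp fun {B B'} h => ?_⟩
  have h2 := B.le
  have h2' := B'.le
  simp only [toPair] at h
  omega

end Block

/-- The word `c^l h_[b_1,a_1] … h_[b_k,a_k]`. -/
def jonesWord {n : ℕ} (l : ℕ) (L : List (Block n)) : List (Gen n) :=
  List.replicate l Gen.c ++ L.flatMap Block.word

theorem mk_jonesWord {n : ℕ} (l : ℕ) (L : List (Block n)) :
    KMonoid.mk (KTerm.ofWord (jonesWord l L)) =
      jonesProd (KMonoid.h n) (KMonoid.mk KTerm.c) l (L.map Block.toPair) := by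
  rw [KMonoid.mk_ofWord, jonesWord, jonesProd, List.map_append, List.prod_append,
    List.map_replicate, List.prod_replicate]
  congr 1
  induction L with
  | nil => rfl
  | cons B L ih => simp [ih, Block.prod_word, Block.toPair]

theorem blockAct_add_count (s : (ℤ → ℤ) × ℕ) (a k l : ℕ) :
    blockAct (s.1, s.2 + l) a k = ((blockAct s a k).1, (blockAct s a k).2 + l) := by
  induction k generalizing a with
  | zero => rfl
  | succ k ih => rw [blockAct, ih, loopAct_add_count]; rfl

theorem act_jonesWord {n : ℕ} (l : ℕ) (L : List (Block n)) :
    (KTerm.ofWord (jonesWord l L)).act unitPairing =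
      ((listAct (L.map Block.toPair)).1, (listAct (L.map Block.toPair)).2 + l) := by
  have h1 : ∀ (l : ℕ) (s : (ℤ → ℤ) × ℕ),
      (List.replicate l Gen.c).foldl (fun s (g : Gen n) => g.act s) s = (s.1, s.2 + l) := by
    intro l
    induction l with
    | zero => intro s; rfl
    | succ l ih =>
      intro s
      rw [List.replicate_succ, List.foldl_cons, ih]
      exact Prod.ext rfl (by simp only [Gen.act]; omega)
  rw [KTerm.act_ofWord, jonesWord, List.foldl_append, h1]
  induction L using List.reverseRecOn with
  | nil => rfl
  | append_singleton L B ih =>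
    rw [List.flatMap_append, List.foldl_append, ih, List.flatMap_singleton, Block.foldl_word,
      blockAct_add_count, List.map_append, List.map_singleton, listAct_concat]
    rfl

theorem KTerm.exists_jonesNormalForm {n : ℕ} (t : KTerm n) :
    ∃ t' : KTerm n, IsJonesNormalForm t' ∧ t.Eqv t' := by
  obtain ⟨l, L, hL, h⟩ := (KMonoid.jonesRelations n).exists_jonesProd le_rfl
    (KMonoid.mk_mem_jonesSubmonoid t)
  obtain ⟨L, rfl, hL'⟩ := Block.exists_map_toPair hL
  exact ⟨_, ⟨l, L, hL', rfl⟩, KMonoid.mk_eq_mk.1 (h.trans (mk_jonesWord l L).symm)⟩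

/-- Blocks of a normal form close no loops, so the loop count is the exponent of `c`, and the
pairing determines the blocks by `listAct_injective`. -/
theorem IsJonesNormalForm.eq_of_act_eq {n : ℕ} {t t' : KTerm n} (ht : IsJonesNormalForm t)
    (ht' : IsJonesNormalForm t') (h : t.act unitPairing = t'.act unitPairing) : t = t' := by
  obtain ⟨l, L, hL, rfl⟩ := ht
  obtain ⟨l', L', hL', rfl⟩ := ht'
  have hJ := Block.isJonesList hL
  have hJ' := Block.isJonesList hL'
  have h' := (act_jonesWord l L).symm.trans (h.trans (act_jonesWord l' L'))
  rw [Prod.mk.injEq, (listAct_spec hJ).2.2.1, (listAct_spec hJ').2.2.1] at h'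
  have e := Block.toPair_injective.list_map (listAct_injective hJ hJ' h'.1)
  rw [e, show l = l' by omega]

/-- For the converse, terms with the same action have normal forms with the same action, and these
are identical. -/
theorem KTerm.eqv_iff_act_eq {n : ℕ} {t u : KTerm n} :
    t.Eqv u ↔ t.act unitPairing = u.act unitPairing := by
  refine ⟨fun h => h.act_eq isPairing_unitPairing, fun h => ?_⟩
  obtain ⟨t', ht, htt⟩ := t.exists_jonesNormalForm
  obtain ⟨u', hu, huu⟩ := u.exists_jonesNormalForm
  obtain rfl := ht.eq_of_act_eq hu ((htt.act_eq isPairing_unitPairing).symm.trans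
    (h.trans (huu.act_eq isPairing_unitPairing)))
  exact htt.trans huu.symm

/-- `exists_word` supplies the pairing without loops; factors `c` add the required number of loops.
-/
theorem KTerm.exists_act_eq {n : ℕ} {s : (ℤ → ℤ) × ℕ} (hs : IsPairing s.1) (hn : NonCrossing s.1)
    (hl : PairingLevel n s.1) : ∃ t : KTerm n, t.act unitPairing = s := by
  obtain ⟨w, hw, h⟩ := exists_word hs hn hl
  have h1 : ∃ t : KTerm n, t.act unitPairing = (s.1, 0) := by
    rw [← h]
    clear h
    induction w using List.reverseRecOn with
    | nil => exact ⟨.one, rfl⟩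
    | append_singleton w i ih =>
      obtain ⟨t, ht⟩ := ih fun j hj => hw j (by simp [hj])
      exact ⟨t.mul (.h i (hw i (by simp))), by
        rw [List.foldl_append, ← ht]; rfl⟩
  have h2 : ∀ l : ℕ, ∃ t : KTerm n, t.act unitPairing = (s.1, l) := by
    intro l
    induction l with
    | zero => exact h1
    | succ l ih =>
      obtain ⟨t, ht⟩ := ih
      exact ⟨t.mul .c, by rw [KTerm.act, ht]; rfl⟩
  exact h2 s.2

end KFrieze

/-! ### The monoid of frieze classes and the isomorphism. -/

namespace KFrieze

open PlaneSet

/-- Composition of `n`-friezes. -/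
def NFrieze.comp {n : ℕ} (D E : NFrieze n) : NFrieze n :=
  ⟨D.1.comp E.1, comp_isNFrieze D.2 E.2⟩

theorem NFrieze.comp_congr {n : ℕ} {D D' E E' : NFrieze n} (hD : D ≈ D') (hE : E ≈ E') :
    D.comp E ≈ D'.comp E' :=
  KEquiv.comp D.2.isDiagram E.2.isDiagram D'.2.isDiagram E'.2.isDiagram hD hE

theorem delta_kEquiv_iff {n : ℕ} {t u : KTerm n} : (delta t).KEquiv (delta u) ↔ t.Eqv u := by
  have ht := delta_isNFrieze t
  have hu := delta_isNFrieze u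
  rw [KTerm.eqv_iff_act_eq]
  refine ⟨fun h => ?_, fun h => ?_⟩
  · exact (KEquiv.hasInvariant ht.isDiagram hu.isDiagram h (delta_hasInvariant t)).eq hu.isDiagram
      (delta_hasInvariant u)
  · exact HasInvariant.kEquiv ht.toIsFrieze hu.toIsFrieze (delta_hasInvariant t)
      (h ▸ delta_hasInvariant u)

/-- The `n`-frieze denoted by a term. -/
def NFrieze.ofTerm {n : ℕ} (t : KTerm n) : NFrieze n := ⟨delta t, delta_isNFrieze t⟩

/-- The invariant of an `n`-frieze is non-crossing and vertical beyond `n`, hence is also the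
invariant of some `δ(t)`, and equal invariants give K-equivalence. -/
theorem NFrieze.exists_ofTerm {n : ℕ} (D : NFrieze n) : ∃ t, NFrieze.ofTerm t ≈ D := by
  obtain ⟨s, h1, h2, h3, h4⟩ := D.2.exists_hasInvariant
  obtain ⟨t, rfl⟩ := KTerm.exists_act_eq h2 h3 h4
  exact ⟨t, HasInvariant.kEquiv (delta_isNFrieze t).toIsFrieze D.2.toIsFrieze
    (delta_hasInvariant t) h1⟩

theorem NFrieze.ofTerm_equiv_iff {n : ℕ} {t u : KTerm n} :
    NFrieze.ofTerm t ≈ NFrieze.ofTerm u ↔ t.Eqv u := delta_kEquiv_iff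

/-- The unit of the monoid of `n`-friezes modulo `K`-equivalence. -/
def NFrieze.one (n : ℕ) : NFrieze n := ⟨unit, unit_isNFrieze n⟩

/-- The unit law holds only up to K-equivalence. Rather than stretching threads by a homeomorphism,
`D` is replaced by an equivalent `δ(t)`, and the unit law of `K_n` is carried over. -/
theorem NFrieze.one_comp {n : ℕ} (D : NFrieze n) : (NFrieze.one n).comp D ≈ D := by
  obtain ⟨t, ht⟩ := D.exists_ofTerm
  have h : NFrieze.ofTerm (KTerm.one.mul t) ≈ NFrieze.ofTerm t :=
    NFrieze.ofTerm_equiv_iff.2 (.one_mul t)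
  exact Setoid.trans (NFrieze.comp_congr (Setoid.refl _) (Setoid.symm ht)) (Setoid.trans h ht)

theorem NFrieze.comp_one {n : ℕ} (D : NFrieze n) : D.comp (NFrieze.one n) ≈ D := by
  obtain ⟨t, ht⟩ := D.exists_ofTerm
  have h : NFrieze.ofTerm (t.mul KTerm.one) ≈ NFrieze.ofTerm t :=
    NFrieze.ofTerm_equiv_iff.2 (.mul_one t)
  exact Setoid.trans (NFrieze.comp_congr (Setoid.symm ht) (Setoid.refl _)) (Setoid.trans h ht)

instance FriezeClass.instMonoid (n : ℕ) : Monoid (FriezeClass n) where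
  mul := Quotient.map₂ NFrieze.comp fun _ _ h _ _ h' => NFrieze.comp_congr h h'
  one := Quotient.mk _ (NFrieze.one n)
  mul_assoc := by
    rintro ⟨D⟩ ⟨E⟩ ⟨F⟩
    exact congrArg (Quotient.mk _) (Subtype.ext (comp_assoc D.1 E.1 F.1).symm)
  one_mul := by
    rintro ⟨D⟩
    exact Quotient.sound D.one_comp
  mul_one := by
    rintro ⟨D⟩
    exact Quotient.sound D.comp_one

/-- The interpretation of terms by friezes as a homomorphism. -/
def KMonoid.interp (n : ℕ) : KMonoid n →* FriezeClass n where
  toFun := Quotient.map NFrieze.ofTerm fun _ _ h => NFrieze.ofTerm_equiv_iff.2 h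
  map_one' := rfl
  map_mul' := by
    rintro ⟨t⟩ ⟨u⟩
    rfl

theorem KMonoid.interp_bijective (n : ℕ) : Function.Bijective (KMonoid.interp n) := by
  refine ⟨?_, ?_⟩
  · rintro ⟨t⟩ ⟨u⟩ h
    exact Quotient.sound (NFrieze.ofTerm_equiv_iff.1 (Quotient.exact h))
  · rintro ⟨D⟩
    obtain ⟨t, ht⟩ := D.exists_ofTerm
    exact ⟨KMonoid.mk t, Quotient.sound ht⟩

theorem KTerm.existsUnique_jonesNormalForm {n : ℕ} (t : KTerm n) :
    ∃! t' : KTerm n, IsJonesNormalForm t' ∧ t.Eqv t' := by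
  obtain ⟨t', ht, htt⟩ := t.exists_jonesNormalForm
  exact ⟨t', ⟨ht, htt⟩, fun u hu => hu.1.eq_of_act_eq ht
    (KTerm.eqv_iff_act_eq.1 (hu.2.symm.trans htt))⟩

end KFrieze

theorem mainTheorem3 (n : ℕ) :
    -- completeness (and soundness) of the diagrammatic interpretation
    (∀ t u : KFrieze.KTerm n,
      (KFrieze.delta t).KEquiv (KFrieze.delta u) ↔ KFrieze.KTerm.Eqv t u) ∧
    -- `K_n` is isomorphic to the monoid of `K`-equivalence classes of `n`-friezes
    (∃ (hdelta : ∀ t : KFrieze.KTerm n, (KFrieze.delta t).IsNFrieze n)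
       (hunit : KFrieze.PlaneSet.unit.IsNFrieze n)
       (hcomp : ∀ D E : KFrieze.PlaneSet, D.IsNFrieze n → E.IsNFrieze n →
          (D.comp E).IsNFrieze n)
       (_ : Monoid (KFrieze.FriezeClass n)),
       (1 : KFrieze.FriezeClass n) = KFrieze.FriezeClass.mk KFrieze.PlaneSet.unit hunit ∧
       (∀ (D E : KFrieze.PlaneSet) (hD : D.IsNFrieze n) (hE : E.IsNFrieze n),
          KFrieze.FriezeClass.mk D hD * KFrieze.FriezeClass.mk E hE =
            KFrieze.FriezeClass.mk (D.comp E) (hcomp D E hD hE)) ∧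
       ∃ φ : KFrieze.KMonoid n ≃* KFrieze.FriezeClass n,
         ∀ t : KFrieze.KTerm n,
           φ (KFrieze.KMonoid.mk t) = KFrieze.FriezeClass.mk (KFrieze.delta t) (hdelta t)) ∧
    -- every term is equal in `K_n` to a unique term in Jones normal form
    (∀ t : KFrieze.KTerm n,
      ∃! t' : KFrieze.KTerm n, KFrieze.IsJonesNormalForm t' ∧ KFrieze.KTerm.Eqv t t') := by
  exact ⟨fun t u => KFrieze.delta_kEquiv_iff, ⟨KFrieze.PlaneSet.delta_isNFrieze,
    KFrieze.PlaneSet.unit_isNFrieze n, fun D E => KFrieze.PlaneSet.comp_isNFrieze, inferInstance,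
    rfl, fun D E hD hE => rfl, MulEquiv.ofBijective _ (KFrieze.KMonoid.interp_bijective n),
    fun t => rfl⟩, KFrieze.KTerm.existsUnique_jonesNormalForm⟩
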